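/- All multicategories, multifunctors and multinatural transformations are symmetric and enriched in $\mathcal{C}at$; $\mathcal{C}at_*$ is the category of small based categories and based functors. **Source and target multicategories.** * $\mathbf{Wald}_\vee$: objects are small Waldhausen categories $\mathcal{C}$ with zero object $*$ and a choice of pushouts $X\xrightarrow{\iota_1}X\vee Y\xleftarrow{\iota_2}Y$ of $X\leftarrow *\to Y$ with $X\vee *=X=*\vee X$ and $\iota_1=\mathrm{id}$, resp. $\iota_2=\mathrm{id}$; $k$-ary morphisms are $k$-exact functors (exact in each variable, and sending families of $k$ cofibrations to cubically cofibrant cubes); $k$-ary cells are all natural transformations. * $\mathbf{SMC}$: objects are small symmetric monoidal categories with strict unit; $k$-ary morphisms are strictly unital $k$-linear functors $(F,\delta_1,\dots,\delta_k)$ with natural isomorphisms $\delta_i\colon F(\dots,c_i,\dots)\oplus F(\dots,c_i',\dots)\cong F(\dots,c_i\oplus c_i',\dots)$ compatible with associativity, symmetry and each other; cells are unital natural transformations commuting with the $\delta_i$. * $\mathcal{E}_*\text{-}\mathcal{C}at$: $\mathcal{E}$ is the Grothendieck construction of $\underline r\mapsto(\Delta^{op})^r$ on finite sets $\underline r=\{1,\dots,r\}$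 and injections, with missing entries filled by $[1]$, and $\odot$ is concatenation. Objects are functors $X\colon\mathcal{E}\to\mathcal{C}at_*$ with $X([m_1],\dots,[m_r])=*$ if some $m_i=0$; $k$-ary morphisms are natural families of functors $\prod_iX_i(\mathbf{m}_i)\to Y(\mathbf{m}_1\odot\dots\odot\mathbf{m}_k)$ compatible with base points; cells are modifications compatible with base points. * $\mathbf{Spec}(s\mathcal{C}at)$: objects are symmetric spectra in simplicial based categories; $k$-ary morphisms are $k$-linear maps; cells are based natural transformations compatible with the structure. **Constructions.** * $\Lambda\mathcal{C}=(\mathcal{C},\vee,*)$ with the associativity and symmetry isomorphisms given by the universal property; on a $k$-exact functor, $\delta_i$ is the isomorphism compatible with the inclusions $\iota_1,\iota_2$. * For strictly unital symmetric monoidal $\mathcal{C}$, $\overline{\mathcal{C}}([m_1],\dots,[m_n])$ is the Elmendorf–Mandell category of systems $\{C_{\langle S\rangle},\rho_{\langle S\rangle,i,T,U}\}$ indexed by tuples of subsets $S_k\subseteq\{1,\dots,m_k\}$, where $\rho_{\langle S\rangle,i,T,U}\colon C_{\langle S\lceil_iT\rangle}\oplus C_{\langle S\lceil_iU\rangle}\cong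 C_{\langle S\rangle}$ for $S_i=T\sqcup U$, satisfying the pointedness, symmetry, associativity and coherence axioms. It is functorial on $\mathcal{E}$ through the simplicial circle $\Delta^{op}\to\mathcal{F}$ (finite pointed sets), permutations and the extension isomorphisms, and on $k$-linear functors by $D_{\langle S_1,\dots,S_k\rangle}=F(C^1_{\langle S_1\rangle},\dots,C^k_{\langle S_k\rangle})$. * $S^{()}_{\bullet,\dots,\bullet}\mathcal{C}$ sends $([m_1],\dots,[m_n])$ to the category, with all natural transformations as morphisms, of functors $A\colon\prod_k\mathrm{Ar}[m_k]\to\mathcal{C}$ such that $A=*$ whenever $i_k=j_k$ for some $k$, the functor $(j_1,\dots,j_n)\mapsto A_{0j_1,\dots,0j_n}$ is cubically cofibrant, and for each $k$ and $i_k\le j_k\le r$ the square with corners $i_kj_k,\ i_kr,\ j_kj_k,\ j_kr$ in the $k$-th coordinate is a pushout. It is functorial on $\mathcal{E}$ by the multisimplicial structure, permutations and the extension isomorphisms, and on $k$-exact functors by $(A_1,\dots,A_k)\mapsto F\circ(A_1\times\dots\times A_k)$. * $I\colon\mathcal{E}_*\text{-}\mathcal{C}at\to\mathbf{Spec}(s\mathcal{C}at)$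 has $IX(p)_q=X([q],\dots,[q])$ ($p$ entries), with $\Sigma_p$ permuting the entries; the structure map on the wedge summand $j\in\{1,\dots,q\}$ of $IX(p)_q\wedge S^1_q$ is induced by appending the map $\beta^j\colon[q]\to[1]$, where $\beta^j(x)=1$ iff $x\ge j$; $I$ restricts multimorphisms and cells to the diagonals. **Theorem.** With these objects, multimorphisms and cells and the evident identities, compositions and symmetric group actions, $\mathbf{Wald}_\vee$, $\mathbf{SMC}$, $\mathcal{E}_*\text{-}\mathcal{C}at$ and $\mathbf{Spec}(s\mathcal{C}at)$ are $\mathcal{C}at$-enriched symmetric multicategories, and $\Lambda\colon\mathbf{Wald}_\vee\to\mathbf{SMC}$, $\overline{(-)}\colon\mathbf{SMC}\to\mathcal{E}_*\text{-}\mathcal{C}at$, $S^{()}_{\bullet,\dots,\bullet}\colon\mathbf{Wald}_\vee\to\mathcal{E}_*\text{-}\mathcal{C}at$ and $I$ are $\mathcal{C}at$-enriched symmetric multifunctors. There is a $\mathcal{C}at$-enriched multinatural transformation $\phi\colon\overline{(-)}\circ\Lambda\Rightarrow S^{()}_{\bullet,\dots,\bullet}$ whose component at $\mathcal{C}$ sends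 a system $\{C,\rho\}$ to the functor $A_{i_1j_1,\dots,i_nj_n}=C_{\langle(i_1,j_1],\dots,(i_n,j_n]\rangle}$, acting on a morphism $i_kj_k\to i_k'j_k'$ in the $k$-th coordinate as $$C_{(i_k,j_k]}\xrightarrow{\iota_1}C_{(i_k,j_k]}\vee C_{(j_k,j_k']}\xrightarrow{\rho}C_{(i_k,j_k']}\xrightarrow{\rho^{-1}}C_{(i_k,i_k']}\vee C_{(i_k',j_k']}\xrightarrow{\pi_2}C_{(i_k',j_k']},$$ and sends a morphism of systems $f$ to the natural transformation with components $f_{\langle(i_1,j_1],\dots,(i_n,j_n]\rangle}$. Moreover, the $1$-ary morphisms $I(\phi_{\mathcal{C}})$ are the components of a $\mathcal{C}at$-enriched multinatural transformation $$I\circ\phi\colon\ \mathbb{K}_{SMC}\circ\Lambda=I\circ\overline{(-)}\circ\Lambda\ \Longrightarrow\ I\circ S^{()}_{\bullet,\dots,\bullet}=\mathbb{K}_{Wald}$$ of multifunctors $\mathbf{Wald}_\vee\to\mathbf{Spec}(s\mathcal{C}at)$. -/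

import Mathlib

open CategoryTheory CategoryTheory.Limits

universe u v w v' w' v'' w'' v₁ v₂ v₃

namespace KTheory

/-! ## Categorically enriched symmetric multicategories -/

/-- `f` is an identity morphism (between objects that are equal). -/
def IsId {C : Type*} [Category C] {X Y : C} (f : X ⟶ Y) : Prop :=
  ∃ h : X = Y, f = eqToHom h

theorem IsId.comp {C : Type*} [Category C] {X Y Z : C} {f : X ⟶ Y} {g : Y ⟶ Z}
    (hf : IsId f) (hg : IsId g) : IsId (f ≫ g) := by
  obtain ⟨rfl, rfl⟩ := hf
  obtain ⟨rfl, rfl⟩ := hg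
  exact ⟨rfl, by simp⟩

theorem isId_id {C : Type*} [Category C] (X : C) : IsId (𝟙 X) := ⟨rfl, rfl⟩

theorem heq_comp {C : Type*} [Category C] {X Y Z X' Y' Z' : C} {f : X ⟶ Y} {g : Y ⟶ Z}
    {f' : X' ⟶ Y'} {g' : Y' ⟶ Z'} (hX : X = X') (hY : Y = Y') (hZ : Z = Z')
    (hf : HEq f f') (hg : HEq g g') : HEq (f ≫ g) (f' ≫ g') := by
  subst hX hY hZ
  rw [eq_of_heq hf, eq_of_heq hg]

/-- The bijection `(Σ _ : Unit, I) ≃ I`. -/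
def unitSigma (I : Type) : (Σ _ : Unit, I) ≃ I where
  toFun x := x.2
  invFun i := ⟨(), i⟩

/-- The bijection `(Σ _ : I, Unit) ≃ I`. -/
def sigmaUnit (I : Type) : (Σ _ : I, Unit) ≃ I where
  toFun x := x.1
  invFun i := ⟨i, ()⟩

section Products

variable {I : Type} {K : I → Type}

/-- The isomorphism `∏_{(i,k)} A i k ⥤ ∏_i ∏_k A i k` of product categories. -/
def sigmaCurry (A : ∀ i, K i → Type u) [∀ i k, Category.{v} (A i k)] :
    (∀ x : Σ i, K i, A x.1 x.2) ⥤ ∀ i, ∀ k, A i k where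
  obj x i k := x ⟨i, k⟩
  map f i k := f ⟨i, k⟩

/-- The inverse of `sigmaCurry`. -/
def sigmaUncurry (A : ∀ i, K i → Type u) [∀ i k, Category.{v} (A i k)] :
    (∀ i, ∀ k, A i k) ⥤ ∀ x : Σ i, K i, A x.1 x.2 where
  obj x y := x y.1 y.2
  map f y := f y.1 y.2

variable {A : ∀ i, K i → Type u} [∀ i k, Category.{v} (A i k)]
  {B : I → Type u} [∀ i, Category.{v} (B i)] {C : Type u} [Category.{v} C]

/-- The multicomposite `G ∘ (∏_i F i)`. -/
def multicomp (G : (∀ i, B i) ⥤ C) (F : ∀ i, (∀ k, A i k) ⥤ B i) :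
    (∀ x : Σ i, K i, A x.1 x.2) ⥤ C :=
  sigmaCurry A ⋙ Functor.pi F ⋙ G

/-- The multicomposite (horizontal composite) of natural transformations. -/
def multicompHom {G G' : (∀ i, B i) ⥤ C} {F F' : ∀ i, (∀ k, A i k) ⥤ B i}
    (α : G ⟶ G') (β : ∀ i, F i ⟶ F' i) : multicomp G F ⟶ multicomp G' F' :=
  Functor.whiskerLeft (sigmaCurry A) (NatTrans.pi β ◫ α)

end Products

/-- A symmetric multicategory enriched in categories, with given objects and given categories
of multimorphisms (`k`-ary morphisms and `k`-ary cells). The inputs of a multimorphism are indexed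
by an arbitrary finite type `I`; the `k`-ary morphisms `(a₁, …, a_k) ⟶ b` are those indexed by
`I = Fin k`. Bijections `I ≃ J` act by reindexing the inputs, and the composition takes a
multimorphism with inputs `(b i)_{i : I}` and, for each `i`, one with inputs `(a i k)_{k : K i}`
and output `b i`, to one with inputs indexed by `Σ i, K i`. All laws are equalities of functors,
so they hold for multimorphisms and for cells. -/
structure Multicategory (Ob : Type w)
    (Hom : ∀ (I : Type) [Finite I], (I → Ob) → Ob → Type v)
    [∀ (I : Type) [Finite I] (a : I → Ob) (b : Ob), Category.{v'} (Hom I a b)] where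
  id (a : Ob) : Hom Unit (fun _ => a) a
  act {I J : Type} [Finite I] [Finite J] (e : I ≃ J) (a : J → Ob) (b : Ob) :
    Hom J a b ⥤ Hom I (fun i => a (e i)) b
  comp {I : Type} [Finite I] {K : I → Type} [∀ i, Finite (K i)]
    (a : ∀ i, K i → Ob) (b : I → Ob) (c : Ob) :
    Hom I b c × (∀ i, Hom (K i) (a i) (b i)) ⥤ Hom (Σ i, K i) (fun x => a x.1 x.2) c
  act_refl {I : Type} [Finite I] (a : I → Ob) (b : Ob) :
    act (Equiv.refl I) a b = 𝟭 _
  act_trans {I J L : Type} [Finite I] [Finite J] [Finite L] (e : I ≃ J) (e' : J ≃ L)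
    (a : L → Ob) (b : Ob) :
    act (e.trans e') a b = act e' a b ⋙ act e (fun j => a (e' j)) b
  act_comp_left {I J : Type} [Finite I] [Finite J] (e : I ≃ J) {K : J → Type} [∀ j, Finite (K j)]
    (a : ∀ j, K j → Ob) (b : J → Ob) (c : Ob) :
    comp a b c ⋙ act (Equiv.sigmaCongrLeft (β := K) e) (fun x => a x.1 x.2) c =
      Functor.prod (act e b c) (Pi.comap (fun j => Hom (K j) (a j) (b j)) e) ⋙
        comp (fun i => a (e i)) (fun i => b (e i)) c
  act_comp_right {I : Type} [Finite I] {K L : I → Type} [∀ i, Finite (K i)] [∀ i, Finite (L i)]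
    (e : ∀ i, K i ≃ L i) (a : ∀ i, L i → Ob) (b : I → Ob) (c : Ob) :
    comp a b c ⋙ act (Equiv.sigmaCongrRight e) (fun x => a x.1 x.2) c =
      Functor.prod (𝟭 _) (Functor.pi fun i => act (e i) (a i) (b i)) ⋙
        comp (fun i k => a i (e i k)) b c
  id_comp {I : Type} [Finite I] (a : I → Ob) (b : Ob) :
    Functor.prod' ((Functor.const _).obj (id b)) (Functor.pi' fun _ : Unit => 𝟭 (Hom I a b)) ⋙
      comp (fun _ => a) (fun _ => b) b = act (unitSigma I) a b
  comp_id {I : Type} [Finite I] (a : I → Ob) (b : Ob) :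
    Functor.prod' (𝟭 (Hom I a b)) ((Functor.const _).obj fun i => id (a i)) ⋙
      comp (fun i _ => a i) a b = act (sigmaUnit I) a b
  assoc {I : Type} [Finite I] {K : I → Type} [∀ i, Finite (K i)]
    {L : ∀ i, K i → Type} [∀ i k, Finite (L i k)]
    (a : ∀ i k, L i k → Ob) (b : ∀ i, K i → Ob) (c : I → Ob) (d : Ob) :
    (Functor.prod' (Functor.prod' (CategoryTheory.Prod.fst _ _) (CategoryTheory.Prod.snd _ _ ⋙ CategoryTheory.Prod.fst _ _) ⋙ comp b c d)
      (CategoryTheory.Prod.snd (Hom I c d) ((∀ i, Hom (K i) (b i) (c i)) × (∀ i k, Hom (L i k) (a i k) (b i k))) ⋙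
        CategoryTheory.Prod.snd _ _ ⋙ sigmaUncurry fun i k => Hom (L i k) (a i k) (b i k))) ⋙
      comp (fun x : Σ i, K i => a x.1 x.2) (fun x => b x.1 x.2) d =
    Functor.prod' (CategoryTheory.Prod.fst _ _)
      (Functor.pi' fun i => Functor.prod'
        (CategoryTheory.Prod.snd _ _ ⋙ CategoryTheory.Prod.fst _ _ ⋙ Pi.eval (fun i => Hom (K i) (b i) (c i)) i)
        (CategoryTheory.Prod.snd _ _ ⋙ CategoryTheory.Prod.snd _ _ ⋙ Pi.eval (fun i => ∀ k, Hom (L i k) (a i k) (b i k)) i) ⋙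
        comp (a i) (b i) (c i)) ⋙
      comp (fun i (x : Σ k, L i k) => a i x.1 x.2) c d ⋙
      act (Equiv.sigmaAssoc L) (fun x => a x.1 x.2.1 x.2.2) d

section Multifunctors

variable {Ob : Type w} {Hom : ∀ (I : Type) [Finite I], (I → Ob) → Ob → Type v}
  [∀ (I : Type) [Finite I] (a : I → Ob) (b : Ob), Category.{v₁} (Hom I a b)]
  {Ob' : Type w'} {Hom' : ∀ (I : Type) [Finite I], (I → Ob') → Ob' → Type v'}
  [∀ (I : Type) [Finite I] (a : I → Ob') (b : Ob'), Category.{v₂} (Hom' I a b)]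
  {Ob'' : Type w''} {Hom'' : ∀ (I : Type) [Finite I], (I → Ob'') → Ob'' → Type v''}
  [∀ (I : Type) [Finite I] (a : I → Ob'') (b : Ob''), Category.{v₃} (Hom'' I a b)]

/-- A categorically enriched symmetric multifunctor `M ⟶ N` with object function `F₀`. -/
structure Multifunctor (M : Multicategory Ob Hom) (N : Multicategory Ob' Hom')
    (F₀ : Ob → Ob') where
  map {I : Type} [Finite I] (a : I → Ob) (b : Ob) :
    Hom I a b ⥤ Hom' I (fun i => F₀ (a i)) (F₀ b)
  map_id (a : Ob) : (map (fun _ => a) a).obj (M.id a) = N.id (F₀ a)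
  map_act {I J : Type} [Finite I] [Finite J] (e : I ≃ J) (a : J → Ob) (b : Ob) :
    M.act e a b ⋙ map (fun i => a (e i)) b = map a b ⋙ N.act e (fun j => F₀ (a j)) (F₀ b)
  map_comp {I : Type} [Finite I] {K : I → Type} [∀ i, Finite (K i)]
    (a : ∀ i, K i → Ob) (b : I → Ob) (c : Ob) :
    M.comp a b c ⋙ map (fun x : Σ i, K i => a x.1 x.2) c =
      Functor.prod (map b c) (Functor.pi fun i => map (a i) (b i)) ⋙
        N.comp (fun i k => F₀ (a i k)) (fun i => F₀ (b i)) (F₀ c)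

/-- Composition of multifunctors. -/
def Multifunctor.comp {M : Multicategory Ob Hom} {N : Multicategory Ob' Hom'}
    {P : Multicategory Ob'' Hom''} {F₀ : Ob → Ob'} {G₀ : Ob' → Ob''}
    (F : Multifunctor M N F₀) (G : Multifunctor N P G₀) :
    Multifunctor M P (fun a => G₀ (F₀ a)) where
  map a b := F.map a b ⋙ G.map (fun i => F₀ (a i)) (F₀ b)
  map_id a := by
    have h := F.map_id a
    have h' := G.map_id (F₀ a)
    simp only [Functor.comp_obj]
    rw [h, h']
  map_act e a b := by
    rw [← Functor.assoc, F.map_act, Functor.assoc, G.map_act e (fun j => F₀ (a j)) (F₀ b),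
      Functor.assoc]
  map_comp a b c := by
    rw [← Functor.assoc, F.map_comp, Functor.assoc,
      G.map_comp (fun i k => F₀ (a i k)) (fun i => F₀ (b i)) (F₀ c)]
    rfl

namespace Multicategory

variable (N : Multicategory Ob' Hom')

/-- Postcomposition with a `1`-ary morphism. -/
def post {I : Type} [Finite I] (a : I → Ob') {b c : Ob'} (h : Hom' Unit (fun _ => b) c) :
    Hom' I a b ⥤ Hom' I a c :=
  Functor.prod' ((Functor.const _).obj h) (Functor.pi' fun _ : Unit => 𝟭 (Hom' I a b)) ⋙
    N.comp (fun _ => a) (fun _ => b) c ⋙ N.act (unitSigma I).symm (fun x => a x.2) c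

/-- Precomposition with a family of `1`-ary morphisms. -/
def pre {I : Type} [Finite I] {a a' : I → Ob'} (h : ∀ i, Hom' Unit (fun _ => a i) (a' i))
    (b : Ob') : Hom' I a' b ⥤ Hom' I a b :=
  Functor.prod' (𝟭 (Hom' I a' b)) ((Functor.const _).obj h) ⋙
    N.comp (fun i _ => a i) a' b ⋙ N.act (sigmaUnit I).symm (fun x => a x.1) b

end Multicategory

/-- A categorically enriched multinatural transformation `F ⟹ G`. -/
structure MultinatTrans {M : Multicategory Ob Hom} {N : Multicategory Ob' Hom'}
    {F₀ G₀ : Ob → Ob'} (F : Multifunctor M N F₀) (G : Multifunctor M N G₀) where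
  app (a : Ob) : Hom' Unit (fun _ => F₀ a) (G₀ a)
  naturality {I : Type} [Finite I] (a : I → Ob) (b : Ob) :
    F.map a b ⋙ N.post (fun i => F₀ (a i)) (app b) =
      G.map a b ⋙ N.pre (fun i => app (a i)) (G₀ b)

end Multifunctors


/-! ## Based categories -/

/-- A small category with a chosen base object. -/
structure BasedCat where
  C : Type u
  [cat : SmallCategory C]
  pt : C

attribute [instance] BasedCat.cat

/-- A functor preserving the base objects. -/
structure BasedFunctor (X Y : BasedCat.{u}) where
  functor : X.C ⥤ Y.C
  map_pt : functor.obj X.pt = Y.pt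

theorem BasedFunctor.ext {X Y : BasedCat.{u}} {F G : BasedFunctor X Y}
    (h : F.functor = G.functor) : F = G := by
  cases F; cases G; cases h; rfl

/-- The category `Cat_*` of small based categories and based functors. -/
instance : Category BasedCat.{u} where
  Hom := BasedFunctor
  id X := ⟨𝟭 _, rfl⟩
  comp F G := ⟨F.functor ⋙ G.functor, by rw [Functor.comp_obj, F.map_pt, G.map_pt]⟩

/-- The underlying functor of a morphism of `Cat_*`. -/
def BasedCat.func {X Y : BasedCat.{u}} (F : X ⟶ Y) : X.C ⥤ Y.C := BasedFunctor.functor F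

@[simp] theorem BasedCat.func_id (X : BasedCat.{u}) : BasedCat.func (𝟙 X) = 𝟭 _ := rfl

@[simp] theorem BasedCat.func_comp {X Y Z : BasedCat.{u}} (F : X ⟶ Y) (G : Y ⟶ Z) :
    BasedCat.func (F ≫ G) = BasedCat.func F ⋙ BasedCat.func G := rfl

theorem BasedCat.func_pt {X Y : BasedCat.{u}} (F : X ⟶ Y) :
    (BasedCat.func F).obj X.pt = Y.pt := BasedFunctor.map_pt F

/-- The constant functor at the base object. -/
def BasedCat.zero (X Y : BasedCat.{u}) : X ⟶ Y :=
  BasedFunctor.mk ((Functor.const _).obj Y.pt) rfl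

/-- The category is the one-point category. -/
def BasedCat.IsTrivial (X : BasedCat.{u}) : Prop :=
  (∀ x : X.C, x = X.pt) ∧ ∀ f : X.pt ⟶ X.pt, f = 𝟙 _

/-! ## The category `ℰ` and `ℰ_*`-categories -/

/-- An object of `ℰ`: a tuple `([m₁], …, [m_r])` of objects of `Δᵒᵖ`. -/
structure EObj where
  len : ℕ
  val : Fin len → ℕ

/-- `m` extended by `m none = 1`, so that for the partial inverse `p` of an injection
`q : r → s` the `j`-th entry of `q_* ⟨m⟩` is `[t.ext (p j)]`. -/
def EObj.ext (t : EObj) : Option (Fin t.len) → ℕ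
  | none => 1
  | some k => t.val k

/-- A morphism of `ℰ`: an injection `q` together with its partial inverse `p` and a morphism
`q_* s ⟶ t` in the product of copies of `Δᵒᵖ`, i.e. monotone maps in the opposite
direction. -/
structure EHom (s t : EObj) where
  q : Fin s.len → Fin t.len
  p : Fin t.len → Option (Fin s.len)
  p_eq_some : ∀ i j, p j = some i ↔ q i = j
  β : ∀ j, Fin (t.val j + 1) →o Fin (s.ext (p j) + 1)

namespace EHom

theorem ext' {s t : EObj} {f g : EHom s t} (hp : ∀ j, f.p j = g.p j)
    (hβ : ∀ j x, (f.β j x).val = (g.β j x).val) : f = g := by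
  obtain ⟨q, p, h, β⟩ := f
  obtain ⟨q', p', h', β'⟩ := g
  obtain rfl : p = p' := funext hp
  obtain rfl : q = q' := by
    funext i
    exact ((h i _).1 ((h' i _).2 rfl))
  obtain rfl : β = β' := by
    funext j
    ext x
    exact hβ j x
  rfl

/-- The maps `β` extended by the identity of `[1]`. -/
def ext {s t : EObj} (f : EHom s t) :
    ∀ o : Option (Fin t.len), Fin (t.ext o + 1) →o Fin (s.ext (o.bind f.p) + 1)
  | none => OrderHom.id
  | some j => f.β j

theorem ext_val_none {s t : EObj} (f : EHom s t) {o : Option (Fin t.len)} (h : o = none)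
    (x : Fin (t.ext o + 1)) : (f.ext o x).val = x.val := by
  subst h; rfl

theorem ext_val_some {s t : EObj} (f : EHom s t) {o : Option (Fin t.len)} {j : Fin t.len}
    (h : o = some j) (x : Fin (t.ext o + 1)) :
    (f.ext o x).val = (f.β j ⟨x.val, by subst h; exact x.2⟩).val := by
  subst h; rfl

theorem β_congr {s t : EObj} (f : EHom s t) {j j' : Fin t.len} (h : j = j')
    {x : Fin (t.val j + 1)} {x' : Fin (t.val j' + 1)} (hx : x.val = x'.val) :
    (f.β j x).val = (f.β j' x').val := by
  subst h
  rw [Fin.ext hx]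

/-- The identity. -/
def id (t : EObj) : EHom t t :=
  ⟨fun i => i, fun j => some j, fun i j => by simp [eq_comm], fun _ => OrderHom.id⟩

/-- The composite `g ∘ f`. -/
def comp {s t u : EObj} (f : EHom s t) (g : EHom t u) : EHom s u :=
  ⟨fun i => g.q (f.q i), fun k => (g.p k).bind f.p, fun i k => by
      simp [Option.bind_eq_some_iff, g.p_eq_some, f.p_eq_some],
    fun k => (f.ext (g.p k)).comp (g.β k)⟩

theorem comp_val_none {s t u : EObj} (f : EHom s t) (g : EHom t u) {k : Fin u.len}
    (h : g.p k = none) (x : Fin (u.val k + 1)) : ((f.comp g).β k x).val = (g.β k x).val :=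
  ext_val_none f h _

theorem comp_val_some {s t u : EObj} (f : EHom s t) (g : EHom t u) {k : Fin u.len} {j : Fin t.len}
    (h : g.p k = some j) (x : Fin (u.val k + 1)) {y : Fin (t.val j + 1)}
    (hy : (g.β k x).val = y.val) : ((f.comp g).β k x).val = (f.β j y).val :=
  (ext_val_some f h _).trans (β_congr f rfl hy)

theorem β_lt {s t : EObj} (f : EHom s t) {j : Fin t.len} {i : Fin s.len} (h : f.p j = some i)
    (x : Fin (t.val j + 1)) : (f.β j x).val < s.val i + 1 := by
  exact (f.β j x).2.trans_eq (by rw [h]; rfl)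

end EHom

instance : Category EObj where
  Hom := EHom
  id := EHom.id
  comp := EHom.comp
  id_comp {s t} f := by
    refine EHom.ext' (fun j => by simp [EHom.comp, EHom.id]) fun j x => ?_
    obtain h | ⟨i, h⟩ := (f.p j).eq_none_or_eq_some
    · rw [EHom.comp_val_none _ _ h]
    · rw [EHom.comp_val_some _ _ h x (y := ⟨_, f.β_lt h x⟩) rfl]; rfl
  comp_id f := EHom.ext' (fun j => rfl) fun j x => rfl
  assoc f g h := by
    refine EHom.ext' (fun j => by simp [EHom.comp, Option.bind_assoc]) fun j x => ?_
    obtain hj | ⟨i, hj⟩ := (h.p j).eq_none_or_eq_some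
    · rw [EHom.comp_val_none f _ (by simp [EHom.comp, hj]), EHom.comp_val_none g _ hj,
        EHom.comp_val_none _ _ hj]
    · rw [EHom.comp_val_some _ _ hj x (y := ⟨_, h.β_lt hj x⟩) rfl]
      have e := EHom.comp_val_some g h hj x (y := ⟨_, h.β_lt hj x⟩) rfl
      obtain hi | ⟨l, hi⟩ := (g.p i).eq_none_or_eq_some
      · have hk : (EHom.comp g h).p j = none := by simp [EHom.comp, hj, hi]
        exact (EHom.comp_val_none f g hi _).trans (e.symm.trans (EHom.comp_val_none f _ hk x).symm)
      · have hk : (EHom.comp g h).p j = some l := by simp [EHom.comp, hj, hi]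
        rw [EHom.comp_val_some f g hi _ (y := ⟨_, g.β_lt hi _⟩) rfl]
        exact (EHom.comp_val_some f _ hk x e).symm

section EAccess
variable {s t : EObj}

/-- The injection underlying a morphism of `ℰ`. -/
def eInj (f : s ⟶ t) : Fin s.len → Fin t.len := EHom.q f
/-- The partial inverse of the injection underlying a morphism of `ℰ`. -/
def ePre (f : s ⟶ t) : Fin t.len → Option (Fin s.len) := EHom.p f
/-- The monotone maps underlying a morphism of `ℰ`, with values regarded as natural numbers. -/
def eMap (f : s ⟶ t) (j : Fin t.len) (x : Fin (t.val j + 1)) : ℕ := (EHom.β f j x).val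

end EAccess

/-- The data of an `ℰ_*`-category whose values on objects are the given based categories. -/
structure EStarStr (X₀ : EObj → BasedCat.{u}) where
  map {s t : EObj} (f : s ⟶ t) : X₀ s ⟶ X₀ t
  map_id (t : EObj) : map (𝟙 t) = 𝟙 _
  map_comp {s t w : EObj} (f : s ⟶ t) (g : t ⟶ w) : map (f ≫ g) = map f ≫ map g
  trivial (t : EObj) : (∃ k, t.val k = 0) → (X₀ t).IsTrivial

/-- An `ℰ_*`-category: a functor `X : ℰ ⥤ Cat_*` with `X ([m₁], …, [m_r]) = *` if some
`m_k = 0`. -/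
structure EStarCat where
  functor : EObj ⥤ BasedCat.{u}
  trivial (t : EObj) : (∃ k, t.val k = 0) → (functor.obj t).IsTrivial

/-- An `ℰ_*`-category from its values on objects and the rest of its structure. -/
abbrev EStarStr.toEStarCat {X₀ : EObj → BasedCat.{u}} (s : EStarStr X₀) : EStarCat.{u} where
  functor :=
    { obj := X₀
      map := s.map
      map_id := s.map_id
      map_comp := s.map_comp }
  trivial := s.trivial

/-- The category `X t`. -/
abbrev EStarCat.at (X : EStarCat.{u}) (t : EObj) : Type u := (X.functor.obj t).C

/-- The functor `X s ⥤ X t` induced by a morphism of `ℰ`. -/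
abbrev EStarCat.tr (X : EStarCat.{u}) {s t : EObj} (f : s ⟶ t) : X.at s ⥤ X.at t :=
  BasedCat.func (X.functor.map f)

/-- A presentation of `t : ℰ` as the concatenation `⊙_{i : I} m i` of a finite family of objects of
`ℰ`, for the ordering of the entries of all the `m i` given by the bijection `e`. For `I = Fin k`
and the lexicographic ordering, this is the concatenation `m₁ ⊙ ⋯ ⊙ m_k`. -/
structure Concat {I : Type} (m : I → EObj) (t : EObj) where
  e : (Σ i, Fin (m i).len) ≃ Fin t.len
  val_eq : ∀ i k, t.val (e ⟨i, k⟩) = (m i).val k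

/-- The one-fold concatenation. -/
def Concat.self (t : EObj) : Concat (fun _ : Unit => t) t := ⟨unitSigma _, fun _ _ => rfl⟩

/-- `g : t ⟶ t'` is the concatenation `⊙_{i : I} f i` of the morphisms `f i : m i ⟶ m' i`. -/
def IsConcat {I : Type} {m m' : I → EObj} {t t' : EObj} (h : Concat m t) (h' : Concat m' t')
    (f : ∀ i, m i ⟶ m' i) (g : t ⟶ t') : Prop :=
  ∀ (i : I) (k : Fin (m' i).len),
    ePre g (h'.e ⟨i, k⟩) = (ePre (f i) k).map (fun l => h.e ⟨i, l⟩) ∧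
    ∀ x y, x.val = y.val → eMap g (h'.e ⟨i, k⟩) x = eMap (f i) k y

/-- A multimorphism `(X i)_{i : I} ⟶ Y` of `ℰ_*`-categories: functors
`∏_i X i (m i) ⥤ Y (⊙_i m i)`, natural in the `m i` (including permutations of the
entries of the concatenation), and compatible with base points. -/
structure EMor (I : Type) [Finite I] (X : I → EStarCat.{u}) (Y : EStarCat.{u}) where
  app {m : I → EObj} {t : EObj} (h : Concat m t) : (∀ i, (X i).at (m i)) ⥤ Y.at t
  naturality {m m' : I → EObj} {t t' : EObj} (h : Concat m t) (h' : Concat m' t')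
    (f : ∀ i, m i ⟶ m' i) (g : t ⟶ t') : IsConcat h h' f g →
    Functor.pi (fun i => (X i).tr (f i)) ⋙ app h' = app h ⋙ Y.tr g
  obj_pt {m : I → EObj} {t : EObj} (h : Concat m t) (x : ∀ i, (X i).at (m i)) (i : I) :
    x i = ((X i).functor.obj (m i)).pt → (app h).obj x = (Y.functor.obj t).pt
  map_pt {m : I → EObj} {t : EObj} (h : Concat m t) {x y : ∀ i, (X i).at (m i)} (f : x ⟶ y)
    (i : I) : x i = ((X i).functor.obj (m i)).pt → IsId (f i) → IsId ((app h).map f)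

/-- A cell between multimorphisms of `ℰ_*`-categories: a modification compatible with base
points. -/
@[ext]
structure EMor.Hom {I : Type} [Finite I] {X : I → EStarCat.{u}} {Y : EStarCat.{u}}
    (F G : EMor I X Y) where
  app {m : I → EObj} {t : EObj} (h : Concat m t) : F.app h ⟶ G.app h
  modification {m m' : I → EObj} {t t' : EObj} (h : Concat m t) (h' : Concat m' t')
    (f : ∀ i, m i ⟶ m' i) (g : t ⟶ t') : IsConcat h h' f g → ∀ x : ∀ i, (X i).at (m i),
    HEq ((app h').app (fun i => ((X i).tr (f i)).obj (x i))) ((Y.tr g).map ((app h).app x))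
  app_pt {m : I → EObj} {t : EObj} (h : Concat m t) (x : ∀ i, (X i).at (m i)) (i : I) :
    x i = ((X i).functor.obj (m i)).pt → IsId ((app h).app x)

theorem EMor.obj_tr {I : Type} [Finite I] {X : I → EStarCat.{u}} {Y : EStarCat.{u}}
    (F : EMor I X Y) {m m' : I → EObj} {t t' : EObj} (h : Concat m t) (h' : Concat m' t')
    (f : ∀ i, m i ⟶ m' i) (g : t ⟶ t') (hc : IsConcat h h' f g) (x : ∀ i, (X i).at (m i)) :
    (F.app h').obj (fun i => ((X i).tr (f i)).obj (x i)) = (Y.tr g).obj ((F.app h).obj x) :=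
  Functor.congr_obj (F.naturality h h' f g hc) x

instance (I : Type) [Finite I] (X : I → EStarCat.{u}) (Y : EStarCat.{u}) :
    Category (EMor I X Y) where
  Hom := EMor.Hom
  id F :=
    { app := fun h => 𝟙 _
      modification := fun h h' f g hc x => by
        simp only [NatTrans.id_app]
        rw [F.obj_tr h h' f g hc x]
        exact heq_of_eq (CategoryTheory.Functor.map_id _ _).symm
      app_pt := fun h x i _ => isId_id _ }
  comp {F G H} α β :=
    { app := fun h => α.app h ≫ β.app h
      modification := fun h h' f g hc x => by
        simp only [NatTrans.comp_app, Functor.map_comp]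
        exact heq_comp (F.obj_tr h h' f g hc x) (G.obj_tr h h' f g hc x) (H.obj_tr h h' f g hc x)
          (α.modification h h' f g hc x) (β.modification h h' f g hc x)
      app_pt := fun h x i hx => (α.app_pt h x i hx).comp (β.app_pt h x i hx) }
  id_comp α := EMor.Hom.ext (by funext m t h; exact Category.id_comp _)
  comp_id α := EMor.Hom.ext (by funext m t h; exact Category.comp_id _)
  assoc α β γ := EMor.Hom.ext (by funext m t h; exact Category.assoc _ _ _)

/-- The component of a cell of `ℰ_*`-categories. -/
def EMor.cell {I : Type} [Finite I] {X : I → EStarCat.{u}} {Y : EStarCat.{u}}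
    {F G : EMor I X Y} (α : F ⟶ G) {m : I → EObj} {t : EObj} (h : Concat m t) :
    F.app h ⟶ G.app h := EMor.Hom.app α h

/-- `E` is the multicategory `ℰ_*-Cat`: its identities, reindexings and composites are the evident
ones. -/
structure IsEStarMulticategory (E : Multicategory EStarCat.{u} EMor.{u}) : Prop where
  id_app (X : EStarCat.{u}) (t : EObj) :
    (E.id X).app (Concat.self t) = Pi.eval (fun _ : Unit => X.at t) ()
  act_app {I J : Type} [Finite I] [Finite J] (e : I ≃ J) (X : J → EStarCat.{u}) (Y : EStarCat.{u})
    (F : EMor J X Y) {m : J → EObj} {t : EObj} (h : Concat (fun i => m (e i)) t)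
    (h' : Concat m t) : (∀ i k, h.e ⟨i, k⟩ = h'.e ⟨e i, k⟩) →
    Pi.comap (fun j => (X j).at (m j)) e ⋙ ((E.act e X Y).obj F).app h = F.app h'
  act_cell {I J : Type} [Finite I] [Finite J] (e : I ≃ J) (X : J → EStarCat.{u}) (Y : EStarCat.{u})
    {F G : EMor J X Y} (α : F ⟶ G) {m : J → EObj} {t : EObj} (h : Concat (fun i => m (e i)) t)
    (h' : Concat m t) : (∀ i k, h.e ⟨i, k⟩ = h'.e ⟨e i, k⟩) →
    HEq (Functor.whiskerLeft (Pi.comap (fun j => (X j).at (m j)) e)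
      (EMor.cell ((E.act e X Y).map α) h)) (EMor.cell α h')
  comp_app {I : Type} [Finite I] {K : I → Type} [∀ i, Finite (K i)] (X : ∀ i, K i → EStarCat.{u})
    (Y : I → EStarCat.{u}) (Z : EStarCat.{u}) (G : EMor I Y Z) (F : ∀ i, EMor (K i) (X i) (Y i))
    {m : ∀ i, K i → EObj} {t : I → EObj} {w : EObj} (h : ∀ i, Concat (m i) (t i))
    (h' : Concat t w) (h'' : Concat (fun x : Σ i, K i => m x.1 x.2) w) :
    (∀ i k l, h''.e ⟨⟨i, k⟩, l⟩ = h'.e ⟨i, (h i).e ⟨k, l⟩⟩) →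
    ((E.comp X Y Z).obj (G, F)).app h'' = multicomp (G.app h') (fun i => (F i).app (h i))
  comp_cell {I : Type} [Finite I] {K : I → Type} [∀ i, Finite (K i)] (X : ∀ i, K i → EStarCat.{u})
    (Y : I → EStarCat.{u}) (Z : EStarCat.{u}) {G G' : EMor I Y Z}
    {F F' : ∀ i, EMor (K i) (X i) (Y i)} (α : G ⟶ G') (β : ∀ i, F i ⟶ F' i)
    {m : ∀ i, K i → EObj} {t : I → EObj} {w : EObj} (h : ∀ i, Concat (m i) (t i))
    (h' : Concat t w) (h'' : Concat (fun x : Σ i, K i => m x.1 x.2) w) :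
    (∀ i k l, h''.e ⟨⟨i, k⟩, l⟩ = h'.e ⟨i, (h i).e ⟨k, l⟩⟩) →
    HEq (EMor.cell ((E.comp X Y Z).map (CategoryTheory.Prod.mkHom α β)) h'')
      (multicompHom (EMor.cell α h') (fun i => EMor.cell (β i) (h i)))

/-! ## Waldhausen categories -/

/-- A small Waldhausen category. -/
structure WaldCat where
  C : Type u
  [cat : SmallCategory C]
  pt : C
  isZero : IsZero pt
  weq : MorphismProperty C
  cof : MorphismProperty C
  weq_comp {X Y Z : C} (f : X ⟶ Y) (g : Y ⟶ Z) : weq f → weq g → weq (f ≫ g)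
  cof_comp {X Y Z : C} (f : X ⟶ Y) (g : Y ⟶ Z) : cof f → cof g → cof (f ≫ g)
  weq_of_isIso {X Y : C} (f : X ⟶ Y) : IsIso f → weq f
  cof_of_isIso {X Y : C} (f : X ⟶ Y) : IsIso f → cof f
  cof_of_pt {X : C} (f : pt ⟶ X) : cof f
  hasPushout {X Y Z : C} (f : X ⟶ Y) (g : X ⟶ Z) : cof f → HasPushout f g
  cof_pushout {X Y Z P : C} {f : X ⟶ Y} {g : X ⟶ Z} {i : Y ⟶ P} {j : Z ⟶ P} :
    IsPushout f g i j → cof f → cof j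
  gluing {X Y Z P X' Y' Z' P' : C} {f : X ⟶ Y} {g : X ⟶ Z} {i : Y ⟶ P} {j : Z ⟶ P}
    {f' : X' ⟶ Y'} {g' : X' ⟶ Z'} {i' : Y' ⟶ P'} {j' : Z' ⟶ P'}
    (a : X ⟶ X') (b : Y ⟶ Y') (c : Z ⟶ Z') (d : P ⟶ P') :
    IsPushout f g i j → IsPushout f' g' i' j' → cof f → cof f' →
    f ≫ b = a ≫ f' → g ≫ c = a ≫ g' → i ≫ d = b ≫ i' → j ≫ d = c ≫ j' →
    weq a → weq b → weq c → weq d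

attribute [instance] WaldCat.cat

/-- A small Waldhausen category with a choice of wedges. -/
structure WaldVee extends WaldCat.{u} where
  wedge : C → C → C
  inl (X Y : C) : X ⟶ wedge X Y
  inr (X Y : C) : Y ⟶ wedge X Y
  isPushout (X Y : C) : IsPushout (isZero.to_ X) (isZero.to_ Y) (inl X Y) (inr X Y)
  wedge_pt (X : C) : wedge X pt = X
  inl_pt (X : C) : inl X pt = eqToHom (wedge_pt X).symm
  pt_wedge (X : C) : wedge pt X = X
  inr_pt (X : C) : inr pt X = eqToHom (pt_wedge X).symm

/-- The product poset `∏_i [m i]`. -/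
def Cube {I : Type} (m : I → ℕ) : Type := ∀ i, Fin (m i + 1)

instance {I : Type} (m : I → ℕ) : PartialOrder (Cube m) :=
  inferInstanceAs (PartialOrder (∀ i, Fin (m i + 1)))

/-- The functor given by a monotone map. -/
abbrev monoFunctor {P Q : Type} [Preorder P] [Preorder Q] (f : P → Q) (hf : Monotone f) : P ⥤ Q :=
  hf.functor

/-- The cocone over the restriction of `G` to the elements `x` with `v ≤ x < w`, with vertex
`G w`. -/
def latchingCocone {P : Type} [Preorder P] {C : Type u} [SmallCategory C] (G : P ⥤ C) (v w : P) :
    Cocone (monoFunctor (fun x : Set.Ico v w => x.1) (fun _ _ h => h) ⋙ G) where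
  pt := G.obj w
  ι :=
    { app := fun x => G.map (homOfLE x.2.2.le)
      naturality := fun x y f => by
        exact ((G.map_comp _ _).symm.trans (congrArg G.map (Subsingleton.elim _ _))).trans
          (Category.comp_id _).symm }

/-- Cubically cofibrant functors `∏_i [m i] ⥤ C`. For `v ≤ w` with `w i ≤ v i + 1` the interval from
`v` to `w` is a subcube with edges of length `1`, and the map from the colimit of this subcube
without its terminal vertex to the terminal vertex has to be a cofibration. -/
def CubicallyCofibrant (W : WaldCat.{u}) {I : Type} {m : I → ℕ} (G : Cube m ⥤ W.C) : Prop :=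
  (∀ {v w : Cube m} (f : v ⟶ w), W.cof (G.map f)) ∧
  ∀ v w : Cube m, v ≤ w → (∀ i, (w i).val ≤ (v i).val + 1) →
    ∃ (c : Cocone (monoFunctor (fun x : Set.Ico v w => x.1) (fun _ _ h => h) ⋙ G))
      (hc : IsColimit c), W.cof (hc.desc (latchingCocone G v w))

/-- A morphism of a product category is an identity in all coordinates except `i`. -/
def IsAlong {I : Type} {A : I → Type u} [∀ i, SmallCategory (A i)] (i : I) {x y : ∀ i, A i}
    (f : x ⟶ y) : Prop := ∀ j, j ≠ i → IsId (f j)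

/-- The cube `[1]^I ⥤ ∏_i A i` given by morphisms `f i` in `A i`. -/
def arrowCube {I : Type} {A : I → Type u} [∀ i, SmallCategory (A i)] {x y : ∀ i, A i}
    (f : x ⟶ y) : Cube (fun _ : I => 1) ⥤ ∀ i, A i :=
  Functor.pi' fun i => monoFunctor (Q := Fin (1 + 1)) (fun v : Cube (fun _ : I => 1) => v i)
    (fun _ _ h => h i) ⋙ ComposableArrows.mk₁ (f i)

/-- `k`-exact functors: exact in each variable, and cubically cofibrant on families of
cofibrations. -/
structure IsMultiexact {I : Type} (A : I → WaldVee.{u}) (B : WaldVee.{u})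
    (F : (∀ i, (A i).C) ⥤ B.C) : Prop where
  map_pt (x : ∀ i, (A i).C) (i : I) : x i = (A i).pt → F.obj x = B.pt
  map_weq {x y : ∀ i, (A i).C} (f : x ⟶ y) (i : I) :
    IsAlong i f → (A i).weq (f i) → B.weq (F.map f)
  map_cof {x y : ∀ i, (A i).C} (f : x ⟶ y) (i : I) :
    IsAlong i f → (A i).cof (f i) → B.cof (F.map f)
  map_pushout {x y z w : ∀ i, (A i).C} (f : x ⟶ y) (g : x ⟶ z) (h : y ⟶ w) (k : z ⟶ w) (i : I) :
    IsAlong i f → IsAlong i g → IsAlong i h → IsAlong i k → (A i).cof (f i) →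
    IsPushout (f i) (g i) (h i) (k i) → IsPushout (F.map f) (F.map g) (F.map h) (F.map k)
  cubical {x y : ∀ i, (A i).C} (f : x ⟶ y) : (∀ i, (A i).cof (f i)) →
    CubicallyCofibrant B.toWaldCat (arrowCube f ⋙ F)

/-- The `k`-exact functors, i.e. the multimorphisms of `Wald_∨`. -/
structure KExact (I : Type) [Finite I] (A : I → WaldVee.{u}) (B : WaldVee.{u}) where
  functor : (∀ i, (A i).C) ⥤ B.C
  isMultiexact : IsMultiexact A B functor

/-- A natural transformation between `k`-exact functors. -/
@[ext]
structure KExact.Hom {I : Type} [Finite I] {A : I → WaldVee.{u}} {B : WaldVee.{u}}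
    (F G : KExact I A B) where
  nat : F.functor ⟶ G.functor

instance (I : Type) [Finite I] (A : I → WaldVee.{u}) (B : WaldVee.{u}) :
    Category (KExact I A B) where
  Hom := KExact.Hom
  id _ := ⟨𝟙 _⟩
  comp α β := ⟨α.nat ≫ β.nat⟩
  id_comp _ := KExact.Hom.ext (Category.id_comp _)
  comp_id _ := KExact.Hom.ext (Category.comp_id _)
  assoc _ _ _ := KExact.Hom.ext (Category.assoc _ _ _)

/-- The natural transformation underlying a cell of `Wald_∨`. -/
def KExact.cell {I : Type} [Finite I] {A : I → WaldVee.{u}} {B : WaldVee.{u}}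
    {F G : KExact I A B} (α : F ⟶ G) : F.functor ⟶ G.functor := KExact.Hom.nat α

/-- `W` is the multicategory `Wald_∨`: identities, reindexings and composites are those of
functors and natural transformations. -/
structure IsWaldMulticategory (W : Multicategory WaldVee.{u} KExact.{u}) : Prop where
  id_functor (A : WaldVee.{u}) : (W.id A).functor = Pi.eval (fun _ : Unit => A.C) ()
  act_functor {I J : Type} [Finite I] [Finite J] (e : I ≃ J) (A : J → WaldVee.{u})
    (B : WaldVee.{u}) (F : KExact J A B) :
    Pi.comap (fun j => (A j).C) e ⋙ ((W.act e A B).obj F).functor = F.functor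
  act_cell {I J : Type} [Finite I] [Finite J] (e : I ≃ J) (A : J → WaldVee.{u})
    (B : WaldVee.{u}) {F G : KExact J A B} (α : F ⟶ G) :
    HEq (Functor.whiskerLeft (Pi.comap (fun j => (A j).C) e) (KExact.cell ((W.act e A B).map α)))
      (KExact.cell α)
  comp_functor {I : Type} [Finite I] {K : I → Type} [∀ i, Finite (K i)]
    (A : ∀ i, K i → WaldVee.{u}) (B : I → WaldVee.{u}) (C : WaldVee.{u}) (G : KExact I B C)
    (F : ∀ i, KExact (K i) (A i) (B i)) :
    ((W.comp A B C).obj (G, F)).functor = multicomp G.functor (fun i => (F i).functor)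
  comp_cell {I : Type} [Finite I] {K : I → Type} [∀ i, Finite (K i)]
    (A : ∀ i, K i → WaldVee.{u}) (B : I → WaldVee.{u}) (C : WaldVee.{u}) {G G' : KExact I B C}
    {F F' : ∀ i, KExact (K i) (A i) (B i)} (α : G ⟶ G') (β : ∀ i, F i ⟶ F' i) :
    HEq (KExact.cell ((W.comp A B C).map (CategoryTheory.Prod.mkHom α β)))
      (multicompHom (KExact.cell α) (fun i => KExact.cell (β i)))

/-! ## Strictly unital symmetric monoidal categories -/

open MonoidalCategory

/-- A small symmetric monoidal category with strict unit. -/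
structure SMCat where
  C : Type u
  [cat : SmallCategory C]
  [mon : MonoidalCategory C]
  [symm : SymmetricCategory C]
  left_strict (X : C) : IsId (λ_ X).hom
  right_strict (X : C) : IsId (ρ_ X).hom

attribute [instance] SMCat.cat SMCat.mon SMCat.symm

/-- `z` arises from `x` and `y`, which agree outside the coordinate `i`, by taking the sum in the
coordinate `i`. -/
def SumAt {I : Type} {A : I → SMCat.{u}} (i : I) (x y z : ∀ i, (A i).C) : Prop :=
  z i = x i ⊗ y i ∧ ∀ j, j ≠ i → x j = z j ∧ y j = z j

/-- `k`-linear functors, i.e. the multimorphisms of `SMC`. The isomorphism `δ i h` is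
`δ_i : F (…, c_i, …) ⊕ F (…, c_i', …) ≅ F (…, c_i ⊕ c_i', …)`. -/
structure KLinear (I : Type) [Finite I] (A : I → SMCat.{u}) (B : SMCat.{u}) where
  functor : (∀ i, (A i).C) ⥤ B.C
  δ (i : I) {x y z : ∀ i, (A i).C} (h : SumAt i x y z) :
    functor.obj x ⊗ functor.obj y ≅ functor.obj z
  δ_naturality (i : I) {x y z x' y' z' : ∀ i, (A i).C} (h : SumAt i x y z)
    (h' : SumAt i x' y' z') (f : x ⟶ x') (g : y ⟶ y') (k : z ⟶ z') :
    HEq (k i) (f i ⊗ₘ g i) → (∀ j, j ≠ i → HEq (f j) (k j) ∧ HEq (g j) (k j)) →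
    (functor.map f ⊗ₘ functor.map g) ≫ (δ i h').hom = (δ i h).hom ≫ functor.map k
  obj_unit (x : ∀ i, (A i).C) (i : I) : x i = 𝟙_ (A i).C → functor.obj x = 𝟙_ B.C
  map_unit {x y : ∀ i, (A i).C} (f : x ⟶ y) (i : I) : x i = 𝟙_ (A i).C → IsId (f i) →
    IsId (functor.map f)
  δ_unit (i : I) {x y z : ∀ i, (A i).C} (h : SumAt i x y z) :
    (x i = 𝟙_ (A i).C ∨ y i = 𝟙_ (A i).C ∨ ∃ j, j ≠ i ∧ z j = 𝟙_ (A j).C) → IsId (δ i h).hom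
  δ_assoc (i : I) {x y w xy yw s s' : ∀ i, (A i).C} (h₁ : SumAt i x y xy) (h₂ : SumAt i xy w s)
    (h₃ : SumAt i y w yw) (h₄ : SumAt i x yw s') (a : s ⟶ s') :
    HEq (a i) (α_ (x i) (y i) (w i)).hom → IsAlong i a →
    (δ i h₁).hom ▷ functor.obj w ≫ (δ i h₂).hom ≫ functor.map a =
      (α_ _ _ _).hom ≫ functor.obj x ◁ (δ i h₃).hom ≫ (δ i h₄).hom
  δ_symm (i : I) {x y s s' : ∀ i, (A i).C} (h : SumAt i x y s) (h' : SumAt i y x s')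
    (a : s ⟶ s') : HEq (a i) (β_ (x i) (y i)).hom → IsAlong i a →
    (δ i h).hom ≫ functor.map a = (β_ _ _).hom ≫ (δ i h').hom
  δ_δ (i j : I) {x₀₀ x₁₀ x₀₁ x₁₁ a b c d s : ∀ i, (A i).C} (hij : i ≠ j)
    (h₁ : SumAt i x₀₀ x₁₀ a) (h₂ : SumAt i x₀₁ x₁₁ b) (h₃ : SumAt j a b s)
    (h₄ : SumAt j x₀₀ x₀₁ c) (h₅ : SumAt j x₁₀ x₁₁ d) (h₆ : SumAt i c d s) :
    ((δ i h₁).hom ⊗ₘ (δ i h₂).hom) ≫ (δ j h₃).hom =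
      tensorμ _ _ _ _ ≫ ((δ j h₄).hom ⊗ₘ (δ j h₅).hom) ≫ (δ i h₆).hom

/-- A `k`-linear natural transformation. -/
@[ext]
structure KLinear.Hom {I : Type} [Finite I] {A : I → SMCat.{u}} {B : SMCat.{u}}
    (F G : KLinear I A B) where
  nat : F.functor ⟶ G.functor
  δ_nat (i : I) {x y z : ∀ i, (A i).C} (h : SumAt i x y z) :
    (F.δ i h).hom ≫ nat.app z = (nat.app x ⊗ₘ nat.app y) ≫ (G.δ i h).hom
  app_unit (x : ∀ i, (A i).C) (i : I) : x i = 𝟙_ (A i).C → IsId (nat.app x)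

instance (I : Type) [Finite I] (A : I → SMCat.{u}) (B : SMCat.{u}) :
    Category (KLinear I A B) where
  Hom := KLinear.Hom
  id F := ⟨𝟙 _, fun i x y z h => by simp, fun x i _ => isId_id _⟩
  comp α β := ⟨α.nat ≫ β.nat, fun i x y z h => by
      rw [NatTrans.comp_app, ← Category.assoc, α.δ_nat i h, Category.assoc, β.δ_nat i h,
        ← Category.assoc]
      simp, fun x i hx => (α.app_unit x i hx).comp (β.app_unit x i hx)⟩
  id_comp α := KLinear.Hom.ext (Category.id_comp _)
  comp_id α := KLinear.Hom.ext (Category.comp_id _)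
  assoc α β γ := KLinear.Hom.ext (Category.assoc _ _ _)

/-- The natural transformation underlying a cell of `SMC`. -/
def KLinear.cell {I : Type} [Finite I] {A : I → SMCat.{u}} {B : SMCat.{u}}
    {F G : KLinear I A B} (α : F ⟶ G) : F.functor ⟶ G.functor := KLinear.Hom.nat α

/-- `M` is the multicategory `SMC`. -/
structure IsSMMulticategory (M : Multicategory SMCat.{u} KLinear.{u}) : Prop where
  id_functor (A : SMCat.{u}) : (M.id A).functor = Pi.eval (fun _ : Unit => A.C) ()
  id_δ (A : SMCat.{u}) {x y z : Unit → A.C} (h : SumAt (A := fun _ : Unit => A) () x y z) :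
    IsId ((M.id A).δ () h).hom
  act_functor {I J : Type} [Finite I] [Finite J] (e : I ≃ J) (A : J → SMCat.{u})
    (B : SMCat.{u}) (F : KLinear J A B) :
    Pi.comap (fun j => (A j).C) e ⋙ ((M.act e A B).obj F).functor = F.functor
  act_δ {I J : Type} [Finite I] [Finite J] (e : I ≃ J) (A : J → SMCat.{u})
    (B : SMCat.{u}) (F : KLinear J A B) (i : I) {x y z : ∀ j, (A j).C} (h : SumAt (e i) x y z)
    (h' : SumAt (A := fun i => A (e i)) i (fun i => x (e i)) (fun i => y (e i))
      (fun i => z (e i))) :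
    HEq (((M.act e A B).obj F).δ i h').hom (F.δ (e i) h).hom
  act_cell {I J : Type} [Finite I] [Finite J] (e : I ≃ J) (A : J → SMCat.{u})
    (B : SMCat.{u}) {F G : KLinear J A B} (α : F ⟶ G) :
    HEq (Functor.whiskerLeft (Pi.comap (fun j => (A j).C) e) (KLinear.cell ((M.act e A B).map α)))
      (KLinear.cell α)
  comp_functor {I : Type} [Finite I] {K : I → Type} [∀ i, Finite (K i)]
    (A : ∀ i, K i → SMCat.{u}) (B : I → SMCat.{u}) (C : SMCat.{u}) (G : KLinear I B C)
    (F : ∀ i, KLinear (K i) (A i) (B i)) :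
    ((M.comp A B C).obj (G, F)).functor = multicomp G.functor (fun i => (F i).functor)
  comp_δ {I : Type} [Finite I] {K : I → Type} [∀ i, Finite (K i)]
    (A : ∀ i, K i → SMCat.{u}) (B : I → SMCat.{u}) (C : SMCat.{u}) (G : KLinear I B C)
    (F : ∀ i, KLinear (K i) (A i) (B i)) (i : I) (k : K i)
    {x y z : ∀ l : Σ i, K i, (A l.1 l.2).C}
    (h : SumAt (A := fun l : Σ i, K i => A l.1 l.2) ⟨i, k⟩ x y z)
    (h' : SumAt k (fun l => x ⟨i, l⟩) (fun l => y ⟨i, l⟩) (fun l => z ⟨i, l⟩))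
    {w : ∀ i, (B i).C}
    (h'' : SumAt i (fun j => (F j).functor.obj fun l => x ⟨j, l⟩)
      (fun j => (F j).functor.obj fun l => y ⟨j, l⟩) w)
    (a : w ⟶ fun j => (F j).functor.obj fun l => z ⟨j, l⟩) :
    HEq (a i) ((F i).δ k h').hom → IsAlong i a →
    HEq (((M.comp A B C).obj (G, F)).δ ⟨i, k⟩ h).hom ((G.δ i h'').hom ≫ G.functor.map a)
  comp_cell {I : Type} [Finite I] {K : I → Type} [∀ i, Finite (K i)]
    (A : ∀ i, K i → SMCat.{u}) (B : I → SMCat.{u}) (C : SMCat.{u}) {G G' : KLinear I B C}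
    {F F' : ∀ i, KLinear (K i) (A i) (B i)} (α : G ⟶ G') (β : ∀ i, F i ⟶ F' i) :
    HEq (KLinear.cell ((M.comp A B C).map (CategoryTheory.Prod.mkHom α β)))
      (multicompHom (KLinear.cell α) (fun i => KLinear.cell (β i)))

/-! ## The symmetric monoidal category of a Waldhausen category with choice of wedges -/

namespace WaldVee

variable (A : WaldVee.{u})

theorem pt_hom_ext {X : A.C} (f g : A.pt ⟶ X) : f = g := A.isZero.eq_of_src f g

/-- The map out of `X ∨ Y` given by its universal property. -/
noncomputable def desc {X Y Z : A.C} (f : X ⟶ Z) (g : Y ⟶ Z) : A.wedge X Y ⟶ Z :=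
  (A.isPushout X Y).desc f g (A.pt_hom_ext _ _)

variable {A}

@[simp]
theorem inl_desc {X Y Z : A.C} (f : X ⟶ Z) (g : Y ⟶ Z) : A.inl X Y ≫ A.desc f g = f :=
  (A.isPushout X Y).inl_desc _ _ _

@[simp]
theorem inr_desc {X Y Z : A.C} (f : X ⟶ Z) (g : Y ⟶ Z) : A.inr X Y ≫ A.desc f g = g :=
  (A.isPushout X Y).inr_desc _ _ _

@[simp]
theorem inl_desc_assoc {X Y Z W : A.C} (f : X ⟶ Z) (g : Y ⟶ Z) (h : Z ⟶ W) :
    A.inl X Y ≫ A.desc f g ≫ h = f ≫ h := by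
  rw [← Category.assoc, inl_desc]

@[simp]
theorem inr_desc_assoc {X Y Z W : A.C} (f : X ⟶ Z) (g : Y ⟶ Z) (h : Z ⟶ W) :
    A.inr X Y ≫ A.desc f g ≫ h = g ≫ h := by
  rw [← Category.assoc, inr_desc]

@[ext]
theorem wedge_ext {X Y Z : A.C} {f g : A.wedge X Y ⟶ Z} (h : A.inl X Y ≫ f = A.inl X Y ≫ g)
    (h' : A.inr X Y ≫ f = A.inr X Y ≫ g) : f = g :=
  (A.isPushout X Y).hom_ext h h'

variable (A)

/-- The projection `X ∨ Y ⟶ Y`. -/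
noncomputable def π₂ (X Y : A.C) : A.wedge X Y ⟶ Y :=
  A.desc (A.isZero.from_ X ≫ A.isZero.to_ Y) (𝟙 Y)

/-- `f ∨ g`. -/
noncomputable def wedgeMap {X Y X' Y' : A.C} (f : X ⟶ X') (g : Y ⟶ Y') :
    A.wedge X Y ⟶ A.wedge X' Y' :=
  A.desc (f ≫ A.inl X' Y') (g ≫ A.inr X' Y')

/-- The symmetry `X ∨ Y ≅ Y ∨ X`. -/
noncomputable def wedgeSymm (X Y : A.C) : A.wedge X Y ≅ A.wedge Y X where
  hom := A.desc (A.inr Y X) (A.inl Y X)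
  inv := A.desc (A.inr X Y) (A.inl X Y)

/-- The associator `(X ∨ Y) ∨ Z ≅ X ∨ (Y ∨ Z)`. -/
noncomputable def wedgeAssoc (X Y Z : A.C) :
    A.wedge (A.wedge X Y) Z ≅ A.wedge X (A.wedge Y Z) where
  hom := A.desc (A.desc (A.inl _ _) (A.inl _ _ ≫ A.inr _ _)) (A.inr _ _ ≫ A.inr _ _)
  inv := A.desc (A.inl _ _ ≫ A.inl _ _) (A.desc (A.inr _ _ ≫ A.inl _ _) (A.inr _ _))

@[simp] theorem inl_pt_unit (X : A.C) :
    A.inl X A.pt ≫ (eqToIso (A.wedge_pt X)).hom = 𝟙 X := by simp [A.inl_pt]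

@[simp] theorem inr_pt_unit (X : A.C) :
    A.inr A.pt X ≫ (eqToIso (A.pt_wedge X)).hom = 𝟙 X := by simp [A.inr_pt]

noncomputable instance : MonoidalCategoryStruct A.C where
  tensorObj := A.wedge
  whiskerLeft X _ _ f := A.wedgeMap (𝟙 X) f
  whiskerRight f Y := A.wedgeMap f (𝟙 Y)
  tensorHom := A.wedgeMap
  tensorUnit := A.pt
  associator := A.wedgeAssoc
  leftUnitor X := eqToIso (A.pt_wedge X)
  rightUnitor X := eqToIso (A.wedge_pt X)

noncomputable instance : MonoidalCategory A.C :=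
  MonoidalCategory.ofTensorHom
    (id_tensorHom_id := fun X Y => by
      change A.wedgeMap (𝟙 X) (𝟙 Y) = 𝟙 (A.wedge X Y)
      ext <;> simp [wedgeMap])
    (id_tensorHom := fun _ _ _ _ => rfl)
    (tensorHom_id := fun _ _ => rfl)
    (tensorHom_comp_tensorHom := fun f g h k => by
      change A.wedgeMap f g ≫ A.wedgeMap h k = A.wedgeMap (f ≫ h) (g ≫ k)
      ext <;> simp [wedgeMap])
    (associator_naturality := fun f g h => by
      change A.wedgeMap (A.wedgeMap f g) h ≫ (A.wedgeAssoc _ _ _).hom =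
        (A.wedgeAssoc _ _ _).hom ≫ A.wedgeMap f (A.wedgeMap g h)
      ext <;> simp [wedgeMap, wedgeAssoc])
    (leftUnitor_naturality := fun {X Y} f => by
      change A.wedgeMap (𝟙 A.pt) f ≫ (eqToIso (A.pt_wedge Y)).hom =
        (eqToIso (A.pt_wedge X)).hom ≫ f
      apply wedge_ext
      · exact A.pt_hom_ext _ _
      · rw [wedgeMap, inr_desc_assoc, Category.assoc, inr_pt_unit, ← Category.assoc, inr_pt_unit]
        simp)
    (rightUnitor_naturality := fun {X Y} f => by
      change A.wedgeMap f (𝟙 A.pt) ≫ (eqToIso (A.wedge_pt Y)).hom =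
        (eqToIso (A.wedge_pt X)).hom ≫ f
      apply wedge_ext
      · rw [wedgeMap, inl_desc_assoc, Category.assoc, inl_pt_unit, ← Category.assoc, inl_pt_unit]
        simp
      · exact A.pt_hom_ext _ _)
    (pentagon := fun W X Y Z => by
      change A.wedgeMap (A.wedgeAssoc _ _ _).hom (𝟙 _) ≫ (A.wedgeAssoc _ _ _).hom ≫
        A.wedgeMap (𝟙 _) (A.wedgeAssoc _ _ _).hom =
          (A.wedgeAssoc _ _ _).hom ≫ (A.wedgeAssoc _ _ _).hom
      ext <;> simp [wedgeMap, wedgeAssoc])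
    (triangle := fun X Y => by
      change (A.wedgeAssoc X A.pt Y).hom ≫ A.wedgeMap (𝟙 X) (eqToIso (A.pt_wedge Y)).hom =
        A.wedgeMap (eqToIso (A.wedge_pt X)).hom (𝟙 Y)
      apply wedge_ext
      · apply wedge_ext
        · simp only [wedgeMap, wedgeAssoc, inl_desc, inl_desc_assoc, Category.id_comp]
          rw [← Category.assoc, inl_pt_unit, Category.id_comp]
        · exact A.pt_hom_ext _ _
      · simp only [wedgeMap, wedgeAssoc, inr_desc, inr_desc_assoc, Category.assoc,
          Category.id_comp]
        rw [← Category.assoc, inr_pt_unit, Category.id_comp])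

noncomputable instance : SymmetricCategory A.C where
  braiding := A.wedgeSymm
  braiding_naturality_right X Y Z f := by
    change A.wedgeMap (𝟙 X) f ≫ (A.wedgeSymm _ _).hom = (A.wedgeSymm _ _).hom ≫ A.wedgeMap f (𝟙 X)
    ext <;> simp [wedgeMap, wedgeSymm]
  braiding_naturality_left f Z := by
    change A.wedgeMap f (𝟙 Z) ≫ (A.wedgeSymm _ _).hom = (A.wedgeSymm _ _).hom ≫ A.wedgeMap (𝟙 Z) f
    ext <;> simp [wedgeMap, wedgeSymm]
  hexagon_forward X Y Z := by
    change (A.wedgeAssoc X Y Z).hom ≫ (A.wedgeSymm X (A.wedge Y Z)).hom ≫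
      (A.wedgeAssoc Y Z X).hom = A.wedgeMap (A.wedgeSymm X Y).hom (𝟙 Z) ≫
        (A.wedgeAssoc Y X Z).hom ≫ A.wedgeMap (𝟙 Y) (A.wedgeSymm X Z).hom
    ext <;> simp [wedgeMap, wedgeSymm, wedgeAssoc]
  hexagon_reverse X Y Z := by
    change (A.wedgeAssoc X Y Z).inv ≫ (A.wedgeSymm (A.wedge X Y) Z).hom ≫
      (A.wedgeAssoc Z X Y).inv = A.wedgeMap (𝟙 X) (A.wedgeSymm Y Z).hom ≫
        (A.wedgeAssoc X Z Y).inv ≫ A.wedgeMap (A.wedgeSymm X Z).hom (𝟙 Y)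
    ext <;> simp [wedgeMap, wedgeSymm, wedgeAssoc]
  symmetry X Y := by
    change (A.wedgeSymm X Y).hom ≫ (A.wedgeSymm Y X).hom = 𝟙 _
    ext <;> simp [wedgeSymm]

/-- The strictly unital symmetric monoidal category `Λ A = (A, ∨, γ, α, *)`. -/
noncomputable abbrev lambda (A : WaldVee.{u}) : SMCat.{u} where
  C := A.C
  left_strict X := ⟨A.pt_wedge X, rfl⟩
  right_strict X := ⟨A.wedge_pt X, rfl⟩

end WaldVee

/-- `L` is the multifunctor `Λ`: it does not change the underlying functors and cells, and the
isomorphisms `δ_i : F (…, X_i, …) ∨ F (…, X_i', …) ≅ F (…, X_i ∨ X_i', …)` are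
the ones compatible with the inclusions into the wedges. -/
structure IsLambda {W : Multicategory WaldVee.{u} KExact.{u}}
    {M : Multicategory SMCat.{u} KLinear.{u}} (L : Multifunctor W M WaldVee.lambda) : Prop where
  functor_eq {I : Type} [Finite I] (A : I → WaldVee.{u}) (B : WaldVee.{u}) (F : KExact I A B) :
    ((L.map A B).obj F).functor = F.functor
  inl_δ {I : Type} [Finite I] (A : I → WaldVee.{u}) (B : WaldVee.{u}) (F : KExact I A B)
    (i : I) {x y z : ∀ i, (A i).C} (h : SumAt (A := fun i => (A i).lambda) i x y z)
    (a : x ⟶ z) : HEq (a i) ((A i).inl (x i) (y i)) → IsAlong i a →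
    HEq (B.inl (((L.map A B).obj F).functor.obj x) (((L.map A B).obj F).functor.obj y) ≫
      (((L.map A B).obj F).δ i h).hom) (F.functor.map a)
  inr_δ {I : Type} [Finite I] (A : I → WaldVee.{u}) (B : WaldVee.{u}) (F : KExact I A B)
    (i : I) {x y z : ∀ i, (A i).C} (h : SumAt (A := fun i => (A i).lambda) i x y z)
    (a : y ⟶ z) : HEq (a i) ((A i).inr (x i) (y i)) → IsAlong i a →
    HEq (B.inr (((L.map A B).obj F).functor.obj x) (((L.map A B).obj F).functor.obj y) ≫
      (((L.map A B).obj F).δ i h).hom) (F.functor.map a)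
  cell_eq {I : Type} [Finite I] (A : I → WaldVee.{u}) (B : WaldVee.{u}) {F G : KExact I A B}
    (α : F ⟶ G) : HEq (KLinear.cell ((L.map A B).map α)) (KExact.cell α)

/-! ## The iterated Waldhausen construction -/

/-- The category `Ar [m₁, …, m_n] = ∏_k Ar [m_k]`: its objects are the tuples
`(i₁ j₁, …, i_n j_n)` with `i_k ≤ j_k`. -/
def Ar {I : Type} (m : I → ℕ) : Type := {y : Cube m × Cube m // y.1 ≤ y.2}

instance {I : Type} (m : I → ℕ) : PartialOrder (Ar m) :=
  inferInstanceAs (PartialOrder {y : Cube m × Cube m // y.1 ≤ y.2})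

namespace Ar

variable {I : Type} {m : I → ℕ}

/-- The tuple `(i₁, …, i_n)`. -/
def src (y : Ar m) : Cube m := y.1.1

/-- The tuple `(j₁, …, j_n)`. -/
def tgt (y : Ar m) : Cube m := y.1.2

/-- The object `(0 j₁, …, 0 j_n)`. -/
def fromZero (j : Cube m) : Ar m := ⟨(fun _ => 0, j), fun _ => Fin.zero_le _⟩

theorem fromZero_mono : Monotone (fromZero (m := m)) := fun _ _ h => ⟨le_refl _, h⟩

end Ar

/-- The conditions on the objects of `S^(n)_{m₁, …, m_n}`. -/
structure IsSdot (A : WaldCat.{u}) {I : Type} {m : I → ℕ} (F : Ar m ⥤ A.C) : Prop where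
  obj_eq_pt (y : Ar m) (k : I) : y.src k = y.tgt k → F.obj y = A.pt
  cubical : CubicallyCofibrant A (monoFunctor Ar.fromZero Ar.fromZero_mono ⋙ F)
  isPushout {x y z w : Ar m} (f : x ⟶ y) (g : x ⟶ z) (h : y ⟶ w) (l : z ⟶ w) (k : I) :
    y.src = x.src → z.tgt = x.tgt → z.src k = x.tgt k → w.src = z.src → w.tgt = y.tgt →
    (∀ j, j ≠ k → y.tgt j = x.tgt j ∧ z.src j = x.src j) →
    IsPushout (F.map f) (F.map g) (F.map h) (F.map l)

/-- The objects of `S^(n)_{m₁, …, m_n} A`. -/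
structure SdotObj (A : WaldCat.{u}) (t : EObj) where
  functor : Ar t.val ⥤ A.C
  isSdot : IsSdot A functor

/-- The morphisms of `S^(n)_{m₁, …, m_n} A`. -/
@[ext]
structure SdotObj.Hom {A : WaldCat.{u}} {t : EObj} (F G : SdotObj A t) where
  nat : F.functor ⟶ G.functor

instance (A : WaldCat.{u}) (t : EObj) : Category (SdotObj A t) where
  Hom := SdotObj.Hom
  id _ := ⟨𝟙 _⟩
  comp α β := ⟨α.nat ≫ β.nat⟩
  id_comp _ := SdotObj.Hom.ext (Category.id_comp _)
  comp_id _ := SdotObj.Hom.ext (Category.comp_id _)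
  assoc _ _ _ := SdotObj.Hom.ext (Category.assoc _ _ _)

/-- The natural transformation underlying a morphism of `S^(n)_{m₁, …, m_n} A`. -/
def SdotObj.trans {A : WaldCat.{u}} {t : EObj} {F G : SdotObj A t} (α : F ⟶ G) :
    F.functor ⟶ G.functor := SdotObj.Hom.nat α

theorem isSdot_const (A : WaldCat.{u}) {I : Type} (m : I → ℕ) :
    IsSdot A ((Functor.const (Ar m)).obj A.pt) where
  obj_eq_pt _ _ _ := rfl
  cubical := by
    refine ⟨fun f => A.cof_of_isIso _ (inferInstanceAs (IsIso (𝟙 A.pt))), fun v w _ _ => ?_⟩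
    let D : Set.Ico v w ⥤ A.C := monoFunctor (fun x : Set.Ico v w => x.1) (fun _ _ h => h) ⋙
      monoFunctor Ar.fromZero Ar.fromZero_mono ⋙ (Functor.const (Ar m)).obj A.pt
    let c : Cocone D :=
      { pt := A.pt
        ι := { app := fun _ => 𝟙 A.pt, naturality := fun _ _ _ => rfl } }
    have hc : IsColimit c :=
      { desc := fun s => A.isZero.to_ s.pt
        fac := fun s j => A.isZero.eq_of_src _ _
        uniq := fun s f _ => A.isZero.eq_of_src _ _ }
    exact ⟨c, hc, A.cof_of_pt _⟩
  isPushout _ _ _ _ _ _ _ _ _ _ _ := by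
    simp only [Functor.const_obj_map]
    exact IsPushout.of_id_fst

/-- The based category `S^(n)_{m₁, …, m_n} A`. -/
abbrev Sdot (A : WaldCat.{u}) (t : EObj) : BasedCat.{u} where
  C := SdotObj A t
  pt := ⟨_, isSdot_const A t.val⟩

/-- For `f : t ⟶ t'` in `ℰ` and `y` in `Ar t'`, the entries of `y` that do not come from `t` are
sent to `01` in `Ar [1]`. -/
def Ar.Nondeg {t t' : EObj} (f : t ⟶ t') (y : Ar t'.val) : Prop :=
  ∀ j, ePre f j = none → eMap f j (y.src j) = 0 ∧ eMap f j (y.tgt j) = 1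

/-- `x` in `Ar t` is the image of `y` in `Ar t'` under `f : t ⟶ t'`. -/
def Ar.IsImage {t t' : EObj} (f : t ⟶ t') (y : Ar t'.val) (x : Ar t.val) : Prop :=
  ∀ k, (x.src k).val = eMap f (eInj f k) (y.src (eInj f k)) ∧
    (x.tgt k).val = eMap f (eInj f k) (y.tgt (eInj f k))

/-- The `ℰ_*`-categories `S^() A`: they are the `r`-fold simplicial categories `S^(r) A` with the
permutations of the entries and the extension isomorphisms. -/
structure IsSdotStr (s : ∀ A : WaldVee.{u}, EStarStr (Sdot A.toWaldCat)) : Prop where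
  obj_nondeg (A : WaldVee.{u}) {t t' : EObj} (f : t ⟶ t') (F : SdotObj A.toWaldCat t)
    (y : Ar t'.val) (x : Ar t.val) : Ar.Nondeg f y → Ar.IsImage f y x →
    (SdotObj.functor ((BasedCat.func ((s A).map f)).obj F)).obj y = F.functor.obj x
  obj_deg (A : WaldVee.{u}) {t t' : EObj} (f : t ⟶ t') (F : SdotObj A.toWaldCat t)
    (y : Ar t'.val) : ¬ Ar.Nondeg f y →
    (SdotObj.functor ((BasedCat.func ((s A).map f)).obj F)).obj y = A.pt
  map_nondeg (A : WaldVee.{u}) {t t' : EObj} (f : t ⟶ t') (F : SdotObj A.toWaldCat t)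
    {y y' : Ar t'.val} {x x' : Ar t.val} (g : y ⟶ y') (h : x ⟶ x') : Ar.Nondeg f y →
    Ar.Nondeg f y' → Ar.IsImage f y x → Ar.IsImage f y' x' →
    HEq ((SdotObj.functor ((BasedCat.func ((s A).map f)).obj F)).map g) (F.functor.map h)
  trans_nondeg (A : WaldVee.{u}) {t t' : EObj} (f : t ⟶ t') {F F' : SdotObj A.toWaldCat t}
    (α : F ⟶ F') (y : Ar t'.val) (x : Ar t.val) : Ar.Nondeg f y → Ar.IsImage f y x →
    HEq ((SdotObj.trans ((BasedCat.func ((s A).map f)).map α)).app y) ((SdotObj.trans α).app x)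

/-- For a concatenation `t = ⊙_i m i`, the object `y` of `Ar t` corresponds to the tuple `x` under
the isomorphism `Ar t ≅ ∏_i Ar (m i)`. -/
def Ar.IsSplit {I : Type} {m : I → EObj} {t : EObj} (h : Concat m t) (y : Ar t.val)
    (x : ∀ i, Ar (m i).val) : Prop :=
  ∀ i k, ((x i).src k).val = (y.src (h.e ⟨i, k⟩)).val ∧
    ((x i).tgt k).val = (y.tgt (h.e ⟨i, k⟩)).val

/-- `S` is the multifunctor `S^()`, which sends a `k`-exact functor `F` to the family of functors
`(A₁, …, A_k) ↦ F ∘ (A₁ × ⋯ × A_k)`, and is given by whiskering on cells. -/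
structure IsSdotMultifunctor {W : Multicategory WaldVee.{u} KExact.{u}}
    {E : Multicategory EStarCat.{u} EMor.{u}} {s : ∀ A : WaldVee.{u}, EStarStr (Sdot A.toWaldCat)}
    (S : Multifunctor W E (fun A => (s A).toEStarCat)) : Prop where
  obj_obj {I : Type} [Finite I] (A : I → WaldVee.{u}) (B : WaldVee.{u}) (F : KExact I A B)
    {m : I → EObj} {t : EObj} (h : Concat m t) (X : ∀ i, SdotObj (A i).toWaldCat (m i))
    (y : Ar t.val) (x : ∀ i, Ar (m i).val) : Ar.IsSplit h y x →
    (SdotObj.functor ((((S.map A B).obj F).app h).obj X)).obj y =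
      F.functor.obj (fun i => (X i).functor.obj (x i))
  obj_map {I : Type} [Finite I] (A : I → WaldVee.{u}) (B : WaldVee.{u}) (F : KExact I A B)
    {m : I → EObj} {t : EObj} (h : Concat m t) (X : ∀ i, SdotObj (A i).toWaldCat (m i))
    {y y' : Ar t.val} {x x' : ∀ i, Ar (m i).val} (g : y ⟶ y') (f : ∀ i, x i ⟶ x' i) :
    Ar.IsSplit h y x → Ar.IsSplit h y' x' →
    HEq ((SdotObj.functor ((((S.map A B).obj F).app h).obj X)).map g)
      (F.functor.map (X := fun i => (X i).functor.obj (x i))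
        (Y := fun i => (X i).functor.obj (x' i)) (fun i => (X i).functor.map (f i)))
  map_app {I : Type} [Finite I] (A : I → WaldVee.{u}) (B : WaldVee.{u}) (F : KExact I A B)
    {m : I → EObj} {t : EObj} (h : Concat m t) {X X' : ∀ i, SdotObj (A i).toWaldCat (m i)}
    (α : ∀ i, X i ⟶ X' i) (y : Ar t.val) (x : ∀ i, Ar (m i).val) : Ar.IsSplit h y x →
    HEq ((SdotObj.trans ((((S.map A B).obj F).app h).map α)).app y)
      (F.functor.map (X := fun i => (X i).functor.obj (x i))
        (Y := fun i => (X' i).functor.obj (x i)) (fun i => (SdotObj.trans (α i)).app (x i)))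
  cell_app {I : Type} [Finite I] (A : I → WaldVee.{u}) (B : WaldVee.{u}) {F G : KExact I A B}
    (μ : F ⟶ G) {m : I → EObj} {t : EObj} (h : Concat m t)
    (X : ∀ i, SdotObj (A i).toWaldCat (m i)) (y : Ar t.val) (x : ∀ i, Ar (m i).val) :
    Ar.IsSplit h y x →
    HEq ((SdotObj.trans ((EMor.cell ((S.map A B).map μ) h).app X)).app y)
      ((KExact.cell μ).app (fun i => (X i).functor.obj (x i)))

/-! ## The construction of Elmendorf and Mandell -/

/-- Tuples `(S₁, …, S_n)` of basepoint free subsets `S_k ⊆ {0, 1, …, m_k}`. The element `l` of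
`Fin m_k` stands for `l + 1`. -/
def Subsets (t : EObj) : Type := ∀ k : Fin t.len, Set (Fin (t.val k))

/-- The set `S i` is the disjoint union of `T i` and `U i`, and the three tuples of sets agree
outside `i`, i.e. `T = S⌈_i T_i` and `U = S⌈_i U_i`. -/
structure Split {t : EObj} (i : Fin t.len) (T U S : Subsets t) : Prop where
  inter : T i ∩ U i = ∅
  union : T i ∪ U i = S i
  left (j : Fin t.len) : j ≠ i → T j = S j
  right (j : Fin t.len) : j ≠ i → U j = S j

/-- The objects of the category `C̄ (m₁, …, m_n)`. -/
structure BarObj (C : SMCat.{u}) (t : EObj) where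
  obj : Subsets t → C.C
  ρ (i : Fin t.len) {T U S : Subsets t} (h : Split i T U S) : obj T ⊗ obj U ≅ obj S
  obj_empty (S : Subsets t) (k : Fin t.len) : S k = ∅ → obj S = 𝟙_ C.C
  ρ_empty (i : Fin t.len) {T U S : Subsets t} (h : Split i T U S) :
    (T i = ∅ ∨ U i = ∅ ∨ ∃ k, S k = ∅) → IsId (ρ i h).hom
  ρ_symm (i : Fin t.len) {T U S : Subsets t} (h : Split i T U S) (h' : Split i U T S) :
    (ρ i h).hom = (β_ _ _).hom ≫ (ρ i h').hom
  ρ_assoc (i : Fin t.len) {T U V TU UV S : Subsets t} (h₁ : Split i T U TU) (h₂ : Split i TU V S)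
    (h₃ : Split i U V UV) (h₄ : Split i T UV S) :
    (ρ i h₁).hom ▷ obj V ≫ (ρ i h₂).hom =
      (α_ _ _ _).hom ≫ obj T ◁ (ρ i h₃).hom ≫ (ρ i h₄).hom
  ρ_ρ (i j : Fin t.len) {S₀₀ S₁₀ S₀₁ S₁₁ A B C D S : Subsets t} (hij : i ≠ j)
    (h₁ : Split i S₀₀ S₁₀ A) (h₂ : Split i S₀₁ S₁₁ B) (h₃ : Split j A B S)
    (h₄ : Split j S₀₀ S₀₁ C) (h₅ : Split j S₁₀ S₁₁ D) (h₆ : Split i C D S) :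
    ((ρ i h₁).hom ⊗ₘ (ρ i h₂).hom) ≫ (ρ j h₃).hom =
      tensorμ _ _ _ _ ≫ ((ρ j h₄).hom ⊗ₘ (ρ j h₅).hom) ≫ (ρ i h₆).hom

/-- The morphisms of the category `C̄ (m₁, …, m_n)`. -/
@[ext]
structure BarObj.Hom {C : SMCat.{u}} {t : EObj} (X Y : BarObj C t) where
  app (S : Subsets t) : X.obj S ⟶ Y.obj S
  app_empty (S : Subsets t) (k : Fin t.len) : S k = ∅ → IsId (app S)
  app_ρ (i : Fin t.len) {T U S : Subsets t} (h : Split i T U S) :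
    (X.ρ i h).hom ≫ app S = (app T ⊗ₘ app U) ≫ (Y.ρ i h).hom

instance (C : SMCat.{u}) (t : EObj) : Category (BarObj C t) where
  Hom := BarObj.Hom
  id X := ⟨fun S => 𝟙 _, fun S k _ => isId_id _, fun i T U S h => by simp⟩
  comp f g := ⟨fun S => f.app S ≫ g.app S,
    fun S k hS => (f.app_empty S k hS).comp (g.app_empty S k hS), fun i T U S h => by
      rw [← Category.assoc, f.app_ρ i h, Category.assoc, g.app_ρ i h, ← Category.assoc]
      simp⟩
  id_comp _ := BarObj.Hom.ext (funext fun _ => Category.id_comp _)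
  comp_id _ := BarObj.Hom.ext (funext fun _ => Category.comp_id _)
  assoc _ _ _ := BarObj.Hom.ext (funext fun _ => Category.assoc _ _ _)

/-- The components of a morphism of `C̄ (m₁, …, m_n)`. -/
def BarObj.component {C : SMCat.{u}} {t : EObj} {X Y : BarObj C t} (f : X ⟶ Y) (S : Subsets t) :
    X.obj S ⟶ Y.obj S := BarObj.Hom.app f S

/-- The constant system at the unit object. -/
def BarObj.const (C : SMCat.{u}) (t : EObj) : BarObj C t where
  obj _ := 𝟙_ C.C
  ρ _ _ _ _ _ := λ_ (𝟙_ C.C)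
  obj_empty _ _ _ := rfl
  ρ_empty _ _ _ _ _ _ := C.left_strict _
  ρ_symm _ _ _ _ _ _ := by
    rw [braiding_leftUnitor, unitors_equal]
  ρ_assoc _ _ _ _ _ _ _ _ _ _ _ := by
    rw [← Category.assoc, triangle, unitors_equal]
  ρ_ρ _ _ _ _ _ _ _ _ _ _ _ _ _ _ _ _ _ _ := by
    have h := tensor_left_unitality (𝟙_ C.C) (𝟙_ C.C)
    have e : (λ_ (𝟙_ C.C ⊗ 𝟙_ C.C)).hom = 𝟙_ C.C ◁ (λ_ (𝟙_ C.C)).hom := by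
      rw [← cancel_mono (λ_ (𝟙_ C.C)).hom, leftUnitor_naturality]
    rw [← cancel_epi ((λ_ (𝟙_ C.C)).inv ▷ (𝟙_ C.C ⊗ 𝟙_ C.C))]
    have h' := congrArg (fun f => f ≫ (λ_ (𝟙_ C.C)).hom) h
    simp only [Category.assoc] at h'
    rw [← h', e, MonoidalCategory.tensorHom_def]
    simp

/-- The based category `C̄ (m₁, …, m_n)`. -/
abbrev bar (C : SMCat.{u}) (t : EObj) : BasedCat.{u} where
  C := BarObj C t
  pt := BarObj.const C t

/-- The preimage of a tuple of subsets under the maps `β^*` of finite based sets. -/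
def Subsets.preimage {t t' : EObj} (f : t ⟶ t') (S : Subsets t') : Subsets t := fun k =>
  {l | ∃ a ∈ S (eInj f k), eMap f (eInj f k) a.castSucc ≤ l.val ∧
    l.val < eMap f (eInj f k) a.succ}

/-- For `f : t ⟶ t'` in `ℰ`, the preimages of those entries of `S` that do not come from `t` are
the subset `{1}` of `{0, 1}`. -/
def Subsets.Nondeg {t t' : EObj} (f : t ⟶ t') (S : Subsets t') : Prop :=
  ∀ j, ePre f j = none → ∃ a ∈ S j, eMap f j a.castSucc = 0 ∧ eMap f j a.succ = 1

/-- The `ℰ_*`-categories `C̄`: a morphism of `ℰ` acts by the maps of finite based sets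
given by the simplicial circle, permutations of the entries and the extension isomorphisms. -/
structure IsBarStr (b : ∀ C : SMCat.{u}, EStarStr (bar C)) : Prop where
  obj_nondeg (C : SMCat.{u}) {t t' : EObj} (f : t ⟶ t') (X : BarObj C t) (S : Subsets t') :
    S.Nondeg f → BarObj.obj ((BasedCat.func ((b C).map f)).obj X) S = X.obj (S.preimage f)
  obj_deg (C : SMCat.{u}) {t t' : EObj} (f : t ⟶ t') (X : BarObj C t) (S : Subsets t') :
    ¬ S.Nondeg f → BarObj.obj ((BasedCat.func ((b C).map f)).obj X) S = 𝟙_ C.C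
  ρ_some (C : SMCat.{u}) {t t' : EObj} (f : t ⟶ t') (X : BarObj C t) (k : Fin t.len)
    {T U S : Subsets t'} (h : Split (eInj f k) T U S)
    (h' : Split k (T.preimage f) (U.preimage f) (S.preimage f)) : S.Nondeg f →
    HEq (BarObj.ρ ((BasedCat.func ((b C).map f)).obj X) (eInj f k) h).hom (X.ρ k h').hom
  ρ_none (C : SMCat.{u}) {t t' : EObj} (f : t ⟶ t') (X : BarObj C t) (j : Fin t'.len)
    {T U S : Subsets t'} (h : Split j T U S) : (¬ S.Nondeg f ∨ ePre f j = none) →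
    IsId (BarObj.ρ ((BasedCat.func ((b C).map f)).obj X) j h).hom
  map_nondeg (C : SMCat.{u}) {t t' : EObj} (f : t ⟶ t') {X Y : BarObj C t} (g : X ⟶ Y)
    (S : Subsets t') : S.Nondeg f →
    HEq (BarObj.component ((BasedCat.func ((b C).map f)).map g) S)
      (BarObj.component g (S.preimage f))
  map_deg (C : SMCat.{u}) {t t' : EObj} (f : t ⟶ t') {X Y : BarObj C t} (g : X ⟶ Y)
    (S : Subsets t') : ¬ S.Nondeg f →
    IsId (BarObj.component ((BasedCat.func ((b C).map f)).map g) S)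

/-- For a concatenation `t = ⊙_i m i`, the tuple `S` of subsets is the concatenation of the
tuples `T i`. -/
def Subsets.IsSplit {I : Type} {m : I → EObj} {t : EObj} (h : Concat m t) (S : Subsets t)
    (T : ∀ i, Subsets (m i)) : Prop :=
  ∀ (i : I) (k : Fin (m i).len) (l : Fin (t.val (h.e ⟨i, k⟩))) (l' : Fin ((m i).val k)),
    l.val = l'.val → (l ∈ S (h.e ⟨i, k⟩) ↔ l' ∈ T i k)

/-- `B` is the multifunctor `C ↦ C̄`, which sends a `k`-linear functor `F` to the family of functors
`(C¹, …, C^k) ↦ D` with `D_S = F (C¹_{T₁}, …, C^k_{T_k})` for `S` the concatenation of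
`T₁, …, T_k`, and with the isomorphisms `ρ` obtained from `δ` and the given isomorphisms `ρ`. -/
structure IsBarMultifunctor {M : Multicategory SMCat.{u} KLinear.{u}}
    {E : Multicategory EStarCat.{u} EMor.{u}} {b : ∀ C : SMCat.{u}, EStarStr (bar C)}
    (B : Multifunctor M E (fun C => (b C).toEStarCat)) : Prop where
  obj_obj {I : Type} [Finite I] (C : I → SMCat.{u}) (D : SMCat.{u}) (F : KLinear I C D)
    {m : I → EObj} {t : EObj} (h : Concat m t) (X : ∀ i, BarObj (C i) (m i)) (S : Subsets t)
    (T : ∀ i, Subsets (m i)) : S.IsSplit h T →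
    BarObj.obj ((((B.map C D).obj F).app h).obj X) S =
      F.functor.obj (fun i => (X i).obj (T i))
  obj_ρ {I : Type} [Finite I] (C : I → SMCat.{u}) (D : SMCat.{u}) (F : KLinear I C D)
    {m : I → EObj} {t : EObj} (h : Concat m t) (X : ∀ i, BarObj (C i) (m i)) (i : I)
    (k : Fin (m i).len) {S S' S'' : Subsets t} {T T' T'' : ∀ i, Subsets (m i)}
    (hS : Split (h.e ⟨i, k⟩) S S' S'') (hT : Split k (T i) (T' i) (T'' i))
    {w : ∀ i, (C i).C} (hw : SumAt i (fun i => (X i).obj (T i)) (fun i => (X i).obj (T' i)) w)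
    (a : w ⟶ fun i => (X i).obj (T'' i)) :
    S.IsSplit h T → S'.IsSplit h T' → S''.IsSplit h T'' →
    HEq (a i) ((X i).ρ k hT).hom → IsAlong i a →
    HEq (BarObj.ρ ((((B.map C D).obj F).app h).obj X) (h.e ⟨i, k⟩) hS).hom
      ((F.δ i hw).hom ≫ F.functor.map a)
  map_app {I : Type} [Finite I] (C : I → SMCat.{u}) (D : SMCat.{u}) (F : KLinear I C D)
    {m : I → EObj} {t : EObj} (h : Concat m t) {X Y : ∀ i, BarObj (C i) (m i)}
    (f : ∀ i, X i ⟶ Y i) (S : Subsets t) (T : ∀ i, Subsets (m i)) : S.IsSplit h T →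
    HEq (BarObj.component ((((B.map C D).obj F).app h).map f) S)
      (F.functor.map (X := fun i => (X i).obj (T i)) (Y := fun i => (Y i).obj (T i))
        (fun i => BarObj.component (f i) (T i)))
  cell_app {I : Type} [Finite I] (C : I → SMCat.{u}) (D : SMCat.{u}) {F G : KLinear I C D}
    (μ : F ⟶ G) {m : I → EObj} {t : EObj} (h : Concat m t) (X : ∀ i, BarObj (C i) (m i))
    (S : Subsets t) (T : ∀ i, Subsets (m i)) : S.IsSplit h T →
    HEq (BarObj.component ((EMor.cell ((B.map C D).map μ) h).app X) S)
      ((KLinear.cell μ).app (fun i => (X i).obj (T i)))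

/-! ## The transformation `φ` -/

/-- The tuple of the half-open intervals `(i_k, j_k] = {i_k + 1, …, j_k}` for `i_k = v k` and
`j_k = w k`. -/
def Subsets.interval {t : EObj} (v w : Cube t.val) : Subsets t := fun k =>
  {l | (v k).val ≤ l.val ∧ l.val < (w k).val}

/-- The components of `φ` are the functors which send a system `C` to the functor
`i₁ j₁, …, i_n j_n ↦ C_{(i₁, j₁], …, (i_n, j_n]}` with the maps
`C_{(i, j]} ⟶ C_{(i, j]} ∨ C_{(j, j']} ≅ C_{(i, j']} ≅ C_{(i, i']} ∨ C_{(i', j']} ⟶ C_{(i', j']}` in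
each direction. -/
structure IsPhi {W : Multicategory WaldVee.{u} KExact.{u}}
    {M : Multicategory SMCat.{u} KLinear.{u}} {E : Multicategory EStarCat.{u} EMor.{u}}
    {s : ∀ A : WaldVee.{u}, EStarStr (Sdot A.toWaldCat)}
    {b : ∀ C : SMCat.{u}, EStarStr (bar C)} {L : Multifunctor W M WaldVee.lambda}
    {B : Multifunctor M E (fun C => (b C).toEStarCat)}
    {S : Multifunctor W E (fun A => (s A).toEStarCat)} (φ : MultinatTrans (L.comp B) S) :
    Prop where
  obj_obj (A : WaldVee.{u}) (t : EObj) (X : BarObj A.lambda t) (y : Ar t.val) :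
    (SdotObj.functor (((φ.app A).app (Concat.self t)).obj fun _ => X)).obj y =
      X.obj (Subsets.interval y.src y.tgt)
  obj_map (A : WaldVee.{u}) (t : EObj) (X : BarObj A.lambda t) {y y' : Ar t.val} (g : y ⟶ y')
    (k : Fin t.len) {U V : Subsets t}
    (h : Split k (Subsets.interval y.src y.tgt) U (Subsets.interval y.src y'.tgt))
    (h' : Split k V (Subsets.interval y'.src y'.tgt) (Subsets.interval y.src y'.tgt)) :
    (∀ j, j ≠ k → y.src j = y'.src j ∧ y.tgt j = y'.tgt j) →
    HEq ((SdotObj.functor (((φ.app A).app (Concat.self t)).obj fun _ => X)).map g)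
      (A.inl (X.obj (Subsets.interval y.src y.tgt)) (X.obj U) ≫ (X.ρ k h).hom ≫ (X.ρ k h').inv ≫
        A.π₂ (X.obj V) (X.obj (Subsets.interval y'.src y'.tgt)))
  map_app (A : WaldVee.{u}) (t : EObj) {X X' : BarObj A.lambda t} (f : X ⟶ X') (y : Ar t.val) :
    HEq ((SdotObj.trans (((φ.app A).app (Concat.self t)).map
        (X := fun _ : Unit => X) (Y := fun _ : Unit => X') fun _ => f)).app y)
      (BarObj.component f (Subsets.interval y.src y.tgt))

/-! ## Symmetric spectra in simplicial categories -/

open Classical in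
/-- The map `β^* : {0, …, n} → {0, …, m}` induced on the simplicial circle by `β : [m] ⟶ [n]`. It
sends `i` to `j` if `β (j - 1) < i ≤ β j`, and to the base point `0` if there is no such `j`. -/
noncomputable def circleMap {m n : SimplexCategory} (β : m ⟶ n) (i : Fin (n.len + 1)) :
    Fin (m.len + 1) :=
  if h : ∃ j : Fin m.len, β.toOrderHom j.castSucc < i ∧ i ≤ β.toOrderHom j.succ then
    h.choose.succ
  else 0

/-- The iterated structure maps `X_n ∧ S^1 ∧ ⋯ ∧ S^1 ⟶ X_{n + p}` in simplicial degree `q`, on the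
wedge summand with label `s`. -/
def iterSigma {X : ℕ → SimplexCategoryᵒᵖ ⥤ BasedCat.{u}}
    (σ : ∀ (n : ℕ) (q : SimplexCategoryᵒᵖ), Fin (q.unop.len + 1) →
      ((X n).obj q ⟶ (X (n + 1)).obj q)) (n : ℕ) (q : SimplexCategoryᵒᵖ) :
    ∀ (p : ℕ), (Fin p → Fin (q.unop.len + 1)) → ((X n).obj q ⟶ (X (n + p)).obj q)
  | 0, _ => 𝟙 _
  | p + 1, s => iterSigma σ n q p (fun i => s i.castSucc) ≫ σ (n + p) q (s (Fin.last p))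

/-- The block sum of permutations. -/
def blockSum {n p : ℕ} (τ : Equiv.Perm (Fin n)) (π : Equiv.Perm (Fin p)) :
    Equiv.Perm (Fin (n + p)) :=
  finSumFinEquiv.permCongr (Equiv.sumCongr τ π)

/-- A symmetric spectrum in simplicial based categories. A map `X_n ∧ S^1 ⟶ X_{n + 1}` is given in
simplicial degree `q` by a based functor `σ n q j` for each element `j` of `S^1_q = {0, …, q}`,
which is constant at the base object for the base point `j = 0`. -/
structure SymSpectrum where
  level : ℕ → SimplexCategoryᵒᵖ ⥤ BasedCat.{u}
  act (n : ℕ) : Equiv.Perm (Fin n) →* End (level n)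
  σ (n : ℕ) (q : SimplexCategoryᵒᵖ) (j : Fin (q.unop.len + 1)) :
    (level n).obj q ⟶ (level (n + 1)).obj q
  σ_zero (n : ℕ) (q : SimplexCategoryᵒᵖ) : σ n q 0 = BasedCat.zero _ _
  σ_naturality (n : ℕ) {q q' : SimplexCategoryᵒᵖ} (f : q ⟶ q') (j : Fin (q.unop.len + 1)) :
    (level n).map f ≫ σ n q' (circleMap f.unop j) = σ n q j ≫ (level (n + 1)).map f
  equivariance (n p : ℕ) (q : SimplexCategoryᵒᵖ) (s : Fin p → Fin (q.unop.len + 1))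
    (τ : Equiv.Perm (Fin n)) (π : Equiv.Perm (Fin p)) :
    NatTrans.app (act n τ) q ≫ iterSigma σ n q p (fun i => s (π.symm i)) =
      iterSigma σ n q p s ≫ NatTrans.app (act (n + p) (blockSum τ π)) q

/-- The category in spectrum degree `n` and simplicial degree `q`. -/
abbrev SymSpectrum.at (X : SymSpectrum.{u}) (n : ℕ) (q : SimplexCategoryᵒᵖ) : Type u := ((X.level n).obj q).C

/-- The base object. -/
abbrev SymSpectrum.pt (X : SymSpectrum.{u}) (n : ℕ) (q : SimplexCategoryᵒᵖ) : X.at n q :=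
  ((X.level n).obj q).pt

/-- The simplicial structure functors. -/
abbrev SymSpectrum.tr (X : SymSpectrum.{u}) (n : ℕ) {q q' : SimplexCategoryᵒᵖ} (f : q ⟶ q') :
    X.at n q ⥤ X.at n q' := BasedCat.func ((X.level n).map f)

/-- The action of permutations. -/
abbrev SymSpectrum.perm (X : SymSpectrum.{u}) {n : ℕ} (τ : Equiv.Perm (Fin n)) (q : SimplexCategoryᵒᵖ) :
    X.at n q ⥤ X.at n q := BasedCat.func (NatTrans.app (X.act n τ) q)

/-- The iterated structure functors. -/
abbrev SymSpectrum.iter (X : SymSpectrum.{u}) (n : ℕ) (q : SimplexCategoryᵒᵖ) {p : ℕ}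
    (s : Fin p → Fin (q.unop.len + 1)) : X.at n q ⥤ X.at (n + p) q :=
  BasedCat.func (iterSigma X.σ n q p s)

/-- The ordering `ê` of the disjoint union of the sets `{1, …, p i + d i}` consists of the ordering
`e` of the disjoint union of the sets `{1, …, p i}`, followed by the ordering `e'` of the remaining
elements. -/
def IsExtension {I : Type} {p d : I → ℕ} {n N : ℕ} (e : (Σ i, Fin (p i)) ≃ Fin n)
    (e' : (Σ i, Fin (d i)) ≃ Fin N) (ê : (Σ i, Fin (p i + d i)) ≃ Fin (n + N)) : Prop :=
  (∀ i k, ê ⟨i, Fin.castAdd (d i) k⟩ = Fin.castAdd N (e ⟨i, k⟩)) ∧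
    ∀ i k, ê ⟨i, Fin.natAdd (p i) k⟩ = Fin.natAdd n (e' ⟨i, k⟩)

/-- A `k`-linear map `(X i)_{i : I} ⟶ Z` of symmetric spectra: based functors
`⋀_i X i (p i) ⟶ Z (∑_i p i)` of simplicial categories, which are equivariant (with respect to all
orderings of the disjoint union of the sets `{1, …, p i}`) and compatible with the structure maps
in each variable. -/
structure MLin (I : Type) [Finite I] (X : I → SymSpectrum.{u}) (Z : SymSpectrum.{u}) where
  app {p : I → ℕ} {n : ℕ} (e : (Σ i, Fin (p i)) ≃ Fin n) (q : SimplexCategoryᵒᵖ) :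
    (∀ i, (X i).at (p i) q) ⥤ Z.at n q
  obj_pt {p : I → ℕ} {n : ℕ} (e : (Σ i, Fin (p i)) ≃ Fin n) (q : SimplexCategoryᵒᵖ)
    (x : ∀ i, (X i).at (p i) q) (i : I) : x i = (X i).pt (p i) q → (app e q).obj x = Z.pt n q
  map_pt {p : I → ℕ} {n : ℕ} (e : (Σ i, Fin (p i)) ≃ Fin n) (q : SimplexCategoryᵒᵖ)
    {x y : ∀ i, (X i).at (p i) q} (f : x ⟶ y) (i : I) : x i = (X i).pt (p i) q → IsId (f i) →
    IsId ((app e q).map f)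
  naturality {p : I → ℕ} {n : ℕ} (e : (Σ i, Fin (p i)) ≃ Fin n) {q q' : SimplexCategoryᵒᵖ}
    (f : q ⟶ q') :
    Functor.pi (fun i => (X i).tr (p i) f) ⋙ app e q' = app e q ⋙ Z.tr n f
  equivariance {p : I → ℕ} {n : ℕ} (e e' : (Σ i, Fin (p i)) ≃ Fin n)
    (τ : ∀ i, Equiv.Perm (Fin (p i))) (π : Equiv.Perm (Fin n)) (q : SimplexCategoryᵒᵖ) :
    (∀ i k, e' ⟨i, τ i k⟩ = π (e ⟨i, k⟩)) →
    Functor.pi (fun i => (X i).perm (τ i) q) ⋙ app e' q = app e q ⋙ Z.perm π q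
  structure_maps {p d : I → ℕ} {n N : ℕ} (e : (Σ i, Fin (p i)) ≃ Fin n)
    (e' : (Σ i, Fin (d i)) ≃ Fin N) (ê : (Σ i, Fin (p i + d i)) ≃ Fin (n + N))
    (q : SimplexCategoryᵒᵖ) (s : ∀ i, Fin (d i) → Fin (q.unop.len + 1)) : IsExtension e e' ê →
    Functor.pi (fun i => (X i).iter (p i) q (s i)) ⋙ app ê q =
      app e q ⋙ Z.iter n q (fun j => s (e'.symm j).1 (e'.symm j).2)

/-- A cell between `k`-linear maps of symmetric spectra: based natural transformations compatible
with all the structure. -/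
@[ext]
structure MLin.Hom {I : Type} [Finite I] {X : I → SymSpectrum.{u}} {Z : SymSpectrum.{u}}
    (F G : MLin I X Z) where
  app {p : I → ℕ} {n : ℕ} (e : (Σ i, Fin (p i)) ≃ Fin n) (q : SimplexCategoryᵒᵖ) :
    F.app e q ⟶ G.app e q
  app_pt {p : I → ℕ} {n : ℕ} (e : (Σ i, Fin (p i)) ≃ Fin n) (q : SimplexCategoryᵒᵖ)
    (x : ∀ i, (X i).at (p i) q) (i : I) : x i = (X i).pt (p i) q → IsId ((app e q).app x)
  naturality {p : I → ℕ} {n : ℕ} (e : (Σ i, Fin (p i)) ≃ Fin n) {q q' : SimplexCategoryᵒᵖ}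
    (f : q ⟶ q') (x : ∀ i, (X i).at (p i) q) :
    HEq ((app e q').app (fun i => ((X i).tr (p i) f).obj (x i)))
      ((Z.tr n f).map ((app e q).app x))
  equivariance {p : I → ℕ} {n : ℕ} (e e' : (Σ i, Fin (p i)) ≃ Fin n)
    (τ : ∀ i, Equiv.Perm (Fin (p i))) (π : Equiv.Perm (Fin n)) (q : SimplexCategoryᵒᵖ)
    (x : ∀ i, (X i).at (p i) q) : (∀ i k, e' ⟨i, τ i k⟩ = π (e ⟨i, k⟩)) →
    HEq ((app e' q).app (fun i => ((X i).perm (τ i) q).obj (x i)))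
      ((Z.perm π q).map ((app e q).app x))
  structure_maps {p d : I → ℕ} {n N : ℕ} (e : (Σ i, Fin (p i)) ≃ Fin n)
    (e' : (Σ i, Fin (d i)) ≃ Fin N) (ê : (Σ i, Fin (p i + d i)) ≃ Fin (n + N))
    (q : SimplexCategoryᵒᵖ) (s : ∀ i, Fin (d i) → Fin (q.unop.len + 1))
    (x : ∀ i, (X i).at (p i) q) : IsExtension e e' ê →
    HEq ((app ê q).app (fun i => ((X i).iter (p i) q (s i)).obj (x i)))
      ((Z.iter n q (fun j => s (e'.symm j).1 (e'.symm j).2)).map ((app e q).app x))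

instance (I : Type) [Finite I] (X : I → SymSpectrum.{u}) (Z : SymSpectrum.{u}) :
    Category (MLin I X Z) where
  Hom := MLin.Hom
  id F :=
    { app := fun e q => 𝟙 _
      app_pt := fun e q x i _ => isId_id _
      naturality := fun {p n} e {q q'} f x => by
        have h := Functor.congr_obj (F.naturality e f) x
        simp only [Functor.comp_obj] at h
        exact (heq_of_eq (NatTrans.id_app _ _)).trans (by
          rw [NatTrans.id_app, CategoryTheory.Functor.map_id, ← h]; rfl)
      equivariance := fun e e' τ π q x hc => by
        have h := Functor.congr_obj (F.equivariance e e' τ π q hc) x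
        simp only [Functor.comp_obj] at h
        exact (heq_of_eq (NatTrans.id_app _ _)).trans (by
          rw [NatTrans.id_app, CategoryTheory.Functor.map_id, ← h]; rfl)
      structure_maps := fun e e' ê q s x hc => by
        have h := Functor.congr_obj (F.structure_maps e e' ê q s hc) x
        simp only [Functor.comp_obj] at h
        exact (heq_of_eq (NatTrans.id_app _ _)).trans (by
          rw [NatTrans.id_app, CategoryTheory.Functor.map_id, ← h]; rfl) }
  comp {F G H} α β :=
    { app := fun e q => α.app e q ≫ β.app e q
      app_pt := fun e q x i hx => (α.app_pt e q x i hx).comp (β.app_pt e q x i hx)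
      naturality := fun e q q' f x => by
        simp only [NatTrans.comp_app, Functor.map_comp]
        exact heq_comp (Functor.congr_obj (F.naturality e f) x)
          (Functor.congr_obj (G.naturality e f) x) (Functor.congr_obj (H.naturality e f) x)
          (α.naturality e f x) (β.naturality e f x)
      equivariance := fun e e' τ π q x hc => by
        simp only [NatTrans.comp_app, Functor.map_comp]
        exact heq_comp (Functor.congr_obj (F.equivariance e e' τ π q hc) x)
          (Functor.congr_obj (G.equivariance e e' τ π q hc) x)
          (Functor.congr_obj (H.equivariance e e' τ π q hc) x)
          (α.equivariance e e' τ π q x hc) (β.equivariance e e' τ π q x hc)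
      structure_maps := fun e e' ê q s x hc => by
        simp only [NatTrans.comp_app, Functor.map_comp]
        exact heq_comp (Functor.congr_obj (F.structure_maps e e' ê q s hc) x)
          (Functor.congr_obj (G.structure_maps e e' ê q s hc) x)
          (Functor.congr_obj (H.structure_maps e e' ê q s hc) x)
          (α.structure_maps e e' ê q s x hc) (β.structure_maps e e' ê q s x hc) }
  id_comp α := MLin.Hom.ext (by funext p n e q; exact Category.id_comp _)
  comp_id α := MLin.Hom.ext (by funext p n e q; exact Category.comp_id _)
  assoc α β γ := MLin.Hom.ext (by funext p n e q; exact Category.assoc _ _ _)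

/-- The natural transformations underlying a cell of symmetric spectra. -/
def MLin.cell {I : Type} [Finite I] {X : I → SymSpectrum.{u}} {Z : SymSpectrum.{u}}
    {F G : MLin I X Z} (α : F ⟶ G) {p : I → ℕ} {n : ℕ} (e : (Σ i, Fin (p i)) ≃ Fin n)
    (q : SimplexCategoryᵒᵖ) : F.app e q ⟶ G.app e q := MLin.Hom.app α e q

/-- `P` is the multicategory `Spec (sCat)`: its identities, reindexings and composites are the
evident ones. -/
structure IsSpecMulticategory (P : Multicategory SymSpectrum.{u} MLin.{u}) : Prop where
  id_app (X : SymSpectrum.{u}) (n : ℕ) (q : SimplexCategoryᵒᵖ) :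
    (P.id X).app (p := fun _ => n) (unitSigma (Fin n)) q = Pi.eval (fun _ : Unit => X.at n q) ()
  act_app {I J : Type} [Finite I] [Finite J] (ε : I ≃ J) (X : J → SymSpectrum.{u})
    (Z : SymSpectrum.{u}) (F : MLin J X Z) {p : J → ℕ} {n : ℕ}
    (e : (Σ i, Fin (p (ε i))) ≃ Fin n) (e' : (Σ j, Fin (p j)) ≃ Fin n) (q : SimplexCategoryᵒᵖ) :
    (∀ i k, e ⟨i, k⟩ = e' ⟨ε i, k⟩) →
    Pi.comap (fun j => (X j).at (p j) q) ε ⋙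
      ((P.act ε X Z).obj F).app (p := fun i => p (ε i)) e q = F.app e' q
  act_cell {I J : Type} [Finite I] [Finite J] (ε : I ≃ J) (X : J → SymSpectrum.{u})
    (Z : SymSpectrum.{u}) {F G : MLin J X Z} (α : F ⟶ G) {p : J → ℕ} {n : ℕ}
    (e : (Σ i, Fin (p (ε i))) ≃ Fin n) (e' : (Σ j, Fin (p j)) ≃ Fin n) (q : SimplexCategoryᵒᵖ) :
    (∀ i k, e ⟨i, k⟩ = e' ⟨ε i, k⟩) →
    HEq (Functor.whiskerLeft (Pi.comap (fun j => (X j).at (p j) q) ε)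
      (MLin.cell ((P.act ε X Z).map α) (p := fun i => p (ε i)) e q)) (MLin.cell α e' q)
  comp_app {I : Type} [Finite I] {K : I → Type} [∀ i, Finite (K i)]
    (X : ∀ i, K i → SymSpectrum.{u}) (Y : I → SymSpectrum.{u}) (Z : SymSpectrum.{u})
    (G : MLin I Y Z) (F : ∀ i, MLin (K i) (X i) (Y i)) {p : ∀ i, K i → ℕ} {n : I → ℕ} {N : ℕ}
    (e : ∀ i, (Σ k, Fin (p i k)) ≃ Fin (n i)) (e' : (Σ i, Fin (n i)) ≃ Fin N)
    (e'' : (Σ x : Σ i, K i, Fin (p x.1 x.2)) ≃ Fin N) (q : SimplexCategoryᵒᵖ) :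
    (∀ i k l, e'' ⟨⟨i, k⟩, l⟩ = e' ⟨i, e i ⟨k, l⟩⟩) →
    ((P.comp X Y Z).obj (G, F)).app (p := fun x => p x.1 x.2) e'' q =
      multicomp (G.app e' q) (fun i => (F i).app (e i) q)
  comp_cell {I : Type} [Finite I] {K : I → Type} [∀ i, Finite (K i)]
    (X : ∀ i, K i → SymSpectrum.{u}) (Y : I → SymSpectrum.{u}) (Z : SymSpectrum.{u})
    {G G' : MLin I Y Z} {F F' : ∀ i, MLin (K i) (X i) (Y i)} (α : G ⟶ G') (β : ∀ i, F i ⟶ F' i)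
    {p : ∀ i, K i → ℕ} {n : I → ℕ} {N : ℕ}
    (e : ∀ i, (Σ k, Fin (p i k)) ≃ Fin (n i)) (e' : (Σ i, Fin (n i)) ≃ Fin N)
    (e'' : (Σ x : Σ i, K i, Fin (p x.1 x.2)) ≃ Fin N) (q : SimplexCategoryᵒᵖ) :
    (∀ i k l, e'' ⟨⟨i, k⟩, l⟩ = e' ⟨i, e i ⟨k, l⟩⟩) →
    HEq (MLin.cell ((P.comp X Y Z).map (CategoryTheory.Prod.mkHom α β))
        (p := fun x => p x.1 x.2) e'' q)
      (multicompHom (MLin.cell α e' q) (fun i => MLin.cell (β i) (e i) q))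

/-! ## The multifunctor from `ℰ_*`-categories to symmetric spectra -/

theorem eHom_ext {s t : EObj} {f g : s ⟶ t} (hp : ∀ j, ePre f j = ePre g j)
    (hβ : ∀ j x, eMap f j x = eMap g j x) : f = g := EHom.ext' hp hβ

theorem ePre_comp {s t w : EObj} (f : s ⟶ t) (g : t ⟶ w) (k : Fin w.len) :
    ePre (f ≫ g) k = (ePre g k).bind (ePre f) := rfl

theorem eMap_comp_none {s t w : EObj} (f : s ⟶ t) (g : t ⟶ w) {k : Fin w.len}
    (h : ePre g k = none) (x : Fin (w.val k + 1)) : eMap (f ≫ g) k x = eMap g k x :=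
  EHom.comp_val_none f g h x

theorem eMap_comp_some {s t w : EObj} (f : s ⟶ t) (g : t ⟶ w) {k : Fin w.len} {j : Fin t.len}
    (h : ePre g k = some j) (x : Fin (w.val k + 1)) (y : Fin (t.val j + 1))
    (hy : eMap g k x = y.val) : eMap (f ≫ g) k x = eMap f j y :=
  EHom.comp_val_some f g h x hy

theorem ePre_id (t : EObj) (k : Fin t.len) : ePre (𝟙 t) k = some k := rfl

theorem eMap_id (t : EObj) (k : Fin t.len) (x : Fin (t.val k + 1)) : eMap (𝟙 t) k x = x.val := rfl

/-- A morphism of `ℰ` with values of the maps `β` regarded as natural numbers. -/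
def eMk {s t : EObj} (q : Fin s.len → Fin t.len) (p : Fin t.len → Option (Fin s.len))
    (h : ∀ i j, p j = some i ↔ q i = j) (β : ∀ j, Fin (t.val j + 1) → ℕ)
    (hβ : ∀ j x, β j x ≤ s.ext (p j)) (hm : ∀ j, Monotone (β j)) : s ⟶ t :=
  EHom.mk q p h fun j => ⟨fun x => ⟨β j x, Nat.lt_succ_of_le (hβ j x)⟩, fun _ _ hx => hm j hx⟩

theorem ePre_eMk {s t : EObj} {q : Fin s.len → Fin t.len} {p : Fin t.len → Option (Fin s.len)}
    {h : ∀ i j, p j = some i ↔ q i = j} {β : ∀ j, Fin (t.val j + 1) → ℕ}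
    {hβ : ∀ j x, β j x ≤ s.ext (p j)} {hm : ∀ j, Monotone (β j)} (j : Fin t.len) :
    ePre (eMk q p h β hβ hm) j = p j := rfl

theorem eMap_eMk {s t : EObj} {q : Fin s.len → Fin t.len} {p : Fin t.len → Option (Fin s.len)}
    {h : ∀ i j, p j = some i ↔ q i = j} {β : ∀ j, Fin (t.val j + 1) → ℕ}
    {hβ : ∀ j x, β j x ≤ s.ext (p j)} {hm : ∀ j, Monotone (β j)} (j : Fin t.len)
    (x : Fin (t.val j + 1)) : eMap (eMk q p h β hβ hm) j x = β j x := rfl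

/-- A morphism of `ℰ` with a constant entry induces the constant functor, as it factors through an
object with an entry `[0]`. -/
theorem EStarCat.map_eq_zero (X : EStarCat.{u}) {s t : EObj} (f : s ⟶ t) (k : Fin t.len)
    (h : ∀ x y, eMap f k x = eMap f k y) : X.functor.map f = BasedCat.zero _ _ := by
  let r : EObj := ⟨t.len, fun j => if j = k then 0 else t.val j⟩
  have hr : ∀ j, r.val j ≤ t.val j := fun j => by
    simp only [r]; split_ifs <;> omega
  let g : s ⟶ r := eMk (s := s) (t := r) (@eInj s t f) (@ePre s t f) (EHom.p_eq_some f)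
    (fun j x => @eMap s t f j (Fin.castLE (Nat.succ_le_succ (hr j)) x))
    (fun j x => Nat.lt_succ_iff.1 (EHom.β f j _).2)
    (fun j x y hxy => (EHom.β f j).monotone (by exact hxy))
  let l : r ⟶ t := eMk (fun j => j) (fun j => some j) (fun i j => by simp [eq_comm])
    (fun j x => if j = k then 0 else x.val)
    (fun j x => by
      change _ ≤ r.val j
      simp only [r]
      split_ifs
      · exact le_refl _
      · exact Nat.lt_succ_iff.1 x.2)
    (fun j x y hxy => by
      dsimp only
      split_ifs
      · exact le_refl _
      · exact hxy)
  have hgl : g ≫ l = f := by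
    refine eHom_ext (fun j => rfl) fun j x => ?_
    have hx : (if j = k then 0 else x.val) < r.val j + 1 := by
      simp only [r]; split_ifs
      · exact Nat.zero_lt_one
      · exact x.2
    rw [eMap_comp_some g l (j := j) rfl x ⟨_, hx⟩ rfl]
    by_cases hj : j = k
    · subst hj; exact h _ _
    · change eMap f j _ = eMap f j _
      congr 1
      exact Fin.ext (by simp [hj])
  rw [← hgl, Functor.map_comp]
  obtain ⟨h₁, h₂⟩ := X.trivial r ⟨k, by simp [r]⟩
  have h₂' : ∀ {a b : X.at r} (m m' : a ⟶ b), m = m' := fun {a b} m m' => by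
    obtain rfl := h₁ a
    obtain rfl := h₁ b
    rw [h₂ m, h₂ m']
  have e : X.tr g = (Functor.const _).obj (X.functor.obj r).pt :=
    CategoryTheory.Functor.ext (fun x => h₁ _) fun x y m => h₂' _ _
  refine BasedFunctor.ext ?_
  change X.tr g ⋙ X.tr l = (Functor.const _).obj (X.functor.obj t).pt
  rw [e]
  refine CategoryTheory.Functor.ext (fun x => BasedCat.func_pt (X.functor.map l)) fun x y m => ?_
  simp

/-- The object `([q], …, [q])` of `ℰ` of length `n`. -/
abbrev diagObj (n : ℕ) (q : SimplexCategoryᵒᵖ) : EObj := ⟨n, fun _ => q.unop.len⟩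

/-- The morphism `(id, (f, …, f)) : ([q], …, [q]) ⟶ ([q'], …, [q'])` of `ℰ`. -/
def diagMap (n : ℕ) {q q' : SimplexCategoryᵒᵖ} (f : q ⟶ q') : diagObj n q ⟶ diagObj n q' :=
  EHom.mk (s := diagObj n q) (t := diagObj n q') (fun j => j) (fun j => some j)
    (fun i j => by rw [Option.some_inj]; exact eq_comm) fun _ => f.unop.toOrderHom

/-- The composite `Δᵒᵖ ⥤ (Δᵒᵖ)^n ⥤ ℰ`. -/
def diag (n : ℕ) : SimplexCategoryᵒᵖ ⥤ EObj where
  obj := diagObj n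
  map := diagMap n
  map_id _ := eHom_ext (fun _ => rfl) fun _ _ => rfl
  map_comp _ _ := eHom_ext (fun _ => rfl) fun _ _ => rfl

/-- The morphism of `ℰ` given by a permutation. -/
def permHom {n : ℕ} (τ : Equiv.Perm (Fin n)) (q : SimplexCategoryᵒᵖ) :
    diagObj n q ⟶ diagObj n q :=
  EHom.mk (s := diagObj n q) (t := diagObj n q) τ (fun j => some (τ.symm j))
    (fun i j => by
      rw [Option.some_inj, Equiv.symm_apply_eq]; exact eq_comm) fun _ => OrderHom.id

/-- The morphism `(ι_n, (id, …, id, β^j)) : ([q], …, [q]) ⟶ ([q], …, [q], [q])` of `ℰ`, where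
`β^j : [q] ⟶ [1]` sends `x` to `1` if and only if `j ≤ x`. -/
def suspHom (n : ℕ) (q : SimplexCategoryᵒᵖ) (j : Fin (q.unop.len + 1)) :
    diagObj n q ⟶ diagObj (n + 1) q :=
  eMk (s := diagObj n q) (t := diagObj (n + 1) q) Fin.castSucc
    (fun k => if h : k.val < n then some ⟨k.val, h⟩ else none)
    (fun i k => by
      split_ifs with h
      · rw [Option.some_inj]
        exact ⟨fun e => Fin.ext (congrArg Fin.val e).symm, fun e => Fin.ext (congrArg Fin.val e).symm⟩
      · exact ⟨fun e => e.elim, fun e => h (by rw [← e]; exact i.2)⟩)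
    (fun k x => if k.val < n then x.val else if j ≤ x then 1 else 0)
    (fun k x => by
      split_ifs
      · exact Nat.lt_succ_iff.1 x.2
      · exact le_refl _
      · exact Nat.zero_le _)
    (fun k x y h => by
      dsimp only
      split_ifs with h₁ h₂ h₃
      · exact h
      · exact le_refl _
      · exact absurd (h₂.trans h) h₃
      · exact Nat.zero_le _
      · exact le_refl _)

/-- The composite of the morphisms `suspHom`. -/
def suspIter (n : ℕ) (q : SimplexCategoryᵒᵖ) :
    ∀ (p : ℕ), (Fin p → Fin (q.unop.len + 1)) → (diagObj n q ⟶ diagObj (n + p) q)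
  | 0, _ => 𝟙 _
  | p + 1, s => suspIter n q p (fun i => s i.castSucc) ≫ suspHom (n + p) q (s (Fin.last p))

theorem suspIter_spec (n : ℕ) (q : SimplexCategoryᵒᵖ) (p : ℕ) (s : Fin p → Fin (q.unop.len + 1)) :
    (∀ k : Fin n, ePre (suspIter n q p s) (Fin.castAdd p k) = some k ∧
      ∀ x, eMap (suspIter n q p s) (Fin.castAdd p k) x = x.val) ∧
    (∀ k : Fin p, ePre (suspIter n q p s) (Fin.natAdd n k) = none ∧
      ∀ x : Fin (q.unop.len + 1),
        eMap (suspIter n q p s) (Fin.natAdd n k) x = if s k ≤ x then 1 else 0) := by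
  induction p with
  | zero => exact ⟨fun k => ⟨rfl, fun x => rfl⟩, fun k => k.elim0⟩
  | succ p ih =>
    obtain ⟨ih₁, ih₂⟩ := ih (fun i => s i.castSucc)
    have h₁ : ∀ k : Fin (n + p), ePre (suspHom (n + p) q (s (Fin.last p))) k.castSucc = some k :=
      fun k => dif_pos k.2
    have h₂ : ∀ (k : Fin (n + p)) (x : Fin (q.unop.len + 1)),
        eMap (suspHom (n + p) q (s (Fin.last p))) k.castSucc x = x.val := fun k x => if_pos k.2
    have h₃ : ePre (suspHom (n + p) q (s (Fin.last p))) (Fin.last (n + p)) = none :=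
      dif_neg (lt_irrefl _)
    have h₄ : ∀ x : Fin (q.unop.len + 1), eMap (suspHom (n + p) q (s (Fin.last p)))
        (Fin.last (n + p)) x = if s (Fin.last p) ≤ x then 1 else 0 := fun x => if_neg (lt_irrefl _)
    refine ⟨fun k => ⟨?_, fun x => ?_⟩, fun k => ?_⟩
    · change (ePre (suspHom (n + p) q (s (Fin.last p))) (Fin.castAdd p k).castSucc).bind _ = _
      rw [h₁]
      exact (ih₁ k).1
    · exact (eMap_comp_some _ _ (h₁ (Fin.castAdd p k)) x x (h₂ _ _)).trans ((ih₁ k).2 x)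
    · refine Fin.lastCases ?_ (fun k => ?_) k
      · refine ⟨?_, fun x => ?_⟩
        · change (ePre (suspHom (n + p) q (s (Fin.last p))) (Fin.last (n + p))).bind _ = _
          rw [h₃]; rfl
        · exact (eMap_comp_none _ _ h₃ x).trans (h₄ x)
      · refine ⟨?_, fun x => ?_⟩
        · change (ePre (suspHom (n + p) q (s (Fin.last p))) (Fin.natAdd n k).castSucc).bind _ = _
          rw [h₁]
          exact (ih₂ k).1
        · exact (eMap_comp_some _ _ (h₁ (Fin.natAdd n k)) x x (h₂ _ _)).trans ((ih₂ k).2 x)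

theorem permHom_suspIter (n p : ℕ) (q : SimplexCategoryᵒᵖ) (s : Fin p → Fin (q.unop.len + 1))
    (τ : Equiv.Perm (Fin n)) (π : Equiv.Perm (Fin p)) :
    permHom τ q ≫ suspIter n q p (fun i => s (π.symm i)) =
      suspIter n q p s ≫ permHom (blockSum τ π) q := by
  obtain ⟨h₁, h₂⟩ := suspIter_spec n q p s
  obtain ⟨h₃, h₄⟩ := suspIter_spec n q p (fun i => s (π.symm i))
  have e₁ : ∀ k : Fin n, ePre (permHom (blockSum τ π) q) (Fin.castAdd p k) =
      some (Fin.castAdd p (τ.symm k)) := fun k => by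
    change some ((blockSum τ π).symm _) = _
    rw [Option.some_inj, Equiv.symm_apply_eq]
    simp [blockSum]
  have e₂ : ∀ k : Fin p, ePre (permHom (blockSum τ π) q) (Fin.natAdd n k) =
      some (Fin.natAdd n (π.symm k)) := fun k => by
    change some ((blockSum τ π).symm _) = _
    rw [Option.some_inj, Equiv.symm_apply_eq]
    simp [blockSum]
  refine eHom_ext (fun j => ?_) fun j x => ?_
  · rw [ePre_comp, ePre_comp]
    refine Fin.addCases (fun k => ?_) (fun k => ?_) j
    · rw [(h₃ k).1, e₁]; exact ((h₁ _).1).symm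
    · rw [(h₄ k).1, e₂]; exact ((h₂ _).1).symm
  · revert x
    refine Fin.addCases (fun k x => ?_) (fun k x => ?_) j
    · rw [eMap_comp_some _ _ (h₃ k).1 x x ((h₃ k).2 x), eMap_comp_some _ _ (e₁ k) x x rfl]
      exact Eq.trans (rfl : eMap (permHom τ q) k x = x.val) ((h₁ (τ.symm k)).2 x).symm
    · rw [eMap_comp_none _ _ (h₄ k).1 x, eMap_comp_some _ _ (e₂ k) x x rfl]
      exact ((h₄ k).2 x).trans ((h₂ _).2 x).symm

theorem circleMap_le_iff {m n : SimplexCategory} (β : m ⟶ n) (i : Fin (n.len + 1))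
    (h₀ : β.toOrderHom 0 < i) (h₁ : i ≤ β.toOrderHom (Fin.last _)) (x : Fin (m.len + 1)) :
    circleMap β i ≤ x ↔ i ≤ β.toOrderHom x := by
  have h : ∃ j : Fin m.len, β.toOrderHom j.castSucc < i ∧ i ≤ β.toOrderHom j.succ := by
    by_contra hn
    push Not at hn
    have : ∀ j : Fin (m.len + 1), β.toOrderHom j < i := fun j =>
      Fin.induction h₀ (fun j hj => hn j hj) j
    exact absurd (this (Fin.last _)) (not_lt.2 h₁)
  rw [circleMap, dif_pos h]
  obtain ⟨h₂, h₃⟩ := h.choose_spec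
  refine ⟨fun hx => h₃.trans (β.toOrderHom.monotone hx), fun hx => ?_⟩
  by_contra hn
  have : x ≤ h.choose.castSucc := Fin.le_castSucc_iff.2 (not_le.1 hn)
  exact absurd (hx.trans (β.toOrderHom.monotone this)) (not_le.2 h₂)

theorem circleMap_eq_zero {m n : SimplexCategory} (β : m ⟶ n) (i : Fin (n.len + 1))
    (h : ¬ (β.toOrderHom 0 < i ∧ i ≤ β.toOrderHom (Fin.last _))) : circleMap β i = 0 := by
  rw [circleMap, dif_neg]
  rintro ⟨j, h₁, h₂⟩
  exact h ⟨(β.toOrderHom.monotone (Fin.zero_le _)).trans_lt h₁,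
    h₂.trans (β.toOrderHom.monotone (Fin.le_last _))⟩

theorem suspHom_last (n : ℕ) (q : SimplexCategoryᵒᵖ) (j : Fin (q.unop.len + 1)) :
    ePre (suspHom n q j) (Fin.last n) = none ∧ ∀ x : Fin (q.unop.len + 1),
      eMap (suspHom n q j) (Fin.last n) x = if j ≤ x then 1 else 0 :=
  ⟨dif_neg (lt_irrefl _), fun _ => if_neg (lt_irrefl _)⟩

theorem suspHom_castSucc (n : ℕ) (q : SimplexCategoryᵒᵖ) (j : Fin (q.unop.len + 1)) (k : Fin n) :
    ePre (suspHom n q j) k.castSucc = some k ∧ ∀ x : Fin (q.unop.len + 1),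
      eMap (suspHom n q j) k.castSucc x = x.val :=
  ⟨dif_pos k.2, fun _ => if_pos k.2⟩

theorem EStarCat.map_suspHom_zero (X : EStarCat.{u}) (n : ℕ) (q : SimplexCategoryᵒᵖ) :
    X.functor.map (suspHom n q 0) = BasedCat.zero _ _ :=
  X.map_eq_zero _ (Fin.last n) fun x y => by
    rw [(suspHom_last n q 0).2, (suspHom_last n q 0).2, if_pos (Fin.zero_le _),
      if_pos (Fin.zero_le _)]

theorem BasedCat.comp_zero {X Y Z : BasedCat.{u}} (F : X ⟶ Y) :
    F ≫ BasedCat.zero Y Z = BasedCat.zero X Z := rfl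

theorem diag_comp_suspHom_last (n : ℕ) {q q' : SimplexCategoryᵒᵖ} (f : q ⟶ q')
    (j : Fin (q.unop.len + 1)) (x : Fin (q'.unop.len + 1)) :
    eMap (suspHom n q j ≫ diagMap (n + 1) f) (Fin.last n) x =
      if j ≤ f.unop.toOrderHom x then 1 else 0 :=
  (eMap_comp_some (suspHom n q j) (diagMap (n + 1) f) (j := Fin.last n) rfl x
    (f.unop.toOrderHom x) rfl).trans ((suspHom_last n q j).2 _)

theorem EStarCat.map_suspHom_naturality (X : EStarCat.{u}) (n : ℕ) {q q' : SimplexCategoryᵒᵖ}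
    (f : q ⟶ q') (j : Fin (q.unop.len + 1)) :
    X.functor.map (diagMap n f) ≫ X.functor.map (suspHom n q' (circleMap f.unop j)) =
      X.functor.map (suspHom n q j) ≫ X.functor.map (diagMap (n + 1) f) := by
  by_cases h : f.unop.toOrderHom 0 < j ∧ j ≤ f.unop.toOrderHom (Fin.last _)
  · refine (X.functor.map_comp _ _).symm.trans (Eq.trans (congrArg X.functor.map ?_)
      (X.functor.map_comp _ _))
    refine eHom_ext (fun k => ?_) fun k x => ?_
    · rw [ePre_comp, ePre_comp]
      refine Fin.lastCases ?_ (fun k => ?_) k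
      · rw [(suspHom_last n q' _).1]
        exact (suspHom_last n q j).1.symm
      · rw [(suspHom_castSucc n q' _ k).1]
        exact (suspHom_castSucc n q j k).1.symm
    · revert x
      refine Fin.lastCases (fun x => ?_) (fun k x => ?_) k
      · rw [eMap_comp_none _ _ (suspHom_last n q' _).1 x]
        refine ((suspHom_last n q' _).2 x).trans (Eq.trans ?_
          (diag_comp_suspHom_last n f j x).symm)
        exact if_congr (circleMap_le_iff f.unop j h.1 h.2 x) rfl rfl
      · rw [eMap_comp_some _ _ (suspHom_castSucc n q' _ k).1 x x ((suspHom_castSucc n q' _ k).2 x)]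
        exact ((eMap_comp_some (suspHom n q j) (diagMap (n + 1) f) (j := k.castSucc) rfl x
          (f.unop.toOrderHom x) rfl).trans ((suspHom_castSucc n q j k).2 _)).symm
  · rw [circleMap_eq_zero _ _ h, X.map_suspHom_zero, BasedCat.comp_zero]
    refine Eq.trans (X.map_eq_zero _ (Fin.last n) fun x y => ?_).symm (X.functor.map_comp _ _)
    rw [diag_comp_suspHom_last, diag_comp_suspHom_last]
    refine if_congr ?_ rfl rfl
    rw [not_and_or, not_lt, not_le] at h
    obtain h | h := h
    · exact ⟨fun _ => h.trans (f.unop.toOrderHom.monotone (Fin.zero_le _)),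
        fun _ => h.trans (f.unop.toOrderHom.monotone (Fin.zero_le _))⟩
    · exact ⟨fun e => absurd (e.trans (f.unop.toOrderHom.monotone (Fin.le_last _))) (not_le.2 h),
        fun e => absurd (e.trans (f.unop.toOrderHom.monotone (Fin.le_last _))) (not_le.2 h)⟩

theorem EStarCat.iterSigma_eq (X : EStarCat.{u}) (n : ℕ) (q : SimplexCategoryᵒᵖ) (p : ℕ)
    (s : Fin p → Fin (q.unop.len + 1)) :
    iterSigma (X := fun n => diag n ⋙ X.functor) (fun n q j => X.functor.map (suspHom n q j))
      n q p s = X.functor.map (suspIter n q p s) := by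
  induction p with
  | zero => exact (X.functor.map_id _).symm
  | succ p ih =>
    rw [iterSigma, ih, suspIter]
    exact (X.functor.map_comp _ _).symm

/-- The symmetric spectrum `I X` of an `ℰ_*`-category `X`. In degree `n` it is the composite
`Δᵒᵖ ⥤ (Δᵒᵖ)^n ⥤ ℰ ⥤ Cat_*`. -/
noncomputable def ISpec (X : EStarCat.{u}) : SymSpectrum.{u} where
  level n := diag n ⋙ X.functor
  act n :=
    { toFun := fun τ =>
        { app := fun q => X.functor.map (permHom τ q)
          naturality := fun q q' f => by
            exact (X.functor.map_comp _ _).symm.trans (Eq.trans (congrArg X.functor.map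
              (eHom_ext (f := diagMap n f ≫ permHom τ q') (g := permHom τ q ≫ diagMap n f)
                (fun _ => rfl) fun _ _ => rfl)) (X.functor.map_comp _ _)) }
      map_one' := by
        refine NatTrans.ext (funext fun q => ?_)
        exact (congrArg X.functor.map (eHom_ext (f := permHom 1 q) (g := 𝟙 _) (fun _ => rfl) fun _ _ => rfl)).trans
          (X.functor.map_id _)
      map_mul' := fun τ τ' => by
        refine NatTrans.ext (funext fun q => ?_)
        exact (congrArg X.functor.map (eHom_ext (f := permHom (τ * τ') q)
          (g := permHom τ' q ≫ permHom τ q) (fun _ => rfl) fun _ _ => rfl)).trans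
          (X.functor.map_comp _ _) }
  σ n q j := X.functor.map (suspHom n q j)
  σ_zero n q := X.map_suspHom_zero n q
  σ_naturality n _ _ f j := X.map_suspHom_naturality n f j
  equivariance n p q s τ π := by
    rw [X.iterSigma_eq, X.iterSigma_eq]
    change X.functor.map (permHom τ q) ≫ _ = _ ≫ X.functor.map (permHom (blockSum τ π) q)
    rw [← Functor.map_comp, ← Functor.map_comp, permHom_suspIter]

/-- The concatenation of tuples `([q], …, [q])`. -/
def diagConcat {I : Type} {p : I → ℕ} {n : ℕ} (e : (Σ i, Fin (p i)) ≃ Fin n)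
    (q : SimplexCategoryᵒᵖ) : Concat (fun i => diagObj (p i) q) (diagObj n q) := ⟨e, fun _ _ => rfl⟩

/-- `J` is the multifunctor `I`, which restricts multimorphisms and cells to the diagonals. -/
structure IsSpectrumMultifunctor {E : Multicategory EStarCat.{u} EMor.{u}}
    {P : Multicategory SymSpectrum.{u} MLin.{u}} (J : Multifunctor E P ISpec) : Prop where
  map_app {I : Type} [Finite I] (X : I → EStarCat.{u}) (Y : EStarCat.{u}) (F : EMor I X Y)
    {p : I → ℕ} {n : ℕ} (e : (Σ i, Fin (p i)) ≃ Fin n) (q : SimplexCategoryᵒᵖ) :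
    ((J.map X Y).obj F).app e q = F.app (diagConcat e q)
  map_cell {I : Type} [Finite I] (X : I → EStarCat.{u}) (Y : EStarCat.{u}) {F G : EMor I X Y}
    (α : F ⟶ G) {p : I → ℕ} {n : ℕ} (e : (Σ i, Fin (p i)) ≃ Fin n) (q : SimplexCategoryᵒᵖ) :
    HEq (MLin.cell ((J.map X Y).map α) e q) (EMor.cell α (diagConcat e q))

end KTheory

open KTheory

noncomputable section

namespace KTheory

open CategoryTheory.Prod (mkHom)
open CategoryTheory.Category (assoc id_comp comp_id)
open CategoryTheory.Functor (hext)
open CategoryTheory.Functor renaming map_id → fmap_id, map_comp → fmap_comp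

/-! ### Heterogeneous equalities -/

lemma isId_of_heq {C : Type*} [Category C] {X Y X' Y' : C} {f : X ⟶ Y} {f' : X' ⟶ Y'}
    (hX : X = X') (hY : Y = Y') (h : HEq f f') (hf : IsId f) : IsId f' := by
  subst hX hY
  rwa [← eq_of_heq h]

lemma isId_of_heq_id {C : Type*} [Category C] {X Y Z : C} {f : X ⟶ Y} (hX : X = Z)
    (hY : Y = Z) (h : HEq f (𝟙 Z)) : IsId f := by
  subst hX hY
  rw [eq_of_heq h]
  exact isId_id _

lemma IsId.map {C D : Type*} [Category C] [Category D] (F : C ⥤ D) {X Y : C} {f : X ⟶ Y}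
    (hf : IsId f) : IsId (F.map f) := by
  obtain ⟨rfl, rfl⟩ := hf
  exact ⟨rfl, by simp⟩

lemma isId_eqToHom {C : Type*} [Category C] {X Y : C} (h : X = Y) : IsId (eqToHom h) := ⟨h, rfl⟩

lemma IsId.heq {C : Type*} [Category C] {X Y X' Y' : C} {f : X ⟶ Y} {g : X' ⟶ Y'}
    (hf : IsId f) (hg : IsId g) (h : X = X') : HEq f g := by
  obtain ⟨rfl, rfl⟩ := hf
  obtain ⟨rfl, rfl⟩ := hg
  subst h
  rfl

lemma IsId.comp_heq {C : Type*} [Category C] {X Y Z : C} {f : X ⟶ Y} (hf : IsId f)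
    (g : Y ⟶ Z) : HEq (f ≫ g) g := by
  obtain ⟨rfl, rfl⟩ := hf
  simp

lemma IsId.heq_comp {C : Type*} [Category C] {X Y Z : C} (f : X ⟶ Y) {g : Y ⟶ Z}
    (hg : IsId g) : HEq (f ≫ g) f := by
  obtain ⟨rfl, rfl⟩ := hg
  simp

lemma pi_heq {I : Type*} {A : I → Type*} [∀ i, Category (A i)] {x y x' y' : ∀ i, A i}
    {f : x ⟶ y} {f' : x' ⟶ y'} (hx : x = x') (hy : y = y') (h : ∀ i, HEq (f i) (f' i)) :
    HEq f f' := by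
  subst hx hy
  exact heq_of_eq (funext fun i => eq_of_heq (h i))

lemma map_heq {C D : Type*} [Category C] [Category D] (F : C ⥤ D) {X Y X' Y' : C} {f : X ⟶ Y}
    {f' : X' ⟶ Y'} (hX : X = X') (hY : Y = Y') (h : HEq f f') : HEq (F.map f) (F.map f') := by
  subst hX hY
  rw [eq_of_heq h]

lemma functor_map_heq {C D : Type*} [Category C] [Category D] {F G : C ⥤ D} (h : F = G)
    {X Y : C} (f : X ⟶ Y) : HEq (F.map f) (G.map f) := by
  subst h
  rfl

lemma app_heq {C D : Type*} [Category C] [Category D] {F G F' G' : C ⥤ D} {α : F ⟶ G}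
    {β : F' ⟶ G'} (h : F = F') (h' : G = G') (hα : HEq α β) (x : C) : HEq (α.app x) (β.app x) := by
  subst h h'
  rw [eq_of_heq hα]

lemma app_heq_of_eq {C D : Type*} [Category C] [Category D] {F G : C ⥤ D} (α : F ⟶ G) {x y : C}
    (h : x = y) : HEq (α.app x) (α.app y) := by
  subst h
  rfl

lemma natTrans_heq {C D : Type*} [Category C] [Category D] {F G F' G' : C ⥤ D} {α : F ⟶ G}
    {β : F' ⟶ G'} (h : F = F') (h' : G = G') (H : ∀ x, HEq (α.app x) (β.app x)) : HEq α β := by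
  subst h h'
  exact heq_of_eq (NatTrans.ext (funext fun x => eq_of_heq (H x)))

lemma isAlong_id {I : Type} {A : I → Type u} [∀ i, SmallCategory (A i)] (i : I) (x : ∀ i, A i) :
    IsAlong i (𝟙 x) := fun _ _ => isId_id _

/-! ### Arrows of functor categories -/

section Arrows

variable {A : Type*} {B : Type*} {C : Type*} {D : Type*} [Category A] [Category B] [Category C]
  [Category D]

/-- Precomposition of a natural transformation with a functor. -/
def preArr (H : A ⥤ B) (a : Arrow (B ⥤ C)) : Arrow (A ⥤ C) :=
  Arrow.mk (Functor.whiskerLeft H a.hom)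

/-- Postcomposition of a natural transformation with a functor. -/
def postArr (a : Arrow (A ⥤ B)) (H : B ⥤ C) : Arrow (A ⥤ C) :=
  Arrow.mk (Functor.whiskerRight a.hom H)

lemma arrow_ext {a b : Arrow (A ⥤ C)} (h₀ : a.left = b.left) (h₁ : a.right = b.right)
    (h : ∀ x, HEq (a.hom.app x) (b.hom.app x)) : a = b := by
  obtain ⟨F, G, α⟩ := a
  obtain ⟨F', G', β⟩ := b
  change ∀ x, HEq (α.app x) (β.app x) at h
  obtain rfl : F = F' := h₀
  obtain rfl : G = G' := h₁
  congr 1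
  exact NatTrans.ext (funext fun x => eq_of_heq (h x))

lemma heq_of_arrow {X Y X' Y' : A} {f : X ⟶ Y} {g : X' ⟶ Y'} (h : Arrow.mk f = Arrow.mk g) :
    HEq f g := by
  have : ∀ a b : Arrow A, a = b → HEq a.hom b.hom := by rintro a _ rfl; rfl
  exact this _ _ h

lemma left_eq_of_arrow {X Y X' Y' : A} {f : X ⟶ Y} {g : X' ⟶ Y'} (h : Arrow.mk f = Arrow.mk g) :
    X = X' := congrArg Arrow.left h

lemma right_eq_of_arrow {X Y X' Y' : A} {f : X ⟶ Y} {g : X' ⟶ Y'} (h : Arrow.mk f = Arrow.mk g) :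
    Y = Y' := congrArg Arrow.right h

lemma preArr_id (a : Arrow (B ⥤ C)) : preArr (𝟭 B) a = a := rfl

lemma preArr_preArr (H : A ⥤ B) (K : B ⥤ C) (a : Arrow (C ⥤ D)) :
    preArr H (preArr K a) = preArr (H ⋙ K) a := rfl

lemma preArr_injective {H : A ⥤ B} {K : B ⥤ A} (h : K ⋙ H = 𝟭 B) {a b : Arrow (B ⥤ C)}
    (e : preArr H a = preArr H b) : a = b := by
  have := congrArg (preArr K) e
  rwa [preArr_preArr, preArr_preArr, h] at this

end Arrows

/-! ### Reindexing of products -/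

section Reindex

/-- The identity functor between equal members of a family of categories. -/
def eqFunctor {J : Type} (A : J → Type u) [∀ j, Category.{v} (A j)] {j j' : J} (h : j = j') :
    A j ⥤ A j' := by
  subst h; exact 𝟭 _

variable {I J : Type} (e : I ≃ J) (A : J → Type u) [∀ j, Category.{v} (A j)]

lemma eqFunctor_obj {j j' : J} (h : j = j') (x : ∀ j, A j) :
    (eqFunctor A h).obj (x j) = x j' := by
  subst h; rfl

lemma eqFunctor_map {j j' : J} (h : j = j') {x y : ∀ j, A j} (f : x ⟶ y) :
    HEq ((eqFunctor A h).map (f j)) (f j') := by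
  subst h; rfl

/-- The inverse of `Pi.comap A e`. -/
def reindex : (∀ i, A (e i)) ⥤ ∀ j, A j :=
  Functor.pi' fun j => Pi.eval (fun i => A (e i)) (e.symm j) ⋙ eqFunctor A (e.apply_symm_apply j)

lemma comap_reindex : Pi.comap A e ⋙ reindex e A = 𝟭 _ := by
  refine Functor.hext (fun x => funext fun j => eqFunctor_obj A _ x) fun x y f => ?_
  exact pi_heq (funext fun j => eqFunctor_obj A _ x) (funext fun j => eqFunctor_obj A _ y)
    fun j => eqFunctor_map A _ f

lemma eqFunctor_obj' {i i' : I} (h : i = i') (h' : e i = e i') (x : ∀ i, A (e i)) :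
    (eqFunctor A h').obj (x i) = x i' := by
  subst h; rfl

lemma eqFunctor_map' {i i' : I} (h : i = i') (h' : e i = e i') {x y : ∀ i, A (e i)}
    (f : x ⟶ y) : HEq ((eqFunctor A h').map (f i)) (f i') := by
  subst h; rfl

lemma reindex_obj (x : ∀ i, A (e i)) (i : I) : (reindex e A).obj x (e i) = x i :=
  eqFunctor_obj' e A (e.symm_apply_apply i) _ x

lemma reindex_map {x y : ∀ i, A (e i)} (f : x ⟶ y) (i : I) :
    HEq ((reindex e A).map f (e i)) (f i) :=
  eqFunctor_map' e A (e.symm_apply_apply i) _ f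

lemma reindex_comap : reindex e A ⋙ Pi.comap A e = 𝟭 _ := by
  refine Functor.hext (fun x => funext fun i => reindex_obj e A x i) fun x y f => ?_
  exact pi_heq (funext fun j => reindex_obj e A x j) (funext fun j => reindex_obj e A y j)
    fun j => reindex_map e A f j

lemma exists_comap_obj (x : ∀ i, A (e i)) : ∃ x' : ∀ j, A j, x = fun i => x' (e i) :=
  ⟨(reindex e A).obj x, (Functor.congr_obj (reindex_comap e A) x).symm⟩

lemma preArr_comap_injective {C : Type*} [Category C] {a b : Arrow ((∀ i, A (e i)) ⥤ C)}
    (h : preArr (Pi.comap A e) a = preArr (Pi.comap A e) b) : a = b :=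
  preArr_injective (reindex_comap e A) h

lemma preArr_comap_reindex {C : Type*} [Category C] (a : Arrow ((∀ j, A j) ⥤ C)) :
    preArr (Pi.comap A e) (preArr (reindex e A) a) = a := by
  rw [preArr_preArr, comap_reindex, preArr_id]

end Reindex

/-! ### Multicomposition of arrows -/

section McompArr

variable {I : Type} {K : I → Type} {A : ∀ i, K i → Type u} [∀ i k, Category.{v} (A i k)]
  {B : I → Type u} [∀ i, Category.{v} (B i)] {C : Type u} [Category.{v} C]

/-- The multicomposite of arrows of functor categories. -/
def mcompArr (a : Arrow ((∀ i, B i) ⥤ C)) (b : ∀ i, Arrow ((∀ k, A i k) ⥤ B i)) :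
    Arrow ((∀ x : Σ i, K i, A x.1 x.2) ⥤ C) :=
  Arrow.mk (multicompHom a.hom fun i => (b i).hom)

end McompArr

lemma functor_ext_arrow {X Y : Type*} [Category X] [Category Y] {L R : X ⥤ Y}
    (h : ∀ {F G : X} (α : F ⟶ G), Arrow.mk (L.map α) = Arrow.mk (R.map α)) : L = R :=
  Functor.hext (fun F => left_eq_of_arrow (h (𝟙 F))) fun _ _ α => heq_of_arrow (h α)

/-! ### Colimits over subsets of posets -/

section Poset

variable {P : Type} [PartialOrder P] {Q : Type} [PartialOrder Q] {C : Type u} [SmallCategory C]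

/-- A compatible family of maps out of the values of `G` on the set `D`. -/
def IsCompat (G : P ⥤ C) (D : Set P) {T : C} (d : ∀ x ∈ D, (G.obj x ⟶ T)) : Prop :=
  ∀ (x y : P) (h : x ≤ y) (hx : x ∈ D) (hy : y ∈ D), G.map (homOfLE h) ≫ d y hy = d x hx

/-- `Z` is the colimit of the restriction of `G` to the set `D`. -/
structure IsColimOn (G : P ⥤ C) (D : Set P) (Z : C) (c : ∀ x ∈ D, (G.obj x ⟶ Z)) : Prop where
  comm : IsCompat G D c
  exists_desc {T : C} (d : ∀ x ∈ D, (G.obj x ⟶ T)) :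
    IsCompat G D d → ∃ f : Z ⟶ T, ∀ x hx, c x hx ≫ f = d x hx
  hom_ext {T : C} (f g : Z ⟶ T) : (∀ x hx, c x hx ≫ f = c x hx ≫ g) → f = g

lemma IsCompat.mono {G : P ⥤ C} {D D' : Set P} {T : C} {d : ∀ x ∈ D, (G.obj x ⟶ T)}
    (h : IsCompat G D d) (hD : D' ⊆ D) : IsCompat G D' fun x hx => d x (hD hx) :=
  fun x y hxy hx hy => h x y hxy (hD hx) (hD hy)

lemma map_homOfLE_comp (G : P ⥤ C) {x y z : P} (h : x ≤ y) (h' : y ≤ z) :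
    G.map (homOfLE h) ≫ G.map (homOfLE h') = G.map (homOfLE (h.trans h')) :=
  (G.map_comp _ _).symm

lemma map_homOfLE_refl (G : P ⥤ C) {x : P} (h : x ≤ x) : G.map (homOfLE h) = 𝟙 _ :=
  G.map_id x

namespace IsColimOn

variable {G : P ⥤ C} {D : Set P} {Z : C} {c : ∀ x ∈ D, (G.obj x ⟶ Z)}

lemma exists_iso (h : IsColimOn G D Z c) {Z' : C} {c' : ∀ x ∈ D, (G.obj x ⟶ Z')}
    (h' : IsColimOn G D Z' c') : ∃ e : Z ≅ Z', ∀ x hx, c x hx ≫ e.hom = c' x hx := by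
  obtain ⟨f, hf⟩ := h.exists_desc c' h'.comm
  obtain ⟨g, hg⟩ := h'.exists_desc c h.comm
  exact ⟨⟨f, g, h.hom_ext _ _ fun x hx => by rw [← assoc, hf, hg, comp_id],
    h'.hom_ext _ _ fun x hx => by rw [← assoc, hg, hf, comp_id]⟩, hf⟩

lemma of_iso (h : IsColimOn G D Z c) {Z' : C} {c' : ∀ x ∈ D, (G.obj x ⟶ Z')}
    (e : Z ≅ Z') (he : ∀ x hx, c x hx ≫ e.hom = c' x hx) : IsColimOn G D Z' c' where
  comm x y hxy hx hy := by rw [← he, ← he, ← assoc, h.comm]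
  exists_desc d hd := by
    obtain ⟨f, hf⟩ := h.exists_desc d hd
    exact ⟨e.inv ≫ f, fun x hx => by rw [← he]; simp [hf]⟩
  hom_ext f g hfg := by
    rw [← cancel_epi e.hom]
    refine h.hom_ext _ _ fun x hx => ?_
    rw [← assoc, ← assoc, he, hfg]

lemma of_top {d : P} (hd : d ∈ D) (hD : ∀ x ∈ D, x ≤ d) (hc : IsCompat G D c)
    (hi : IsIso (c d hd)) : IsColimOn G D Z c where
  comm := hc
  exists_desc τ hτ := ⟨inv (c d hd) ≫ τ d hd, fun x hx => by
    rw [← hc x d (hD x hx) hx hd, assoc, IsIso.hom_inv_id_assoc, hτ]⟩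
  hom_ext f g h := by rw [← cancel_epi (c d hd), h]

lemma iic (G : P ⥤ C) (w : P) :
    IsColimOn G (Set.Iic w) (G.obj w) fun _ hx => G.map (homOfLE hx) :=
  of_top (le_refl w) (fun _ h => h) (fun _ _ _ _ _ => map_homOfLE_comp _ _ _) <| by
    rw [map_homOfLE_refl]; infer_instance

lemma of_adjoint (h : IsColimOn G D Z c) {H : Q ⥤ C} {D' : Set Q} (b : Q → P)
    (hb : MonotoneOn b D') (hbD : ∀ x ∈ D', b x ∈ D)
    (hadj : ∀ p ∈ D, ∃ x₀ ∈ D', p ≤ b x₀ ∧ ∀ x ∈ D', p ≤ b x → x₀ ≤ x)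
    (θ : ∀ x, x ∈ D' → (H.obj x ≅ G.obj (b x)))
    (hθ : ∀ (x y : Q) (hxy : x ≤ y) (hx : x ∈ D') (hy : y ∈ D'),
      H.map (homOfLE hxy) ≫ (θ y hy).hom = (θ x hx).hom ≫ G.map (homOfLE (hb hx hy hxy))) :
    IsColimOn H D' Z fun x hx => (θ x hx).hom ≫ c (b x) (hbD x hx) where
  comm x y hxy hx hy := by
    rw [← assoc, hθ x y hxy hx hy, assoc, h.comm]
  exists_desc τ hτ := by
    choose g hg hpg hmin using hadj
    have key : ∀ (p : P) (hp : p ∈ D) (x : Q) (hx : x ∈ D') (hpx : p ≤ b x),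
        G.map (homOfLE (hpg p hp)) ≫ (θ (g p hp) (hg p hp)).inv ≫ τ (g p hp) (hg p hp) =
          G.map (homOfLE hpx) ≫ (θ x hx).inv ≫ τ x hx := fun p hp x hx hpx => by
      have hle := hmin p hp x hx hpx
      have := hθ (g p hp) x hle (hg p hp) hx
      rw [← hτ (g p hp) x hle (hg p hp) hx, ← map_homOfLE_comp G (hpg p hp) (hb (hg p hp) hx hle)]
      simp only [assoc]
      congr 1
      rw [Iso.inv_comp_eq, ← assoc (θ (g p hp) _).hom, ← this]
      simp
    obtain ⟨f, hf⟩ := h.exists_desc (fun p hp => G.map (homOfLE (hpg p hp)) ≫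
        (θ (g p hp) (hg p hp)).inv ≫ τ (g p hp) (hg p hp)) fun p q hpq hp hq => by
      rw [← assoc, map_homOfLE_comp G hpq (hpg q hq)]
      exact (key p hp _ (hg q hq) _).symm
    refine ⟨f, fun x hx => ?_⟩
    rw [assoc, hf, key (b x) (hbD x hx) x hx le_rfl, map_homOfLE_refl]
    simp
  hom_ext f f' hff := h.hom_ext _ _ fun p hp => by
    obtain ⟨x, hx, hpx, -⟩ := hadj p hp
    rw [← h.comm p (b x) hpx hp (hbD x hx)]
    have := hff x hx
    simp only [assoc, Iso.cancel_iso_hom_left] at this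
    simp only [assoc, this]

lemma restrict (h : IsColimOn G D Z c) {D' : Set P} (hD : D' ⊆ D)
    (hadj : ∀ p ∈ D, ∃ x₀ ∈ D', p ≤ x₀ ∧ ∀ x ∈ D', p ≤ x → x₀ ≤ x) :
    IsColimOn G D' Z fun x hx => c x (hD hx) := by
  have := h.of_adjoint (H := G) (D' := D') (fun x => x) (fun _ _ _ _ h => h) hD hadj
    (fun x _ => Iso.refl _) (fun _ _ _ _ _ => by simp)
  simpa using this

lemma extend {D' : Set P} {c' : ∀ x, x ∈ D' → (G.obj x ⟶ Z)} (h : IsColimOn G D' Z c')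
    (hD : D' ⊆ D) (hadj : ∀ p ∈ D, ∃ x₀ ∈ D', p ≤ x₀ ∧ ∀ x ∈ D', p ≤ x → x₀ ≤ x) :
    ∃ c : ∀ x ∈ D, (G.obj x ⟶ Z), IsColimOn G D Z c ∧ ∀ x hx, c x (hD hx) = c' x hx := by
  choose! g hg hpg hmin using hadj
  have key : ∀ (p : P) (hp : p ∈ D) (x : P) (hx : x ∈ D') (hpx : p ≤ x),
      G.map (homOfLE (hpg p hp)) ≫ c' (g p) (hg p hp) = G.map (homOfLE hpx) ≫ c' x hx :=
    fun p hp x hx hpx => by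
      rw [← h.comm _ x (hmin p hp x hx hpx) (hg p hp) hx, ← assoc, map_homOfLE_comp]
  have hc : ∀ x (hx : x ∈ D'), G.map (homOfLE (hpg x (hD hx))) ≫ c' (g x) (hg x (hD hx)) = c' x hx :=
    fun x hx => by rw [key x (hD hx) x hx le_rfl, map_homOfLE_refl, id_comp]
  refine ⟨fun p hp => G.map (homOfLE (hpg p hp)) ≫ c' (g p) (hg p hp), ⟨?_, ?_, ?_⟩, hc⟩
  · intro p q hpq hp hq
    dsimp only
    rw [← assoc, map_homOfLE_comp, key p hp _ (hg q hq) (hpq.trans (hpg q hq))]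
  · intro T d hd
    obtain ⟨f, hf⟩ := h.exists_desc _ (hd.mono hD)
    exact ⟨f, fun x hx => by rw [assoc, hf, hd]⟩
  · intro T f f' hff
    refine h.hom_ext _ _ fun x hx => ?_
    have := hff x (hD hx)
    rwa [hc] at this

lemma insert {w : P} (hZ : IsColimOn G D Z c) (hw : w ∉ D) (hD : IsLowerSet D)
    (hlt : ∀ x, x < w → x ∈ D) {L : C} {l : ∀ x, x ∈ Set.Iio w → (G.obj x ⟶ L)}
    (hL : IsColimOn G (Set.Iio w) L l) {f : L ⟶ G.obj w}
    (hf : ∀ x hx, l x hx ≫ f = G.map (homOfLE (le_of_lt hx))) {g : L ⟶ Z}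
    (hg : ∀ x hx, l x hx ≫ g = c x (hlt x hx)) {Z' : C} {i : G.obj w ⟶ Z'} {j : Z ⟶ Z'}
    (hp : IsPushout f g i j) :
    ∃ c' : ∀ x, x ∈ Insert.insert w D → (G.obj x ⟶ Z'), IsColimOn G (Insert.insert w D) Z' c' ∧
      (∀ x hx, c' x (Set.mem_insert_of_mem w hx) = c x hx ≫ j) ∧ c' w (Set.mem_insert w D) = i := by
  classical
  have hmem : ∀ x, x ∈ Insert.insert w D → x ≠ w → x ∈ D := fun x hx h =>
    (Set.mem_insert_iff.1 hx).resolve_left h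
  let c' : ∀ x, x ∈ Insert.insert w D → (G.obj x ⟶ Z') := fun x hx =>
    if h : x = w then eqToHom (by rw [h]) ≫ i else c x (hmem x hx h) ≫ j
  have h₁ : ∀ x hx, c' x (Set.mem_insert_of_mem w hx) = c x hx ≫ j := fun x hx =>
    dif_neg (fun h => hw (by rwa [← h]))
  have h₂ : c' w (Set.mem_insert w D) = i := (dif_pos rfl).trans (id_comp _)
  refine ⟨c', ⟨?_, ?_, ?_⟩, h₁, h₂⟩
  · intro x y hxy hx hy
    obtain rfl | hy := Set.mem_insert_iff.1 hy
    · obtain rfl | hx' := eq_or_lt_of_le hxy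
      · rw [map_homOfLE_refl, id_comp]
      · rw [h₂, h₁ x (hlt x hx'), ← hf x hx', ← hg x hx', assoc, assoc, hp.w]
    · have hx := hD hxy hy
      rw [h₁ y hy, h₁ x hx, ← assoc, hZ.comm]
  · intro T d hd
    obtain ⟨a, ha⟩ := hZ.exists_desc _ (hd.mono (Set.subset_insert w D))
    refine ⟨hp.desc (d w (Set.mem_insert w D)) a ?_, fun x hx => ?_⟩
    · refine hL.hom_ext _ _ fun x hx => ?_
      rw [← assoc, hf, ← assoc, hg, ha]
      exact hd _ _ _ _ _
    · obtain rfl | hx := Set.mem_insert_iff.1 hx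
      · rw [h₂, hp.inl_desc]
      · rw [h₁ x hx, assoc, hp.inr_desc, ha]
  · intro T a b hab
    refine hp.hom_ext ?_ (hZ.hom_ext _ _ fun x hx => ?_)
    · rw [← h₂]
      exact hab w (Set.mem_insert w D)
    · have := hab x (Set.mem_insert_of_mem w hx)
      rwa [h₁ x hx, assoc, assoc] at this

lemma congr_set {D' : Set P} (hZ : IsColimOn G D Z c) (h : D = D') :
    IsColimOn G D' Z fun x hx => c x (by rwa [h]) := by
  subst h
  exact hZ

lemma of_isZero (hZ : IsZero Z) (h : ∀ x ∈ D, IsZero (G.obj x)) : IsColimOn G D Z c where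
  comm x _ _ hx _ := (h x hx).eq_of_src _ _
  exists_desc _ _ := ⟨hZ.to_ _, fun x hx => (h x hx).eq_of_src _ _⟩
  hom_ext _ _ _ := hZ.eq_of_src _ _

lemma of_upper {N : Set P} (hN : IsUpperSet N) (hz : ∀ x ∈ D, x ∉ N → IsZero (G.obj x))
    (hZ : IsColimOn G (N ∩ D) Z fun x hx => c x hx.2) : IsColimOn G D Z c where
  comm x y hxy hx hy := by
    by_cases hxN : x ∈ N
    · exact hZ.comm x y hxy ⟨hxN, hx⟩ ⟨hN hxy hxN, hy⟩
    · exact (hz x hx hxN).eq_of_src _ _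
  exists_desc d hd := by
    obtain ⟨f, hf⟩ := hZ.exists_desc _ (hd.mono Set.inter_subset_right)
    refine ⟨f, fun x hx => ?_⟩
    by_cases hxN : x ∈ N
    · exact hf x ⟨hxN, hx⟩
    · exact (hz x hx hxN).eq_of_src _ _
  hom_ext f g hfg := hZ.hom_ext _ _ fun x hx => hfg x hx.2

end IsColimOn

/-! ### Reedy cofibrant functors -/

/-- `G` is Reedy cofibrant: its latching objects exist and its latching maps are cofibrations. -/
def Reedy (W : WaldCat.{u}) (G : P ⥤ W.C) : Prop :=
  ∀ w : P, ∃ (L : W.C) (l : ∀ x, x ∈ Set.Iio w → (G.obj x ⟶ L)) (f : L ⟶ G.obj w),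
    IsColimOn G (Set.Iio w) L l ∧ (∀ x hx, l x hx ≫ f = G.map (homOfLE (le_of_lt hx))) ∧ W.cof f

/-- A functor preserving the zero object and pushouts along cofibrations. -/
structure IsExactFunctor (W W' : WaldCat.{u}) (H : W.C ⥤ W'.C) : Prop where
  map_pt : IsZero (H.obj W.pt)
  map_pushout {X Y Z T : W.C} {f : X ⟶ Y} {g : X ⟶ Z} {h : Y ⟶ T} {k : Z ⟶ T} :
    W.cof f → IsPushout f g h k → IsPushout (H.map f) (H.map g) (H.map h) (H.map k)

namespace Reedy

variable {W : WaldCat.{u}} {G : P ⥤ W.C}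

lemma exists_insert (hG : Reedy W G) {D : Set P} (hD : IsLowerSet D) {w : P} (hw : w ∉ D)
    (hlt : ∀ x, x < w → x ∈ D) {Z : W.C} {c : ∀ x ∈ D, (G.obj x ⟶ Z)}
    (hZ : IsColimOn G D Z c) :
    ∃ (L : W.C) (l : ∀ x, x ∈ Set.Iio w → (G.obj x ⟶ L)) (f : L ⟶ G.obj w) (g : L ⟶ Z) (Z' : W.C)
      (i : G.obj w ⟶ Z') (j : Z ⟶ Z') (c' : ∀ x, x ∈ Insert.insert w D → (G.obj x ⟶ Z')),
      IsColimOn G (Set.Iio w) L l ∧ (∀ x hx, l x hx ≫ f = G.map (homOfLE (le_of_lt hx))) ∧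
      (∀ x hx, l x hx ≫ g = c x (hlt x hx)) ∧ W.cof f ∧ W.cof j ∧ IsPushout f g i j ∧
      IsColimOn G (Insert.insert w D) Z' c' ∧
      (∀ x hx, c' x (Set.mem_insert_of_mem w hx) = c x hx ≫ j) ∧
      c' w (Set.mem_insert w D) = i := by
  obtain ⟨L, l, f, hL, hf, hcof⟩ := hG w
  obtain ⟨g, hg⟩ := hL.exists_desc (fun x hx => c x (hlt x hx)) (hZ.comm.mono hlt)
  have := W.hasPushout f g hcof
  have hp := IsPushout.of_hasPushout f g
  obtain ⟨c', h₁, h₂, h₃⟩ := hZ.insert hw hD hlt hL hf hg hp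
  exact ⟨L, l, f, g, _, _, _, c', hL, hf, hg, hcof, W.cof_pushout hp hcof, hp, h₁, h₂,
    h₃⟩

lemma lower_induction [Finite P] {D : Set P} (hD : IsLowerSet D) (Φ : Set P → Prop) (h₀ : Φ D)
    (hs : ∀ (E : Set P) (w : P), D ⊆ E → IsLowerSet E → w ∉ E → (∀ x, x < w → x ∈ E) → Φ E →
      Φ (Insert.insert w E)) {E : Set P} (hE : IsLowerSet E) (hDE : D ⊆ E) : Φ E := by
  induction h : (E \ D).ncard using Nat.strong_induction_on generalizing E with
  | _ n ih =>
    by_cases hne : (E \ D).Nonempty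
    · obtain ⟨w, hw⟩ := (Set.toFinite (E \ D)).exists_maximal hne
      have hmax : ∀ x ∈ E \ D, w ≤ x → x = w := fun x hx hwx => (hw.2 hx hwx).antisymm hwx
      have hE' : IsLowerSet (E \ {w}) := by
        rintro x y hyx ⟨hx, hxw⟩
        refine ⟨hE hyx hx, fun hyw => ?_⟩
        obtain rfl : y = w := hyw
        by_cases hxD : x ∈ D
        · exact hw.1.2 (hD hyx hxD)
        · exact hxw (hmax x ⟨hx, hxD⟩ hyx)
      have hDE' : D ⊆ E \ {w} := fun x hx => ⟨hDE hx, fun h => hw.1.2 (by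
        obtain rfl : x = w := h
        exact hx)⟩
      have hlt : ((E \ {w}) \ D).ncard < n := by
        rw [← h]
        refine Set.ncard_lt_ncard ⟨fun x hx => ⟨hx.1.1, hx.2⟩, fun hh => ?_⟩ (Set.toFinite _)
        exact (hh hw.1).1.2 rfl
      have := hs (E \ {w}) w hDE' hE' (fun h => h.2 rfl)
        (fun x hx => ⟨hE hx.le hw.1.1, fun h => hx.ne h⟩) (ih _ hlt hE' hDE' rfl)
      rwa [Set.insert_sdiff_singleton, Set.insert_eq_of_mem hw.1.1] at this
    · rw [Set.not_nonempty_iff_eq_empty, Set.sdiff_eq_empty] at hne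
      rwa [hne.antisymm hDE]

lemma exists_colim_of_subset [Finite P] (hG : Reedy W G) {D E : Set P} (hD : IsLowerSet D)
    (hE : IsLowerSet E) (hDE : D ⊆ E) {Z : W.C} {c : ∀ x ∈ D, (G.obj x ⟶ Z)}
    (hZ : IsColimOn G D Z c) :
    ∃ (Z' : W.C) (c' : ∀ x ∈ E, (G.obj x ⟶ Z')) (j : Z ⟶ Z'), IsColimOn G E Z' c' ∧
      (∀ x hx, c x hx ≫ j = c' x (hDE hx)) ∧ W.cof j := by
  suffices h : ∀ hDE : D ⊆ E, ∃ (Z' : W.C) (c' : ∀ x ∈ E, (G.obj x ⟶ Z')) (j : Z ⟶ Z'),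
      IsColimOn G E Z' c' ∧ (∀ x hx, c x hx ≫ j = c' x (hDE hx)) ∧ W.cof j from h hDE
  refine lower_induction hD (fun E => ∀ hDE : D ⊆ E, ∃ (Z' : W.C)
    (c' : ∀ x ∈ E, (G.obj x ⟶ Z')) (j : Z ⟶ Z'),
      IsColimOn G E Z' c' ∧ (∀ x hx, c x hx ≫ j = c' x (hDE hx)) ∧ W.cof j)
    (fun _ => ⟨Z, c, 𝟙 Z, hZ, fun x hx => comp_id _, W.cof_of_isIso _ inferInstance⟩)
    (fun E w hDE hE hw hlt ih _ => ?_) hE hDE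
  obtain ⟨Z₁, c₁, j₁, h₁, h₁', h₁''⟩ := ih hDE
  obtain ⟨L, l, f, g, Z', i, j, c', -, -, -, -, hj, -, hZ', hc', -⟩ := hG.exists_insert hE hw hlt h₁
  exact ⟨Z', c', j₁ ≫ j, hZ', fun x hx => by rw [← assoc, h₁', hc'],
    W.cof_comp _ _ h₁'' hj⟩

lemma exists_colim [Finite P] (hG : Reedy W G) {D : Set P} (hD : IsLowerSet D) :
    ∃ (Z : W.C) (c : ∀ x ∈ D, (G.obj x ⟶ Z)), IsColimOn G D Z c := by
  obtain ⟨Z, c, -, h, -⟩ := hG.exists_colim_of_subset (D := ∅) (fun _ _ _ h => h) hD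
    (Set.empty_subset _) (Z := W.pt) (c := fun _ h => h.elim)
    (IsColimOn.of_isZero W.isZero fun x hx => hx.elim)
  exact ⟨Z, c, h⟩

lemma cof_of_subset [Finite P] (hG : Reedy W G) {D E : Set P} (hD : IsLowerSet D)
    (hE : IsLowerSet E) (hDE : D ⊆ E) {Z : W.C} {c : ∀ x ∈ D, (G.obj x ⟶ Z)}
    (hZ : IsColimOn G D Z c) {Z' : W.C} {c' : ∀ x ∈ E, (G.obj x ⟶ Z')}
    (hZ' : IsColimOn G E Z' c') {j : Z ⟶ Z'} (hj : ∀ x hx, c x hx ≫ j = c' x (hDE hx)) :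
    W.cof j := by
  obtain ⟨Z₁, c₁, j₁, h₁, h₂, h₃⟩ := hG.exists_colim_of_subset hD hE hDE hZ
  obtain ⟨e, he⟩ := h₁.exists_iso hZ'
  obtain rfl : j = j₁ ≫ e.hom := hZ.hom_ext _ _ fun x hx => by
    rw [hj, ← assoc, h₂, he]
  exact W.cof_comp _ _ h₃ (W.cof_of_isIso _ inferInstance)

lemma map_cof [Finite P] (hG : Reedy W G) {x y : P} (h : x ≤ y) : W.cof (G.map (homOfLE h)) :=
  hG.cof_of_subset (isLowerSet_Iic x) (isLowerSet_Iic y) (Set.Iic_subset_Iic.2 h)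
    (IsColimOn.iic G x) (IsColimOn.iic G y) fun _ _ => map_homOfLE_comp _ _ _

lemma preserves [Finite P] (hG : Reedy W G) {W' : WaldCat.{u}} {H : W.C ⥤ W'.C}
    (hH : IsExactFunctor W W' H) {D : Set P} (hD : IsLowerSet D) {Z : W.C}
    {c : ∀ x ∈ D, (G.obj x ⟶ Z)} (hZ : IsColimOn G D Z c) :
    IsColimOn (G ⋙ H) D (H.obj Z) fun x hx => H.map (c x hx) := by
  induction h : D.ncard using Nat.strong_induction_on generalizing D Z with
  | _ n ih =>
    by_cases hne : D.Nonempty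
    · obtain ⟨w, hw⟩ := (Set.toFinite D).exists_maximal hne
      have hmax : ∀ x ∈ D, w ≤ x → x = w := fun x hx hwx => (hw.2 hx hwx).antisymm hwx
      have hD' : IsLowerSet (D \ {w}) := by
        rintro x y hyx ⟨hx, hxw⟩
        refine ⟨hD hyx hx, fun hyw => ?_⟩
        obtain rfl : y = w := hyw
        exact hxw (hmax x hx hyx)
      have hcard : ∀ E : Set P, E ⊆ D → w ∉ E → E.ncard < n := fun E hE hwE => by
        rw [← h]
        exact Set.ncard_lt_ncard ⟨hE, fun hh => hwE (hh hw.1)⟩ (Set.toFinite _)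
      obtain ⟨Z₁, c₁, h₁⟩ := hG.exists_colim hD'
      have hwD : w ∉ D \ {w} := fun h => h.2 rfl
      have hlt : ∀ x, x < w → x ∈ D \ {w} := fun x hx => ⟨hD hx.le hw.1, fun h => hx.ne h⟩
      obtain ⟨L, l, f, g, Z', i, j, c', hL, hf, hg, hcf, hcj, hp, hZ', hc', hi⟩ :=
        hG.exists_insert hD' hwD hlt h₁
      have e : Insert.insert w (D \ {w}) = D := by
        rw [Set.insert_sdiff_singleton, Set.insert_eq_of_mem hw.1]
      have hL' := ih _ (hcard _ (fun x hx => (hlt x hx).1) (lt_irrefl w)) (isLowerSet_Iio w) hL rfl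
      have h₁' := ih _ (hcard _ Set.sdiff_subset hwD) hD' h₁ rfl
      obtain ⟨c'', hc'', hc₁, hc₂⟩ := h₁'.insert hwD hD' hlt hL' (f := H.map f) (g := H.map g)
        (fun x hx => by rw [← H.map_comp, hf]; rfl) (fun x hx => by rw [← H.map_comp, hg])
        (hH.map_pushout hcf hp)
      have hc : c'' = fun x hx => H.map (c' x hx) := by
        funext x hx
        obtain rfl | hx := Set.mem_insert_iff.1 hx
        · rw [hc₂, hi]
        · rw [hc₁ x hx, hc' x hx, H.map_comp]
      subst hc
      obtain ⟨φ, hφ⟩ := (hZ'.congr_set e).exists_iso hZ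
      exact (hc''.congr_set e).of_iso (H.mapIso φ) fun x hx => by
        rw [Functor.mapIso_hom, ← H.map_comp, hφ]
    · rw [Set.not_nonempty_iff_eq_empty] at hne
      subst hne
      obtain ⟨φ, -⟩ := hZ.exists_iso (IsColimOn.of_isZero (Z := W.pt) (c := fun _ h => h.elim)
        W.isZero fun x hx => hx.elim)
      exact IsColimOn.of_isZero (hH.map_pt.of_iso (H.mapIso φ)) fun x hx => hx.elim

lemma of_partial_adjoint [Finite P] (hG : Reedy W G) {N : Set Q} (hN : IsUpperSet N)
    {H : Q ⥤ W.C} (hz : ∀ x, x ∉ N → IsZero (H.obj x)) (b : Q → P) (hb : MonotoneOn b N)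
    (θ : ∀ x ∈ N, (H.obj x ≅ G.obj (b x)))
    (hθ : ∀ (x y : Q) (hxy : x ≤ y) (hx : x ∈ N) (hy : y ∈ N),
      H.map (homOfLE hxy) ≫ (θ y hy).hom = (θ x hx).hom ≫ G.map (homOfLE (hb hx hy hxy)))
    (hadj : ∀ p, (∃ x ∈ N, p ≤ b x) → ∃ x₀ ∈ N, p ≤ b x₀ ∧ ∀ x ∈ N, p ≤ b x → x₀ ≤ x) :
    Reedy W H := by
  classical
  intro w
  by_cases hw : w ∈ N
  · let D : Set P := {p | ∃ x, x ∈ N ∧ x < w ∧ p ≤ b x}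
    have hD : IsLowerSet D := fun p q hqp ⟨x, hx, hxw, hpx⟩ => ⟨x, hx, hxw, hqp.trans hpx⟩
    have hDw : D ⊆ Set.Iic (b w) := fun p ⟨x, hx, hxw, hpx⟩ => hpx.trans (hb hx hw hxw.le)
    obtain ⟨Z, c, hZ⟩ := hG.exists_colim hD
    obtain ⟨j, hj⟩ := hZ.exists_desc _ ((IsColimOn.iic G (b w)).comm.mono hDw)
    have hcof := hG.cof_of_subset hD (isLowerSet_Iic (b w)) hDw hZ (IsColimOn.iic G (b w)) hj
    have hZ' := hZ.of_adjoint (H := H) (D' := N ∩ Set.Iio w) b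
      (hb.mono Set.inter_subset_left) (fun x hx => ⟨x, hx.1, hx.2, le_rfl⟩)
      (fun p ⟨x, hx, hxw, hpx⟩ => by
        obtain ⟨x₀, h₀, h₁, h₂⟩ := hadj p ⟨x, hx, hpx⟩
        exact ⟨x₀, ⟨h₀, (h₂ x hx hpx).trans_lt hxw⟩, h₁, fun y hy hpy => h₂ y hy.1 hpy⟩)
      (fun x hx => θ x hx.1) (fun x y hxy hx hy => hθ x y hxy hx.1 hy.1)
    let l : ∀ x, x ∈ Set.Iio w → (H.obj x ⟶ Z) := fun x hx =>
      if h : x ∈ N then (θ x h).hom ≫ c (b x) ⟨x, h, hx, le_rfl⟩ else (hz x h).to_ Z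
    refine ⟨Z, l, j ≫ (θ w hw).inv, IsColimOn.of_upper hN (fun x _ hx => hz x hx) ?_,
      fun x hx => ?_, W.cof_comp _ _ hcof (W.cof_of_isIso _ inferInstance)⟩
    · have : (fun x (hx : x ∈ N ∩ Set.Iio w) => l x hx.2) =
          fun x hx => (θ x hx.1).hom ≫ c (b x) ⟨x, hx.1, hx.2, le_rfl⟩ := by
        funext x hx
        exact dif_pos hx.1
      rw [this]
      exact hZ'
    · by_cases h : x ∈ N
      · have e : l x hx = (θ x h).hom ≫ c (b x) ⟨x, h, hx, le_rfl⟩ := dif_pos h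
        rw [e, assoc, ← assoc (c _ _), hj, ← assoc,
          ← hθ x w (le_of_lt hx) h hw, assoc, Iso.hom_inv_id, comp_id]
      · exact (hz x h).eq_of_src _ _
  · have h : ∀ x ∈ Set.Iio w, IsZero (H.obj x) := fun x hx => hz x fun h => hw (hN (le_of_lt hx) h)
    exact ⟨W.pt, fun x hx => (h x hx).to_ _, W.isZero.to_ _, IsColimOn.of_isZero W.isZero h,
      fun x hx => (h x hx).eq_of_src _ _, W.cof_of_pt _⟩

lemma of_orderIso [Finite P] (hG : Reedy W G) (e : Q ≃o P) {H : Q ⥤ W.C}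
    (θ : H ≅ e.monotone.functor ⋙ G) : Reedy W H :=
  hG.of_partial_adjoint (N := Set.univ) isUpperSet_univ (fun x hx => (hx trivial).elim) e
    (e.monotone.monotoneOn _) (fun x _ => θ.app x)
    (fun x y hxy _ _ => θ.hom.naturality (homOfLE hxy))
    fun p _ => ⟨e.symm p, trivial, by simp, fun x _ hx => by
      rwa [← e.le_iff_le, e.apply_symm_apply]⟩

lemma quotient [Finite P] (hG : Reedy W G) {E : Set P} (hE : IsLowerSet E) (s : P → P)
    (hsE : ∀ x, s x ∈ E) (hs : ∀ x, s x ≤ x) (hs' : ∀ x, ∀ y ∈ E, y ≤ x → y ≤ s x) {G' : P ⥤ W.C}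
    (τ : G ⟶ G') (hp : ∀ x, IsPushout (G.map (homOfLE (hs x))) (W.isZero.from_ _) (τ.app x)
      (W.isZero.to_ _)) : Reedy W G' := by
  have hz : ∀ x ∈ E, IsZero (G'.obj x) := fun x hx => by
    have e : s x = x := (hs x).antisymm (hs' x x hx le_rfl)
    have : IsIso (G.map (homOfLE (hs x))) := by
      have : IsIso (homOfLE (hs x)) := ⟨homOfLE e.ge, rfl, rfl⟩
      infer_instance
    have := (hp x).isIso_inr_of_isIso
    exact W.isZero.of_iso (asIso (W.isZero.to_ (G'.obj x))).symm
  intro w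
  by_cases hw : w ∈ E
  · have h : ∀ x ∈ Set.Iio w, IsZero (G'.obj x) := fun x hx => hz x (hE (le_of_lt hx) hw)
    exact ⟨W.pt, fun x hx => (h x hx).to_ _, W.isZero.to_ _, IsColimOn.of_isZero W.isZero h,
      fun x hx => (h x hx).eq_of_src _ _, W.cof_of_pt _⟩
  · have hsw : s w < w := lt_of_le_of_ne (hs w) fun h => hw (h ▸ hsE w)
    obtain ⟨L, l, f, hL, hf, hcof⟩ := hG w
    have hl : W.cof (l (s w) hsw) := hG.cof_of_subset (isLowerSet_Iic (s w)) (isLowerSet_Iio w)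
      (fun x hx => lt_of_le_of_lt hx (Set.mem_Iio.1 hsw)) (IsColimOn.iic G (s w)) hL
      fun x hx => hL.comm _ _ _ _ _
    have := W.hasPushout (l (s w) hsw) (W.isZero.from_ _) hl
    obtain ⟨L', a, b, hL'⟩ : ∃ (L' : W.C) (a : L ⟶ L') (b : W.pt ⟶ L'),
      IsPushout (l (s w) hsw) (W.isZero.from_ _) a b := ⟨_, _, _, IsPushout.of_hasPushout _ _⟩
    have h₁ : ∀ x (hx : x ∈ Set.Iio w), G.map (homOfLE (hs x)) ≫ l x hx ≫ a =
        W.isZero.from_ _ ≫ b := fun x hx => by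
      rw [← assoc, hL.comm _ _ _ (show s x ∈ Set.Iio w from lt_of_le_of_lt (hs x) hx) hx,
        ← hL.comm (s x) (s w) (hs' w _ (hsE x) ((hs x).trans (le_of_lt hx))) _ hsw, assoc,
        hL'.w, ← assoc]
      congr 1
      exact W.isZero.eq_of_tgt _ _
    let l' : ∀ x, x ∈ Set.Iio w → (G'.obj x ⟶ L') := fun x hx => (hp x).desc (l x hx ≫ a) b (h₁ x hx)
    have hl' : ∀ x hx, τ.app x ≫ l' x hx = l x hx ≫ a := fun x hx => (hp x).inl_desc _ _ _
    have hlf : l (s w) hsw ≫ f = G.map (homOfLE (hs w)) := hf _ _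
    let f' : L' ⟶ G'.obj w := hL'.desc (f ≫ τ.app w) (W.isZero.to_ _) (by
      rw [← assoc, hlf, (hp w).w])
    have hf' : a ≫ f' = f ≫ τ.app w := hL'.inl_desc _ _ _
    have hbig : IsPushout (l (s w) hsw ≫ f) (W.isZero.from_ _) (τ.app w) (b ≫ f') := by
      have := hp w
      rw [← hlf] at this
      convert this using 1
      exact W.isZero.eq_of_src _ _
    have hpf : IsPushout f a (τ.app w) f' := IsPushout.of_left hbig hf'.symm hL'
    have hext : ∀ {T : W.C} {x : P} (p q : G'.obj x ⟶ T), τ.app x ≫ p = τ.app x ≫ q → p = q :=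
      fun p q h => (hp _).hom_ext h (W.isZero.eq_of_src _ _)
    refine ⟨L', l', f', ⟨?_, ?_, ?_⟩, ?_, W.cof_pushout hpf hcof⟩
    · intro x y hxy hx hy
      refine hext _ _ ?_
      rw [hl', ← assoc, ← τ.naturality, assoc, hl', ← assoc, hL.comm]
    · intro T d hd
      obtain ⟨g, hg⟩ := hL.exists_desc (fun x hx => τ.app x ≫ d x hx) fun x y hxy hx hy => by
        rw [← assoc, τ.naturality, assoc, hd]
      refine ⟨hL'.desc g (W.isZero.to_ _) ?_, fun x hx => hext _ _ ?_⟩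
      · refine (hg (s w) hsw).trans ?_
        rw [(hz _ (hsE w)).eq_of_src (d (s w) hsw) (W.isZero.from_ _ ≫ W.isZero.to_ T), ← assoc]
        congr 1
        exact W.isZero.eq_of_tgt _ _
      · rw [← assoc, hl', assoc, hL'.inl_desc, hg]
    · intro T g g' h
      refine hL'.hom_ext (hL.hom_ext _ _ fun x hx => ?_) (W.isZero.eq_of_src _ _)
      rw [← assoc, ← assoc, ← hl', assoc, h, assoc]
    · intro x hx
      refine hext _ _ ?_
      rw [← assoc, hl', assoc, hf', ← assoc, hf, τ.naturality]

end Reedy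

/-- The cocone of a colimit over a set. -/
def IsColimOn.cocone {G : P ⥤ C} {D : Set P} {Z : C} {c : ∀ x ∈ D, (G.obj x ⟶ Z)}
    (h : IsColimOn G D Z c) :
    Cocone (monoFunctor (fun x : D => x.1) (fun _ _ h => h) ⋙ G) where
  pt := Z
  ι :=
    { app := fun x => c x.1 x.2
      naturality := fun x y f => (h.comm x.1 y.1 (leOfHom f) x.2 y.2).trans
        (comp_id _).symm }

lemma IsColimOn.nonempty_isColimit {G : P ⥤ C} {D : Set P} {Z : C}
    {c : ∀ x ∈ D, (G.obj x ⟶ Z)} (h : IsColimOn G D Z c) : Nonempty (IsColimit h.cocone) := by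
  have : ∀ s : Cocone (monoFunctor (fun x : D => x.1) (fun _ _ h => h) ⋙ G),
      ∃ f : Z ⟶ s.pt, ∀ x hx, c x hx ≫ f = s.ι.app ⟨x, hx⟩ := fun s =>
    h.exists_desc (fun x hx => s.ι.app ⟨x, hx⟩) fun x y hxy hx hy =>
      s.w (homOfLE (show (⟨x, hx⟩ : D) ≤ ⟨y, hy⟩ from hxy))
  choose f hf using this
  exact ⟨⟨f, fun s j => hf s j.1 j.2, fun s m hm => h.hom_ext _ _ fun x hx =>
    (hm ⟨x, hx⟩).trans (hf s x hx).symm⟩⟩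

lemma isColimOn_of_isColimit {G : P ⥤ C} {D : Set P}
    {c : Cocone (monoFunctor (fun x : D => x.1) (fun _ _ h => h) ⋙ G)} (hc : IsColimit c) :
    IsColimOn G D c.pt fun x hx => c.ι.app ⟨x, hx⟩ where
  comm x y hxy hx hy := c.w (homOfLE (show (⟨x, hx⟩ : D) ≤ ⟨y, hy⟩ from hxy))
  exists_desc {T} d hd := ⟨hc.desc ⟨T, ⟨fun x => d x.1 x.2, fun x y f =>
    (hd x.1 y.1 (leOfHom f) x.2 y.2).trans (comp_id _).symm⟩⟩,
    fun x hx => hc.fac _ _⟩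
  hom_ext f g h := hc.hom_ext fun x => h x.1 x.2

end Poset

instance {I : Type} [Finite I] (m : I → ℕ) : Finite (Cube m) :=
  inferInstanceAs (Finite (∀ i, Fin (m i + 1)))

/-- The supremum of two elements of a cube. -/
def Cube.sup {I : Type} {m : I → ℕ} (p v : Cube m) : Cube m := fun i => max (p i) (v i)

namespace Cube

variable {I : Type} {m : I → ℕ} {p v w : Cube m}

lemma le_sup_left : p ≤ p.sup v := fun _ => le_max_left _ _

lemma le_sup_right : v ≤ p.sup v := fun _ => le_max_right _ _

lemma sup_le (hp : p ≤ w) (hv : v ≤ w) : p.sup v ≤ w := fun i => max_le (hp i) (hv i)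

lemma lt_iff : v < w ↔ v ≤ w ∧ ∃ i, v i < w i :=
  Pi.lt_def (x := (v : ∀ i, Fin (m i + 1))) (y := w)

lemma sup_lt (hp : p ≤ w) (hv : v ≤ w) {i : I} (hi : p i < w i) (hi' : v i < w i) :
    p.sup v < w :=
  lt_iff.2 ⟨sup_le hp hv, i, max_lt hi hi'⟩

end Cube

lemma cubicallyCofibrant_iff {W : WaldCat.{u}} {I : Type} [Finite I] {m : I → ℕ}
    {G : Cube m ⥤ W.C} : CubicallyCofibrant W G ↔ Reedy W G := by
  refine ⟨fun h w => ?_, fun h => ⟨fun f => ?_, fun v w hvw hw => ?_⟩⟩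
  · let v : Cube m := fun i => ⟨(w i).val - 1, by omega⟩
    have hvw : v ≤ w := fun i => Fin.le_def.2 (Nat.sub_le _ _)
    have hsup : ∀ p ∈ Set.Iio w, p.sup v < w := fun p hp => by
      obtain ⟨hp, i, hi⟩ := Cube.lt_iff.1 hp
      refine Cube.sup_lt hp hvw hi ?_
      simp only [Fin.lt_def, v] at hi ⊢
      omega
    obtain ⟨c, hc, hcof⟩ := h.2 v w hvw (fun i => by simp only [v]; omega)
    obtain ⟨l, hl, hl'⟩ := (isColimOn_of_isColimit hc).extend (D := Set.Iio w) (fun x hx => hx.2)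
      fun p hp => ⟨p.sup v, ⟨Cube.le_sup_right, hsup p hp⟩, Cube.le_sup_left,
        fun x hx hpx => Cube.sup_le hpx hx.1⟩
    refine ⟨c.pt, l, _, hl, fun x hx => ?_, hcof⟩
    have hy : x.sup v ∈ Set.Ico v w := ⟨Cube.le_sup_right, hsup x hx⟩
    rw [← hl.comm x (x.sup v) Cube.le_sup_left hx hy.2, hl' _ hy]
    refine (assoc _ _ _).trans ((congrArg (G.map (homOfLE Cube.le_sup_left) ≫ ·)
      (hc.fac (latchingCocone G v w) ⟨x.sup v, hy⟩)).trans ?_)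
    exact map_homOfLE_comp G Cube.le_sup_left hy.2.le
  · exact h.map_cof (leOfHom f)
  · let D : Set (Cube m) := {x | x ≤ w ∧ ∃ i, v i < w i ∧ x i < w i}
    have hD : IsLowerSet D := fun x y hyx ⟨hx, i, hi, hi'⟩ =>
      ⟨hyx.trans hx, i, hi, (hyx i).trans_lt hi'⟩
    have hDw : D ⊆ Set.Iic w := fun x hx => hx.1
    have hsub : Set.Ico v w ⊆ D := fun x hx => by
      obtain ⟨h₁, i, hi⟩ := Cube.lt_iff.1 hx.2
      exact ⟨h₁, i, (hx.1 i).trans_lt hi, hi⟩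
    have hsup : ∀ p ∈ D, p.sup v ∈ Set.Ico v w := fun p ⟨hp, i, hi, hi'⟩ =>
      ⟨Cube.le_sup_right, Cube.sup_lt hp hvw hi' hi⟩
    obtain ⟨Z, c, hZ⟩ := h.exists_colim hD
    have hZ' := hZ.restrict hsub fun p hp => ⟨p.sup v, hsup p hp, Cube.le_sup_left,
      fun x hx hpx => Cube.sup_le hpx hx.1⟩
    obtain ⟨hc⟩ := hZ'.nonempty_isColimit
    refine ⟨_, hc, h.cof_of_subset hD (isLowerSet_Iic w) hDw hZ (IsColimOn.iic G w)
      fun x hx => ?_⟩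
    rw [← hZ.comm x (x.sup v) Cube.le_sup_left hx (hsub (hsup x hx))]
    refine (assoc _ _ _).trans ((congrArg (G.map (homOfLE Cube.le_sup_left) ≫ ·)
      (hc.fac (latchingCocone G v w) ⟨x.sup v, hsup x hx⟩)).trans ?_)
    exact map_homOfLE_comp G Cube.le_sup_left (hsup x hx).2.le

/-! ### Replacing one coordinate in a product -/

section Upd

variable {I : Type} {A : I → Type u} [∀ i, Category.{v} (A i)]

open Classical in
/-- The functor replacing the coordinate `i` of `z`. -/
def upd (z : ∀ i, A i) (i : I) : A i ⥤ ∀ j, A j :=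
  Functor.pi' fun j => if h : i = j then eqFunctor A h else (Functor.const _).obj (z j)

lemma upd_eval_self (z : ∀ i, A i) (i : I) : upd z i ⋙ Pi.eval A i = 𝟭 _ := dif_pos rfl

lemma upd_eval_ne (z : ∀ i, A i) {i j : I} (h : i ≠ j) :
    upd z i ⋙ Pi.eval A j = (Functor.const _).obj (z j) := dif_neg h

lemma upd_obj_self (z : ∀ i, A i) (i : I) (a : A i) : (upd z i).obj a i = a :=
  Functor.congr_obj (upd_eval_self z i) a

lemma upd_obj_ne (z : ∀ i, A i) {i j : I} (h : i ≠ j) (a : A i) : (upd z i).obj a j = z j :=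
  Functor.congr_obj (upd_eval_ne z h) a

lemma upd_map_self (z : ∀ i, A i) (i : I) {a b : A i} (f : a ⟶ b) :
    HEq ((upd z i).map f i) f :=
  functor_map_heq (upd_eval_self z i) f

lemma upd_map_ne (z : ∀ i, A i) {i j : I} (h : i ≠ j) {a b : A i} (f : a ⟶ b) :
    IsId ((upd z i).map f j) :=
  isId_of_heq_id (upd_obj_ne z h a) (upd_obj_ne z h b) (functor_map_heq (upd_eval_ne z h) f)

lemma upd_obj_eq_of (z z' : ∀ i, A i) (i : I) (h : ∀ j, i ≠ j → z j = z' j) :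
    (upd z i).obj (z' i) = z' := by
  funext j
  by_cases hj : i = j
  · subst hj; exact upd_obj_self _ _ _
  · rw [upd_obj_ne z hj, h j hj]

lemma upd_obj_eq (z : ∀ i, A i) (i : I) : (upd z i).obj (z i) = z :=
  upd_obj_eq_of z z i fun _ _ => rfl

lemma upd_map_isAlong {A : I → Type u} [∀ i, SmallCategory (A i)] (z : ∀ i, A i) (i : I)
    {a b : A i} (f : a ⟶ b) : IsAlong i ((upd z i).map f) :=
  fun _ hj => upd_map_ne z hj.symm f

end Upd

lemma isPushout_heq {C : Type*} [Category C] {X Y Z T X' Y' Z' T' : C} {f : X ⟶ Y} {g : X ⟶ Z}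
    {h : Y ⟶ T} {k : Z ⟶ T} {f' : X' ⟶ Y'} {g' : X' ⟶ Z'} {h' : Y' ⟶ T'} {k' : Z' ⟶ T'}
    (hX : X = X') (hY : Y = Y') (hZ : Z = Z') (hT : T = T') (hf : HEq f f') (hg : HEq g g')
    (hh : HEq h h') (hk : HEq k k') (hp : IsPushout f g h k) : IsPushout f' g' h' k' := by
  subst hX hY hZ hT
  rwa [← eq_of_heq hf, ← eq_of_heq hg, ← eq_of_heq hh, ← eq_of_heq hk]

lemma property_heq {C : Type*} [Category C] (P : MorphismProperty C) {X Y X' Y' : C} {f : X ⟶ Y}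
    {f' : X' ⟶ Y'} (hX : X = X') (hY : Y = Y') (hf : HEq f f') (h : P f) : P f' := by
  subst hX hY
  rwa [← eq_of_heq hf]

section Multiexact

variable {I : Type} {A : I → WaldVee.{u}} {B : WaldVee.{u}} {F : (∀ i, (A i).C) ⥤ B.C}

lemma IsMultiexact.isExactFunctor (hF : IsMultiexact A B F) (z : ∀ i, (A i).C) (i : I) :
    IsExactFunctor (A i).toWaldCat B.toWaldCat (upd z i ⋙ F) where
  map_pt := by
    have : (upd z i ⋙ F).obj (A i).pt = B.pt := hF.map_pt _ i (upd_obj_self _ _ _)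
    rw [this]
    exact B.isZero
  map_pushout {X Y Z T f g h k} hf hp :=
    hF.map_pushout _ _ _ _ i (upd_map_isAlong z i f) (upd_map_isAlong z i g)
      (upd_map_isAlong z i h) (upd_map_isAlong z i k)
      (property_heq _ (upd_obj_self z i X).symm (upd_obj_self z i Y).symm
        (upd_map_self z i f).symm hf)
      (isPushout_heq (upd_obj_self z i X).symm (upd_obj_self z i Y).symm (upd_obj_self z i Z).symm
        (upd_obj_self z i T).symm (upd_map_self z i f).symm (upd_map_self z i g).symm
        (upd_map_self z i h).symm (upd_map_self z i k).symm hp)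

variable {P : I → Type} [∀ i, PartialOrder (P i)] {T : Type} [PartialOrder T]

/-- The product of the functors `X i`, for a poset `T` with projections to the posets `P i`. -/
def prodDiag {A : I → Type u} [∀ i, SmallCategory (A i)] (X : ∀ i, P i ⥤ A i) (pr : ∀ i, T → P i)
    (hm : ∀ i, Monotone (pr i)) : T ⥤ ∀ i, A i :=
  Functor.pi' fun i => monoFunctor (pr i) (hm i) ⋙ X i

lemma IsColimOn.isIso_of_top {P : Type} [PartialOrder P] {C : Type u} [SmallCategory C]
    {G : P ⥤ C} {D : Set P} {Z : C} {c : ∀ x ∈ D, (G.obj x ⟶ Z)} (h : IsColimOn G D Z c)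
    {d : P} (hd : d ∈ D) (hD : ∀ x ∈ D, x ≤ d) : IsIso (c d hd) := by
  have h' : IsColimOn G D (G.obj d) fun x hx => G.map (homOfLE (hD x hx)) :=
    IsColimOn.of_top hd hD (fun _ _ _ _ _ => map_homOfLE_comp _ _ _) <| by
      rw [map_homOfLE_refl]; infer_instance
  obtain ⟨e, he⟩ := h.exists_iso h'
  have : c d hd = e.inv := by
    rw [Iso.eq_comp_inv e |>.2 (he d hd), map_homOfLE_refl, id_comp]
  rw [this]
  infer_instance

lemma IsMultiexact.isColimOn [Finite I] (hF : IsMultiexact A B F) [∀ i, Finite (P i)]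
    {X : ∀ i, P i ⥤ (A i).C} (hX : ∀ i, Reedy (A i).toWaldCat (X i)) {pr : ∀ i, T → P i}
    (hm : ∀ i, Monotone (pr i)) (hpr : ∀ x y, (∀ i, pr i x ≤ pr i y) → x ≤ y)
    (hs : ∀ p : ∀ i, P i, ∃ t, ∀ i, pr i t = p i) {D : ∀ i, Set (P i)} (hD : ∀ i, IsLowerSet (D i))
    {Z : ∀ i, (A i).C} {c : ∀ i x, x ∈ D i → ((X i).obj x ⟶ Z i)}
    (hc : ∀ i, IsColimOn (X i) (D i) (Z i) (c i)) :
    IsColimOn (prodDiag X pr hm ⋙ F) {x | ∀ i, pr i x ∈ D i} (F.obj Z)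
      fun x hx => F.map (X := fun i => (X i).obj (pr i x)) fun i => c i (pr i x) (hx i) := by
  classical
  have := Fintype.ofFinite I
  suffices h : ∀ S : Finset I, ∀ (D : ∀ i, Set (P i)) (hD : ∀ i, IsLowerSet (D i))
      (Z : ∀ i, (A i).C) (c : ∀ i x, x ∈ D i → ((X i).obj x ⟶ Z i))
      (hc : ∀ i, IsColimOn (X i) (D i) (Z i) (c i)) (ht : ∀ i ∉ S, ∃ d ∈ D i, ∀ x ∈ D i, x ≤ d),
      IsColimOn (prodDiag X pr hm ⋙ F) {x | ∀ i, pr i x ∈ D i} (F.obj Z)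
        fun x hx => F.map (X := fun i => (X i).obj (pr i x)) fun i => c i (pr i x) (hx i) from
    h Finset.univ D hD Z c hc fun i hi => (hi (Finset.mem_univ i)).elim
  intro S
  induction S using Finset.induction_on with
  | empty =>
    intro D hD Z c hc ht
    choose d hd hdt using fun i => ht i (Finset.notMem_empty i)
    obtain ⟨t, ht⟩ := hs d
    obtain rfl : (fun i => pr i t) = d := funext ht
    refine IsColimOn.of_top (d := t) hd (fun x hx => hpr _ _ fun i => hdt i _ (hx i))
      (fun x y hxy hx hy => ?_) ?_
    · refine (F.map_comp _ _).symm.trans (congrArg F.map (funext fun i => ?_))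
      exact (hc i).comm _ _ _ _ _
    · have : ∀ i, IsIso (c i (pr i t) (hd i)) := fun i => (hc i).isIso_of_top (hd i) (hdt i)
      have : IsIso (X := fun i => (X i).obj (pr i t)) (Y := Z) fun i => c i (pr i t) (hd i) :=
        (isIso_pi_iff _).2 this
      exact Functor.map_isIso F _
  | insert i S hi ih =>
    intro D hD Z c hc ht
    have claim : ∀ d ∈ D i, ∃ c' : ∀ j x, x ∈ {x | x ∈ D j ∧ ∀ h : i = j, x ≤ h ▸ d} →
        ((X j).obj x ⟶ (upd Z i).obj ((X i).obj d) j),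
        (∀ j, i ≠ j → ∀ x hx, HEq (c' j x hx) (c j x hx.1)) ∧
        (∀ x hx, HEq (c' i x hx) ((X i).map (homOfLE (hx.2 rfl)))) ∧
        IsColimOn (prodDiag X pr hm ⋙ F)
          {x | ∀ j, pr j x ∈ {x | x ∈ D j ∧ ∀ h : i = j, x ≤ h ▸ d}}
          (F.obj ((upd Z i).obj ((X i).obj d)))
          fun x hx => F.map (X := fun i => (X i).obj (pr i x)) fun j => c' j (pr j x) (hx j) := by
      intro d hd
      have h₁ : ∀ j, ∃ c' : ∀ x, x ∈ {x | x ∈ D j ∧ ∀ h : i = j, x ≤ h ▸ d} →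
          ((X j).obj x ⟶ (upd Z i).obj ((X i).obj d) j),
          IsColimOn (X j) {x | x ∈ D j ∧ ∀ h : i = j, x ≤ h ▸ d} _ c' ∧
          (i ≠ j → ∀ x hx, HEq (c' x hx) (c j x hx.1)) ∧
          (∀ (h : i = j) x hx, HEq (c' x hx)
            ((X j).map (homOfLE (show x ≤ h ▸ d from hx.2 h)))) := by
        intro j
        by_cases hj : i = j
        · subst hj
          suffices h : ∀ Z', Z' = (X i).obj d → ∃ c' : ∀ x, x ∈ {x | x ∈ D i ∧
              ∀ h : i = i, x ≤ h ▸ d} → ((X i).obj x ⟶ Z'),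
              IsColimOn (X i) {x | x ∈ D i ∧ ∀ h : i = i, x ≤ h ▸ d} _ c' ∧
              ∀ x hx, HEq (c' x hx) ((X i).map (homOfLE (show x ≤ d from hx.2 rfl))) by
            obtain ⟨c', h₁, h₂⟩ := h _ (upd_obj_self Z i ((X i).obj d))
            exact ⟨c', h₁, fun h => (h rfl).elim, fun _ x hx => h₂ x hx⟩
          rintro _ rfl
          refine ⟨fun x hx => (X i).map (homOfLE (show x ≤ d from hx.2 rfl)), ?_, fun _ _ => HEq.rfl⟩
          refine IsColimOn.of_top (d := d) (show d ∈ {x | x ∈ D i ∧ ∀ h : i = i, x ≤ h ▸ d} from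
            ⟨hd, fun _ => le_rfl⟩) (fun x hx => hx.2 rfl)
            (fun _ _ _ _ _ => map_homOfLE_comp _ _ _) ?_
          rw [map_homOfLE_refl]
          infer_instance
        · suffices h : ∀ Z', Z' = Z j → ∃ c' : ∀ x, x ∈ {x | x ∈ D j ∧ ∀ h : i = j, x ≤ h ▸ d} →
              ((X j).obj x ⟶ Z'), IsColimOn (X j) {x | x ∈ D j ∧ ∀ h : i = j, x ≤ h ▸ d} _ c' ∧
              ∀ x hx, HEq (c' x hx) (c j x hx.1) by
            obtain ⟨c', h₁, h₂⟩ := h _ (upd_obj_ne Z hj ((X i).obj d))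
            exact ⟨c', h₁, fun _ => h₂, fun h => (hj h).elim⟩
          rintro _ rfl
          refine ⟨fun x hx => c j x hx.1, ?_, fun _ _ => HEq.rfl⟩
          have hset : D j = {x | x ∈ D j ∧ ∀ h : i = j, x ≤ h ▸ d} := by
            ext x
            exact ⟨fun h => ⟨h, fun h => (hj h).elim⟩, fun h => h.1⟩
          exact (hc j).congr_set hset
      choose c' h₁ h₂ h₃ using h₁
      refine ⟨c', h₂, h₃ i rfl, ih (fun j => {x | x ∈ D j ∧ ∀ h : i = j, x ≤ h ▸ d}) (fun j x y hyx hx => ⟨hD j hyx hx.1,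
        fun h => hyx.trans (hx.2 h)⟩) _ _ h₁ fun j hj => ?_⟩
      by_cases hij : i = j
      · subst hij
        exact ⟨d, ⟨hd, fun _ => le_rfl⟩, fun x hx => hx.2 rfl⟩
      · obtain ⟨e, he, he'⟩ := ht j fun h => (Finset.mem_insert.1 h).elim (fun h => hij h.symm) hj
        exact ⟨e, ⟨he, fun h => (hij h).elim⟩, fun x hx => he' x hx.1⟩
    choose c' hne heq hcol using claim
    have hmem : ∀ {x : T} {d : P i}, (∀ j, pr j x ∈ D j) → pr i x ≤ d →
        ∀ j, pr j x ∈ {x | x ∈ D j ∧ ∀ h : i = j, x ≤ h ▸ d} := fun hx hd j =>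
      ⟨hx j, fun h => by subst h; exact hd⟩
    let κ : ∀ (d : P i) (hd : d ∈ D i) (x : T) (hx : ∀ j, pr j x ∈ D j) (hxd : pr i x ≤ d),
        (fun j => (X j).obj (pr j x)) ⟶ (upd Z i).obj ((X i).obj d) := fun d hd x hx hxd j =>
      c' d hd j (pr j x) (hmem hx hxd j)
    have hκ : ∀ (d d' : P i) (hd : d ∈ D i) (hd' : d' ∈ D i) (h : d ≤ d') (x : T) hx
        (hxd : pr i x ≤ d), κ d hd x hx hxd ≫ (upd Z i).map ((X i).map (homOfLE h)) =
          κ d' hd' x hx (hxd.trans h) := by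
      intro d d' hd hd' h x hx hxd
      funext j
      apply eq_of_heq
      by_cases hj : i = j
      · subst hj
        refine (heq_comp rfl (upd_obj_self Z i _) (upd_obj_self Z i _) (heq d hd _ _)
          (upd_map_self Z i _)).trans ?_
        rw [map_homOfLE_comp]
        exact (heq d' hd' _ _).symm
      · exact (IsId.heq_comp _ (upd_map_ne Z hj _)).trans
          ((hne d hd j hj _ _).trans (hne d' hd' j hj _ _).symm)
    have hκ' : ∀ (d : P i) (hd : d ∈ D i) (x : T) hx (hxd : pr i x ≤ d),
        κ d hd x hx hxd ≫ (upd Z i).map (c i d hd) ≫ eqToHom (upd_obj_eq Z i) =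
          fun j => c j (pr j x) (hx j) := by
      intro d hd x hx hxd
      funext j
      apply eq_of_heq
      rw [← assoc]
      refine (IsId.heq_comp _ ?_).trans ?_
      · exact isId_of_heq_id (congrFun (upd_obj_eq Z i) j) rfl (by
          rw [Functor.eqToHom_proj]
          exact (isId_eqToHom _).heq (isId_id _) (congrFun (upd_obj_eq Z i) j))
      by_cases hj : i = j
      · subst hj
        refine (heq_comp rfl (upd_obj_self Z i _) (upd_obj_self Z i _) (heq d hd _ _)
          (upd_map_self Z i _)).trans ?_
        rw [(hc i).comm]
      · exact (IsId.heq_comp _ (upd_map_ne Z hj _)).trans (hne d hd j hj _ _)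
    have hκF : ∀ (d : P i) (hd : d ∈ D i) (x : T) hx (hxd : pr i x ≤ d) {Y : B.C}
        (f : F.obj Z ⟶ Y), F.map (κ d hd x hx hxd) ≫ F.map ((upd Z i).map (c i d hd)) ≫
          F.map (eqToHom (upd_obj_eq Z i)) ≫ f =
          F.map (X := fun i => (X i).obj (pr i x)) (fun j => c j (pr j x) (hx j)) ≫ f := by
      intro d hd x hx hxd Y f
      rw [← hκ' d hd x hx hxd, F.map_comp, F.map_comp, assoc, assoc]
    have hpres := (hX i).preserves (hF.isExactFunctor Z i) (hD i) (hc i)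
    refine ⟨fun x y hxy hx hy => ?_, fun {Y} τ hτ => ?_, fun {Y} f g hfg => ?_⟩
    · refine (F.map_comp _ _).symm.trans (congrArg F.map (funext fun j => ?_))
      exact (hc j).comm _ _ _ _ _
    · have hτd : ∀ d (hd : d ∈ D i), ∃ m : F.obj ((upd Z i).obj ((X i).obj d)) ⟶ Y,
          ∀ x hx (hxd : pr i x ≤ d), F.map (κ d hd x hx hxd) ≫ m = τ x hx := fun d hd => by
        obtain ⟨m, hmm⟩ := (hcol d hd).exists_desc (fun x hx => τ x fun j => (hx j).1)
          (hτ.mono fun x hx j => (hx j).1)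
        exact ⟨m, fun x hx hxd => hmm x (hmem hx hxd)⟩
      choose m hm' using hτd
      obtain ⟨f, hf⟩ := hpres.exists_desc m fun d d' h hd hd' => by
        refine (hcol d hd).hom_ext _ _ fun x hx => ?_
        have hx' : ∀ j, pr j x ∈ D j := fun j => (hx j).1
        have hxd : pr i x ≤ d := (hx i).2 rfl
        refine Eq.trans ?_ (hm' d hd x hx' hxd).symm
        rw [← hm' d' hd' x hx' (hxd.trans h), ← hκ d d' hd hd' h x hx' hxd, F.map_comp,
          assoc]
        rfl
      refine ⟨F.map (eqToHom (upd_obj_eq Z i).symm) ≫ f, fun x hx => ?_⟩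
      refine (hκF (pr i x) (hx i) x hx le_rfl _).symm.trans ?_
      rw [← F.map_comp_assoc (eqToHom _), eqToHom_trans, eqToHom_refl, F.map_id, id_comp,
        ← hm' (pr i x) (hx i) x hx le_rfl, ← hf (pr i x) (hx i)]
      rfl
    · rw [← cancel_epi (F.map (eqToHom (upd_obj_eq Z i)))]
      refine hpres.hom_ext _ _ fun d hd => (hcol d hd).hom_ext _ _ fun x hx => ?_
      have hx' : ∀ j, pr j x ∈ D j := fun j => (hx j).1
      have hxd : pr i x ≤ d := (hx i).2 rfl
      exact (hκF d hd x hx' hxd f).trans ((hfg x hx').trans (hκF d hd x hx' hxd g).symm)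

lemma Reedy.of_iso {P : Type} [PartialOrder P] {W : WaldCat.{u}} {G G' : P ⥤ W.C}
    (hG : Reedy W G) (e : G ≅ G') : Reedy W G' := by
  intro w
  obtain ⟨L, l, f, hL, hf, hcof⟩ := hG w
  refine ⟨L, fun x hx => e.inv.app x ≫ l x hx, f ≫ e.hom.app w, ⟨fun x y hxy hx hy => ?_,
    fun d hd => ?_, fun f g h => ?_⟩, fun x hx => ?_,
    W.cof_comp _ _ hcof (W.cof_of_isIso _ inferInstance)⟩
  · rw [← assoc, e.inv.naturality, assoc, hL.comm]
  · obtain ⟨g, hg⟩ := hL.exists_desc (fun x hx => e.hom.app x ≫ d x hx) fun x y hxy hx hy => by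
      rw [← assoc, e.hom.naturality, assoc, hd]
    exact ⟨g, fun x hx => by rw [assoc, hg]; simp⟩
  · exact hL.hom_ext _ _ fun x hx => by
      simpa only [assoc, Iso.cancel_iso_inv_left] using
        (by have := h x hx; simpa using this : l x hx ≫ f = l x hx ≫ g)
  · rw [assoc, ← assoc (l x hx), hf, e.hom.naturality]
    simp

lemma IsMultiexact.reedy [Finite I] (hF : IsMultiexact A B F) [∀ i, Finite (P i)]
    {X : ∀ i, P i ⥤ (A i).C} (hX : ∀ i, Reedy (A i).toWaldCat (X i)) {pr : ∀ i, T → P i}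
    (hm : ∀ i, Monotone (pr i)) (hpr : ∀ x y, (∀ i, pr i x ≤ pr i y) → x ≤ y)
    (hs : ∀ p : ∀ i, P i, ∃ t, ∀ i, pr i t = p i) :
    Reedy B.toWaldCat (prodDiag X pr hm ⋙ F) := by
  classical
  intro w
  choose L l f hL hf hcof using fun i => hX i (pr i w)
  let f' : (L : ∀ i, (A i).C) ⟶ fun i => (X i).obj (pr i w) := f
  have hcube := cubicallyCofibrant_iff.1 (hF.cubical f' hcof)
  obtain ⟨Z, z, g, hZ, hg, hgcof⟩ := hcube (fun _ => 1)
  let S : ∀ i, Fin (1 + 1) → Set (P i) := fun i b => {x | x ≤ pr i w ∧ (b = 0 → x < pr i w)}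
  let D : Cube (fun _ : I => 1) → ∀ i, Set (P i) := fun v i => S i (v i)
  have hD : ∀ v i, IsLowerSet (D v i) := fun v i x y hyx hx =>
    ⟨hyx.trans hx.1, fun h => hyx.trans_lt (hx.2 h)⟩
  have hleg : ∀ i (b : Fin (1 + 1)), ∃ c : ∀ x, x ∈ S i b →
      ((X i).obj x ⟶ (ComposableArrows.mk₁ (f i)).obj b),
      IsColimOn (X i) (S i b) _ c ∧ (∀ (x : P i) (hx : x ≤ pr i w) hx', c x hx' ≫
        (ComposableArrows.mk₁ (f i)).map (homOfLE (Fin.le_last b)) = (X i).map (homOfLE hx)) := by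
    intro i b
    have h10 : (1 : Fin (1 + 1)) ≠ 0 := by decide
    have hS₀ : Set.Iio (pr i w) = S i 0 := by
      ext x
      exact ⟨fun h => ⟨le_of_lt h, fun _ => h⟩, fun h => h.2 rfl⟩
    have hS₁ : Set.Iic (pr i w) = S i 1 := by
      ext x
      exact ⟨fun h => ⟨h, fun h => absurd h h10⟩, fun h => h.1⟩
    match b with
    | 0 => exact ⟨fun x hx => l i x (hx.2 rfl), (hL i).congr_set hS₀,
        fun x hx hx' => hf i x (hx'.2 rfl)⟩
    | 1 => exact ⟨fun x hx => (X i).map (homOfLE hx.1), (IsColimOn.iic (X i) (pr i w)).congr_set hS₁,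
        fun x hx hx' => by
          have : (ComposableArrows.mk₁ (f i)).map (homOfLE (Fin.le_last (1 : Fin (1 + 1)))) = 𝟙 _ :=
            fmap_id _ _
          rw [this]
          exact comp_id _⟩
  choose c hc hc' using hleg
  have hc'' : ∀ i (b b' : Fin (1 + 1)) (h : b ≤ b') x hx hx',
      c i b x hx ≫ (ComposableArrows.mk₁ (f i)).map (homOfLE h) = c i b' x hx' := by
    intro i b b' h x hx hx'
    have h₁ : ∀ hx₁, c i 1 x hx₁ = (X i).map (homOfLE hx₁.1) := fun hx₁ => by
      rw [← hc' i 1 x hx₁.1 hx₁]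
      exact (comp_id _).symm.trans (congrArg (c i 1 x hx₁ ≫ ·)
        (fmap_id (ComposableArrows.mk₁ (f i)) 1).symm)
    match b, b' with
    | 0, 0 => exact (congrArg (c i 0 x hx ≫ ·)
        (fmap_id (ComposableArrows.mk₁ (f i)) 0)).trans (comp_id _)
    | 0, 1 => rw [h₁ hx', ← hc' i 0 x hx'.1 hx]
    | 1, 1 => exact (congrArg (c i 1 x hx ≫ ·)
        (fmap_id (ComposableArrows.mk₁ (f i)) 1)).trans (comp_id _)
  have hM : ∀ v : Cube (fun _ : I => 1), IsColimOn (prodDiag X pr hm ⋙ F)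
      {x | ∀ i, pr i x ∈ D v i} ((arrowCube f' ⋙ F).obj v)
      fun x hx => F.map (X := fun i => (X i).obj (pr i x)) fun i => c i (v i) (pr i x) (hx i) :=
    fun v => hF.isColimOn hX hm hpr hs (hD v) fun i => hc i (v i)
  let leg : ∀ (v : Cube (fun _ : I => 1)) (x : T), (∀ i, pr i x ∈ D v i) →
      ((prodDiag X pr hm ⋙ F).obj x ⟶ (arrowCube f' ⋙ F).obj v) := fun v x hx =>
    F.map (X := fun i => (X i).obj (pr i x)) fun i => c i (v i) (pr i x) (hx i)
  have hleg : ∀ v v' (h : v ≤ v') x hx hx', leg v x hx ≫ (arrowCube f' ⋙ F).map (homOfLE h) =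
      leg v' x hx' := fun v v' h x hx hx' =>
    (F.map_comp _ _).symm.trans (congrArg F.map (funext fun i =>
      hc'' i (v i) (v' i) (h i) (pr i x) (hx i) (hx' i)))
  have hleg₁ : ∀ v (h : v ≤ fun _ => 1) x hx (hxw : x ≤ w),
      leg v x hx ≫ (arrowCube f' ⋙ F).map (homOfLE h) =
      (show (prodDiag X pr hm ⋙ F).obj x ⟶ (arrowCube f' ⋙ F).obj fun _ => 1 from
        (prodDiag X pr hm ⋙ F).map (homOfLE hxw)) := fun v h x hx hxw =>
    (F.map_comp _ _).symm.trans (congrArg F.map (funext fun i =>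
      hc' i (v i) (pr i x) (hm i hxw) (hx i)))
  have hDlt : ∀ v, v < (fun _ => 1) → ∀ x, (∀ i, pr i x ∈ D v i) → x < w := fun v hv x hx => by
    obtain ⟨-, i, hi⟩ := Cube.lt_iff.1 hv
    refine lt_of_le_of_ne (hpr _ _ fun i => (hx i).1) fun e => ?_
    subst e
    have h₀ : v i = 0 := by
      have : (v i).val < 1 := hi
      exact Fin.ext (by simpa using this)
    exact lt_irrefl _ ((hx i).2 h₀)
  let v : T → Cube (fun _ : I => 1) := fun x i => if pr i x = pr i w then 1 else 0
  have hv₀ : ∀ x i, pr i x ≠ pr i w → v x i = 0 := fun x i h => if_neg h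
  have hv₁ : ∀ x i, pr i x = pr i w → v x i = 1 := fun x i h => if_pos h
  have hv : ∀ x, x < w → v x < fun _ => 1 := fun x hx => by
    refine Cube.lt_iff.2 ⟨fun i => Fin.le_last _, ?_⟩
    by_contra hn
    push Not at hn
    refine hx.not_ge (hpr _ _ fun i => ?_)
    by_contra h
    have := hn i
    rw [hv₀ x i fun e => h e.ge] at this
    exact absurd (le_antisymm this (Fin.zero_le _)) (by decide : (1 : Fin (1 + 1)) ≠ 0)
  have hvD : ∀ x, x < w → ∀ i, pr i x ∈ D (v x) i := fun x hx i =>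
    ⟨hm i hx.le, fun h => lt_of_le_of_ne (hm i hx.le) fun e =>
      (by decide : (1 : Fin (1 + 1)) ≠ 0) ((hv₁ x i e).symm.trans h)⟩
  have hvle : ∀ x v', (∀ i, pr i x ∈ D v' i) → v x ≤ v' := fun x v' hx i => by
    by_cases h : pr i x = pr i w
    · by_contra hn
      rw [hv₁ x i h] at hn
      have h₀ : v' i = 0 := by
        have : (v' i).val < 1 := not_le.1 hn
        exact Fin.ext (by simpa using this)
      exact ((hx i).2 h₀).ne h
    · rw [hv₀ x i h]
      exact Fin.zero_le _
  let l' : ∀ x, x ∈ Set.Iio w → ((prodDiag X pr hm ⋙ F).obj x ⟶ Z) := fun x hx =>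
    leg (v x) x (hvD x hx) ≫ z (v x) (hv x hx)
  have hl' : ∀ x hx v' hv' hx', l' x hx = leg v' x hx' ≫ z v' hv' := fun x hx v' hv' hx' => by
    rw [← hleg _ _ (hvle x v' hx') x (hvD x hx) hx', assoc, hZ.comm _ _ _ (hv x hx) hv']
  refine ⟨Z, l', g, ⟨fun x y hxy hx hy => ?_, fun τ hτ => ?_, fun a b hab => ?_⟩, fun x hx => ?_,
    hgcof⟩
  · have hx' : ∀ i, pr i x ∈ D (v y) i := fun i => hD _ i (hm i hxy) (hvD y hy i)
    rw [hl' x hx (v y) (hv y hy) hx', ← assoc]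
    exact congrArg (· ≫ z (v y) (hv y hy)) ((hM (v y)).comm x y hxy hx' (hvD y hy))
  · have : ∀ v' (hv' : v' < fun _ => 1), ∃ m : (arrowCube f' ⋙ F).obj v' ⟶ _, ∀ x hx,
        leg v' x hx ≫ m = τ x (hDlt v' hv' x hx) := fun v' hv' =>
      (hM v').exists_desc _ (hτ.mono (D' := {x | ∀ i, pr i x ∈ D v' i}) (hDlt v' hv'))
    choose m hmm using this
    obtain ⟨k, hk⟩ := hZ.exists_desc m fun v₁ v₂ h h₁ h₂ => (hM v₁).hom_ext _ _ fun x hx => by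
      have hx₂ : ∀ i, pr i x ∈ D v₂ i := fun i => by
        refine ⟨(hx i).1, fun h₀ => (hx i).2 (le_antisymm ?_ (Fin.zero_le _))⟩
        rw [← h₀]
        exact h i
      refine Eq.trans ?_ (hmm v₁ h₁ x hx).symm
      rw [← hmm v₂ h₂ x hx₂, ← hleg v₁ v₂ h x hx hx₂, assoc]
    exact ⟨k, fun x hx => (assoc _ _ _).trans
      ((congrArg (leg (v x) x (hvD x hx) ≫ ·) (hk _ (hv x hx))).trans
        (hmm (v x) (hv x hx) x (hvD x hx)))⟩
  · refine hZ.hom_ext _ _ fun v' hv' => (hM v').hom_ext _ _ fun x hx => ?_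
    have e := hl' x (hDlt v' hv' x hx) v' hv' hx
    exact (assoc _ _ _).symm.trans ((congrArg (· ≫ a) e.symm).trans
      ((hab x (hDlt v' hv' x hx)).trans ((congrArg (· ≫ b) e).trans (assoc _ _ _))))
  · exact (assoc _ _ _).trans ((congrArg (leg (v x) x (hvD x hx) ≫ ·)
      (hg _ (hv x hx))).trans (hleg₁ _ _ _ _ _))

end Multiexact

lemma exists_comap_fun {I J : Type*} (e : I ≃ J) {S : J → Type*} (x : ∀ i, S (e i)) :
    ∃ x' : ∀ j, S j, x = fun i => x' (e i) :=
  ⟨Equiv.piCongrLeft S e x, funext fun i => (Equiv.piCongrLeft_apply_apply S e x i).symm⟩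

/-! ### Concatenations -/

lemma app_heq_of_arrow {A C : Type*} [Category A] [Category C] {F G F' G' : A ⥤ C} {α : F ⟶ G}
    {β : F' ⟶ G'} (h : Arrow.mk α = Arrow.mk β) (x : A) : HEq (α.app x) (β.app x) :=
  app_heq (left_eq_of_arrow h) (right_eq_of_arrow h) (heq_of_arrow h) x

lemma eMap_congr {s t : EObj} (f : s ⟶ t) {j j' : Fin t.len} (h : j = j')
    {x : Fin (t.val j + 1)} {x' : Fin (t.val j' + 1)} (hx : x.val = x'.val) :
    eMap f j x = eMap f j' x' := EHom.β_congr f h hx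

lemma eMap_le {s t : EObj} (f : s ⟶ t) (j : Fin t.len) (x : Fin (t.val j + 1)) :
    eMap f j x ≤ s.ext (ePre f j) := Nat.lt_succ_iff.1 (EHom.β f j x).2

lemma eMap_mono {s t : EObj} (f : s ⟶ t) (j : Fin t.len) : Monotone (eMap f j) :=
  fun _ _ h => (EHom.β f j).monotone h

section Concatenation

variable {I : Type} {m m' m'' : I → EObj} {t t' t'' w : EObj}

lemma Concat.ext {h h' : Concat m t} (H : ∀ i k, h.e ⟨i, k⟩ = h'.e ⟨i, k⟩) : h = h' := by
  obtain ⟨e, he⟩ := h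
  obtain ⟨e', he'⟩ := h'
  obtain rfl : e = e' := Equiv.ext fun x => H x.1 x.2
  rfl

lemma Concat.surj (h : Concat m t) (j : Fin t.len) : ∃ i k, h.e ⟨i, k⟩ = j :=
  ⟨(h.e.symm j).1, (h.e.symm j).2, h.e.apply_symm_apply j⟩

lemma IsConcat.unique {h : Concat m t} {h' : Concat m' t'} {f : ∀ i, m i ⟶ m' i} {g g' : t ⟶ t'}
    (hg : IsConcat h h' f g) (hg' : IsConcat h h' f g') : g = g' := by
  refine eHom_ext (fun j => ?_) fun j x => ?_
  · obtain ⟨i, k, rfl⟩ := h'.surj j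
    exact (hg i k).1.trans (hg' i k).1.symm
  · obtain ⟨i, k, rfl⟩ := h'.surj j
    let y : Fin ((m' i).val k + 1) := ⟨x.val, x.2.trans_eq (congrArg (· + 1) (h'.val_eq i k))⟩
    exact ((hg i k).2 x y rfl).trans ((hg' i k).2 x y rfl).symm

lemma isConcat_id (h : Concat m t) : IsConcat h h (fun i => 𝟙 (m i)) (𝟙 t) :=
  fun _ _ => ⟨rfl, fun _ _ hx => hx⟩

lemma isConcat_self {s t : EObj} (f : s ⟶ t) :
    IsConcat (Concat.self s) (Concat.self t) (fun _ => f) f :=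
  fun _ k => ⟨by
    change ePre f k = _
    cases ePre f k <;> rfl, fun x y hx => congrArg (eMap f k) (Fin.ext hx)⟩

lemma IsConcat.comp {h : Concat m t} {h' : Concat m' t'} {h'' : Concat m'' t''}
    {f : ∀ i, m i ⟶ m' i} {g : t ⟶ t'} {f' : ∀ i, m' i ⟶ m'' i} {g' : t' ⟶ t''}
    (hg : IsConcat h h' f g) (hg' : IsConcat h' h'' f' g') :
    IsConcat h h'' (fun i => f i ≫ f' i) (g ≫ g') := by
  intro i k
  obtain ⟨h₁, h₂⟩ := hg' i k
  rw [ePre_comp, ePre_comp]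
  obtain hk | ⟨l, hk⟩ := (ePre (f' i) k).eq_none_or_eq_some
  · rw [hk] at h₁ ⊢
    refine ⟨by rw [h₁]; rfl, fun x y hx => ?_⟩
    rw [eMap_comp_none _ _ h₁, eMap_comp_none _ _ hk]
    exact h₂ x y hx
  · rw [hk] at h₁ ⊢
    refine ⟨by rw [h₁]; exact (hg i l).1, fun x y hx => ?_⟩
    have hy : eMap (f' i) k y < (m' i).val l + 1 := Nat.lt_succ_iff.2 ((eMap_le _ _ _).trans_eq (by rw [hk]; rfl))
    have hy' : eMap (f' i) k y < t'.val (h'.e ⟨i, l⟩) + 1 := by rwa [h'.val_eq]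
    rw [eMap_comp_some _ _ h₁ x ⟨_, hy'⟩ (h₂ x y hx), eMap_comp_some _ _ hk y ⟨_, hy⟩ rfl]
    exact (hg i l).2 _ _ rfl

lemma exists_isConcat (h : Concat m t) (h' : Concat m' t') (f : ∀ i, m i ⟶ m' i) :
    ∃ g : t ⟶ t', IsConcat h h' f g := by
  have hv : ∀ j : Fin t'.len, t'.val j = (m' (h'.e.symm j).1).val (h'.e.symm j).2 := fun j => by
    conv_lhs => rw [← h'.e.apply_symm_apply j]
    exact h'.val_eq _ _
  have hext : ∀ i o, t.ext (Option.map (fun l => h.e ⟨i, l⟩) o) = (m i).ext o := fun i o => by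
    cases o
    · rfl
    · exact h.val_eq _ _
  refine ⟨eMk (fun l => h'.e ⟨(h.e.symm l).1, eInj (f _) (h.e.symm l).2⟩)
    (fun j => (ePre (f (h'.e.symm j).1) (h'.e.symm j).2).map fun l => h.e ⟨(h'.e.symm j).1, l⟩)
    (fun l j => ?_) (fun j x => eMap (f _) (h'.e.symm j).2 (Fin.cast (congrArg (· + 1) (hv j)) x))
    (fun j x => (eMap_le _ _ _).trans_eq (hext _ _).symm)
    (fun j x y hx => eMap_mono _ _ (by exact hx)), fun i k => ⟨?_, fun x y hx => ?_⟩⟩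
  · obtain ⟨i, l, rfl⟩ := h.surj l
    obtain ⟨i', k, rfl⟩ := h'.surj j
    rw [h'.e.symm_apply_apply, h.e.symm_apply_apply, h'.e.apply_eq_iff_eq]
    rw [Option.map_eq_some_iff]
    constructor
    · rintro ⟨l', hl', e⟩
      rw [h.e.apply_eq_iff_eq] at e
      cases e
      exact congrArg (Sigma.mk i') ((EHom.p_eq_some (f i') _ _).1 hl')
    · rintro e
      cases e
      exact ⟨l, (EHom.p_eq_some (f i) _ _).2 rfl, rfl⟩
  · have : ∀ x : Σ i, Fin (m' i).len, x = ⟨i, k⟩ → (ePre (f x.1) x.2).map (fun l => h.e ⟨x.1, l⟩) =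
        (ePre (f i) k).map fun l => h.e ⟨i, l⟩ := by
      rintro _ rfl; rfl
    exact this _ (h'.e.symm_apply_apply _)
  · have : ∀ (x : Σ i, Fin (m' i).len) (z : Fin ((m' x.1).val x.2 + 1)), x = ⟨i, k⟩ →
        z.val = y.val → eMap (f x.1) x.2 z = eMap (f i) k y := by
      rintro _ z rfl hz
      exact congrArg _ (Fin.ext hz)
    exact this _ _ (h'.e.symm_apply_apply _) hx

/-- Families of levels have concatenations. -/
def HasConcat {L : Type} (o : L → EObj) : Prop :=
  ∀ (I : Type) [Finite I] (m : I → L), ∃ t, Nonempty (Concat (fun i => o (m i)) (o t))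

lemma exists_concat : HasConcat fun t => t := fun I _ m => by
  let e := Finite.equivFin (Σ i, Fin (m i).len)
  exact ⟨⟨_, fun j => (m (e.symm j).1).val (e.symm j).2⟩, ⟨e, fun i k => by
    change (m (e.symm (e ⟨i, k⟩)).1).val (e.symm (e ⟨i, k⟩)).2 = _
    rw [e.symm_apply_apply]⟩⟩

/-- The concatenation of a reindexed family. -/
def Concat.uncomap {J : Type} (e : I ≃ J) {m : J → EObj} (h : Concat (fun i => m (e i)) t) :
    Concat m t where
  e := (Equiv.sigmaCongrLeft (β := fun j => Fin (m j).len) e).symm.trans h.e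
  val_eq j k := by
    obtain ⟨i, rfl⟩ := e.surjective j
    refine Eq.trans ?_ (h.val_eq i k)
    have : (Equiv.sigmaCongrLeft (β := fun j => Fin (m j).len) e).symm ⟨e i, k⟩ = ⟨i, k⟩ := by
      rw [Equiv.symm_apply_eq]; rfl
    exact congrArg (fun x => t.val (h.e x)) this

lemma Concat.uncomap_e {J : Type} (e : I ≃ J) {m : J → EObj} (h : Concat (fun i => m (e i)) t)
    (i : I) (k) : h.e ⟨i, k⟩ = (h.uncomap e).e ⟨e i, k⟩ := by
  have : (Equiv.sigmaCongrLeft (β := fun j => Fin (m j).len) e).symm ⟨e i, k⟩ = ⟨i, k⟩ := by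
    rw [Equiv.symm_apply_eq]; rfl
  exact (congrArg h.e this).symm

lemma IsConcat.of_comap {J : Type} (e : I ≃ J) {m m' : J → EObj} {f : ∀ j, m j ⟶ m' j}
    {h : Concat (fun i => m (e i)) t} {h' : Concat (fun i => m' (e i)) t'} {g : t ⟶ t'}
    (hg : IsConcat h h' (fun i => f (e i)) g) {H : Concat m t} {H' : Concat m' t'}
    (hh : ∀ i k, h.e ⟨i, k⟩ = H.e ⟨e i, k⟩) (hh' : ∀ i k, h'.e ⟨i, k⟩ = H'.e ⟨e i, k⟩) :
    IsConcat H H' f g := by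
  intro j k
  obtain ⟨i, rfl⟩ := e.surjective j
  obtain ⟨h₁, h₂⟩ := hg i k
  rw [← hh']
  refine ⟨h₁.trans ?_, fun x y hx => ?_⟩
  · cases ePre (f (e i)) k
    · rfl
    · exact congrArg some (hh _ _)
  · exact h₂ _ _ hx

variable {K : I → Type} {n n' : ∀ i, K i → EObj}

/-- The outer part of an iterated concatenation. -/
def Concat.outer (h : ∀ i, Concat (n i) (m i)) (h' : Concat (fun x : Σ i, K i => n x.1 x.2) w) :
    Concat m w where
  e := (Equiv.sigmaCongrRight fun i => (h i).e.symm).trans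
    ((Equiv.sigmaAssoc fun i k => Fin (n i k).len).symm.trans h'.e)
  val_eq i l := by
    obtain ⟨k, l, rfl⟩ := (h i).surj l
    rw [(h i).val_eq]
    refine Eq.trans ?_ (h'.val_eq ⟨i, k⟩ l)
    exact congrArg (fun x : Σ k, Fin (n i k).len => w.val (h'.e ⟨⟨i, x.1⟩, x.2⟩))
      ((h i).e.symm_apply_apply ⟨k, l⟩)

lemma Concat.outer_e (h : ∀ i, Concat (n i) (m i))
    (h' : Concat (fun x : Σ i, K i => n x.1 x.2) w) (i : I) (k : K i) (l : Fin (n i k).len) :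
    h'.e ⟨⟨i, k⟩, l⟩ = (Concat.outer h h').e ⟨i, (h i).e ⟨k, l⟩⟩ :=
  (congrArg (fun x : Σ k, Fin (n i k).len => h'.e ⟨⟨i, x.1⟩, x.2⟩)
      ((h i).e.symm_apply_apply ⟨k, l⟩)).symm

lemma IsConcat.outer {h : ∀ i, Concat (n i) (m i)} {h' : ∀ i, Concat (n' i) (m' i)}
    {H : Concat (fun x : Σ i, K i => n x.1 x.2) w} {H' : Concat (fun x : Σ i, K i => n' x.1 x.2) t}
    {O : Concat m w} {O' : Concat m' t}
    (hO : ∀ i k l, H.e ⟨⟨i, k⟩, l⟩ = O.e ⟨i, (h i).e ⟨k, l⟩⟩)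
    (hO' : ∀ i k l, H'.e ⟨⟨i, k⟩, l⟩ = O'.e ⟨i, (h' i).e ⟨k, l⟩⟩)
    {f : ∀ x : Σ i, K i, n x.1 x.2 ⟶ n' x.1 x.2} {g : w ⟶ t} {g' : ∀ i, m i ⟶ m' i}
    (hg : IsConcat H H' f g) (hg' : ∀ i, IsConcat (h i) (h' i) (fun k => f ⟨i, k⟩) (g' i)) :
    IsConcat O O' g' g := by
  intro i l
  obtain ⟨k, l, rfl⟩ := (h' i).surj l
  obtain ⟨h₁, h₂⟩ := hg ⟨i, k⟩ l
  obtain ⟨h₃, h₄⟩ := hg' i k l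
  rw [← hO', h₃]
  refine ⟨h₁.trans ?_, fun x y hx => ?_⟩
  · dsimp only
    cases ePre (f ⟨i, k⟩) l
    · rfl
    · exact congrArg some (hO _ _ _)
  · let z : Fin ((n' i k).val l + 1) := ⟨x.val, x.2.trans_eq (congrArg (· + 1) (H'.val_eq ⟨i, k⟩ l))⟩
    exact (h₂ x z rfl).trans (h₄ y z hx.symm).symm

end Concatenation

/-! ### Reindexing and multicomposition of arrows -/

section ArrowLaws

variable {I J : Type} {C : Type u} [Category.{v} C]

lemma preArr_unitSigma (A : I → Type u) [∀ i, Category.{v} (A i)]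
    (b : Arrow ((∀ i, A i) ⥤ C)) :
    preArr (Pi.comap A (unitSigma I))
      (mcompArr (A := fun _ : Unit => A) (B := fun _ : Unit => C)
        (Arrow.mk (𝟙 (Pi.eval (fun _ : Unit => C) ()))) fun _ => b) = b :=
  arrow_ext rfl rfl fun x => heq_of_eq (by
    change 𝟙 _ ≫ b.hom.app x = _
    rw [id_comp])

lemma preArr_sigmaUnit (A : I → Type u) [∀ i, Category.{v} (A i)]
    (a : Arrow ((∀ i, A i) ⥤ C)) :
    preArr (Pi.comap A (sigmaUnit I))
      (mcompArr (A := fun i (_ : Unit) => A i) a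
        fun i => Arrow.mk (𝟙 (Pi.eval (fun _ : Unit => A i) ()))) = a :=
  arrow_ext rfl rfl fun x => heq_of_eq (by
    change a.hom.app x ≫ a.right.map (𝟙 x) = _
    rw [fmap_id, comp_id])

lemma mcompArr_mcompArr {K : I → Type} {L : ∀ i, K i → Type} (A : ∀ i k, L i k → Type u)
    [∀ i k l, Category.{v} (A i k l)] {B : ∀ i, K i → Type u} [∀ i k, Category.{v} (B i k)]
    {D : I → Type u} [∀ i, Category.{v} (D i)] (a : Arrow ((∀ i, D i) ⥤ C))
    (b : ∀ i, Arrow ((∀ k, B i k) ⥤ D i)) (c : ∀ i k, Arrow ((∀ l, A i k l) ⥤ B i k)) :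
    mcompArr (A := fun x : Σ i, K i => A x.1 x.2) (mcompArr a b) (fun x => c x.1 x.2) =
      preArr (Pi.comap (fun x : Σ x : Σ i, K i, L x.1 x.2 => A x.1.1 x.1.2 x.2)
        (Equiv.sigmaAssoc L).symm)
        (mcompArr (A := fun i (x : Σ k, L i k) => A i x.1 x.2) a
          fun i => mcompArr (b i) (c i)) :=
  arrow_ext rfl rfl fun x => heq_of_eq (by
    change (a.hom.app _ ≫ a.right.map (fun i => (b i).hom.app _)) ≫
      a.right.map (fun i => (b i).right.map fun k => (c i k).hom.app _) =
      a.hom.app _ ≫ a.right.map fun i => (b i).hom.app _ ≫ (b i).right.map fun k => (c i k).hom.app _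
    rw [assoc, ← Functor.map_comp]
    rfl)

lemma multicompHom_id {K : I → Type} {A : ∀ i, K i → Type u} [∀ i k, Category.{v} (A i k)]
    {B : I → Type u} [∀ i, Category.{v} (B i)] (G : (∀ i, B i) ⥤ C)
    (F : ∀ i, (∀ k, A i k) ⥤ B i) : multicompHom (𝟙 G) (fun i => 𝟙 (F i)) = 𝟙 _ :=
  NatTrans.ext (funext fun x => by
    change 𝟙 _ ≫ G.map (𝟙 _) = 𝟙 _
    rw [fmap_id, comp_id])

lemma multicompHom_comp {K : I → Type} {A : ∀ i, K i → Type u} [∀ i k, Category.{v} (A i k)]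
    {B : I → Type u} [∀ i, Category.{v} (B i)] {G G' G'' : (∀ i, B i) ⥤ C}
    {F F' F'' : ∀ i, (∀ k, A i k) ⥤ B i} (α : G ⟶ G') (α' : G' ⟶ G'') (β : ∀ i, F i ⟶ F' i)
    (β' : ∀ i, F' i ⟶ F'' i) : multicompHom (α ≫ α') (fun i => β i ≫ β' i) =
      multicompHom α β ≫ multicompHom α' β' :=
  NatTrans.ext (funext fun x => by
    change (α.app _ ≫ α'.app _) ≫ G''.map (fun i => (β i).app _ ≫ (β' i).app _) =
      (α.app _ ≫ G'.map fun i => (β i).app _) ≫ α'.app _ ≫ G''.map fun i => (β' i).app _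
    rw [assoc, assoc, ← assoc (G'.map _), α'.naturality,
      assoc, ← Functor.map_comp]
    rfl)

end ArrowLaws

/-! ### Multicategories presented by components -/

/-- The identities, reindexings and composites of a multicategory, together with the components of
its multimorphisms and cells at concatenations of levels. -/
structure Components {Ob : Type w} (Hom : ∀ (I : Type) [Finite I], (I → Ob) → Ob → Type v)
    [∀ (I : Type) [Finite I] (X : I → Ob) (Y : Ob), Category.{v'} (Hom I X Y)] {L Q : Type}
    (o : L → EObj) (T : Ob → L → Q → Type u) [∀ X l q, SmallCategory (T X l q)] where
  id (X : Ob) : Hom Unit (fun _ => X) X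
  act {I J : Type} [Finite I] [Finite J] (e : I ≃ J) (X : J → Ob) (Y : Ob) :
    Hom J X Y ⥤ Hom I (fun i => X (e i)) Y
  comp {I : Type} [Finite I] {K : I → Type} [∀ i, Finite (K i)] (X : ∀ i, K i → Ob) (Y : I → Ob)
    (Z : Ob) : Hom I Y Z × (∀ i, Hom (K i) (X i) (Y i)) ⥤ Hom (Σ i, K i) (fun x => X x.1 x.2) Z
  arr {I : Type} [Finite I] {X : I → Ob} {Y : Ob} {F G : Hom I X Y} (α : F ⟶ G) {m : I → L} {t : L}
    (h : Concat (fun i => o (m i)) (o t)) (q : Q) : Arrow ((∀ i, T (X i) (m i) q) ⥤ T Y t q)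
  exists_concat : HasConcat o
  id_arr (X : Ob) (t : L) (q : Q) : arr (𝟙 (id X)) (m := fun _ => t) (Concat.self (o t)) q =
    Arrow.mk (𝟙 (Pi.eval (fun _ : Unit => T X t q) ()))
  act_arr {I J : Type} [Finite I] [Finite J] (e : I ≃ J) {X : J → Ob} {Y : Ob} {F G : Hom J X Y}
    (α : F ⟶ G) {m : J → L} {t : L} (h : Concat (fun i => o (m (e i))) (o t))
    (h' : Concat (fun j => o (m j)) (o t)) (q : Q) : (∀ i k, h.e ⟨i, k⟩ = h'.e ⟨e i, k⟩) →
    preArr (Pi.comap (fun j => T (X j) (m j) q) e) (arr ((act e X Y).map α) (m := fun i => m (e i))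
      h q) = arr α h' q
  comp_arr {I : Type} [Finite I] {K : I → Type} [∀ i, Finite (K i)] {X : ∀ i, K i → Ob} {Y : I → Ob}
    {Z : Ob} {F G : Hom I Y Z × (∀ i, Hom (K i) (X i) (Y i))} (α : F ⟶ G) {m : ∀ i, K i → L}
    {t : I → L} {w : L} (h : ∀ i, Concat (fun k => o (m i k)) (o (t i)))
    (O : Concat (fun i => o (t i)) (o w)) (H : Concat (fun x : Σ i, K i => o (m x.1 x.2)) (o w))
    (q : Q) : (∀ i k l, H.e ⟨⟨i, k⟩, l⟩ = O.e ⟨i, (h i).e ⟨k, l⟩⟩) →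
    arr ((comp X Y Z).map α) (m := fun x => m x.1 x.2) H q =
      mcompArr (arr α.1 O q) fun i => arr (α.2 i) (h i) q

namespace Components

variable {Ob : Type w} {Hom : ∀ (I : Type) [Finite I], (I → Ob) → Ob → Type v}
  [∀ (I : Type) [Finite I] (X : I → Ob) (Y : Ob), Category.{v'} (Hom I X Y)] {L Q : Type}
  {o : L → EObj} {T : Ob → L → Q → Type u} [∀ X l q, SmallCategory (T X l q)]
  (D : Components Hom o T) {I J : Type} [Finite I] [Finite J] {K : I → Type} [∀ i, Finite (K i)]
  {Z V : Ob} {t : L} (q : Q)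

lemma exists_nested (D : Components Hom o T) {m : (Σ i, K i) → L} (H : Concat (fun x => o (m x)) (o t)) :
    ∃ (s : I → L) (h : ∀ i, Concat (fun k => o (m ⟨i, k⟩)) (o (s i)))
      (O : Concat (fun i => o (s i)) (o t)),
      ∀ i k l, H.e ⟨⟨i, k⟩, l⟩ = O.e ⟨i, (h i).e ⟨k, l⟩⟩ := by
  choose s h using fun i => D.exists_concat _ fun k : K i => m ⟨i, k⟩
  exact ⟨s, fun i => (h i).some, _, Concat.outer_e (fun i => (h i).some) H⟩

lemma arr_act_refl {X : I → Ob} {F G : Hom I X Z} (α : F ⟶ G) {m : I → L}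
    (h : Concat (fun i => o (m i)) (o t)) :
    D.arr ((D.act (Equiv.refl I) X Z).map α) h q = D.arr α h q :=
  D.act_arr (Equiv.refl I) α h h q fun _ _ => rfl

lemma arr_act_eq (e : I ≃ J) {X : J → Ob} {F G : Hom J X Z} (α : F ⟶ G)
    {F' G' : Hom I (fun i => X (e i)) Z} (β : F' ⟶ G')
    (hb : ∀ (m : J → L) (h : Concat (fun i => o (m (e i))) (o t)) (h' : Concat (fun j => o (m j)) (o t)),
      (∀ i k, h.e ⟨i, k⟩ = h'.e ⟨e i, k⟩) →
      preArr (Pi.comap (fun j => T (X j) (m j) q) e) (D.arr β (m := fun i => m (e i)) h q) = D.arr α h' q) {m : I → L}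
    (h : Concat (fun i => o (m i)) (o t)) : D.arr ((D.act e X Z).map α) h q = D.arr β h q := by
  obtain ⟨m, rfl⟩ := exists_comap_fun e (S := fun _ => L) m
  have hh := h.uncomap_e e (m := fun j => o (m j))
  exact preArr_comap_injective e (fun j => T (X j) (m j) q)
    ((D.act_arr e α h _ q hh).trans (hb m h _ hh).symm)

lemma arr_act_trans {N : Type} [Finite N] (e : I ≃ J) (e' : J ≃ N) {X : N → Ob} {F G : Hom N X Z}
    (α : F ⟶ G) {m : I → L} (h : Concat (fun i => o (m i)) (o t)) :
    D.arr ((D.act (e.trans e') X Z).map α) h q =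
      D.arr ((D.act e (fun j => X (e' j)) Z).map ((D.act e' X Z).map α)) h q := by
  refine D.arr_act_eq q (e.trans e') α _ (fun m h h' hh => ?_) h
  have h₁ := Concat.uncomap_e e (m := fun j => o (m (e' j))) h
  refine (congrArg (preArr (Pi.comap (fun j => T (X j) (m j) q) e')) (D.act_arr e
    ((D.act e' X Z).map α) (m := fun j => m (e' j)) h _ q h₁)).trans
    (D.act_arr e' α _ _ q fun j k => ?_)
  obtain ⟨i, rfl⟩ := e.surjective j
  exact (h₁ i k).symm.trans (hh i k)

lemma arr_act_comp_left {K : J → Type} [∀ j, Finite (K j)] (e : I ≃ J) {X : ∀ j, K j → Ob}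
    {Y : J → Ob} {F G : Hom J Y Z × (∀ j, Hom (K j) (X j) (Y j))} (α : F ⟶ G)
    {m : (Σ i, K (e i)) → L} (h : Concat (fun x => o (m x)) (o t)) :
    D.arr ((D.act (Equiv.sigmaCongrLeft (β := K) e) (fun x => X x.1 x.2) Z).map
      ((D.comp X Y Z).map α)) h q = D.arr ((D.comp (fun i => X (e i)) (fun i => Y (e i)) Z).map
        ((Functor.prod (D.act e Y Z) (Pi.comap (fun j => Hom (K j) (X j) (Y j)) e)).map α)) h q := by
  refine D.arr_act_eq q _ _ _ (fun m h h₀ hh => ?_) h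
  obtain ⟨s, h', O, hO⟩ := D.exists_nested h₀
  let O' : Concat (fun i => o (s (e i))) (o t) :=
    ⟨(Equiv.sigmaCongrLeft (β := fun j => Fin (o (s j)).len) e).trans O.e, fun i => O.val_eq (e i)⟩
  refine (congrArg (preArr _) (D.comp_arr _ (m := fun i k => m ⟨e i, k⟩) (fun i => h' (e i)) O' h q
    fun i k l => (hh ⟨i, k⟩ l).trans (hO (e i) k l))).trans ?_
  exact (congrArg (fun a => mcompArr (A := fun j k => T (X j k) (m ⟨j, k⟩) q) a
    fun i => D.arr (α.2 i) (h' i) q) (D.act_arr e α.1 O' O q fun _ _ => rfl)).trans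
    (D.comp_arr α (m := fun j k => m ⟨j, k⟩) h' O h₀ q hO).symm

lemma arr_act_comp_right {N : I → Type} [∀ i, Finite (N i)] (e : ∀ i, K i ≃ N i)
    {X : ∀ i, N i → Ob} {Y : I → Ob} {F G : Hom I Y Z × (∀ i, Hom (N i) (X i) (Y i))} (α : F ⟶ G)
    {m : (Σ i, K i) → L} (h : Concat (fun x => o (m x)) (o t)) :
    D.arr ((D.act (Equiv.sigmaCongrRight e) (fun x => X x.1 x.2) Z).map ((D.comp X Y Z).map α))
      h q = D.arr ((D.comp (fun i k => X i (e i k)) Y Z).map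
        ((Functor.prod (𝟭 _) (Functor.pi fun i => D.act (e i) (X i) (Y i))).map α)) h q := by
  refine D.arr_act_eq q _ _ _ (fun m h h₀ hh => ?_) h
  obtain ⟨s, h', O, hO⟩ := D.exists_nested h₀
  let h'' : ∀ i, Concat (fun k => o (m ⟨i, e i k⟩)) (o (s i)) := fun i =>
    ⟨(Equiv.sigmaCongrLeft (β := fun k => Fin (o (m ⟨i, k⟩)).len) (e i)).trans (h' i).e,
      fun k => (h' i).val_eq (e i k)⟩
  refine (congrArg (preArr _) (D.comp_arr _ (m := fun i k => m ⟨i, e i k⟩) h'' O h q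
    fun i k l => (hh ⟨i, k⟩ l).trans (hO i (e i k) l))).trans ?_
  exact (congrArg (mcompArr (A := fun j k => T (X j k) (m ⟨j, k⟩) q) (D.arr α.1 O q)) (funext fun i =>
    D.act_arr (e i) (α.2 i) (h'' i) (h' i) q fun _ _ => rfl)).trans
    (D.comp_arr α (m := fun j k => m ⟨j, k⟩) h' O h₀ q hO).symm

lemma arr_id_comp {X : I → Ob} {F G : Hom I X Z} (α : F ⟶ G) {m : (Σ _ : Unit, I) → L}
    (h : Concat (fun x => o (m x)) (o t)) :
    D.arr ((D.comp (fun _ => X) (fun _ => Z) Z).map (mkHom (𝟙 (D.id Z)) fun _ : Unit => α)) h q =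
      D.arr ((D.act (unitSigma I) X Z).map α) h q := by
  refine (D.arr_act_eq q (unitSigma I) α _ (fun m h h₀ hh => ?_) h).symm
  refine (congrArg (preArr _) (D.comp_arr _ (m := fun _ => m) (fun _ => h₀) (Concat.self (o t)) h q
    fun i k l => hh ⟨i, k⟩ l)).trans ?_
  exact (congrArg (fun a => preArr _ (mcompArr (A := fun (_ : Unit) i => T (X i) (m i) q) a
    fun _ => D.arr α h₀ q)) (D.id_arr Z t q)).trans (preArr_unitSigma _ _)

lemma arr_comp_id {X : I → Ob} {F G : Hom I X Z} (α : F ⟶ G) {m : (Σ _ : I, Unit) → L}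
    (h : Concat (fun x => o (m x)) (o t)) :
    D.arr ((D.comp (fun i _ => X i) X Z).map (mkHom α fun i => 𝟙 (D.id (X i)))) h q =
      D.arr ((D.act (sigmaUnit I) X Z).map α) h q := by
  refine (D.arr_act_eq q (sigmaUnit I) α _ (fun m h h₀ hh => ?_) h).symm
  refine (congrArg (preArr _) (D.comp_arr _ (m := fun i _ => m i) (fun i => Concat.self (o (m i))) h₀
    h q fun i k l => hh ⟨i, k⟩ l)).trans ?_
  exact (congrArg (fun b => preArr _ (mcompArr (A := fun i (_ : Unit) => T (X i) (m i) q)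
    (D.arr α h₀ q) b)) (funext fun i => D.id_arr (X i) (m i) q)).trans (preArr_sigmaUnit _ _)

lemma arr_assoc {N : ∀ i, K i → Type} [∀ i k, Finite (N i k)] {X : ∀ i k, N i k → Ob}
    {Y : ∀ i, K i → Ob} {Z : I → Ob} {F F' : Hom I Z V} {G G' : ∀ i, Hom (K i) (Y i) (Z i)}
    {H H' : ∀ i k, Hom (N i k) (X i k) (Y i k)} (α : F ⟶ F') (β : ∀ i, G i ⟶ G' i)
    (γ : ∀ i k, H i k ⟶ H' i k) {m : (Σ x : Σ i, K i, N x.1 x.2) → L}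
    (h : Concat (fun x => o (m x)) (o t)) :
    D.arr ((D.comp (fun x : Σ i, K i => X x.1 x.2) (fun x => Y x.1 x.2) V).map
      (mkHom ((D.comp Y Z V).map (mkHom α β)) fun x => γ x.1 x.2)) h q =
    D.arr ((D.act (Equiv.sigmaAssoc N) (fun x => X x.1 x.2.1 x.2.2) V).map
      ((D.comp (fun i (x : Σ k, N i k) => X i x.1 x.2) Z V).map (mkHom α fun i =>
        (D.comp (X i) (Y i) (Z i)).map (mkHom (β i) (γ i))))) h q := by
  refine (D.arr_act_eq q (Equiv.sigmaAssoc N) (X := fun x => X x.1 x.2.1 x.2.2) _ _ (fun m h h₀ hh => ?_) h).symm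
  obtain ⟨s, h₁, O₁, hO₁⟩ := D.exists_nested h₀
  choose r h₂ O₂ hO₂ using fun i => D.exists_nested (m := fun x => m ⟨i, x⟩) (h₁ i)
  let O₃ : Concat (fun x : Σ i, K i => o (r x.1 x.2)) (o t) := ⟨(Equiv.sigmaAssoc
    fun i k => Fin (o (r i k)).len).trans ((Equiv.sigmaCongrRight fun i => (O₂ i).e).trans O₁.e),
    fun x l => (O₁.val_eq x.1 _).trans ((O₂ x.1).val_eq x.2 l)⟩
  have e₁ := D.comp_arr (mkHom ((D.comp Y Z V).map (mkHom α β)) fun x : Σ i, K i => γ x.1 x.2)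
    (m := fun x l => m ⟨x.1, ⟨x.2, l⟩⟩) (fun x => h₂ x.1 x.2) O₃ h q fun x k l =>
      (hh ⟨x, k⟩ l).trans ((hO₁ x.1 ⟨x.2, k⟩ l).trans
        (congrArg (fun l => O₁.e ⟨x.1, l⟩) (hO₂ x.1 x.2 k l)))
  refine congrArg (preArr _) ((e₁.trans (congrArg (fun a => mcompArr (A := fun (x : Σ i, K i) l =>
    T (X x.1 x.2 l) (m ⟨x.1, ⟨x.2, l⟩⟩) q) a fun x => D.arr (γ x.1 x.2) (h₂ x.1 x.2) q)
    (D.comp_arr (mkHom α β) O₂ O₁ O₃ q fun i k l => rfl))).trans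
    (mcompArr_mcompArr (fun i k l => T (X i k l) (m ⟨i, ⟨k, l⟩⟩) q) (D.arr α O₁ q)
      (fun i => D.arr (β i) (O₂ i) q) fun i k => D.arr (γ i k) (h₂ i k) q)) |>.trans ?_
  refine Eq.trans ?_ (D.comp_arr (X := fun i (x : Σ k, N i k) => X i x.1 x.2) _
    (m := fun i x => m ⟨i, x⟩) h₁ O₁ h₀ q hO₁).symm
  exact congrArg (mcompArr (A := fun i (x : Σ k, N i k) => T (X i x.1 x.2) (m ⟨i, x⟩) q)
    (D.arr α O₁ q)) (funext fun i => (D.comp_arr (mkHom (β i) (γ i)) (m := fun k l => m ⟨i, ⟨k, l⟩⟩)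
      (h₂ i) (O₂ i) (h₁ i) q (hO₂ i)).symm)

/-- The multicategory presented by components which determine multimorphisms and cells. -/
def multicategory (hD : ∀ {I : Type} [Finite I] {X : I → Ob} {Y : Ob} {C : Type v}
    [Category.{v'} C] {R S : C ⥤ Hom I X Y}, (∀ {F G : C} (α : F ⟶ G) {m : I → L} {t : L}
      (h : Concat (fun i => o (m i)) (o t)) (q : Q),
      D.arr (R.map α) h q = D.arr (S.map α) h q) → R = S) : Multicategory Ob Hom where
  id := D.id
  act := D.act
  comp := D.comp
  act_refl _ _ := hD fun α _ _ h q => D.arr_act_refl q α h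
  act_trans e e' _ _ := hD fun α _ _ h q => D.arr_act_trans q e e' α h
  act_comp_left e _ _ _ _ _ := hD fun α _ _ h q => D.arr_act_comp_left q e α h
  act_comp_right e _ _ _ := hD fun α _ _ h q => D.arr_act_comp_right q e α h
  id_comp _ _ := hD fun α _ _ h q => D.arr_id_comp q α h
  comp_id _ _ := hD fun α _ _ h q => D.arr_comp_id q α h
  assoc _ _ _ _ := hD fun α _ _ h q => D.arr_assoc q α.1 α.2.1 α.2.2 h

end Components

/-! ### Reindexing, identities and composition of multiexact functors -/

lemma isId_pi {I : Type*} {A : I → Type*} [∀ i, Category (A i)] {x y : ∀ i, A i}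
    {f : x ⟶ y} (h : ∀ i, IsId (f i)) : IsId f := by
  obtain rfl : x = y := funext fun i => (h i).1
  exact ⟨rfl, funext fun i => (h i).2⟩

lemma IsId.pi {I : Type*} {A : I → Type*} [∀ i, Category (A i)] {x y : ∀ i, A i}
    {f : x ⟶ y} (h : IsId f) (i : I) : IsId (f i) := by
  obtain ⟨rfl, rfl⟩ := h
  exact isId_id _

lemma isAlong_reindex {I J : Type} (e : I ≃ J) {A : J → Type u} [∀ j, SmallCategory (A j)]
    {x y : ∀ i, A (e i)} {f : x ⟶ y} {i : I} (h : IsAlong i f) :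
    IsAlong (e i) ((reindex e A).map f) := by
  intro j hj
  obtain ⟨i', rfl⟩ := e.surjective j
  exact isId_of_heq (reindex_obj e A x i').symm (reindex_obj e A y i').symm
    (reindex_map e A f i').symm (h i' fun h => hj (h ▸ rfl))

lemma exists_comap_map {I J : Type} (e : I ≃ J) (A : J → Type u) [∀ j, Category.{v} (A j)]
    {x y : ∀ j, A j} (f : (Pi.comap A e).obj x ⟶ (Pi.comap A e).obj y) :
    ∃ g : x ⟶ y, f = fun i => g (e i) := by
  have h : ∀ x, (reindex e A).obj ((Pi.comap A e).obj x) = x := Functor.congr_obj (comap_reindex e A)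
  refine ⟨eqToHom (h x).symm ≫ (reindex e A).map f ≫ eqToHom (h y), funext fun i => eq_of_heq ?_⟩
  exact (((isId_eqToHom (h x).symm).pi (e i)).comp_heq _ |>.trans
    ((IsId.heq_comp _ ((isId_eqToHom (h y)).pi (e i))).trans (reindex_map e A f i))).symm

lemma Reedy.of_orderIso_comp {P Q : Type} [PartialOrder P] [PartialOrder Q] [Finite P]
    {W : WaldCat.{u}} {H : Q ⥤ W.C} (E : P ≃o Q) (h : Reedy W (E.monotone.functor ⋙ H)) :
    Reedy W H :=
  h.of_orderIso E.symm (eqToIso (Functor.hext (fun x => congrArg H.obj (E.apply_symm_apply x).symm)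
    fun x y f => map_heq H (E.apply_symm_apply x).symm (E.apply_symm_apply y).symm
      (by
        have : ∀ {a b a' b' : Q} (f : a ⟶ b) (f' : a' ⟶ b'), a = a' → b = b' → HEq f f' := by
          rintro a b _ _ f f' rfl rfl
          exact heq_of_eq (Subsingleton.elim _ _)
        exact this _ _ (E.apply_symm_apply x).symm (E.apply_symm_apply y).symm)))

/-- The reindexing of cubes. -/
def Cube.comapIso {I J : Type} (e : I ≃ J) :
    Cube (fun _ : J => 1) ≃o Cube (fun _ : I => 1) where
  toFun v i := v (e i)
  invFun v j := v (e.symm j)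
  left_inv v := funext fun j => congrArg v (e.apply_symm_apply j)
  right_inv v := funext fun i => congrArg v (e.symm_apply_apply i)
  map_rel_iff' {v w} := ⟨fun h j => by
    have := h (e.symm j)
    change v (e (e.symm j)) ≤ w (e (e.symm j)) at this
    rwa [e.apply_symm_apply] at this, fun h i => h (e i)⟩

lemma IsMultiexact.reindex {I J : Type} [Finite I] [Finite J] (e : I ≃ J) {A : J → WaldVee.{u}}
    {B : WaldVee.{u}} {F : (∀ j, (A j).C) ⥤ B.C} (hF : IsMultiexact A B F) :
    IsMultiexact (fun i => A (e i)) B (KTheory.reindex e (fun j => (A j).C) ⋙ F) where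
  map_pt x i h := hF.map_pt _ (e i) ((reindex_obj e (fun j => (A j).C) x i).trans h)
  map_weq {x y} f i h h' := hF.map_weq _ (e i) (isAlong_reindex e h)
    (property_heq _ (reindex_obj e (fun j => (A j).C) x i).symm (reindex_obj e (fun j => (A j).C) y i).symm
      (reindex_map e (fun j => (A j).C) f i).symm h')
  map_cof {x y} f i h h' := hF.map_cof _ (e i) (isAlong_reindex e h)
    (property_heq _ (reindex_obj e (fun j => (A j).C) x i).symm (reindex_obj e (fun j => (A j).C) y i).symm
      (reindex_map e (fun j => (A j).C) f i).symm h')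
  map_pushout {x y z w} f g h k i hf hg hh hk hc hp :=
    hF.map_pushout _ _ _ _ (e i) (isAlong_reindex e hf) (isAlong_reindex e hg)
      (isAlong_reindex e hh) (isAlong_reindex e hk)
      (property_heq _ (reindex_obj e (fun j => (A j).C) x i).symm (reindex_obj e (fun j => (A j).C) y i).symm
        (reindex_map e (fun j => (A j).C) f i).symm hc)
      (isPushout_heq (reindex_obj e (fun j => (A j).C) x i).symm (reindex_obj e (fun j => (A j).C) y i).symm
        (reindex_obj e (fun j => (A j).C) z i).symm (reindex_obj e (fun j => (A j).C) w i).symm (reindex_map e (fun j => (A j).C) f i).symm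
        (reindex_map e (fun j => (A j).C) g i).symm (reindex_map e (fun j => (A j).C) h i).symm
        (reindex_map e (fun j => (A j).C) k i).symm hp)
  cubical {x y} f hf := by
    obtain ⟨x, rfl⟩ := exists_comap_obj e (fun j => (A j).C) x
    obtain ⟨y, rfl⟩ := exists_comap_obj e (fun j => (A j).C) y
    obtain ⟨g, rfl⟩ := exists_comap_map e (fun j => (A j).C) f
    rw [cubicallyCofibrant_iff]
    refine Reedy.of_orderIso_comp (Cube.comapIso e) ?_
    have h : (Cube.comapIso e).monotone.functor ⋙ arrowCube (fun i => g (e i)) ⋙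
        KTheory.reindex e (fun j => (A j).C) ⋙ F = arrowCube g ⋙ F := by
      have : (Cube.comapIso e).monotone.functor ⋙ arrowCube (fun i => g (e i)) =
        arrowCube g ⋙ Pi.comap (fun j => (A j).C) e := rfl
      rw [← Functor.assoc, this, Functor.assoc, ← Functor.assoc (Pi.comap _ _), comap_reindex,
        Functor.id_comp]
    rw [h, ← cubicallyCofibrant_iff]
    refine hF.cubical g fun j => ?_
    obtain ⟨i, rfl⟩ := e.surjective j
    exact hf i

lemma reedy_mk₁ {W : WaldCat.{u}} {X Y : W.C} {f : X ⟶ Y} (hf : W.cof f) :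
    Reedy W (P := Fin (1 + 1)) (ComposableArrows.mk₁ f) := by
  intro w
  match w with
  | 0 =>
    exact ⟨W.pt, fun x hx => absurd hx (Fin.not_lt_zero _), W.isZero.to_ _,
      IsColimOn.of_isZero W.isZero fun x hx => absurd hx (Fin.not_lt_zero _),
      fun x hx => absurd hx (Fin.not_lt_zero _), W.cof_of_pt _⟩
  | 1 =>
    have h : Set.Iic (0 : Fin (1 + 1)) = Set.Iio 1 := by
      ext x; simp only [Set.mem_Iic, Set.mem_Iio, Fin.le_def, Fin.lt_def]; simp
    refine ⟨X, _, f, (IsColimOn.iic (ComposableArrows.mk₁ f) (0 : Fin (1 + 1))).congr_set h,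
      fun x hx => ?_, hf⟩
    have : f = (ComposableArrows.mk₁ f).map (homOfLE (Fin.zero_le (1 : Fin (1 + 1)))) := rfl
    refine (congrArg ((ComposableArrows.mk₁ f).map _ ≫ ·) this).trans ?_
    exact map_homOfLE_comp (P := Fin (1 + 1)) (ComposableArrows.mk₁ f) _ _

lemma isMultiexact_eval (A : WaldVee.{u}) :
    IsMultiexact (fun _ : Unit => A) A (Pi.eval (fun _ : Unit => A.C) ()) where
  map_pt _ _ h := h
  map_weq _ _ _ h := h
  map_cof _ _ _ h := h
  map_pushout _ _ _ _ _ _ _ _ _ _ h := h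
  cubical {x y} f hf := by
    rw [cubicallyCofibrant_iff]
    let E : Fin (1 + 1) ≃o Cube (fun _ : Unit => 1) :=
      { toFun := fun b _ => b
        invFun := fun v => v ()
        left_inv := fun _ => rfl
        right_inv := fun _ => rfl
        map_rel_iff' := ⟨fun h => h (), fun h _ => h⟩ }
    exact Reedy.of_orderIso_comp E (reedy_mk₁ (hf ()))

lemma isMultiexact_multicomp {I : Type} [Finite I] {K : I → Type} [∀ i, Finite (K i)]
    {A : ∀ i, K i → WaldVee.{u}} {B : I → WaldVee.{u}} {C : WaldVee.{u}}
    {G : (∀ i, (B i).C) ⥤ C.C} {F : ∀ i, (∀ k, (A i k).C) ⥤ (B i).C} (hG : IsMultiexact B C G)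
    (hF : ∀ i, IsMultiexact (A i) (B i) (F i)) :
    IsMultiexact (fun x : Σ i, K i => A x.1 x.2) C (multicomp G F) := by
  have hal : ∀ {x y : ∀ l : Σ i, K i, (A l.1 l.2).C} {f : x ⟶ y} {i : I} {k : K i},
      IsAlong (A := fun l : Σ i, K i => (A l.1 l.2).C) ⟨i, k⟩ f →
      IsAlong (A := fun i => (B i).C) i ((Functor.pi F).map ((sigmaCurry _).map f)) ∧
      IsAlong (A := fun k => (A i k).C) k fun k => f ⟨i, k⟩ := fun {x y f i k} h =>
    ⟨fun j hj => IsId.map (F j) (isId_pi fun l => h ⟨j, l⟩ fun e => hj (by cases e; rfl)),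
      fun l hl => h ⟨i, l⟩ fun e => hl (by cases e; rfl)⟩
  refine ⟨fun x l h => hG.map_pt _ l.1 ((hF l.1).map_pt _ l.2 h), fun f l h h' => ?_,
    fun f l h h' => ?_, fun f g h k l hf hg hh hk hc hp => ?_, fun {x y} f hf => ?_⟩
  · exact hG.map_weq _ l.1 (hal h).1 ((hF l.1).map_weq _ l.2 (hal h).2 h')
  · exact hG.map_cof _ l.1 (hal h).1 ((hF l.1).map_cof _ l.2 (hal h).2 h')
  · exact hG.map_pushout _ _ _ _ l.1 (hal hf).1 (hal hg).1 (hal hh).1 (hal hk).1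
      ((hF l.1).map_cof _ l.2 (hal hf).2 hc)
      ((hF l.1).map_pushout _ _ _ _ l.2 (hal hf).2 (hal hg).2 (hal hh).2 (hal hk).2 hc hp)
  · rw [cubicallyCofibrant_iff]
    exact hG.reedy (P := fun i => Cube fun _ : K i => 1)
      (X := fun i => arrowCube (fun k => f ⟨i, k⟩) ⋙ F i)
      (fun i => cubicallyCofibrant_iff.1 ((hF i).cubical _ fun k => hf ⟨i, k⟩))
      (T := Cube fun _ : Σ i, K i => 1) (pr := fun i v k => v ⟨i, k⟩)
      (fun i v w (h : ∀ l, v l ≤ w l) k => h ⟨i, k⟩)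
      (fun v w (h : ∀ i k, v ⟨i, k⟩ ≤ w ⟨i, k⟩) l => h l.1 l.2)
      fun p => ⟨fun l => p l.1 l.2, fun i => rfl⟩

/-! ### The multicategory of Waldhausen categories -/

namespace KExact

variable {I : Type} [Finite I] {A : I → WaldVee.{u}} {B : WaldVee.{u}}

lemma ext {F G : KExact I A B} (h : F.functor = G.functor) : F = G := by
  cases F; cases G; cases h; rfl

/-- A cell, as an arrow in the category of functors. -/
def arr {F G : KExact I A B} (α : F ⟶ G) : Arrow ((∀ i, (A i).C) ⥤ B.C) := Arrow.mk (cell α)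

lemma arrow_eq {F G F' G' : KExact I A B} {α : F ⟶ G} {β : F' ⟶ G'} (h : arr α = arr β) :
    Arrow.mk α = Arrow.mk β := by
  obtain rfl := ext (left_eq_of_arrow h)
  obtain rfl := ext (right_eq_of_arrow h)
  congr 1
  exact KExact.Hom.ext (eq_of_heq (heq_of_arrow h))

lemma functor_ext {X : Type*} [Category X] {L R : X ⥤ KExact I A B}
    (h : ∀ {F G : X} (α : F ⟶ G), arr (L.map α) = arr (R.map α)) : L = R :=
  functor_ext_arrow fun α => arrow_eq (h α)

end KExact

/-- The action of a bijection on multiexact functors. -/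
def kexactAct {I J : Type} [Finite I] [Finite J] (e : I ≃ J) (A : J → WaldVee.{u})
    (B : WaldVee.{u}) : KExact J A B ⥤ KExact I (fun i => A (e i)) B where
  obj F := ⟨_, F.isMultiexact.reindex e⟩
  map α := ⟨Functor.whiskerLeft _ (KExact.cell α)⟩

/-- Composition of multiexact functors. -/
def kexactComp {I : Type} [Finite I] {K : I → Type} [∀ i, Finite (K i)]
    (A : ∀ i, K i → WaldVee.{u}) (B : I → WaldVee.{u}) (C : WaldVee.{u}) :
    KExact I B C × (∀ i, KExact (K i) (A i) (B i)) ⥤ KExact (Σ i, K i) (fun x => A x.1 x.2) C where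
  obj F := ⟨_, isMultiexact_multicomp F.1.isMultiexact fun i => (F.2 i).isMultiexact⟩
  map α := ⟨multicompHom (KExact.cell α.1) fun i => KExact.cell (α.2 i)⟩
  map_id F := KExact.Hom.ext (multicompHom_id F.1.functor fun i => (F.2 i).functor)
  map_comp α β := KExact.Hom.ext (multicompHom_comp (KExact.cell α.1) (KExact.cell β.1)
    (fun i => KExact.cell (α.2 i)) fun i => KExact.cell (β.2 i))

lemma kexactAct_arr {I J : Type} [Finite I] [Finite J] (e : I ≃ J) (A : J → WaldVee.{u})
    (B : WaldVee.{u}) {F G : KExact J A B} (α : F ⟶ G) :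
    preArr (Pi.comap (fun j => (A j).C) e) (KExact.arr ((kexactAct e A B).map α)) =
      KExact.arr α :=
  preArr_comap_reindex e (fun j => (A j).C) (KExact.arr α)

/-- The concatenation of empty sequences. -/
def Concat.nil (I : Type) : Concat (fun _ : I => ⟨0, Fin.elim0⟩) ⟨0, Fin.elim0⟩ :=
  ⟨⟨fun x => x.2.elim0, fun k => k.elim0, fun x => x.2.elim0, fun k => k.elim0⟩, fun _ k => k.elim0⟩

/-- The components of multiexact functors. -/
def waldComponents : Components KExact.{u} (L := Unit) (Q := Unit)
    (fun _ => ⟨0, Fin.elim0⟩) fun A _ _ => A.C where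
  id A := ⟨_, isMultiexact_eval A⟩
  act e A B := kexactAct e A B
  comp A B C := kexactComp A B C
  arr α _ _ _ _ := KExact.arr α
  exists_concat _ _ _ := ⟨(), ⟨Concat.nil _⟩⟩
  id_arr _ _ _ := rfl
  act_arr e _ _ _ _ α _ _ _ _ _ _ := kexactAct_arr e _ _ α
  comp_arr _ _ _ _ _ _ _ _ _ := rfl

/-- The multicategory `Wald_∨`. -/
def waldMulticategory : Multicategory WaldVee.{u} KExact.{u} :=
  waldComponents.multicategory fun h => KExact.functor_ext fun α =>
    h α (m := fun _ => ()) (t := ()) (Concat.nil _) ()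

lemma isWaldMulticategory : IsWaldMulticategory waldMulticategory.{u} where
  id_functor _ := rfl
  act_functor e A B F := left_eq_of_arrow (kexactAct_arr e A B (𝟙 F))
  act_cell e A B _ _ α := heq_of_arrow (kexactAct_arr e A B α)
  comp_functor _ _ _ _ _ := rfl
  comp_cell _ _ _ _ _ _ _ _ _ := HEq.rfl

section

open MonoidalCategory

/-! ### Sums in one coordinate -/

lemma IsId.eq {C : Type*} [Category C] {X Y : C} {f g : X ⟶ Y} (hf : IsId f) (hg : IsId g) :
    f = g := eq_of_heq (hf.heq hg rfl)

lemma IsId.tensorHom {C : Type*} [Category C] [MonoidalCategory C] {X Y X' Y' : C} {f : X ⟶ Y}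
    {g : X' ⟶ Y'} (hf : IsId f) (hg : IsId g) : IsId (f ⊗ₘ g) := by
  obtain ⟨rfl, rfl⟩ := hf
  obtain ⟨rfl, rfl⟩ := hg
  exact ⟨rfl, by simp⟩

lemma IsId.inv {C : Type*} [Category C] {X Y : C} {e : X ≅ Y} (h : IsId e.hom) : IsId e.inv := by
  obtain ⟨rfl, h⟩ := h
  refine ⟨rfl, ?_⟩
  rw [← cancel_epi e.hom, e.hom_inv_id, h]
  simp

lemma tensorHom_heq {C : Type*} [Category C] [MonoidalCategory C] {X Y X' Y' Z T Z' T' : C}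
    {f : X ⟶ Y} {g : Z ⟶ T} {f' : X' ⟶ Y'} {g' : Z' ⟶ T'} (hX : X = X') (hY : Y = Y')
    (hZ : Z = Z') (hT : T = T') (hf : HEq f f') (hg : HEq g g') :
    HEq (f ⊗ₘ g) (f' ⊗ₘ g') := by
  subst hX hY hZ hT
  rw [eq_of_heq hf, eq_of_heq hg]

lemma exists_heq_hom {C : Type*} [Category C] {X Y X' Y' : C} (hX : X = X') (hY : Y = Y')
    (m : X' ⟶ Y') : ∃ f : X ⟶ Y, HEq f m := by
  subst hX hY
  exact ⟨m, HEq.rfl⟩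

lemma hom_ext_along {I : Type} {A : I → Type u} [∀ i, SmallCategory (A i)] {i : I}
    {x y : ∀ i, A i} {f g : x ⟶ y} (hf : IsAlong i f) (hg : IsAlong i g) (h : f i = g i) :
    f = g := by
  funext j
  by_cases hj : j = i
  · subst hj; exact h
  · exact (hf j hj).eq (hg j hj)

lemma eq_upd {I : Type} {A : I → Type u} [∀ i, Category.{v} (A i)] {x z : ∀ i, A i} {i : I}
    (h : ∀ j ≠ i, x j = z j) : x = (upd z i).obj (x i) :=
  (upd_obj_eq_of z x i fun j hj => (h j hj.symm).symm).symm

lemma heq_upd_map {I : Type} {A : I → Type u} [∀ i, SmallCategory (A i)] {i : I} {s s' : ∀ i, A i} (h : ∀ j ≠ i, s j = s' j) (k : s ⟶ s')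
    (hk : IsAlong i k) : HEq k ((upd s' i).map (k i)) := by
  refine pi_heq (eq_upd h) (eq_upd fun _ _ => rfl) fun j => ?_
  by_cases hj : j = i
  · subst hj; exact (upd_map_self _ _ _).symm
  · exact (hk j hj).heq (upd_map_ne _ (Ne.symm hj) _) (congrFun (eq_upd h) j)

section SumAt

variable {I : Type} {A : I → SMCat.{u}}

lemma sumAt_upd (z : ∀ i, (A i).C) (i : I) (a b : (A i).C) :
    SumAt i ((upd z i).obj a) ((upd z i).obj b) ((upd z i).obj (a ⊗ b)) := by
  refine ⟨by rw [upd_obj_self, upd_obj_self, upd_obj_self], fun j hj => ?_⟩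
  rw [upd_obj_ne z hj.symm, upd_obj_ne z hj.symm, upd_obj_ne z hj.symm]
  exact ⟨rfl, rfl⟩

lemma SumAt.ext {i : I} {x y z z' : ∀ i, (A i).C} (h : SumAt i x y z) (h' : SumAt i x y z') :
    z = z' := by
  funext j
  by_cases hj : j = i
  · subst hj; rw [h.1, h'.1]
  · rw [← (h.2 j hj).1, (h'.2 j hj).1]

lemma exists_along {i : I} {w z : ∀ i, (A i).C} (h : ∀ j ≠ i, w j = z j) {a : (A i).C}
    (ha : w i = a) (r : a ⟶ z i) : ∃ k : w ⟶ z, HEq (k i) r ∧ IsAlong i k := by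
  classical
  have : ∀ j, ∃ k : w j ⟶ z j, (∀ e : j = i, HEq k r) ∧ (j ≠ i → IsId k) := fun j => by
    by_cases hj : j = i
    · subst hj
      obtain ⟨k, hk⟩ := exists_heq_hom ha rfl r
      exact ⟨k, fun _ => hk, fun h => (h rfl).elim⟩
    · exact ⟨eqToHom (h j hj), fun e => (hj e).elim, fun _ => isId_eqToHom _⟩
  choose k hk hk' using this
  exact ⟨k, hk i rfl, hk'⟩

lemma exists_sumAt {i : I} {x y z : ∀ i, (A i).C} (hx : ∀ j ≠ i, x j = z j) (hy : ∀ j ≠ i, y j = z j) :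
    ∃ w, SumAt i x y w :=
  ⟨(upd z i).obj (x i ⊗ y i), by
    have := sumAt_upd z i (x i) (y i)
    rwa [← eq_upd hx, ← eq_upd hy] at this⟩

end SumAt

section Lax

variable {C D : Type*} [Category C] [Category D] [MonoidalCategory C] [MonoidalCategory D]
  (H : C ⥤ D)

open Functor.LaxMonoidal

lemma lax_assoc [H.LaxMonoidal] {a b c ab bc d d' : C} (r₁ : a ⊗ b ⟶ ab) (r₂ : ab ⊗ c ⟶ d)
    (r₃ : b ⊗ c ⟶ bc) (r₄ : a ⊗ bc ⟶ d') (m : d ⟶ d')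
    (h : r₁ ▷ c ≫ r₂ ≫ m = (α_ _ _ _).hom ≫ a ◁ r₃ ≫ r₄) :
    (μ H a b ≫ H.map r₁) ▷ H.obj c ≫ (μ H ab c ≫ H.map r₂) ≫ H.map m =
      (α_ _ _ _).hom ≫ H.obj a ◁ (μ H b c ≫ H.map r₃) ≫ μ H a bc ≫ H.map r₄ := by
  have h₄ := congrArg H.map h
  simp only [Functor.map_comp] at h₄
  rw [comp_whiskerRight, MonoidalCategory.whiskerLeft_comp]
  simp only [assoc]
  rw [μ_natural_left_assoc, μ_natural_right_assoc, h₄, associativity_assoc]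

variable [BraidedCategory C] [BraidedCategory D]

lemma lax_symm [H.LaxBraided] {a b d d' : C} (r : a ⊗ b ⟶ d) (r' : b ⊗ a ⟶ d') (m : d ⟶ d')
    (h : r ≫ m = (β_ _ _).hom ≫ r') :
    (μ H a b ≫ H.map r) ≫ H.map m = (β_ _ _).hom ≫ μ H b a ≫ H.map r' := by
  have h₄ := congrArg H.map h
  simp only [Functor.map_comp] at h₄
  rw [assoc, h₄, Functor.LaxBraided.braided_assoc]

lemma lax_tensorμ [H.LaxBraided] {a b c d ab cd ac bd t : C} (r₁ : a ⊗ b ⟶ ab)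
    (r₂ : c ⊗ d ⟶ cd) (r₃ : ab ⊗ cd ⟶ t) (r₄ : a ⊗ c ⟶ ac) (r₅ : b ⊗ d ⟶ bd) (r₆ : ac ⊗ bd ⟶ t)
    (h : (r₁ ⊗ₘ r₂) ≫ r₃ = tensorμ _ _ _ _ ≫ (r₄ ⊗ₘ r₅) ≫ r₆) :
    ((μ H a b ≫ H.map r₁) ⊗ₘ (μ H c d ≫ H.map r₂)) ≫ μ H ab cd ≫ H.map r₃ =
      tensorμ _ _ _ _ ≫ ((μ H a c ≫ H.map r₄) ⊗ₘ (μ H b d ≫ H.map r₅)) ≫ μ H ac bd ≫ H.map r₆ := by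
  have h₄ := congrArg H.map h
  simp only [Functor.map_comp] at h₄
  simp only [← tensorHom_comp_tensorHom, assoc]
  rw [μ_natural_assoc, μ_natural_assoc, h₄, tensorμ_comp_μ_tensorHom_μ_comp_μ_assoc]

end Lax

namespace KLinear

variable {I : Type} [Finite I] {A : I → SMCat.{u}} {B : SMCat.{u}} (F : KLinear I A B) (i : I)

lemma δ_congr {i i' : I} (hi : i = i') {x y z x' y' z' : ∀ i, (A i).C} (hx : x = x')
    (hy : y = y') (hz : z = z') (h : SumAt i x y z) (h' : SumAt i' x' y' z') :
    HEq (F.δ i h).hom (F.δ i' h').hom := by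
  subst hi hx hy hz
  rfl

section Var

variable (z : ∀ i, (A i).C)

/-- A multilinear functor as a functor in one variable. -/
noncomputable abbrev var : (A i).C ⥤ B.C := upd z i ⋙ F.functor

lemma δ_map {a b a' b' : (A i).C} (f : a ⟶ a') (g : b ⟶ b') :
    ((F.var i z).map f ⊗ₘ (F.var i z).map g) ≫ (F.δ i (sumAt_upd z i a' b')).hom =
      (F.δ i (sumAt_upd z i a b)).hom ≫ (F.var i z).map (f ⊗ₘ g) :=
  F.δ_naturality i _ _ _ _ _ ((upd_map_self z i _).trans
    (tensorHom_heq (upd_obj_self z i _).symm (upd_obj_self z i _).symm (upd_obj_self z i _).symm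
      (upd_obj_self z i _).symm (upd_map_self z i f).symm (upd_map_self z i g).symm))
    fun _ hj => ⟨(upd_map_ne z hj.symm _).heq (upd_map_ne z hj.symm _)
      ((upd_obj_ne z hj.symm _).trans (upd_obj_ne z hj.symm _).symm),
      (upd_map_ne z hj.symm _).heq (upd_map_ne z hj.symm _)
      ((upd_obj_ne z hj.symm _).trans (upd_obj_ne z hj.symm _).symm)⟩

lemma associator_heq {C : Type*} [Category C] [MonoidalCategory C] {X Y Z X' Y' Z' : C}
    (hX : X = X') (hY : Y = Y') (hZ : Z = Z') : HEq (α_ X Y Z).hom (α_ X' Y' Z').hom := by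
  subst hX hY hZ; rfl

lemma braiding_heq {C : Type*} [Category C] [MonoidalCategory C] [BraidedCategory C]
    {X Y X' Y' : C} (hX : X = X') (hY : Y = Y') : HEq (β_ X Y).hom (β_ X' Y').hom := by
  subst hX hY; rfl

/-- A multilinear functor is lax symmetric monoidal in each variable. -/
@[reducible]
def laxBraided : (F.var i z).LaxBraided where
  ε := eqToHom (F.obj_unit _ i (upd_obj_self z i _)).symm
  μ a b := (F.δ i (sumAt_upd z i a b)).hom
  μ_natural_left f b := by
    have := F.δ_map i z f (𝟙 b)
    rwa [fmap_id, tensorHom_id, tensorHom_id] at this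
  μ_natural_right a f := by
    have := F.δ_map i z (𝟙 a) f
    rwa [fmap_id, id_tensorHom, id_tensorHom] at this
  associativity a b c := F.δ_assoc i _ _ _ _ _ ((upd_map_self z i _).trans
    (associator_heq (upd_obj_self z i _).symm (upd_obj_self z i _).symm (upd_obj_self z i _).symm))
    (upd_map_isAlong z i _)
  left_unitality a := by
    refine (B.left_strict _).eq (IsId.comp ?_ (IsId.comp ?_ (IsId.map _ ((A i).left_strict _))))
    · rw [← tensorHom_id]
      exact (isId_eqToHom _).tensorHom (isId_id _)
    · exact F.δ_unit i _ (Or.inl (upd_obj_self z i _))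
  right_unitality a := by
    refine (B.right_strict _).eq (IsId.comp ?_ (IsId.comp ?_ (IsId.map _ ((A i).right_strict _))))
    · rw [← id_tensorHom]
      exact (isId_id _).tensorHom (isId_eqToHom _)
    · exact F.δ_unit i _ (Or.inr (Or.inl (upd_obj_self z i _)))
  braided a b := F.δ_symm i _ _ _ ((upd_map_self z i _).trans
    (braiding_heq (upd_obj_self z i _).symm (upd_obj_self z i _).symm)) (upd_map_isAlong z i _)

end Var

section SumOf

variable (z : ∀ i, (A i).C)

/-- The isomorphism `F x ⊗ F y ≅ F w` induced by an isomorphism `x i ⊗ y i ≅ w i`. -/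
def sumOf {a b c : (A i).C} (r : a ⊗ b ≅ c) {x y w : ∀ i, (A i).C}
    (hx : x = (upd z i).obj a) (hy : y = (upd z i).obj b) (hw : w = (upd z i).obj c) :
    F.functor.obj x ⊗ F.functor.obj y ≅ F.functor.obj w :=
  eqToIso (by rw [hx, hy]) ≪≫ F.δ i (sumAt_upd z i a b) ≪≫ (F.var i z).mapIso r ≪≫
    eqToIso (by rw [hw]; rfl)

lemma sumOf_hom {a b c : (A i).C} (r : a ⊗ b ≅ c) : (F.sumOf i z r rfl rfl rfl).hom =
    (F.δ i (sumAt_upd z i a b)).hom ≫ (F.var i z).map r.hom := by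
  simp [sumOf]

lemma sumOf_assoc {a b c ab bc d d' : (A i).C} (r₁ : a ⊗ b ≅ ab) (r₂ : ab ⊗ c ≅ d)
    (r₃ : b ⊗ c ≅ bc) (r₄ : a ⊗ bc ≅ d') (m : d ⟶ d')
    (h : r₁.hom ▷ c ≫ r₂.hom ≫ m = (α_ _ _ _).hom ≫ a ◁ r₃.hom ≫ r₄.hom)
    {x y w xy yw s s' : ∀ i, (A i).C} (hx : x = (upd z i).obj a) (hy : y = (upd z i).obj b)
    (hw : w = (upd z i).obj c) (hxy : xy = (upd z i).obj ab) (hyw : yw = (upd z i).obj bc)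
    (hs : s = (upd z i).obj d) (hs' : s' = (upd z i).obj d') (k : s ⟶ s')
    (hk : HEq k ((upd z i).map m)) :
    (F.sumOf i z r₁ hx hy hxy).hom ▷ F.functor.obj w ≫ (F.sumOf i z r₂ hxy hw hs).hom ≫
      F.functor.map k = (α_ _ _ _).hom ≫ F.functor.obj x ◁ (F.sumOf i z r₃ hy hw hyw).hom ≫
        (F.sumOf i z r₄ hx hyw hs').hom := by
  subst hx hy hw hxy hyw hs hs'
  obtain rfl := eq_of_heq hk
  rw [sumOf_hom, sumOf_hom, sumOf_hom, sumOf_hom]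
  let := F.laxBraided i z
  exact lax_assoc (F.var i z) _ _ _ _ m h

lemma sumOf_symm {a b d d' : (A i).C} (r : a ⊗ b ≅ d) (r' : b ⊗ a ≅ d') (m : d ⟶ d')
    (h : r.hom ≫ m = (β_ _ _).hom ≫ r'.hom) {x y s s' : ∀ i, (A i).C}
    (hx : x = (upd z i).obj a) (hy : y = (upd z i).obj b) (hs : s = (upd z i).obj d)
    (hs' : s' = (upd z i).obj d') (k : s ⟶ s') (hk : HEq k ((upd z i).map m)) :
    (F.sumOf i z r hx hy hs).hom ≫ F.functor.map k =
      (β_ _ _).hom ≫ (F.sumOf i z r' hy hx hs').hom := by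
  subst hx hy hs hs'
  obtain rfl := eq_of_heq hk
  rw [sumOf_hom, sumOf_hom]
  let := F.laxBraided i z
  exact lax_symm (F.var i z) _ _ m h

lemma sumOf_tensorμ {a b c d ab cd ac bd t : (A i).C} (r₁ : a ⊗ b ≅ ab) (r₂ : c ⊗ d ≅ cd)
    (r₃ : ab ⊗ cd ≅ t) (r₄ : a ⊗ c ≅ ac) (r₅ : b ⊗ d ≅ bd) (r₆ : ac ⊗ bd ≅ t)
    (h : (r₁.hom ⊗ₘ r₂.hom) ≫ r₃.hom = tensorμ _ _ _ _ ≫ (r₄.hom ⊗ₘ r₅.hom) ≫ r₆.hom)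
    {x₁ x₂ x₃ x₄ x₁₂ x₃₄ x₁₃ x₂₄ s : ∀ i, (A i).C} (h₁ : x₁ = (upd z i).obj a)
    (h₂ : x₂ = (upd z i).obj b) (h₃ : x₃ = (upd z i).obj c) (h₄ : x₄ = (upd z i).obj d)
    (h₁₂ : x₁₂ = (upd z i).obj ab) (h₃₄ : x₃₄ = (upd z i).obj cd) (h₁₃ : x₁₃ = (upd z i).obj ac)
    (h₂₄ : x₂₄ = (upd z i).obj bd) (hs : s = (upd z i).obj t) :
    ((F.sumOf i z r₁ h₁ h₂ h₁₂).hom ⊗ₘ (F.sumOf i z r₂ h₃ h₄ h₃₄).hom) ≫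
      (F.sumOf i z r₃ h₁₂ h₃₄ hs).hom = tensorμ _ _ _ _ ≫
      ((F.sumOf i z r₄ h₁ h₃ h₁₃).hom ⊗ₘ (F.sumOf i z r₅ h₂ h₄ h₂₄).hom) ≫
      (F.sumOf i z r₆ h₁₃ h₂₄ hs).hom := by
  subst h₁ h₂ h₃ h₄ h₁₂ h₃₄ h₁₃ h₂₄ hs
  simp only [sumOf_hom]
  let := F.laxBraided i z
  exact lax_tensorμ (F.var i z) _ _ _ _ _ _ h

end SumOf

/-! ### Sums along isomorphisms -/

section SumIso

variable {x y z : ∀ i, (A i).C} {i}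

/-- The isomorphism `F x ⊗ F y ≅ F z` induced by an isomorphism `x i ⊗ y i ≅ z i`, for families
which agree outside `i`. -/
def sumIso (hx : ∀ j ≠ i, x j = z j) (hy : ∀ j ≠ i, y j = z j)
    (r : x i ⊗ y i ≅ z i) : F.functor.obj x ⊗ F.functor.obj y ≅ F.functor.obj z :=
  F.sumOf i z r (eq_upd hx) (eq_upd hy) (eq_upd fun _ _ => rfl)

lemma sumOf_hom_eq (z₀ : ∀ i, (A i).C) {a b c : (A i).C} (r : a ⊗ b ≅ c)
    (hx : x = (upd z₀ i).obj a) (hy : y = (upd z₀ i).obj b) (hz : z = (upd z₀ i).obj c)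
    {w : ∀ i, (A i).C} (h : SumAt i x y w) (k : w ⟶ z) (hk : HEq (k i) r.hom)
    (hk' : IsAlong i k) :
    (F.sumOf i z₀ r hx hy hz).hom = (F.δ i h).hom ≫ F.functor.map k := by
  subst hx hy hz
  obtain rfl := h.ext (sumAt_upd z₀ i a b)
  obtain rfl : k = (upd z₀ i).map r.hom := hom_ext_along hk' (upd_map_isAlong _ _ _)
    (eq_of_heq (hk.trans (upd_map_self z₀ i r.hom).symm))
  exact F.sumOf_hom i z₀ r

lemma sumIso_hom_eq (hx : ∀ j ≠ i, x j = z j) (hy : ∀ j ≠ i, y j = z j)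
    (r : x i ⊗ y i ≅ z i) {w : ∀ i, (A i).C} (h : SumAt i x y w) (k : w ⟶ z)
    (hk : HEq (k i) r.hom) (hk' : IsAlong i k) :
    (F.sumIso hx hy r).hom = (F.δ i h).hom ≫ F.functor.map k :=
  F.sumOf_hom_eq _ _ _ _ _ h k hk hk'

lemma exists_sumIso (hx : ∀ j ≠ i, x j = z j) (hy : ∀ j ≠ i, y j = z j)
    (r : x i ⊗ y i ≅ z i) : ∃ (w : ∀ i, (A i).C) (h : SumAt i x y w) (k : w ⟶ z),
      HEq (k i) r.hom ∧ IsAlong i k ∧ (F.sumIso hx hy r).hom = (F.δ i h).hom ≫ F.functor.map k := by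
  obtain ⟨w, h⟩ := exists_sumAt hx hy
  obtain ⟨k, hk, hk'⟩ := exists_along (fun j hj => ((h.2 j hj).1.symm.trans (hx j hj))) h.1 r.hom
  exact ⟨w, h, k, hk, hk', F.sumIso_hom_eq hx hy r h k hk hk'⟩

lemma sumIso_eq_sumOf (z₀ : ∀ i, (A i).C) (h₀ : ∀ j ≠ i, z j = z₀ j)
    (hx : ∀ j ≠ i, x j = z j) (hy : ∀ j ≠ i, y j = z j) (r : x i ⊗ y i ≅ z i) :
    F.sumIso hx hy r = F.sumOf i z₀ r (eq_upd fun j hj => (hx j hj).trans (h₀ j hj))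
      (eq_upd fun j hj => (hy j hj).trans (h₀ j hj)) (eq_upd h₀) := by
  obtain ⟨w, h, k, hk, hk', e⟩ := F.exists_sumIso hx hy r
  exact Iso.ext (e.trans (F.sumOf_hom_eq _ _ _ _ _ h k hk hk').symm)

lemma sumIso_heq {F F' : KLinear I A B} (hF : F = F') {i i' : I} (hi : i = i')
    {x y z x' y' z' : ∀ i, (A i).C} (hx : x = x') (hy : y = y') (hz : z = z')
    (h₁ : ∀ j ≠ i, x j = z j) (h₂ : ∀ j ≠ i, y j = z j)
    (h₁' : ∀ j, j ≠ i' → x' j = z' j) (h₂' : ∀ j, j ≠ i' → y' j = z' j)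
    {r : x i ⊗ y i ≅ z i} {r' : x' i' ⊗ y' i' ≅ z' i'} (hr : HEq r.hom r'.hom) :
    HEq (F.sumIso h₁ h₂ r).hom (F'.sumIso h₁' h₂' r').hom := by
  subst hF hi hx hy hz
  rw [Iso.ext (eq_of_heq hr)]

lemma sumIso_of_isId (h : SumAt i x y z) (r : x i ⊗ y i ≅ z i) (hr : IsId r.hom) :
    F.sumIso (fun j hj => (h.2 j hj).1) (fun j hj => (h.2 j hj).2) r = F.δ i h := by
  refine Iso.ext ((F.sumIso_hom_eq _ _ r h (𝟙 z) ?_ (isAlong_id i z)).trans (by simp))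
  exact (isId_id (z i)).heq hr h.1

lemma isId_sumIso (hx : ∀ j ≠ i, x j = z j) (hy : ∀ j ≠ i, y j = z j)
    (r : x i ⊗ y i ≅ z i)
    (h : (IsId r.hom ∧ (x i = 𝟙_ (A i).C ∨ y i = 𝟙_ (A i).C)) ∨ ∃ j, j ≠ i ∧ z j = 𝟙_ (A j).C) :
    IsId (F.sumIso hx hy r).hom := by
  obtain ⟨w, h', k, hk, hk', e⟩ := F.exists_sumIso hx hy r
  rw [e]
  rcases h with ⟨hr, h⟩ | ⟨j, hj, h⟩
  · have : IsId k := isId_pi fun j => by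
      by_cases hj : j = i
      · subst hj; exact isId_of_heq h'.1.symm rfl hk.symm hr
      · exact hk' j hj
    refine IsId.comp (F.δ_unit i h' ?_) (this.map _)
    exact h.imp id fun h => Or.inl h
  · have hw : w j = 𝟙_ (A j).C := ((h'.2 j hj).1.symm.trans (hx j hj)).trans h
    exact IsId.comp (F.δ_unit i h' (Or.inr (Or.inr ⟨j, hj, hw⟩))) (F.map_unit k j hw (hk' j hj))

lemma sumIso_naturality {x' y' z' : ∀ i, (A i).C} (hx : ∀ j ≠ i, x j = z j)
    (hy : ∀ j ≠ i, y j = z j) (r : x i ⊗ y i ≅ z i) (hx' : ∀ j ≠ i, x' j = z' j)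
    (hy' : ∀ j ≠ i, y' j = z' j) (r' : x' i ⊗ y' i ≅ z' i) (f : x ⟶ x') (g : y ⟶ y')
    (k : z ⟶ z') (h : (f i ⊗ₘ g i) ≫ r'.hom = r.hom ≫ k i)
    (hf : ∀ j ≠ i, HEq (f j) (k j)) (hg : ∀ j ≠ i, HEq (g j) (k j)) :
    (F.functor.map f ⊗ₘ F.functor.map g) ≫ (F.sumIso hx' hy' r').hom =
      (F.sumIso hx hy r).hom ≫ F.functor.map k := by
  obtain ⟨w, hw, a, ha, ha', e⟩ := F.exists_sumIso hx hy r
  obtain ⟨w', hw', a', hb, hb', e'⟩ := F.exists_sumIso hx' hy' r'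
  have hwz : ∀ j ≠ i, w j = z j := fun j hj => (hw.2 j hj).1.symm.trans (hx j hj)
  have hwz' : ∀ j ≠ i, w' j = z' j := fun j hj => (hw'.2 j hj).1.symm.trans (hx' j hj)
  have : ∀ j, ∃ m : w j ⟶ w' j, (∀ e : j = i, HEq m (f j ⊗ₘ g j)) ∧ (j ≠ i → HEq m (k j)) := by
    intro j
    by_cases hj : j = i
    · subst hj
      obtain ⟨m, hm⟩ := exists_heq_hom hw.1 hw'.1 (f j ⊗ₘ g j)
      exact ⟨m, fun _ => hm, fun h => (h rfl).elim⟩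
    · obtain ⟨m, hm⟩ := exists_heq_hom (hwz j hj) (hwz' j hj) (k j)
      exact ⟨m, fun e => (hj e).elim, fun _ => hm⟩
  choose m hm hm' using this
  have hm'' : m ≫ a' = a ≫ k := by
    funext j
    apply eq_of_heq
    by_cases hj : j = i
    · subst hj
      refine (heq_comp hw.1 hw'.1 rfl (hm j rfl) hb).trans ?_
      rw [h]
      exact (heq_comp hw.1 rfl rfl ha HEq.rfl).symm
    · exact (IsId.heq_comp _ (hb' j hj)).trans ((hm' j hj).trans ((ha' j hj).comp_heq _).symm)
  rw [e, e', ← assoc, F.δ_naturality i hw hw' f g m (hm i rfl)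
    fun j hj => ⟨(hf j hj).trans (hm' j hj).symm, (hg j hj).trans (hm' j hj).symm⟩,
    assoc, assoc, ← F.functor.map_comp, ← F.functor.map_comp, hm'']

lemma map_sumIso {x' y' z' : ∀ i, (A i).C} (hz : SumAt i x y z)
    (hx' : ∀ j ≠ i, x' j = z' j) (hy' : ∀ j ≠ i, y' j = z' j) (r' : x' i ⊗ y' i ≅ z' i)
    (f : x ⟶ x') (g : y ⟶ y') (k : z ⟶ z') (h : HEq ((f i ⊗ₘ g i) ≫ r'.hom) (k i))
    (hf : ∀ j ≠ i, HEq (f j) (k j)) (hg : ∀ j ≠ i, HEq (g j) (k j)) :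
    (F.functor.map f ⊗ₘ F.functor.map g) ≫ (F.sumIso hx' hy' r').hom =
      (F.δ i hz).hom ≫ F.functor.map k := by
  have hr : IsId (eqToIso hz.1.symm : x i ⊗ y i ≅ z i).hom := isId_eqToHom hz.1.symm
  rw [← F.sumIso_of_isId hz (eqToIso hz.1.symm) hr]
  exact F.sumIso_naturality _ _ _ _ _ _ f g k
    (eq_of_heq (h.trans (IsId.comp_heq (isId_eqToHom hz.1.symm) _).symm)) hf hg

lemma sumIso_cell {F G : KLinear I A B} (α : F ⟶ G) (hx : ∀ j ≠ i, x j = z j)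
    (hy : ∀ j ≠ i, y j = z j) (r : x i ⊗ y i ≅ z i) :
    (F.sumIso hx hy r).hom ≫ (cell α).app z =
      ((cell α).app x ⊗ₘ (cell α).app y) ≫ (G.sumIso hx hy r).hom := by
  obtain ⟨w, h, k, hk, hk', e⟩ := F.exists_sumIso hx hy r
  rw [e, G.sumIso_hom_eq hx hy r h k hk hk', assoc, (cell α).naturality,
    ← assoc, ← assoc]
  exact congrArg (· ≫ G.functor.map k) (KLinear.Hom.δ_nat α i h)

lemma sumIso_assoc {x y w xy yw s s' : ∀ i, (A i).C} (hx : ∀ j ≠ i, x j = xy j)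
    (hy : ∀ j ≠ i, y j = xy j) (hxy : ∀ j ≠ i, xy j = s j) (hw : ∀ j ≠ i, w j = s j)
    (hy' : ∀ j ≠ i, y j = yw j) (hw' : ∀ j ≠ i, w j = yw j)
    (hx' : ∀ j ≠ i, x j = s' j) (hyw : ∀ j ≠ i, yw j = s' j) (r₁ : x i ⊗ y i ≅ xy i)
    (r₂ : xy i ⊗ w i ≅ s i) (r₃ : y i ⊗ w i ≅ yw i) (r₄ : x i ⊗ yw i ≅ s' i) (k : s ⟶ s')
    (hk : IsAlong i k)
    (h : r₁.hom ▷ w i ≫ r₂.hom ≫ k i = (α_ _ _ _).hom ≫ x i ◁ r₃.hom ≫ r₄.hom) :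
    (F.sumIso hx hy r₁).hom ▷ F.functor.obj w ≫ (F.sumIso hxy hw r₂).hom ≫ F.functor.map k =
      (α_ _ _ _).hom ≫ F.functor.obj x ◁ (F.sumIso hy' hw' r₃).hom ≫
        (F.sumIso hx' hyw r₄).hom := by
  have hs : ∀ j ≠ i, s j = s' j := fun j hj =>
    (hxy j hj).symm.trans ((hx j hj).symm.trans (hx' j hj))
  rw [F.sumIso_eq_sumOf s' (fun j hj => (hxy j hj).trans (hs j hj)) hx hy r₁,
    F.sumIso_eq_sumOf s' hs hxy hw r₂, F.sumIso_eq_sumOf s' hyw hy' hw' r₃]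
  exact F.sumOf_assoc i s' r₁ r₂ r₃ r₄ (k i) h _ _ _ _ _ _ _ k (heq_upd_map hs k hk)

lemma sumIso_symm {x y s s' : ∀ i, (A i).C} (hx : ∀ j ≠ i, x j = s j)
    (hy : ∀ j ≠ i, y j = s j) (hx' : ∀ j ≠ i, x j = s' j) (hy' : ∀ j ≠ i, y j = s' j)
    (r : x i ⊗ y i ≅ s i) (r' : y i ⊗ x i ≅ s' i) (k : s ⟶ s') (hk : IsAlong i k)
    (h : r.hom ≫ k i = (β_ _ _).hom ≫ r'.hom) :
    (F.sumIso hx hy r).hom ≫ F.functor.map k = (β_ _ _).hom ≫ (F.sumIso hy' hx' r').hom := by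
  have hs : ∀ j ≠ i, s j = s' j := fun j hj => (hx j hj).symm.trans (hx' j hj)
  rw [F.sumIso_eq_sumOf s' hs hx hy r]
  exact F.sumOf_symm i s' r r' (k i) h _ _ _ _ k (heq_upd_map hs k hk)

lemma sumIso_tensorμ {x₁ x₂ x₃ x₄ a b c d s : ∀ i, (A i).C} (h₁ : ∀ j ≠ i, x₁ j = a j)
    (h₂ : ∀ j ≠ i, x₂ j = a j) (h₃ : ∀ j ≠ i, x₃ j = b j) (h₄ : ∀ j ≠ i, x₄ j = b j)
    (ha : ∀ j ≠ i, a j = s j) (hb : ∀ j ≠ i, b j = s j) (h₁' : ∀ j ≠ i, x₁ j = c j)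
    (h₃' : ∀ j ≠ i, x₃ j = c j) (h₂' : ∀ j ≠ i, x₂ j = d j)
    (h₄' : ∀ j ≠ i, x₄ j = d j) (hc : ∀ j ≠ i, c j = s j) (hd : ∀ j ≠ i, d j = s j)
    (r₁ : x₁ i ⊗ x₂ i ≅ a i) (r₂ : x₃ i ⊗ x₄ i ≅ b i) (r₃ : a i ⊗ b i ≅ s i)
    (r₄ : x₁ i ⊗ x₃ i ≅ c i) (r₅ : x₂ i ⊗ x₄ i ≅ d i) (r₆ : c i ⊗ d i ≅ s i)
    (h : (r₁.hom ⊗ₘ r₂.hom) ≫ r₃.hom = tensorμ _ _ _ _ ≫ (r₄.hom ⊗ₘ r₅.hom) ≫ r₆.hom) :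
    ((F.sumIso h₁ h₂ r₁).hom ⊗ₘ (F.sumIso h₃ h₄ r₂).hom) ≫ (F.sumIso ha hb r₃).hom =
      tensorμ _ _ _ _ ≫ ((F.sumIso h₁' h₃' r₄).hom ⊗ₘ (F.sumIso h₂' h₄' r₅).hom) ≫
        (F.sumIso hc hd r₆).hom := by
  rw [F.sumIso_eq_sumOf s ha h₁ h₂ r₁, F.sumIso_eq_sumOf s hb h₃ h₄ r₂,
    F.sumIso_eq_sumOf s hc h₁' h₃' r₄, F.sumIso_eq_sumOf s hd h₂' h₄' r₅]
  exact F.sumOf_tensorμ i s r₁ r₂ r₃ r₄ r₅ r₆ h _ _ _ _ _ _ _ _ _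

lemma sumIso_interchange {i j : I} (hij : i ≠ j) {x₁ x₂ x₃ x₄ a b c d s : ∀ i, (A i).C}
    (h₁ : ∀ l ≠ i, x₁ l = a l) (h₂ : ∀ l ≠ i, x₂ l = a l) (h₃ : ∀ l ≠ i, x₃ l = b l)
    (h₄ : ∀ l ≠ i, x₄ l = b l) (ha : ∀ l ≠ j, a l = s l) (hb : ∀ l ≠ j, b l = s l)
    (h₁' : ∀ l ≠ j, x₁ l = c l) (h₃' : ∀ l ≠ j, x₃ l = c l)
    (h₂' : ∀ l ≠ j, x₂ l = d l) (h₄' : ∀ l ≠ j, x₄ l = d l)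
    (hc : ∀ l ≠ i, c l = s l) (hd : ∀ l ≠ i, d l = s l) (r₁ : x₁ i ⊗ x₂ i ≅ a i)
    (r₂ : x₃ i ⊗ x₄ i ≅ b i) (r₃ : a j ⊗ b j ≅ s j) (r₄ : x₁ j ⊗ x₃ j ≅ c j)
    (r₅ : x₂ j ⊗ x₄ j ≅ d j) (r₆ : c i ⊗ d i ≅ s i) (e₁ : HEq r₁.hom r₆.hom)
    (e₂ : HEq r₂.hom r₆.hom) (e₄ : HEq r₄.hom r₃.hom) (e₅ : HEq r₅.hom r₃.hom) :
    ((F.sumIso h₁ h₂ r₁).hom ⊗ₘ (F.sumIso h₃ h₄ r₂).hom) ≫ (F.sumIso ha hb r₃).hom =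
      tensorμ _ _ _ _ ≫ ((F.sumIso h₁' h₃' r₄).hom ⊗ₘ (F.sumIso h₂' h₄' r₅).hom) ≫
        (F.sumIso hc hd r₆).hom := by
  obtain ⟨w₁, k₁, m₁, p₁, q₁, E₁⟩ := F.exists_sumIso h₁ h₂ r₁
  obtain ⟨w₂, k₂, m₂, p₂, q₂, E₂⟩ := F.exists_sumIso h₃ h₄ r₂
  obtain ⟨w₄, k₄, m₄, p₄, q₄, E₄⟩ := F.exists_sumIso h₁' h₃' r₄
  obtain ⟨w₅, k₅, m₅, p₅, q₅, E₅⟩ := F.exists_sumIso h₂' h₄' r₅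
  have hji := hij.symm
  have w₁j : w₁ j = a j := (k₁.2 j hji).1.symm.trans (h₁ j hji)
  have w₂j : w₂ j = b j := (k₂.2 j hji).1.symm.trans (h₃ j hji)
  have w₄i : w₄ i = c i := (k₄.2 i hij).1.symm.trans (h₁' i hij)
  have w₅i : w₅ i = d i := (k₅.2 i hij).1.symm.trans (h₂' i hij)
  have hw₁ : ∀ l ≠ i, w₁ l = a l := fun l hl => (k₁.2 l hl).1.symm.trans (h₁ l hl)
  have hw₂ : ∀ l ≠ i, w₂ l = b l := fun l hl => (k₂.2 l hl).1.symm.trans (h₃ l hl)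
  have hw₄ : ∀ l ≠ j, w₄ l = c l := fun l hl => (k₄.2 l hl).1.symm.trans (h₁' l hl)
  have hw₅ : ∀ l ≠ j, w₅ l = d l := fun l hl => (k₅.2 l hl).1.symm.trans (h₂' l hl)
  obtain ⟨w, hw⟩ : ∃ w, SumAt j w₁ w₂ w := by
    refine exists_sumAt (z := w₂) (fun l hl => ?_) fun _ _ => rfl
    by_cases hli : l = i
    · subst hli
      rw [k₁.1, k₂.1, h₁' l hl, h₃' l hl, h₂' l hl, h₄' l hl]
    · rw [hw₁ l hli, hw₂ l hli, ha l hl, hb l hl]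
  have hw' : SumAt i w₄ w₅ w := by
    refine ⟨?_, fun l hl => ?_⟩
    · rw [w₄i, w₅i, ← (hw.2 i hij).1, k₁.1, h₁' i hij, h₂' i hij]
    · by_cases hlj : l = j
      · subst hlj
        rw [hw.1, k₄.1, k₅.1, w₁j, w₂j, h₁ l hl, h₂ l hl, h₃ l hl, h₄ l hl]
        exact ⟨rfl, rfl⟩
      · rw [hw₄ l hlj, hw₅ l hlj, ← (hw.2 l hlj).1, hw₁ l hl, ← h₁ l hl, ← h₁' l hlj,
          ← h₂' l hlj, h₂ l hl, h₁ l hl]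
        exact ⟨rfl, rfl⟩
  have wi : w i = c i ⊗ d i := by rw [hw'.1, w₄i, w₅i]
  have wj : w j = a j ⊗ b j := by rw [hw.1, w₁j, w₂j]
  have wl : ∀ l ≠ i, l ≠ j → w l = s l := fun l hl hl' => by
    rw [← (hw.2 l hl').1, hw₁ l hl, ha l hl']
  obtain ⟨k, hki, hkj, hkl⟩ : ∃ k : w ⟶ s, HEq (k i) r₆.hom ∧ HEq (k j) r₃.hom ∧
      ∀ l ≠ i, l ≠ j → IsId (k l) := by
    have : ∀ l, ∃ k : w l ⟶ s l, (∀ e : l = i, HEq k r₆.hom) ∧ (∀ e : l = j, HEq k r₃.hom) ∧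
        (l ≠ i → l ≠ j → IsId k) := fun l => by
      by_cases hl : l = i
      · subst hl
        obtain ⟨k, hk⟩ := exists_heq_hom wi rfl r₆.hom
        exact ⟨k, fun _ => hk, fun e => (hij e).elim, fun e => (e rfl).elim⟩
      · by_cases hl' : l = j
        · subst hl'
          obtain ⟨k, hk⟩ := exists_heq_hom wj rfl r₃.hom
          exact ⟨k, fun e => (hl e).elim, fun _ => hk, fun _ e => (e rfl).elim⟩
        · exact ⟨eqToHom (wl l hl hl'), fun e => (hl e).elim, fun e => (hl' e).elim,
            fun _ _ => isId_eqToHom _⟩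
    choose k h₁ h₂ h₃ using this
    exact ⟨k, h₁ i rfl, h₂ j rfl, h₃⟩
  have hsi : a i = s i := ha i hij
  have hsi' : b i = s i := hb i hij
  have key₁ : (F.functor.map m₁ ⊗ₘ F.functor.map m₂) ≫ (F.sumIso ha hb r₃).hom =
      (F.δ j hw).hom ≫ F.functor.map k := by
    refine F.map_sumIso hw ha hb r₃ m₁ m₂ k ?_ (fun l hl => ?_) fun l hl => ?_
    · exact (IsId.comp_heq ((q₁ j hji).tensorHom (q₂ j hji)) _).trans hkj.symm
    · by_cases hli : l = i
      · subst hli; exact p₁.trans (e₁.trans hki.symm)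
      · exact (q₁ l hli).heq (hkl l hli hl) (hw.2 l hl).1
    · by_cases hli : l = i
      · subst hli; exact p₂.trans (e₂.trans hki.symm)
      · exact (q₂ l hli).heq (hkl l hli hl) (hw.2 l hl).2
  have key₂ : (F.functor.map m₄ ⊗ₘ F.functor.map m₅) ≫ (F.sumIso hc hd r₆).hom =
      (F.δ i hw').hom ≫ F.functor.map k := by
    refine F.map_sumIso hw' hc hd r₆ m₄ m₅ k ?_ (fun l hl => ?_) fun l hl => ?_
    · exact (IsId.comp_heq ((q₄ i hij).tensorHom (q₅ i hij)) _).trans hki.symm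
    · by_cases hlj : l = j
      · subst hlj; exact p₄.trans (e₄.trans hkj.symm)
      · exact (q₄ l hlj).heq (hkl l hl hlj) (hw'.2 l hl).1
    · by_cases hlj : l = j
      · subst hlj; exact p₅.trans (e₅.trans hkj.symm)
      · exact (q₅ l hlj).heq (hkl l hl hlj) (hw'.2 l hl).2
  rw [E₁, E₂, E₄, E₅, ← tensorHom_comp_tensorHom, ← tensorHom_comp_tensorHom, assoc,
    assoc, key₁, key₂, ← assoc, F.δ_δ i j hij k₁ k₂ hw k₄ k₅ hw']
  simp only [assoc]

end SumIso

end KLinear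

end

section

open MonoidalCategory

/-! ### The multicategory of symmetric monoidal categories -/

lemma isId_eqToIso {C : Type*} [Category C] {X Y : C} (h : X = Y) : IsId (eqToIso h).hom :=
  ⟨h, rfl⟩

section SumAt

lemma SumAt.reindex {I J : Type} (e : I ≃ J) {A : J → SMCat.{u}} {i : I}
    {x y z : ∀ i, (A (e i)).C} (h : SumAt (A := fun i => A (e i)) i x y z) :
    SumAt (e i) ((reindex e fun j => (A j).C).obj x) ((reindex e fun j => (A j).C).obj y)
      ((reindex e fun j => (A j).C).obj z) := by
  refine ⟨by rw [reindex_obj, reindex_obj, reindex_obj, h.1], fun j hj => ?_⟩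
  obtain ⟨l, rfl⟩ := e.surjective j
  rw [reindex_obj, reindex_obj, reindex_obj]
  exact h.2 l fun h => hj (h ▸ rfl)

lemma SumAt.of_comap {I J : Type} (e : I ≃ J) {A : J → SMCat.{u}} {i : I}
    {x y z : ∀ j, (A j).C} (h : SumAt (A := fun i => A (e i)) i (fun i => x (e i))
      (fun i => y (e i)) fun i => z (e i)) : SumAt (e i) x y z := by
  refine ⟨h.1, fun j hj => ?_⟩
  obtain ⟨l, rfl⟩ := e.surjective j
  exact h.2 l fun h => hj (h ▸ rfl)

variable {I : Type} {K : I → Type} {A : ∀ i, K i → SMCat.{u}}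

lemma SumAt.slice {l : Σ i, K i} {x y z : ∀ l : Σ i, K i, (A l.1 l.2).C}
    (h : SumAt (A := fun l : Σ i, K i => A l.1 l.2) l x y z) :
    SumAt l.2 (fun k => x ⟨l.1, k⟩) (fun k => y ⟨l.1, k⟩) (fun k => z ⟨l.1, k⟩) := by
  obtain ⟨i, k⟩ := l
  exact ⟨h.1, fun m hm => h.2 ⟨i, m⟩ fun e => hm (by cases e; rfl)⟩

lemma SumAt.slice_left {l : Σ i, K i} {x y z : ∀ l : Σ i, K i, (A l.1 l.2).C}
    (h : SumAt (A := fun l : Σ i, K i => A l.1 l.2) l x y z) {j : I} (hj : j ≠ l.1) :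
    (fun k => x ⟨j, k⟩) = fun k => z ⟨j, k⟩ :=
  funext fun k => (h.2 ⟨j, k⟩ fun e => hj (by cases e; rfl)).1

lemma SumAt.slice_right {l : Σ i, K i} {x y z : ∀ l : Σ i, K i, (A l.1 l.2).C}
    (h : SumAt (A := fun l : Σ i, K i => A l.1 l.2) l x y z) {j : I} (hj : j ≠ l.1) :
    (fun k => y ⟨j, k⟩) = fun k => z ⟨j, k⟩ :=
  funext fun k => (h.2 ⟨j, k⟩ fun e => hj (by cases e; rfl)).2

end SumAt

namespace KLinear

section Ext

variable {I : Type} [Finite I] {A : I → SMCat.{u}} {B : SMCat.{u}}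

lemma ext {F G : KLinear I A B} (h : F.functor = G.functor)
    (hδ : ∀ (i : I) {x y z : ∀ i, (A i).C} (h : SumAt i x y z),
      HEq (F.δ i h).hom (G.δ i h).hom) : F = G := by
  obtain ⟨F₀, δ⟩ := F
  obtain ⟨G₀, δ'⟩ := G
  obtain rfl : F₀ = G₀ := h
  obtain rfl : @δ = @δ' := by
    funext i x y z h
    exact Iso.ext (eq_of_heq (hδ i h))
  rfl

/-- A cell, as an arrow in the category of functors. -/
def arr {F G : KLinear I A B} (α : F ⟶ G) : Arrow ((∀ i, (A i).C) ⥤ B.C) := Arrow.mk (cell α)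

lemma functor_ext {X : Type*} [Category X] {L R : X ⥤ KLinear I A B}
    (h : ∀ {F G : X} (α : F ⟶ G), arr (L.map α) = arr (R.map α))
    (hδ : ∀ (F : X) (i : I) {x y z : ∀ i, (A i).C} (h : SumAt i x y z),
      HEq ((L.obj F).δ i h).hom ((R.obj F).δ i h).hom) : L = R := by
  have h₀ : ∀ F, L.obj F = R.obj F := fun F =>
    ext (left_eq_of_arrow (h (𝟙 F))) (hδ F)
  refine Functor.hext h₀ fun F G α => ?_
  have key : ∀ {F₁ G₁ F₂ G₂ : KLinear I A B} (α : F₁ ⟶ G₁) (β : F₂ ⟶ G₂), F₁ = F₂ → G₁ = G₂ →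
      arr α = arr β → HEq α β := by
    rintro F₁ G₁ _ _ α β rfl rfl h
    exact heq_of_eq (KLinear.Hom.ext (eq_of_heq (heq_of_arrow h)))
  exact key _ _ (h₀ F) (h₀ G) (h α)

end Ext

/-- The identity. -/
def id (A : SMCat.{u}) : KLinear Unit (fun _ => A) A where
  functor := Pi.eval (fun _ : Unit => A.C) ()
  δ _ _ _ _ h := eqToIso h.1.symm
  δ_naturality i x y z x' y' z' h h' f g k hk _ := by
    apply eq_of_heq
    exact (IsId.heq_comp _ (isId_eqToIso _)).trans
      (hk.symm.trans (IsId.comp_heq (isId_eqToIso _) _).symm)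
  obj_unit _ _ h := h
  map_unit _ _ _ h := h
  δ_unit _ _ _ _ _ _ := isId_eqToIso _
  δ_assoc i x y w xy yw s s' h₁ h₂ h₃ h₄ a ha _ := by
    apply eq_of_heq
    refine (IsId.comp_heq ?_ _).trans ((IsId.comp_heq (isId_eqToIso _) _).trans (ha.trans ?_))
    · rw [← tensorHom_id]
      exact (isId_eqToIso _).tensorHom (isId_id _)
    · refine (IsId.heq_comp _ (IsId.comp ?_ (isId_eqToIso _))).symm
      rw [← id_tensorHom]
      exact (isId_id _).tensorHom (isId_eqToIso _)
  δ_symm i x y s s' h h' a ha _ := by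
    apply eq_of_heq
    exact (IsId.comp_heq (isId_eqToIso _) _).trans
      (ha.trans (IsId.heq_comp _ (isId_eqToIso _)).symm)
  δ_δ i j _ _ _ _ _ _ _ _ _ hij := (hij rfl).elim

/-- The action of a bijection. -/
def act {I J : Type} [Finite I] [Finite J] (e : I ≃ J) {A : J → SMCat.{u}}
    {B : SMCat.{u}} (F : KLinear J A B) : KLinear I (fun i => A (e i)) B where
  functor := reindex e (fun j => (A j).C) ⋙ F.functor
  δ i _ _ _ h := F.δ (e i) (h.reindex e)
  δ_naturality i x y z x' y' z' h h' f g k hk hj := by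
    have hm : ∀ {x y : ∀ i, (A (e i)).C} (f : x ⟶ y) (i : I),
      HEq ((reindex e fun j => (A j).C).map f (e i)) (f i) := fun f i => reindex_map e (fun j => (A j).C) f i
    have ho : ∀ (x : ∀ i, (A (e i)).C) (i : I),
      (reindex e fun j => (A j).C).obj x (e i) = x i := fun x i => reindex_obj e (fun j => (A j).C) x i
    refine F.δ_naturality (e i) _ _ _ _ _ ((hm k i).trans (hk.trans (tensorHom_heq (ho x i).symm
      (ho x' i).symm (ho y i).symm (ho y' i).symm (hm f i).symm (hm g i).symm))) fun j hj' => ?_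
    obtain ⟨l, rfl⟩ := e.surjective j
    obtain ⟨h₁, h₂⟩ := hj l fun h => hj' (h ▸ rfl)
    exact ⟨(hm f l).trans (h₁.trans (hm k l).symm), (hm g l).trans (h₂.trans (hm k l).symm)⟩
  obj_unit x i h := F.obj_unit _ (e i) ((reindex_obj e (fun j => (A j).C) x i).trans h)
  map_unit {x y} f i h h' := F.map_unit _ (e i) ((reindex_obj e (fun j => (A j).C) x i).trans h)
    (isId_of_heq (reindex_obj e (fun j => (A j).C) x i).symm
      (reindex_obj e (fun j => (A j).C) y i).symm (reindex_map e (fun j => (A j).C) f i).symm h')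
  δ_unit i x y z h hu := by
    refine F.δ_unit (e i) _ ?_
    rw [reindex_obj e (fun j => (A j).C), reindex_obj e (fun j => (A j).C)]
    refine hu.imp_right (Or.imp_right ?_)
    rintro ⟨j, hj, h⟩
    exact ⟨e j, fun h => hj (e.injective h), (reindex_obj e (fun j => (A j).C) z j).trans h⟩
  δ_assoc i x y w xy yw s s' h₁ h₂ h₃ h₄ a ha ha' := by
    refine F.δ_assoc (e i) _ _ _ _ _ ((reindex_map e (fun j => (A j).C) a i).trans
      (ha.trans ?_)) (isAlong_reindex e ha')
    exact associator_heq (reindex_obj e (fun j => (A j).C) x i).symm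
      (reindex_obj e (fun j => (A j).C) y i).symm (reindex_obj e (fun j => (A j).C) w i).symm
  δ_symm i x y s s' h h' a ha ha' := by
    refine F.δ_symm (e i) _ _ _ ((reindex_map e (fun j => (A j).C) a i).trans
      (ha.trans ?_)) (isAlong_reindex e ha')
    exact braiding_heq (reindex_obj e (fun j => (A j).C) x i).symm
      (reindex_obj e (fun j => (A j).C) y i).symm
  δ_δ i j _ _ _ _ _ _ _ _ _ hij h₁ h₂ h₃ h₄ h₅ h₆ :=
    F.δ_δ (e i) (e j) (fun h => hij (e.injective h)) _ _ _ _ _ _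

section Comp

variable {I : Type} [Finite I] {K : I → Type} [∀ i, Finite (K i)] {A : ∀ i, K i → SMCat.{u}}
  {B : I → SMCat.{u}} {C : SMCat.{u}} (G : KLinear I B C) (F : ∀ i, KLinear (K i) (A i) (B i))

/-- The values of the functors `F i`. -/
abbrev vals (x : ∀ l : Σ i, K i, (A l.1 l.2).C) (i : I) : (B i).C :=
  (F i).functor.obj fun k => x ⟨i, k⟩

omit [Finite I] in
lemma vals_left {l : Σ i, K i} {x y z : ∀ l : Σ i, K i, (A l.1 l.2).C}
    (h : SumAt (A := fun l : Σ i, K i => A l.1 l.2) l x y z) :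
    ∀ j, j ≠ l.1 → vals F x j = vals F z j := fun j hj =>
  congrArg (F j).functor.obj (h.slice_left hj)

omit [Finite I] in
lemma vals_right {l : Σ i, K i} {x y z : ∀ l : Σ i, K i, (A l.1 l.2).C}
    (h : SumAt (A := fun l : Σ i, K i => A l.1 l.2) l x y z) :
    ∀ j, j ≠ l.1 → vals F y j = vals F z j := fun j hj =>
  congrArg (F j).functor.obj (h.slice_right hj)

/-- The isomorphism `δ` of a composite. -/
def compδ (l : Σ i, K i) {x y z : ∀ l : Σ i, K i, (A l.1 l.2).C}
    (h : SumAt (A := fun l : Σ i, K i => A l.1 l.2) l x y z) :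
    G.functor.obj (vals F x) ⊗ G.functor.obj (vals F y) ≅ G.functor.obj (vals F z) :=
  G.sumIso (i := l.1) (vals_left F h) (vals_right F h) ((F l.1).δ l.2 h.slice)

omit [Finite I] in
lemma isAlong_vals {l : Σ i, K i} {x y : ∀ l : Σ i, K i, (A l.1 l.2).C} {a : x ⟶ y}
    (h : IsAlong l a) : IsAlong (A := fun i => (B i).C) (x := vals F x) (y := vals F y) l.1
      fun i => (F i).functor.map fun k => a ⟨i, k⟩ := fun j hj =>
  IsId.map _ (isId_pi fun k => h ⟨j, k⟩ fun e => hj (by cases e; rfl))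

/-- Composition. -/
def comp : KLinear (Σ i, K i) (fun l => A l.1 l.2) C where
  functor := multicomp G.functor fun i => (F i).functor
  δ l _ _ _ h := compδ G F l h
  δ_naturality := by
    rintro ⟨i, k⟩ x y z x' y' z' h h' f g a ha haj
    refine G.sumIso_naturality _ _ _ _ _ _ (fun j => (F j).functor.map fun k => f ⟨j, k⟩)
      (fun j => (F j).functor.map fun k => g ⟨j, k⟩) (fun j => (F j).functor.map fun k => a ⟨j, k⟩)
      ?_ (fun j hj => ?_) fun j hj => ?_
    · exact (F i).δ_naturality k _ _ _ _ _ ha fun m hm => haj ⟨i, m⟩ fun e => hm (by cases e; rfl)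
    · exact map_heq _ (h.slice_left hj) (h'.slice_left hj) (pi_heq (h.slice_left hj)
        (h'.slice_left hj) fun m => (haj ⟨j, m⟩ fun e => hj (by cases e; rfl)).1)
    · exact map_heq _ (h.slice_right hj) (h'.slice_right hj) (pi_heq (h.slice_right hj)
        (h'.slice_right hj) fun m => (haj ⟨j, m⟩ fun e => hj (by cases e; rfl)).2)
  obj_unit x l h := G.obj_unit _ l.1 ((F l.1).obj_unit _ l.2 h)
  map_unit f l h h' := G.map_unit _ l.1 ((F l.1).obj_unit _ l.2 h) ((F l.1).map_unit _ l.2 h h')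
  δ_unit := by
    rintro ⟨i, k⟩ x y z h (hu | hu | ⟨⟨j, m⟩, hj, hu⟩)
    · exact G.isId_sumIso _ _ _ (Or.inl ⟨(F i).δ_unit k _ (Or.inl hu),
        Or.inl ((F i).obj_unit _ k hu)⟩)
    · exact G.isId_sumIso _ _ _ (Or.inl ⟨(F i).δ_unit k _ (Or.inr (Or.inl hu)),
        Or.inr ((F i).obj_unit _ k hu)⟩)
    · by_cases hij : j = i
      · subst hij
        have hm : m ≠ k := fun e => hj (by rw [e])
        exact G.isId_sumIso _ _ _ (Or.inl ⟨(F j).δ_unit k _ (Or.inr (Or.inr ⟨m, hm, hu⟩)),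
          Or.inl ((F j).obj_unit _ m ((h.2 ⟨j, m⟩ hj).1.trans hu))⟩)
      · exact G.isId_sumIso _ _ _ (Or.inr ⟨j, hij, (F j).obj_unit _ m hu⟩)
  δ_assoc := by
    rintro ⟨i, k⟩ x y w xy yw s s' h₁ h₂ h₃ h₄ a ha ha'
    exact G.sumIso_assoc _ _ _ _ _ _ _ _ _ _ _ _ (fun j => (F j).functor.map fun k => a ⟨j, k⟩)
      (isAlong_vals F ha') ((F i).δ_assoc k _ _ _ _ (fun k => a ⟨i, k⟩) ha
        fun m hm => ha' ⟨i, m⟩ fun e => hm (by cases e; rfl))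
  δ_symm := by
    rintro ⟨i, k⟩ x y s s' h h' a ha ha'
    exact G.sumIso_symm _ _ _ _ _ _ (fun j => (F j).functor.map fun k => a ⟨j, k⟩)
      (isAlong_vals F ha') ((F i).δ_symm k _ _ (fun k => a ⟨i, k⟩) ha
        fun m hm => ha' ⟨i, m⟩ fun e => hm (by cases e; rfl))
  δ_δ := by
    rintro ⟨i, k⟩ ⟨j, m⟩ x₁ x₂ x₃ x₄ a b c d s hij h₁ h₂ h₃ h₄ h₅ h₆
    by_cases e : i = j
    · subst e
      exact G.sumIso_tensorμ _ _ _ _ _ _ _ _ _ _ _ _ _ _ _ _ _ _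
        ((F i).δ_δ k m (fun e => hij (by rw [e])) _ _ _ _ _ _)
    · have e' : j ≠ i := Ne.symm e
      exact G.sumIso_interchange e _ _ _ _ _ _ _ _ _ _ _ _ _ _ _ _ _ _
        (δ_congr _ rfl (h₄.slice_left e) (h₅.slice_left e) (h₃.slice_left e) _ _)
        (δ_congr _ rfl (h₄.slice_right e) (h₅.slice_right e) (h₃.slice_right e) _ _)
        (δ_congr _ rfl (h₁.slice_left e') (h₂.slice_left e') (h₆.slice_left e') _ _)
        (δ_congr _ rfl (h₁.slice_right e') (h₂.slice_right e') (h₆.slice_right e') _ _)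

lemma comp_sumIso {i : I} {k : K i} {x y z : ∀ l : Σ i, K i, (A l.1 l.2).C}
    (hx : ∀ l, l ≠ ⟨i, k⟩ → x l = z l) (hy : ∀ l, l ≠ ⟨i, k⟩ → y l = z l)
    (r : x ⟨i, k⟩ ⊗ y ⟨i, k⟩ ≅ z ⟨i, k⟩) (hx₁ : ∀ j ≠ i, vals F x j = vals F z j)
    (hy₁ : ∀ j ≠ i, vals F y j = vals F z j) (hx₂ : ∀ m ≠ k, x ⟨i, m⟩ = z ⟨i, m⟩)
    (hy₂ : ∀ m ≠ k, y ⟨i, m⟩ = z ⟨i, m⟩) :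
    ((comp G F).sumIso hx hy r).hom = (G.sumIso (z := vals F z) hx₁ hy₁
      ((F i).sumIso (x := fun k => x ⟨i, k⟩) (y := fun k => y ⟨i, k⟩) (z := fun k => z ⟨i, k⟩)
        hx₂ hy₂ r)).hom := by
  obtain ⟨w, h, a, ha, ha', e⟩ := (comp G F).exists_sumIso hx hy r
  rw [e]
  have := G.sumIso_naturality (vals_left F h) (vals_right F h) ((F i).δ k h.slice) hx₁ hy₁
    ((F i).sumIso (x := fun k => x ⟨i, k⟩) (y := fun k => y ⟨i, k⟩) (z := fun k => z ⟨i, k⟩)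
        hx₂ hy₂ r) (𝟙 _) (𝟙 _) (fun j => (F j).functor.map fun k => a ⟨j, k⟩) ?_
    (fun j hj => ?_) fun j hj => ?_
  · rw [fmap_id, fmap_id, id_tensorHom_id,
      id_comp] at this
    exact this.symm
  · change (𝟙 _ ⊗ₘ 𝟙 _) ≫ _ = _
    rw [id_tensorHom_id, id_comp]
    exact (F i).sumIso_hom_eq _ _ r h.slice (fun k => a ⟨i, k⟩) ha
      fun m hm => ha' ⟨i, m⟩ fun e => hm (by cases e; rfl)
  · exact (isId_id _).heq (isAlong_vals F ha' j hj) (vals_left F h j hj)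
  · exact (isId_id _).heq (isAlong_vals F ha' j hj) (vals_right F h j hj)

end Comp

lemma id_sumIso (A : SMCat.{u}) {x y z : Unit → A.C} (hx : ∀ j, j ≠ () → x j = z j)
    (hy : ∀ j, j ≠ () → y j = z j) (r : x () ⊗ y () ≅ z ()) :
    HEq ((id A).sumIso (i := ()) hx hy r).hom r.hom := by
  obtain ⟨w, h, k, hk, -, e⟩ := (id A).exists_sumIso hx hy r
  rw [e]
  exact (IsId.comp_heq (isId_eqToIso h.1.symm) _).trans hk

section Act

variable {I J : Type} [Finite I] [Finite J] (e : I ≃ J) {A : J → SMCat.{u}} {B : SMCat.{u}}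
  (F : KLinear J A B)

lemma act_δ (i : I) {x y z : ∀ j, (A j).C} (h : SumAt (e i) x y z)
    (h' : SumAt (A := fun i => A (e i)) i (fun i => x (e i)) (fun i => y (e i))
      (fun i => z (e i))) : HEq ((act e F).δ i h').hom (F.δ (e i) h).hom :=
  F.δ_congr rfl (Functor.congr_obj (comap_reindex e fun j => (A j).C) x)
    (Functor.congr_obj (comap_reindex e fun j => (A j).C) y)
    (Functor.congr_obj (comap_reindex e fun j => (A j).C) z) _ _

lemma act_functor : Pi.comap (fun j => (A j).C) e ⋙ (act e F).functor = F.functor :=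
  left_eq_of_arrow (preArr_comap_reindex e (fun j => (A j).C) (Arrow.mk (𝟙 F.functor)))

lemma act_obj (x : ∀ j, (A j).C) :
    (act e F).functor.obj (fun i => x (e i)) = F.functor.obj x :=
  Functor.congr_obj (act_functor e F) x

lemma act_map {x y : ∀ j, (A j).C} (f : x ⟶ y) :
    HEq ((act e F).functor.map (X := fun i => x (e i)) (Y := fun i => y (e i)) fun i => f (e i))
      (F.functor.map f) :=
  functor_map_heq (act_functor e F) f

lemma act_sumIso {i : I} {x y z : ∀ j, (A j).C} (hx : ∀ l ≠ i, x (e l) = z (e l))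
    (hy : ∀ l ≠ i, y (e l) = z (e l)) (hx' : ∀ l, l ≠ e i → x l = z l)
    (hy' : ∀ l, l ≠ e i → y l = z l) (r : x (e i) ⊗ y (e i) ≅ z (e i)) :
    HEq ((act e F).sumIso (x := fun i => x (e i)) (y := fun i => y (e i)) (z := fun i => z (e i))
      hx hy r).hom (F.sumIso hx' hy' r).hom := by
  obtain ⟨w, h, k, hk, hk', E⟩ := F.exists_sumIso hx' hy' r
  have h' : SumAt (A := fun i => A (e i)) i (fun i => x (e i)) (fun i => y (e i))
      (fun i => w (e i)) := ⟨h.1, fun j hj => h.2 (e j) fun h => hj (e.injective h)⟩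
  rw [E, (act e F).sumIso_hom_eq hx hy r h' (fun i => k (e i)) hk
    fun j hj => hk' (e j) fun h => hj (e.injective h)]
  refine heq_comp ?_ (act_obj e F w) (act_obj e F z) (act_δ e F i h h') (act_map e F k)
  rw [act_obj, act_obj]

end Act

end KLinear

/-- The action of a bijection on multilinear functors. -/
def klinearAct {I J : Type} [Finite I] [Finite J] (e : I ≃ J) (A : J → SMCat.{u})
    (B : SMCat.{u}) : KLinear J A B ⥤ KLinear I (fun i => A (e i)) B where
  obj F := F.act e
  map α := ⟨Functor.whiskerLeft _ (KLinear.cell α), fun i _ _ _ h => KLinear.Hom.δ_nat α (e i) _,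
    fun x i h => KLinear.Hom.app_unit α _ (e i)
      ((reindex_obj e (fun j => (A j).C) x i).trans h)⟩

/-- Composition of multilinear functors. -/
def klinearComp {I : Type} [Finite I] {K : I → Type} [∀ i, Finite (K i)]
    (A : ∀ i, K i → SMCat.{u}) (B : I → SMCat.{u}) (C : SMCat.{u}) :
    KLinear I B C × (∀ i, KLinear (K i) (A i) (B i)) ⥤
      KLinear (Σ i, K i) (fun x => A x.1 x.2) C where
  obj F := F.1.comp F.2
  map {F G} α := ⟨multicompHom (KLinear.cell α.1) fun i => KLinear.cell (α.2 i), by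
      rintro ⟨i, k⟩ x y z h
      change (KLinear.compδ F.1 F.2 ⟨i, k⟩ h).hom ≫ (KLinear.cell α.1).app _ ≫ G.1.functor.map _ =
        (((KLinear.cell α.1).app _ ≫ G.1.functor.map _) ⊗ₘ
          ((KLinear.cell α.1).app _ ≫ G.1.functor.map _)) ≫ (KLinear.compδ G.1 G.2 ⟨i, k⟩ h).hom
      rw [← tensorHom_comp_tensorHom, assoc]
      have h₁ := KLinear.sumIso_cell α.1 (KLinear.vals_left F.2 h) (KLinear.vals_right F.2 h)
        ((F.2 i).δ k h.slice)
      have h₂ := G.1.sumIso_naturality (KLinear.vals_left F.2 h) (KLinear.vals_right F.2 h)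
        ((F.2 i).δ k h.slice) (KLinear.vals_left G.2 h) (KLinear.vals_right G.2 h)
        ((G.2 i).δ k h.slice) (fun j => (KLinear.cell (α.2 j)).app _)
        (fun j => (KLinear.cell (α.2 j)).app _) (fun j => (KLinear.cell (α.2 j)).app _)
        (KLinear.Hom.δ_nat (α.2 i) k h.slice).symm
        (fun j hj => app_heq_of_eq _ (h.slice_left hj))
        (fun j hj => app_heq_of_eq _ (h.slice_right hj))
      refine ((assoc _ _ _).symm.trans (congrArg (· ≫ _) h₁)).trans
        ((assoc _ _ _).trans (congrArg (_ ≫ ·) h₂.symm)),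
    fun x l h => IsId.comp (KLinear.Hom.app_unit α.1 _ l.1 ((F.2 l.1).obj_unit _ l.2 h))
      (G.1.map_unit _ l.1 ((F.2 l.1).obj_unit _ l.2 h) (KLinear.Hom.app_unit (α.2 l.1) _ l.2 h))⟩
  map_id F := KLinear.Hom.ext (multicompHom_id F.1.functor fun i => (F.2 i).functor)
  map_comp α β := KLinear.Hom.ext (multicompHom_comp (KLinear.cell α.1) (KLinear.cell β.1)
    (fun i => KLinear.cell (α.2 i)) fun i => KLinear.cell (β.2 i))

lemma klinearAct_arr {I J : Type} [Finite I] [Finite J] (e : I ≃ J) (A : J → SMCat.{u})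
    (B : SMCat.{u}) {F G : KLinear J A B} (α : F ⟶ G) :
    preArr (Pi.comap (fun j => (A j).C) e) (KLinear.arr ((klinearAct e A B).map α)) =
      KLinear.arr α :=
  preArr_comap_reindex e (fun j => (A j).C) (KLinear.arr α)

end

section

open MonoidalCategory

lemma SumAt.exists_comap {I J : Type} (e : I ≃ J) {A : J → SMCat.{u}} {i : I}
    {x y z : ∀ i, (A (e i)).C} (h : SumAt (A := fun i => A (e i)) i x y z) :
    ∃ x' y' z' : ∀ j, (A j).C, SumAt (e i) x' y' z' ∧ x = (fun i => x' (e i)) ∧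
      y = (fun i => y' (e i)) ∧ z = fun i => z' (e i) := by
  obtain ⟨x, rfl⟩ := exists_comap_obj e (fun j => (A j).C) x
  obtain ⟨y, rfl⟩ := exists_comap_obj e (fun j => (A j).C) y
  obtain ⟨z, rfl⟩ := exists_comap_obj e (fun j => (A j).C) z
  exact ⟨x, y, z, h.of_comap e, rfl, rfl, rfl⟩

/-- The components of multilinear functors. -/
def smComponents : Components KLinear.{u} (L := Unit) (Q := Unit)
    (fun _ => ⟨0, Fin.elim0⟩) fun A _ _ => A.C where
  id A := KLinear.id A
  act e A B := klinearAct e A B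
  comp A B C := klinearComp A B C
  arr α _ _ _ _ := KLinear.arr α
  exists_concat _ _ _ := ⟨(), ⟨Concat.nil _⟩⟩
  id_arr _ _ _ := rfl
  act_arr e _ _ _ _ α _ _ _ _ _ _ := klinearAct_arr e _ _ α
  comp_arr _ _ _ _ _ _ _ _ _ := rfl

/-- The multicategory `SMC`. -/
def smMulticategory : Multicategory SMCat.{u} KLinear.{u} where
  id A := KLinear.id A
  act e A B := klinearAct e A B
  comp A B C := klinearComp A B C
  act_refl {I} _ A B := KLinear.functor_ext (fun α => klinearAct_arr (Equiv.refl I) A B α)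
    fun F i x y z h => F.act_δ (Equiv.refl I) i h h
  act_trans {I J L} _ _ _ e e' A B := KLinear.functor_ext (fun α => smComponents.arr_act_trans () e e' α (m := fun _ => ()) (t := ()) (Concat.nil _)) fun F i x y z h => by
    obtain ⟨x, y, z, h', rfl, rfl, rfl⟩ := h.exists_comap (e.trans e')
    have h'' : SumAt (A := fun j => A (e' j)) (e i) (fun j => x (e' j)) (fun j => y (e' j))
      (fun j => z (e' j)) := h.of_comap (A := fun j => A (e' j)) e
    exact (F.act_δ (e.trans e') i h' h).trans (((F.act e').act_δ e i h'' h).trans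
      (F.act_δ e' (e i) h' h'')).symm
  act_comp_left {I J} _ _ e K _ A B C := KLinear.functor_ext (fun α => smComponents.arr_act_comp_left () e α (m := fun _ => ()) (t := ()) (Concat.nil _)) fun F l x y z h => by
    obtain ⟨x, y, z, h', rfl, rfl, rfl⟩ := h.exists_comap (Equiv.sigmaCongrLeft (β := K) e)
      (A := fun x : Σ j, K j => A x.1 x.2)
    obtain ⟨i, k⟩ := l
    refine ((F.1.comp F.2).act_δ (Equiv.sigmaCongrLeft (β := K) e) ⟨i, k⟩ h' h).trans ?_
    exact (F.1.act_sumIso e (x := KLinear.vals F.2 x) (y := KLinear.vals F.2 y)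
      (z := KLinear.vals F.2 z) (KLinear.vals_left (fun i => F.2 (e i)) h)
      (KLinear.vals_right (fun i => F.2 (e i)) h) (KLinear.vals_left F.2 h')
      (KLinear.vals_right F.2 h') _).symm
  act_comp_right {I} _ {K L} _ _ e A B C := KLinear.functor_ext (fun α => smComponents.arr_act_comp_right () e α (m := fun _ => ()) (t := ()) (Concat.nil _)) fun F l x y z h => by
    obtain ⟨x, y, z, h', rfl, rfl, rfl⟩ := h.exists_comap (Equiv.sigmaCongrRight e)
      (A := fun x : Σ j, L j => A x.1 x.2)
    obtain ⟨i, k⟩ := l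
    refine ((F.1.comp F.2).act_δ (Equiv.sigmaCongrRight e) ⟨i, k⟩ h' h).trans ?_
    have hv : ∀ x : ∀ l : Σ i, L i, (A l.1 l.2).C, KLinear.vals F.2 x =
        KLinear.vals (A := fun i k => A i (e i k)) (fun i => (F.2 i).act (e i))
          (fun l => x ⟨l.1, e l.1 l.2⟩) := fun x => funext fun i =>
      ((F.2 i).act_obj (e i) fun m => x ⟨i, m⟩).symm
    have s' := SumAt.slice (A := A) (l := ⟨i, e i k⟩) h'
    have s := SumAt.slice (A := fun i k => A i (e i k)) (l := ⟨i, k⟩) h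
    exact KLinear.sumIso_heq rfl rfl (hv x) (hv y) (hv z)
      (KLinear.vals_left F.2 h') (KLinear.vals_right F.2 h')
      (KLinear.vals_left (A := fun i k => A i (e i k)) (fun i => (F.2 i).act (e i)) h)
      (KLinear.vals_right (A := fun i k => A i (e i k)) (fun i => (F.2 i).act (e i)) h)
      ((F.2 i).act_δ (e i) k s' s).symm
  id_comp {I} _ A B := KLinear.functor_ext (fun α => smComponents.arr_id_comp () α (m := fun _ => ()) (t := ()) (Concat.nil _)) fun F l x y z h => by
    obtain ⟨x, y, z, h', rfl, rfl, rfl⟩ := h.exists_comap (unitSigma I)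
    obtain ⟨⟨⟩, i⟩ := l
    refine HEq.trans ?_ (F.act_δ (unitSigma I) ⟨(), i⟩ h' h).symm
    exact KLinear.id_sumIso B
      (KLinear.vals_left (A := fun _ => A) (B := fun _ : Unit => B) (fun _ => F) h)
      (KLinear.vals_right (A := fun _ => A) (B := fun _ : Unit => B) (fun _ => F) h)
      (F.δ i (SumAt.slice (A := fun _ : Unit => A) (l := ⟨(), i⟩) h))
  comp_id {I} _ A B := KLinear.functor_ext (fun α => smComponents.arr_comp_id () α (m := fun _ => ()) (t := ()) (Concat.nil _)) fun F l x y z h => by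
    obtain ⟨x, y, z, h', rfl, rfl, rfl⟩ := h.exists_comap (sigmaUnit I)
    obtain ⟨i, ⟨⟩⟩ := l
    refine HEq.trans ?_ (F.act_δ (sigmaUnit I) ⟨i, ()⟩ h' h).symm
    exact heq_of_eq (congrArg Iso.hom (F.sumIso_of_isId h' _ (isId_eqToIso _)))
  assoc {I} _ {K} _ {L} _ A B C D := KLinear.functor_ext (fun α => smComponents.arr_assoc () α.1 α.2.1 α.2.2 (m := fun _ => ()) (t := ()) (Concat.nil _)) fun F l x y z h => by
    obtain ⟨x, y, z, h', rfl, rfl, rfl⟩ := h.exists_comap (Equiv.sigmaAssoc L)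
      (A := fun x : Σ i, Σ k, L i k => A x.1 x.2.1 x.2.2)
    obtain ⟨⟨i, k⟩, m⟩ := l
    refine HEq.trans ?_ ((F.1.comp (A := fun i (x : Σ k, L i k) => A i x.1 x.2)
      fun i => (F.2.1 i).comp (F.2.2 i)).act_δ (A := fun x : Σ i, Σ k, L i k => A x.1 x.2.1 x.2.2)
      (Equiv.sigmaAssoc L) ⟨⟨i, k⟩, m⟩ h' h).symm
    have h₁ := KLinear.vals_left (A := fun i (x : Σ k, L i k) => A i x.1 x.2)
      (fun i => (F.2.1 i).comp (F.2.2 i)) h'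
    have h₂ := KLinear.vals_right (A := fun i (x : Σ k, L i k) => A i x.1 x.2)
      (fun i => (F.2.1 i).comp (F.2.2 i)) h'
    have s := SumAt.slice (A := fun i (x : Σ k, L i k) => A i x.1 x.2) (l := ⟨i, ⟨k, m⟩⟩) h'
    have h₃ := KLinear.vals_left (A := fun x : Σ i, K i => A x.1 x.2)
      (B := fun x : Σ i, K i => B x.1 x.2) (fun x => F.2.2 x.1 x.2) h
    have h₄ := KLinear.vals_right (A := fun x : Σ i, K i => A x.1 x.2)
      (B := fun x : Σ i, K i => B x.1 x.2) (fun x => F.2.2 x.1 x.2) h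
    have s' := SumAt.slice (A := fun k m => A i k m) (l := ⟨k, m⟩) s
    exact heq_of_eq (KLinear.comp_sumIso F.1 F.2.1 h₃ h₄ ((F.2.2 i k).δ m s') h₁ h₂
      (KLinear.vals_left (F.2.2 i) (l := ⟨k, m⟩) s) (KLinear.vals_right (F.2.2 i) (l := ⟨k, m⟩) s))

lemma isSMMulticategory : IsSMMulticategory smMulticategory.{u} where
  id_functor _ := rfl
  id_δ _ _ _ _ h := isId_eqToIso h.1.symm
  act_functor e A B F := F.act_functor e
  act_δ e A B F i _ _ _ h h' := F.act_δ e i h h'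
  act_cell e A B _ _ α := heq_of_arrow (klinearAct_arr e A B α)
  comp_functor _ _ _ _ _ := rfl
  comp_δ A B C G F i k x y z h h' w h'' a ha ha' :=
    heq_of_eq (G.sumIso_hom_eq (KLinear.vals_left F h) (KLinear.vals_right F h)
      ((F i).δ k h.slice) h'' a ha ha')
  comp_cell _ _ _ _ _ _ _ _ _ := HEq.rfl

end

/-! ### Families of functors indexed by concatenations -/

lemma mcompArr_law {I : Type} {K : I → Type} {A A' : ∀ i, K i → Type u}
    [∀ i k, Category.{v} (A i k)] [∀ i k, Category.{v} (A' i k)] {B B' : I → Type u}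
    [∀ i, Category.{v} (B i)] [∀ i, Category.{v} (B' i)] {C C' : Type u} [Category.{v} C]
    [Category.{v} C'] {a : Arrow ((∀ i, B i) ⥤ C)} {a' : Arrow ((∀ i, B' i) ⥤ C')}
    {b : ∀ i, Arrow ((∀ k, A i k) ⥤ B i)} {b' : ∀ i, Arrow ((∀ k, A' i k) ⥤ B' i)}
    {r : ∀ i k, A i k ⥤ A' i k} {s' : ∀ i, B i ⥤ B' i} {s : C ⥤ C'}
    (h : preArr (Functor.pi s') a' = postArr a s)
    (h' : ∀ i, preArr (Functor.pi (r i)) (b' i) = postArr (b i) (s' i)) :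
    preArr (Functor.pi fun x : Σ i, K i => r x.1 x.2) (mcompArr a' b') = postArr (mcompArr a b) s :=
  (congrArg (mcompArr a') (funext h')).trans ((congrArg (mcompArr · b) h).trans
    (arrow_ext rfl rfl fun _ => heq_of_eq (s.map_comp _ _).symm))

section Families

variable {Ob : Type w} {L Q : Type} {o : L → EObj} {T : Ob → L → Q → Type u}
  [∀ X l q, SmallCategory (T X l q)]

/-- Families of functors indexed by concatenations of levels. -/
abbrev Fam {I : Type} (o : L → EObj) (T : Ob → L → Q → Type u) [∀ X l q, SmallCategory (T X l q)]
    (X : I → Ob) (Z : Ob) :=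
  ∀ (m : I → L) (t : L), Concat (fun i => o (m i)) (o t) → ∀ q, (∀ i, T (X i) (m i) q) ⥤ T Z t q

namespace Fam

section

variable {I : Type} {X : I → Ob} {Z : Ob}

abbrev Hom (F G : Fam o T X Z) := ∀ m t h q, F m t h q ⟶ G m t h q

/-- Compatibility of a family of functors with base points. -/
structure Based (pt : ∀ X l q, T X l q) (F : Fam o T X Z) : Prop where
  obj {m t} h q x i : x i = pt (X i) (m i) q → (F m t h q).obj x = pt Z t q
  map {m t} h q {x y : ∀ i, T (X i) (m i) q} (f : x ⟶ y) i :
    x i = pt (X i) (m i) q → IsId (f i) → IsId ((F m t h q).map f)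

/-- Compatibility of a family of transformations with base points. -/
structure Hom.Based (pt : ∀ X l q, T X l q) {F G : Fam o T X Z} (α : Hom F G) : Prop where
  app {m t} h q x i : x i = pt (X i) (m i) q → IsId ((α m t h q).app x)

end

lemma comap_symm {I J S : Type} (e : I ≃ J) (m : I → S) : m = fun i => m (e.symm (e i)) := by
  simp only [Equiv.symm_apply_apply]

section Act

variable {I J : Type} (e : I ≃ J) {X : J → Ob} {Z : Ob} {F G H : Fam o T X Z}

def actAt (F : Fam o T X Z) {m : I → L} {t : L} (m' : J → L) (hm : m = fun i => m' (e i))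
    (h : Concat (fun i => o (m i)) (o t)) (q : Q) : (∀ i, T (X (e i)) (m i) q) ⥤ T Z t q := by
  subst hm
  exact reindex e (fun j => T (X j) (m' j) q) ⋙ F m' t (h.uncomap e) q

def Hom.actAt (α : Hom F G) {m : I → L} {t : L} (m' : J → L) (hm : m = fun i => m' (e i))
    (h : Concat (fun i => o (m i)) (o t)) (q : Q) :
    Fam.actAt e F m' hm h q ⟶ Fam.actAt e G m' hm h q := by
  subst hm
  exact Functor.whiskerLeft (reindex e (fun j => T (X j) (m' j) q)) (α m' t (h.uncomap e) q)

/-- The action of a bijection on families. -/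
abbrev act (F : Fam o T X Z) : Fam o T (fun i => X (e i)) Z :=
  fun m _ h q => actAt e F (fun j => m (e.symm j)) (comap_symm e m) h q

/-- The action of a bijection on transformations of families. -/
abbrev Hom.act (α : Hom F G) : Hom (Fam.act e F) (Fam.act e G) :=
  fun m _ h q => Hom.actAt e α (fun j => m (e.symm j)) (comap_symm e m) h q

lemma Hom.act_id (m t h q) : Hom.act e (F := F) (fun _ _ _ _ => 𝟙 _) m t h q = 𝟙 _ := by
  have : ∀ m' hm, Hom.actAt e (F := F) (fun _ _ _ _ => 𝟙 _) (m := m) m' hm h q = 𝟙 _ := by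
    intro m' hm; subst hm; rfl
  exact this _ _

lemma Hom.act_comp (α : Hom F G) (β : Hom G H) (m t h q) :
    Hom.act e (fun m t h q => α m t h q ≫ β m t h q) m t h q =
      Hom.act e α m t h q ≫ Hom.act e β m t h q := by
  have : ∀ m' hm, Hom.actAt e (fun m t h q => α m t h q ≫ β m t h q) (m := m) m' hm h q =
      Hom.actAt e α m' hm h q ≫ Hom.actAt e β m' hm h q := by
    intro m' hm; subst hm; rfl
  exact this _ _

variable (α : Hom F G) {m : J → L} {t : L} (h : Concat (fun i => o (m (e i))) (o t)) (q : Q)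

lemma Hom.act_arr {h' : Concat (fun j => o (m j)) (o t)} (hh : ∀ i k, h.e ⟨i, k⟩ = h'.e ⟨e i, k⟩) :
    preArr (Pi.comap (fun j => T (X j) (m j) q) e)
      (Arrow.mk (Hom.act e α (fun i => m (e i)) t h q)) = Arrow.mk (α m t h' q) := by
  obtain rfl : h.uncomap e = h' := Concat.ext fun j k => by
    obtain ⟨i, rfl⟩ := e.surjective j
    exact (h.uncomap_e e (m := fun j => o (m j)) i k).symm.trans (hh i k)
  have : ∀ m' hm, m' = m → preArr (Pi.comap (fun j => T (X j) (m j) q) e)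
      (Arrow.mk (Hom.actAt e α m' hm h q)) = Arrow.mk (α m t (h.uncomap e) q) := by
    rintro m' hm rfl
    exact preArr_comap_reindex e (fun j => T (X j) (m' j) q) (Arrow.mk (α m' t (h.uncomap e) q))
  exact this _ _ (funext fun j => congrArg m (e.apply_symm_apply j))

lemma Hom.act_law {m' : J → L} {t' : L} {h : Concat (fun i => o (m (e i))) (o t)}
    {h' : Concat (fun i => o (m' (e i))) (o t')} {q q' : Q}
    {r : ∀ j, T (X j) (m j) q ⥤ T (X j) (m' j) q'} {s : T Z t q ⥤ T Z t' q'}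
    (H : preArr (Functor.pi r) (Arrow.mk (α m' t' (h'.uncomap e) q')) =
      postArr (Arrow.mk (α m t (h.uncomap e) q)) s) :
    preArr (Functor.pi fun i => r (e i)) (Arrow.mk (Hom.act e α (fun i => m' (e i)) t' h' q')) =
      postArr (Arrow.mk (Hom.act e α (fun i => m (e i)) t h q)) s :=
  preArr_comap_injective e (fun j => T (X j) (m j) q) ((congrArg (preArr (Functor.pi r))
    (Hom.act_arr e α h' q' (h'.uncomap_e e (m := fun j => o (m' j))))).trans (H.trans
      (congrArg (postArr · s) (Hom.act_arr e α h q (h.uncomap_e e (m := fun j => o (m j)))).symm)))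

lemma comap_act (F : Fam o T X Z) : Pi.comap (fun j => T (X j) (m j) q) e ⋙
    Fam.act e F (fun i => m (e i)) t h q = F m t (h.uncomap e) q :=
  left_eq_of_arrow (Hom.act_arr e (F := F) (fun _ _ _ _ => 𝟙 _) h q (h.uncomap_e e (m := fun j => o (m j))))

variable {e α} {pt : ∀ X l q, T X l q}

lemma Based.act (hF : Based pt F) : Based pt (Fam.act e F) where
  obj {m t} h q x i hx := by
    obtain ⟨m, rfl⟩ := exists_comap_fun e (S := fun _ => L) m
    obtain ⟨x, rfl⟩ := exists_comap_obj e (fun j => T (X j) (m j) q) x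
    exact (Functor.congr_obj (comap_act e h q F) x).trans (hF.obj _ q x (e i) hx)
  map {m t} h q x y f i hx hf := by
    obtain ⟨m, rfl⟩ := exists_comap_fun e (S := fun _ => L) m
    obtain ⟨x, rfl⟩ := exists_comap_obj e (fun j => T (X j) (m j) q) x
    obtain ⟨y, rfl⟩ := exists_comap_obj e (fun j => T (X j) (m j) q) y
    obtain ⟨f, rfl⟩ := exists_comap_map e (fun j => T (X j) (m j) q) f
    have H := Functor.congr_obj (comap_act e h q F)
    exact isId_of_heq (H x).symm (H y).symm (functor_map_heq (comap_act e h q F) f).symm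
      (hF.map _ q f (e i) hx hf)

lemma Hom.Based.act (hα : Hom.Based pt α) : Hom.Based pt (Hom.act e α) where
  app {m t} h q x i hx := by
    obtain ⟨m, rfl⟩ := exists_comap_fun e (S := fun _ => L) m
    obtain ⟨x, rfl⟩ := exists_comap_obj e (fun j => T (X j) (m j) q) x
    exact isId_of_heq (Functor.congr_obj (comap_act e h q F) x).symm
      (Functor.congr_obj (comap_act e h q G) x).symm (app_heq_of_arrow
        (Hom.act_arr e α h q (h.uncomap_e e (m := fun j => o (m j)))) x).symm
      (hα.app _ q x (e i) hx)

end Act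

section Comp

variable {I : Type} {K : I → Type} [∀ i, Finite (K i)] {X : ∀ i, K i → Ob} {Y : I → Ob} {Z : Ob}
  {G G' : Fam o T Y Z} {F F' : ∀ i, Fam o T (X i) (Y i)}
  (hc : HasConcat o)

/-- A concatenation of a part of a family. -/
def part (m : (Σ i, K i) → L) (i : I) :
    Concat (fun k => o (m ⟨i, k⟩)) (o (hc _ fun k => m ⟨i, k⟩).choose) :=
  (hc _ fun k => m ⟨i, k⟩).choose_spec.some

/-- The composite of families. -/
abbrev comp (G : Fam o T Y Z) (F : ∀ i, Fam o T (X i) (Y i)) :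
    Fam o T (fun x : Σ i, K i => X x.1 x.2) Z := fun m w h q =>
  multicomp (A := fun i k => T (X i k) (m ⟨i, k⟩) q)
    (G _ w (Concat.outer (n := fun i k => o (m ⟨i, k⟩)) (part hc m) h) q)
    fun i => F i _ _ (part hc m i) q

/-- The composite of transformations of families. -/
abbrev Hom.comp (α : Hom G G') (β : ∀ i, Hom (F i) (F' i)) : Hom (comp hc G F) (comp hc G' F') :=
  fun m w h q => multicompHom (A := fun i k => T (X i k) (m ⟨i, k⟩) q)
    (α _ w (Concat.outer (n := fun i k => o (m ⟨i, k⟩)) (part hc m) h) q)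
    fun i => β i _ _ (part hc m i) q

lemma outer_part {m : (Σ i, K i) → L} {t : L} (h : Concat (fun x => o (m x)) (o t)) (i k l) :
    h.e ⟨⟨i, k⟩, l⟩ = (Concat.outer (n := fun i k => o (m ⟨i, k⟩)) (part hc m) h).e
      ⟨i, (part hc m i).e ⟨k, l⟩⟩ :=
  Concat.outer_e (n := fun i k => o (m ⟨i, k⟩)) (part hc m) h i k l

variable {hc} {pt : ∀ X l q, T X l q}

lemma Based.comp (hG : Based pt G) (hF : ∀ i, Based pt (F i)) : Based pt (Fam.comp hc G F) where
  obj {m _} _ q x l hx := hG.obj _ q _ l.1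
    ((hF l.1).obj (part hc m l.1) q (fun k => x ⟨l.1, k⟩) l.2 hx)
  map {m _} _ q x y f l hx hf := hG.map _ q _ l.1
    ((hF l.1).obj (part hc m l.1) q (fun k => x ⟨l.1, k⟩) l.2 hx)
    ((hF l.1).map (part hc m l.1) q (x := fun k => x ⟨l.1, k⟩) (y := fun k => y ⟨l.1, k⟩)
      (fun k => f ⟨l.1, k⟩) l.2 hx hf)

lemma Hom.Based.comp {α : Hom G G'} {β : ∀ i, Hom (F i) (F' i)} (hα : Hom.Based pt α)
    (hβ : ∀ i, Hom.Based pt (β i)) (hF : ∀ i, Fam.Based pt (F i)) (hG : Fam.Based pt G') :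
    Hom.Based pt (Hom.comp hc α β) where
  app {m _} _ q x l hx := by
    have h := (hF l.1).obj (part hc m l.1) q (fun k => x ⟨l.1, k⟩) l.2 hx
    exact (hα.app _ q _ l.1 h).comp (hG.map _ q _ l.1 h
      ((hβ l.1).app (part hc m l.1) q (fun k => x ⟨l.1, k⟩) l.2 hx))

end Comp

end Fam

end Families

lemma EStarCat.tr_id (X : EStarCat.{u}) (t : EObj) : X.tr (𝟙 t) = 𝟭 _ :=
  congrArg BasedCat.func (X.functor.map_id t)

lemma EStarCat.tr_comp (X : EStarCat.{u}) {s t r : EObj} (f : s ⟶ t) (g : t ⟶ r) :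
    X.tr (f ≫ g) = X.tr f ⋙ X.tr g :=
  congrArg BasedCat.func (X.functor.map_comp f g)

lemma EStarCat.tr_pt (X : EStarCat.{u}) {s t : EObj} (f : s ⟶ t) :
    (X.tr f).obj (X.functor.obj s).pt = (X.functor.obj t).pt := BasedCat.func_pt _

lemma EStarCat.pi_tr_id {I : Type} (X : I → EStarCat.{u}) (m : I → EObj) :
    Functor.pi (fun i => (X i).tr (𝟙 (m i))) = 𝟭 _ := by
  have : (fun i => (X i).tr (𝟙 (m i))) = fun i => 𝟭 _ := funext fun i => (X i).tr_id (m i)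
  rw [this]
  rfl

/-! ### The multicategory of `ℰ_*`-categories -/

namespace EMor

section Basic

variable {I : Type} [Finite I] {X : I → EStarCat.{u}} {Y : EStarCat.{u}}

lemma ext {F G : EMor I X Y} (h : ∀ {m : I → EObj} {t : EObj} (h : Concat m t),
    F.app h = G.app h) : F = G := by
  obtain ⟨F, _, _, _⟩ := F
  obtain ⟨G, _, _, _⟩ := G
  obtain rfl : @F = @G := by
    funext m t c
    exact h c
  rfl

/-- The component of a cell, as an arrow in the category of functors. -/
def arr {F G : EMor I X Y} (α : F ⟶ G) {m : I → EObj} {t : EObj} (h : Concat m t) :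
    Arrow ((∀ i, (X i).at (m i)) ⥤ Y.at t) := Arrow.mk (cell α h)

lemma arrow_eq {F G F' G' : EMor I X Y} {α : F ⟶ G} {β : F' ⟶ G'}
    (h : ∀ {m t} (h : Concat m t), arr α h = arr β h) : Arrow.mk α = Arrow.mk β := by
  obtain rfl := ext fun c => left_eq_of_arrow (h c)
  obtain rfl := ext fun c => right_eq_of_arrow (h c)
  congr 1
  refine EMor.Hom.ext ?_
  funext m t c
  exact eq_of_heq (heq_of_arrow (h c))

lemma functor_ext {Z : Type*} [Category Z] {L R : Z ⥤ EMor I X Y}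
    (h : ∀ {F G : Z} (α : F ⟶ G) {m : I → EObj} {t : EObj} (h : Concat m t),
      arr (L.map α) h = arr (R.map α) h) : L = R :=
  functor_ext_arrow fun α => arrow_eq (h α)

lemma arr_naturality {F G : EMor I X Y} (α : F ⟶ G) {m m' : I → EObj} {t t' : EObj}
    {h : Concat m t} {h' : Concat m' t'} {f : ∀ i, m i ⟶ m' i} {g : t ⟶ t'}
    (hc : IsConcat h h' f g) :
    preArr (Functor.pi fun i => (X i).tr (f i)) (arr α h') = postArr (arr α h) (Y.tr g) :=
  arrow_ext (F.naturality h h' f g hc) (G.naturality h h' f g hc)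
    (EMor.Hom.modification α h h' f g hc)

/-- The family of functors underlying a multimorphism. -/
abbrev fam (F : EMor I X Y) :
    Fam (fun t => t) (fun (X : EStarCat.{u}) t (_ : Unit) => X.at t) X Y := fun _ _ h _ => F.app h

lemma based (F : EMor I X Y) : Fam.Based (fun X t _ => (X.functor.obj t).pt) F.fam :=
  ⟨fun h _ => F.obj_pt h, fun h _ => F.map_pt h⟩

abbrev famHom {F G : EMor I X Y} (α : F ⟶ G) : Fam.Hom F.fam G.fam := fun _ _ h _ => cell α h

lemma based_famHom {F G : EMor I X Y} (α : F ⟶ G) :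
    Fam.Hom.Based (fun X t _ => (X.functor.obj t).pt) (famHom α) :=
  ⟨fun h _ => EMor.Hom.app_pt α h⟩

end Basic

/-- The `1`-ary morphism given by a natural family of functors. -/
def ofNatural {X Y : EStarCat.{u}} (F : ∀ t, X.at t ⥤ Y.at t)
    (hF : ∀ {s t : EObj} (f : s ⟶ t), X.tr f ⋙ F t = F s ⋙ Y.tr f)
    (hp : ∀ t, (F t).obj (X.functor.obj t).pt = (Y.functor.obj t).pt) :
    EMor Unit (fun _ => X) Y where
  app {m _} h := Pi.eval (fun u => X.at (m u)) () ⋙ F (m ()) ⋙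
    Y.tr (exists_isConcat (Concat.self (m ())) h fun _ => 𝟙 _).choose
  naturality {m m' _ _} h h' f g hc := by
    have h₁ := (exists_isConcat (Concat.self (m ())) h fun _ => 𝟙 _).choose_spec
    have h₂ := (exists_isConcat (Concat.self (m' ())) h' fun _ => 𝟙 _).choose_spec
    have := ((isConcat_self (f ())).comp h₂).unique (by
      rw [show (fun i : Unit => f () ≫ 𝟙 (m' ())) = fun i => 𝟙 (m ()) ≫ f () by simp]
      exact h₁.comp hc)
    exact ((congrArg (fun T => Pi.eval (fun u => X.at (m u)) () ⋙ T ⋙ Y.tr _) (hF (f ()))).trans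
      (congrArg (Pi.eval (fun u => X.at (m u)) () ⋙ F (m ()) ⋙ ·) ((Y.tr_comp _ _).symm.trans
        ((congrArg Y.tr this).trans (Y.tr_comp _ _)))) :)
  obj_pt h x i hx := by
    change (Y.tr _).obj ((F _).obj (x ())) = _
    rw [hx, hp, Y.tr_pt]
  map_pt h x y f i _ hf := (hf.map _).map _

lemma ofNatural_app {X Y : EStarCat.{u}} (F : ∀ t, X.at t ⥤ Y.at t)
    (hF : ∀ {s t : EObj} (f : s ⟶ t), X.tr f ⋙ F t = F s ⋙ Y.tr f)
    (hp : ∀ t, (F t).obj (X.functor.obj t).pt = (Y.functor.obj t).pt) (t : EObj) :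
    (ofNatural F hF hp).app (Concat.self t) = Pi.eval (fun _ : Unit => X.at t) () ⋙ F t := by
  have := (exists_isConcat (Concat.self t) (Concat.self t) fun _ => 𝟙 _).choose_spec.unique
    (isConcat_self (𝟙 t))
  change Pi.eval (fun _ : Unit => X.at t) () ⋙ F t ⋙ Y.tr _ = _
  rw [this, Y.tr_id]
  rfl

lemma unit_ext {X Y : EStarCat.{u}} {F G : EMor Unit (fun _ => X) Y}
    (h : ∀ t, F.app (Concat.self t) = G.app (Concat.self t)) : F = G :=
  ext fun {m t} c => by
    have hc := (exists_isConcat (Concat.self (m ())) c fun _ => 𝟙 _).choose_spec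
    have e := fun F : EMor Unit (fun _ => X) Y => F.naturality (m := fun _ => m ())
      (Concat.self (m ())) c (fun i => 𝟙 (m i)) _ hc
    rw [EStarCat.pi_tr_id (fun _ => X) m] at e
    exact (e F).trans ((congrArg (· ⋙ Y.tr _) (h (m ()))).trans (e G).symm)

/-- The identity. -/
def id (X : EStarCat.{u}) : EMor Unit (fun _ => X) X :=
  ofNatural (fun _ => 𝟭 _) (fun _ => rfl) fun _ => rfl

lemma id_app (X : EStarCat.{u}) (t : EObj) :
    (id X).app (Concat.self t) = Pi.eval (fun _ : Unit => X.at t) () :=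
  ofNatural_app (fun _ => 𝟭 _) (fun _ => rfl) (fun _ => rfl) t

section Act

variable {I J : Type} [Finite I] [Finite J] (e : I ≃ J) (X : J → EStarCat.{u}) (Y : EStarCat.{u})

variable {X Y} in
lemma act_naturality {F G : EMor J X Y} (α : F ⟶ G) {m m' : I → EObj} {t t' : EObj}
    (h : Concat m t) (h' : Concat m' t') (f : ∀ i, m i ⟶ m' i) (g : t ⟶ t')
    (hc : IsConcat h h' f g) : preArr (Functor.pi fun i => (X (e i)).tr (f i))
      (Arrow.mk ((famHom α).act e m' t' h' ())) =
      postArr (Arrow.mk ((famHom α).act e m t h ())) (Y.tr g) := by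
  obtain ⟨m, rfl⟩ := exists_comap_obj e (fun _ => EObj) m
  obtain ⟨m', rfl⟩ := exists_comap_obj e (fun _ => EObj) m'
  obtain ⟨f, rfl⟩ := exists_comap_map e (fun _ => EObj) f
  exact Fam.Hom.act_law e (famHom α) (r := fun j => (X j).tr (f j)) (arr_naturality α
    (hc.of_comap e (h.uncomap_e e) (h'.uncomap_e e)))

/-- The action of a bijection on multimorphisms and cells. -/
def actFunctor : EMor J X Y ⥤ EMor I (fun i => X (e i)) Y where
  obj F :=
    { app := fun h => F.fam.act e _ _ h ()
      naturality := fun h h' f g hc => left_eq_of_arrow (act_naturality e (𝟙 F) h h' f g hc)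
      obj_pt := fun h => F.based.act.obj h ()
      map_pt := fun h => F.based.act.map h () }
  map α :=
    { app := fun h => (famHom α).act e _ _ h ()
      modification := fun h h' f g hc x =>
        app_heq_of_arrow (act_naturality e α h h' f g hc) x
      app_pt := fun h => (based_famHom α).act.app h () }
  map_id F := EMor.Hom.ext (by
    funext m t h
    exact Fam.Hom.act_id e (F := F.fam) m t h ())
  map_comp α β := EMor.Hom.ext (by
    funext m t h
    exact Fam.Hom.act_comp e (famHom α) (famHom β) m t h ())

lemma act_arr {F G : EMor J X Y} (α : F ⟶ G) {m : J → EObj} {t : EObj}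
    (h : Concat (fun i => m (e i)) t) (h' : Concat m t)
    (hh : ∀ i k, h.e ⟨i, k⟩ = h'.e ⟨e i, k⟩) :
    preArr (Pi.comap (fun j => (X j).at (m j)) e) (arr ((actFunctor e X Y).map α) h) = arr α h' :=
  Fam.Hom.act_arr e (famHom α) h () hh

end Act

end EMor

namespace EMor

section Comp

variable {I : Type} [Finite I] {K : I → Type} [∀ i, Finite (K i)] {X : ∀ i, K i → EStarCat.{u}}
  {Y : I → EStarCat.{u}} {Z : EStarCat.{u}}

lemma mcompArr_naturality {G G' : EMor I Y Z} {F F' : ∀ i, EMor (K i) (X i) (Y i)}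
    (α : G ⟶ G') (β : ∀ i, F i ⟶ F' i) {m m' : ∀ i, K i → EObj} {t t' : I → EObj} {w w' : EObj}
    {h : ∀ i, Concat (m i) (t i)} {h' : ∀ i, Concat (m' i) (t' i)}
    {H : Concat (fun x : Σ i, K i => m x.1 x.2) w} {H' : Concat (fun x : Σ i, K i => m' x.1 x.2) w'}
    {O : Concat t w} {O' : Concat t' w'} (hO : ∀ i k l, H.e ⟨⟨i, k⟩, l⟩ = O.e ⟨i, (h i).e ⟨k, l⟩⟩)
    (hO' : ∀ i k l, H'.e ⟨⟨i, k⟩, l⟩ = O'.e ⟨i, (h' i).e ⟨k, l⟩⟩)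
    {f : ∀ x : Σ i, K i, m x.1 x.2 ⟶ m' x.1 x.2} {g : w ⟶ w'} (hg : IsConcat H H' f g) :
    preArr (Functor.pi fun x : Σ i, K i => (X x.1 x.2).tr (f x))
      (mcompArr (arr α O') fun i => arr (β i) (h' i)) =
      postArr (mcompArr (arr α O) fun i => arr (β i) (h i)) (Z.tr g) := by
  choose g' hg' using fun i => exists_isConcat (h i) (h' i) fun k => f ⟨i, k⟩
  exact mcompArr_law (r := fun i k => (X i k).tr (f ⟨i, k⟩)) (arr_naturality α (hg.outer hO hO' hg')) fun i => arr_naturality (β i) (hg' i)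

lemma mcompArr_congr {G G' : EMor I Y Z} {F F' : ∀ i, EMor (K i) (X i) (Y i)}
    (α : G ⟶ G') (β : ∀ i, F i ⟶ F' i) {m : ∀ i, K i → EObj} {t t' : I → EObj} {w : EObj}
    {h : ∀ i, Concat (m i) (t i)} {h' : ∀ i, Concat (m i) (t' i)}
    {H : Concat (fun x : Σ i, K i => m x.1 x.2) w} {O : Concat t w} {O' : Concat t' w}
    (hO : ∀ i k l, H.e ⟨⟨i, k⟩, l⟩ = O.e ⟨i, (h i).e ⟨k, l⟩⟩)
    (hO' : ∀ i k l, H.e ⟨⟨i, k⟩, l⟩ = O'.e ⟨i, (h' i).e ⟨k, l⟩⟩) :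
    mcompArr (arr α O') (fun i => arr (β i) (h' i)) =
      mcompArr (arr α O) fun i => arr (β i) (h i) := by
  have := mcompArr_naturality α β hO hO' (isConcat_id H)
  rw [EStarCat.tr_id] at this
  refine Eq.trans ?_ this
  have e := EStarCat.pi_tr_id (fun x : Σ i, K i => X x.1 x.2) fun x => m x.1 x.2
  exact (congrArg (fun T => preArr T (mcompArr (arr α O') fun i => arr (β i) (h' i))) e).symm

lemma comp_naturality {G G' : EMor I Y Z} {F F' : ∀ i, EMor (K i) (X i) (Y i)} (α : G ⟶ G')
    (β : ∀ i, F i ⟶ F' i) {m m' : (Σ i, K i) → EObj} {w w' : EObj} (H : Concat m w)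
    (H' : Concat m' w') (f : ∀ x, m x ⟶ m' x) (g : w ⟶ w') (hg : IsConcat H H' f g) :
    preArr (Functor.pi fun x : Σ i, K i => (X x.1 x.2).tr (f x)) (Arrow.mk
      (Fam.Hom.comp exists_concat (famHom α) (fun i => famHom (β i)) m' w' H' ())) =
      postArr (Arrow.mk (Fam.Hom.comp exists_concat (famHom α) (fun i => famHom (β i)) m w H ()))
        (Z.tr g) :=
  mcompArr_naturality α β (m := fun i k => m ⟨i, k⟩) (m' := fun i k => m' ⟨i, k⟩)
    (Fam.outer_part (o := fun t => t) exists_concat H) (Fam.outer_part (o := fun t => t) exists_concat H') hg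

/-- The composite of multimorphisms. -/
def comp (G : EMor I Y Z) (F : ∀ i, EMor (K i) (X i) (Y i)) :
    EMor (Σ i, K i) (fun x => X x.1 x.2) Z where
  app H := Fam.comp exists_concat G.fam (fun i => (F i).fam) _ _ H ()
  naturality H H' f g hg :=
    left_eq_of_arrow (comp_naturality (𝟙 G) (fun i => 𝟙 (F i)) H H' f g hg)
  obj_pt H := (G.based.comp fun i => (F i).based).obj H ()
  map_pt H := (G.based.comp fun i => (F i).based).map H ()

variable (X Y Z) in
/-- Composition of multimorphisms and cells. -/
def compFunctor :
    EMor I Y Z × (∀ i, EMor (K i) (X i) (Y i)) ⥤ EMor (Σ i, K i) (fun x => X x.1 x.2) Z where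
  obj F := comp F.1 F.2
  map {F G} α :=
    { app := fun H => Fam.Hom.comp exists_concat (famHom α.1) (fun i => famHom (α.2 i)) _ _ H ()
      modification := fun H H' f g hg x =>
        app_heq_of_arrow (comp_naturality α.1 α.2 H H' f g hg) x
      app_pt := fun H => ((based_famHom α.1).comp (fun i => based_famHom (α.2 i))
        (fun i => (F.2 i).based) G.1.based).app H () }
  map_id F := by
    refine EMor.Hom.ext ?_
    funext m t H
    exact multicompHom_id (A := fun i k => (X i k).at (m ⟨i, k⟩)) _ _
  map_comp α β := by
    refine EMor.Hom.ext ?_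
    funext m t H
    exact multicompHom_comp (A := fun i k => (X i k).at (m ⟨i, k⟩)) _ _ _ _

variable (X Y Z) in
lemma comp_arr {F F' : EMor I Y Z × (∀ i, EMor (K i) (X i) (Y i))} (α : F ⟶ F')
    {m : ∀ i, K i → EObj} {t : I → EObj} {w : EObj} (h : ∀ i, Concat (m i) (t i)) (O : Concat t w)
    (H : Concat (fun x : Σ i, K i => m x.1 x.2) w)
    (hO : ∀ i k l, H.e ⟨⟨i, k⟩, l⟩ = O.e ⟨i, (h i).e ⟨k, l⟩⟩) :
    arr ((compFunctor X Y Z).map α) H = mcompArr (arr α.1 O) fun i => arr (α.2 i) (h i) :=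
  mcompArr_congr α.1 α.2 (h' := fun i => Fam.part (o := fun t => t) exists_concat (fun x => m x.1 x.2) i) hO
    (Fam.outer_part (o := fun t => t) exists_concat H)

end Comp

lemma id_arr (X : EStarCat.{u}) (t : EObj) :
    arr (𝟙 (id X)) (Concat.self t) = Arrow.mk (𝟙 (Pi.eval (fun _ : Unit => X.at t) ())) :=
  congrArg (fun F => Arrow.mk (𝟙 F)) (id_app X t)

end EMor

/-- The components of multimorphisms of `ℰ_*`-categories. -/
def estarComponents : Components EMor.{u} (Q := Unit) (fun t => t)
    fun X t _ => X.at t where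
  id X := EMor.id X
  act e X Y := EMor.actFunctor e X Y
  comp X Y Z := EMor.compFunctor X Y Z
  arr α _ _ h _ := EMor.arr α h
  exists_concat := exists_concat
  id_arr X t _ := EMor.id_arr X t
  act_arr e _ _ _ _ α _ _ h h' _ hh := EMor.act_arr e _ _ α h h' hh
  comp_arr α _ _ _ h O H _ hO := EMor.comp_arr _ _ _ α h O H hO

/-- The multicategory of `ℰ_*`-categories. -/
def estarMulticategory : Multicategory EStarCat.{u} EMor.{u} :=
  estarComponents.multicategory fun H => EMor.functor_ext fun α _ _ h => H α h ()

lemma isEStarMulticategory : IsEStarMulticategory estarMulticategory.{u} where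
  id_app X t := EMor.id_app X t
  act_app e X Y F _ _ h h' hh := left_eq_of_arrow (EMor.act_arr e X Y (𝟙 F) h h' hh)
  act_cell e X Y _ _ α _ _ h h' hh := heq_of_arrow (EMor.act_arr e X Y α h h' hh)
  comp_app X Y Z G F _ _ _ h O H hO := left_eq_of_arrow (EMor.comp_arr X Y Z
    (mkHom (𝟙 G) fun i => 𝟙 (F i)) h O H hO)
  comp_cell X Y Z _ _ _ _ α β _ _ _ h O H hO :=
    heq_of_arrow (EMor.comp_arr X Y Z (mkHom α β) h O H hO)

/-! ### Orderings of disjoint unions -/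

/-- Orderings of the disjoint union of finite ordinals. -/
abbrev Ord {I : Type} (p : I → ℕ) (n : ℕ) := (Σ i, Fin (p i)) ≃ Fin n

abbrev specO (n : ℕ) : EObj := ⟨n, fun _ => 0⟩

section Orderings

variable {I J : Type} {K : I → Type} {n N M : ℕ}

abbrev Ord.cat {p : I → ℕ} (e : Ord p n) : Concat (fun i => specO (p i)) (specO n) :=
  ⟨e, fun _ _ => rfl⟩

lemma hasConcat_specO : HasConcat specO := fun _ _ p =>
  ⟨_, ⟨Ord.cat (p := p) (Finite.equivFin _)⟩⟩

/-- An ordering of the disjoint union of a reindexed family. -/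
abbrev uncomapEquiv (ε : I ≃ J) {p : J → ℕ} (e : Ord (fun i => p (ε i)) n) : Ord p n :=
  (e.cat.uncomap ε (m := fun j => specO (p j))).e

lemma uncomapEquiv_apply (ε : I ≃ J) {p : J → ℕ} (e : Ord (fun i => p (ε i)) n) (i : I)
    (k : Fin (p (ε i))) : e ⟨i, k⟩ = uncomapEquiv ε e ⟨ε i, k⟩ :=
  e.cat.uncomap_e ε (m := fun j => specO (p j)) i k

lemma exists_isExtension {p d : I → ℕ} (e : Ord p n) (e' : Ord d N) :
    ∃ ê : Ord (fun i => p i + d i) (n + N), IsExtension e e' ê := by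
  refine ⟨(Equiv.sigmaCongrRight fun i => finSumFinEquiv.symm).trans
    ((Equiv.sigmaSumDistrib _ _).trans ((Equiv.sumCongr e e').trans finSumFinEquiv)),
    fun i k => ?_, fun i k => ?_⟩ <;>
  simp [Equiv.sigmaSumDistrib]

lemma IsExtension.uncomap (ε : I ≃ J) {p d : J → ℕ} {e : Ord (fun i => p (ε i)) n}
    {e' : Ord (fun i => d (ε i)) N} {ê : Ord (fun i => p (ε i) + d (ε i)) (n + N)}
    (h : IsExtension e e' ê) : IsExtension (uncomapEquiv ε e) (uncomapEquiv ε e')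
      (uncomapEquiv ε (p := fun j => p j + d j) ê) := by
  refine ⟨fun j k => ?_, fun j k => ?_⟩ <;> obtain ⟨i, rfl⟩ := ε.surjective j
  · rw [← uncomapEquiv_apply ε e]
    exact (uncomapEquiv_apply ε (p := fun j => p j + d j) ê i _).symm.trans (h.1 i k)
  · rw [← uncomapEquiv_apply ε e']
    exact (uncomapEquiv_apply ε (p := fun j => p j + d j) ê i _).symm.trans (h.2 i k)

lemma IsExtension.nested {p d : ∀ i, K i → ℕ} {m r : I → ℕ}
    {e : Ord (fun x : Σ i, K i => p x.1 x.2) n} {e' : Ord (fun x : Σ i, K i => d x.1 x.2) N}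
    {ê : Ord (fun x : Σ i, K i => p x.1 x.2 + d x.1 x.2) (n + N)} (h : IsExtension e e' ê)
    {a : ∀ i, Ord (p i) (m i)} {a' : ∀ i, Ord (d i) (r i)}
    {â : ∀ i, Ord (fun k => p i k + d i k) (m i + r i)}
    (ha : ∀ i, IsExtension (a i) (a' i) (â i)) {o : Ord m n} {o' : Ord r N}
    {ô : Ord (fun i => m i + r i) (n + N)}
    (ho : IsExtension o o' ô) (hr : ∀ i k l, e ⟨⟨i, k⟩, l⟩ = o ⟨i, a i ⟨k, l⟩⟩)
    (hr' : ∀ i k l, e' ⟨⟨i, k⟩, l⟩ = o' ⟨i, a' i ⟨k, l⟩⟩) (i : I) (k : K i)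
    (l : Fin (p i k + d i k)) : ê ⟨⟨i, k⟩, l⟩ = ô ⟨i, â i ⟨k, l⟩⟩ := by
  refine Fin.addCases (fun l => ?_) (fun l => ?_) l
  · rw [(ha i).1, ho.1, ← hr]
    exact h.1 ⟨i, k⟩ l
  · rw [(ha i).2, ho.2, ← hr']
    exact h.2 ⟨i, k⟩ l

lemma labels_eq {S : Type} {p : I → ℕ} {e : Ord p n} {s : ∀ i, Fin (p i) → S} {s' : Fin n → S}
    (h : ∀ i k, s' (e ⟨i, k⟩) = s i k) : (fun j => s (e.symm j).1 (e.symm j).2) = s' :=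
  funext fun j => by
    obtain ⟨⟨i, k⟩, rfl⟩ := e.surjective j
    rw [e.symm_apply_apply, h]

end Orderings

namespace SymSpectrum

variable (X : SymSpectrum.{u})

lemma perm_pt {n : ℕ} (τ : Equiv.Perm (Fin n)) (q : SimplexCategoryᵒᵖ) :
    (X.perm τ q).obj (X.pt n q) = X.pt n q := BasedCat.func_pt _

lemma perm_one {n : ℕ} (q : SimplexCategoryᵒᵖ) : X.perm (1 : Equiv.Perm (Fin n)) q = 𝟭 _ := by
  have : X.act n 1 = 1 := map_one _
  exact congrArg (fun a : End (X.level n) => BasedCat.func (NatTrans.app a q)) this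

lemma perm_mul {n : ℕ} (τ τ' : Equiv.Perm (Fin n)) (q : SimplexCategoryᵒᵖ) :
    X.perm (τ * τ') q = X.perm τ' q ⋙ X.perm τ q := by
  have : X.act n (τ * τ') = X.act n τ * X.act n τ' := map_mul _ _ _
  exact congrArg (fun a : End (X.level n) => BasedCat.func (NatTrans.app a q)) this

lemma pi_perm_one {I : Type} (X : I → SymSpectrum.{u}) (p : I → ℕ) (q : SimplexCategoryᵒᵖ) :
    Functor.pi (fun i => (X i).perm (1 : Equiv.Perm (Fin (p i))) q) = 𝟭 _ := by
  have : (fun i => (X i).perm (1 : Equiv.Perm (Fin (p i))) q) = fun i => 𝟭 _ :=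
    funext fun i => (X i).perm_one q
  rw [this]
  rfl

/-- The functor given by an ordering of a single set. -/
def idApp {p n : ℕ} (e : Fin p ≃ Fin n) (q : SimplexCategoryᵒᵖ) : X.at p q ⥤ X.at n q := by
  have h : p = n := Fin.equiv_iff_eq.1 ⟨e⟩
  subst h
  exact X.perm e q

lemma idApp_pt {p n : ℕ} (e : Fin p ≃ Fin n) (q : SimplexCategoryᵒᵖ) :
    (X.idApp e q).obj (X.pt p q) = X.pt n q := by
  obtain rfl : p = n := Fin.equiv_iff_eq.1 ⟨e⟩
  exact X.perm_pt e q

lemma idApp_naturality {p n : ℕ} (e : Fin p ≃ Fin n) {q q' : SimplexCategoryᵒᵖ} (f : q ⟶ q') :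
    X.tr p f ⋙ X.idApp e q' = X.idApp e q ⋙ X.tr n f := by
  obtain rfl : p = n := Fin.equiv_iff_eq.1 ⟨e⟩
  exact congrArg BasedCat.func (NatTrans.naturality (X.act p e) f)

lemma idApp_equivariance {p n : ℕ} (e e' : Fin p ≃ Fin n) (τ : Equiv.Perm (Fin p))
    (π : Equiv.Perm (Fin n)) (q : SimplexCategoryᵒᵖ) (h : ∀ k, e' (τ k) = π (e k)) :
    X.perm τ q ⋙ X.idApp e' q = X.idApp e q ⋙ X.perm π q := by
  obtain rfl : p = n := Fin.equiv_iff_eq.1 ⟨e⟩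
  have : (e' : Equiv.Perm (Fin p)) * τ = π * e := Equiv.ext h
  exact (X.perm_mul e' τ q).symm.trans ((congrArg (X.perm · q) this).trans (X.perm_mul π e q))

lemma idApp_structure_maps {p d n N : ℕ} (e : Fin p ≃ Fin n) (e' : Fin d ≃ Fin N)
    (ê : Fin (p + d) ≃ Fin (n + N)) (q : SimplexCategoryᵒᵖ) (s : Fin d → Fin (q.unop.len + 1))
    (h : ∀ k, ê (Fin.castAdd d k) = Fin.castAdd N (e k))
    (h' : ∀ k, ê (Fin.natAdd p k) = Fin.natAdd n (e' k)) :
    X.iter p q s ⋙ X.idApp ê q = X.idApp e q ⋙ X.iter n q fun j => s (e'.symm j) := by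
  obtain rfl : p = n := Fin.equiv_iff_eq.1 ⟨e⟩
  obtain rfl : d = N := Fin.equiv_iff_eq.1 ⟨e'⟩
  have hb : ê = blockSum e e' := Equiv.ext fun k => by
    refine Fin.addCases (fun k => ?_) (fun k => ?_) k
    · rw [h]; simp [blockSum]
    · rw [h']; simp [blockSum]
  subst hb
  exact (congrArg BasedCat.func (X.equivariance p d q s e e')).symm

end SymSpectrum

/-! ### The multicategory of symmetric spectra -/

abbrev specT (X : SymSpectrum.{u}) (n : ℕ) (q : SimplexCategoryᵒᵖ) := X.at n q

/-- Compatibility of a family of arrows of functors with the structure of symmetric spectra. -/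
structure MLaws {I : Type} {X : I → SymSpectrum.{u}} {Z : SymSpectrum.{u}}
    (a : ∀ (p : I → ℕ) (n : ℕ), Ord p n → ∀ q, Arrow ((∀ i, (X i).at (p i) q) ⥤ Z.at n q)) :
    Prop where
  tr {p n} (e : Ord p n) {q q' : SimplexCategoryᵒᵖ} (f : q ⟶ q') :
    preArr (Functor.pi fun i => (X i).tr (p i) f) (a p n e q') = postArr (a p n e q) (Z.tr n f)
  perm {p n} (e e' : Ord p n) (τ : ∀ i, Equiv.Perm (Fin (p i))) (π : Equiv.Perm (Fin n)) q
    (h : ∀ i k, e' ⟨i, τ i k⟩ = π (e ⟨i, k⟩)) :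
    preArr (Functor.pi fun i => (X i).perm (τ i) q) (a p n e' q) =
      postArr (a p n e q) (Z.perm π q)
  iter {p d n N} (e : Ord p n) (e' : Ord d N) (ê : Ord (fun i => p i + d i) (n + N)) q
    (s : ∀ i, Fin (d i) → Fin (q.unop.len + 1)) (h : IsExtension e e' ê) :
    preArr (Functor.pi fun i => (X i).iter (p i) q (s i)) (a _ _ ê q) =
      postArr (a p n e q) (Z.iter n q fun j => s (e'.symm j).1 (e'.symm j).2)

namespace MLaws

section

variable {I J : Type} (ε : I ≃ J) {X : J → SymSpectrum.{u}} {Z : SymSpectrum.{u}}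
  {F G : Fam specO specT X Z} {α : Fam.Hom F G}

lemma act (h : MLaws fun p n e q => Arrow.mk (α p n e.cat q)) :
    MLaws fun p n e q => Arrow.mk (Fam.Hom.act ε α p n e.cat q) where
  tr {p n} e q q' f := by
    obtain ⟨p, rfl⟩ := exists_comap_fun ε (S := fun _ => ℕ) p
    exact Fam.Hom.act_law ε α (r := fun j => (X j).tr (p j) f) (h.tr _ f)
  perm {p n} e e' τ π q hp := by
    obtain ⟨p, rfl⟩ := exists_comap_fun ε (S := fun _ => ℕ) p
    obtain ⟨τ, rfl⟩ := exists_comap_fun ε (S := fun j => Equiv.Perm (Fin (p j))) τ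
    refine Fam.Hom.act_law ε α (r := fun j => (X j).perm (τ j) q)
      (h.perm (uncomapEquiv ε e) (uncomapEquiv ε e') τ π q fun j k => ?_)
    obtain ⟨i, rfl⟩ := ε.surjective j
    rw [← uncomapEquiv_apply, ← uncomapEquiv_apply]
    exact hp i k
  iter {p d n N} e e' ê q s hx := by
    obtain ⟨p, rfl⟩ := exists_comap_fun ε (S := fun _ => ℕ) p
    obtain ⟨d, rfl⟩ := exists_comap_fun ε (S := fun _ => ℕ) d
    obtain ⟨s, rfl⟩ := exists_comap_fun ε (S := fun j => Fin (d j) → Fin (q.unop.len + 1)) s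
    have := h.iter _ _ _ q s hx.uncomap
    rw [labels_eq (s' := fun j => s (ε (e'.symm j).1) (e'.symm j).2) fun j k => ?_] at this
    · exact Fam.Hom.act_law ε α (m' := fun j => p j + d j) (r := fun j => (X j).iter (p j) q (s j)) this
    obtain ⟨i, rfl⟩ := ε.surjective j
    rw [← uncomapEquiv_apply ε e', e'.symm_apply_apply]

end

section

variable {I : Type} [Finite I] {K : I → Type} [∀ i, Finite (K i)] {X : ∀ i, K i → SymSpectrum.{u}}
  {Y : I → SymSpectrum.{u}} {Z : SymSpectrum.{u}}
  {a : ∀ (p : I → ℕ) (n : ℕ), Ord p n → ∀ q, Arrow ((∀ i, (Y i).at (p i) q) ⥤ Z.at n q)}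
  {b : ∀ i (p : K i → ℕ) (n : ℕ), Ord p n → ∀ q,
    Arrow ((∀ k, (X i k).at (p k) q) ⥤ (Y i).at n q)}
  {p : ∀ i, K i → ℕ} {n n' : I → ℕ} {N : ℕ}
  {c : ∀ i, Ord (p i) (n i)} {c' : ∀ i, Ord (p i) (n' i)}
  {e e' : Ord (fun x : Σ i, K i => p x.1 x.2) N} {o : Ord n N} {o' : Ord n' N}

lemma mcompArr_perm (ha : MLaws a) (hb : ∀ i, MLaws (b i))
    (ho : ∀ i k l, e ⟨⟨i, k⟩, l⟩ = o ⟨i, c i ⟨k, l⟩⟩)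
    (ho' : ∀ i k l, e' ⟨⟨i, k⟩, l⟩ = o' ⟨i, c' i ⟨k, l⟩⟩)
    (τ : ∀ x : Σ i, K i, Equiv.Perm (Fin (p x.1 x.2))) (π : Equiv.Perm (Fin N)) (q)
    (h : ∀ x k, e' ⟨x, τ x k⟩ = π (e ⟨x, k⟩)) :
    preArr (Functor.pi fun x : Σ i, K i => (X x.1 x.2).perm (τ x) q)
      (mcompArr (a _ _ o' q) fun i => b i _ _ (c' i) q) =
      postArr (mcompArr (a _ _ o q) fun i => b i _ _ (c i) q) (Z.perm π q) := by
  obtain rfl : n = n' := funext fun i => Fin.equiv_iff_eq.1 ⟨(c i).symm.trans (c' i)⟩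
  let g : ∀ i, Equiv.Perm (Fin (n i)) := fun i =>
    (c i).symm.trans ((Equiv.sigmaCongrRight fun k => τ ⟨i, k⟩).trans (c' i))
  have hg : ∀ i k l, c' i ⟨k, τ ⟨i, k⟩ l⟩ = g i (c i ⟨k, l⟩) := fun i k l => by
    simp [g]
  refine mcompArr_law (r := fun i k => (X i k).perm (τ ⟨i, k⟩) q)
    (ha.perm o o' g π q fun i k => ?_) fun i => (hb i).perm (c i) (c' i) _ (g i) q (hg i)
  obtain ⟨⟨k, l⟩, rfl⟩ := (c i).surjective k
  rw [← hg, ← ho', ← ho]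
  exact h ⟨i, k⟩ l

lemma mcompArr_congr (ha : MLaws a) (hb : ∀ i, MLaws (b i))
    (ho : ∀ i k l, e ⟨⟨i, k⟩, l⟩ = o ⟨i, c i ⟨k, l⟩⟩)
    (ho' : ∀ i k l, e ⟨⟨i, k⟩, l⟩ = o' ⟨i, c' i ⟨k, l⟩⟩) (q) :
    mcompArr (a _ _ o' q) (fun i => b i _ _ (c' i) q) =
      mcompArr (a _ _ o q) fun i => b i _ _ (c i) q := by
  have := mcompArr_perm ha hb ho ho' (fun _ => 1) 1 q fun _ _ => rfl
  rw [SymSpectrum.perm_one] at this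
  refine Eq.trans ?_ this
  have h := SymSpectrum.pi_perm_one (fun x : Σ i, K i => X x.1 x.2) (fun x => p x.1 x.2) q
  exact (congrArg (fun T => preArr T (mcompArr (a _ _ o' q) fun i => b i _ _ (c' i) q)) h).symm

lemma mcompArr_iter (ha : MLaws a) (hb : ∀ i, MLaws (b i)) {d : ∀ i, K i → ℕ} {r : I → ℕ} {M : ℕ}
    {ĉ : ∀ i, Ord (fun k => p i k + d i k) (n' i)} {c' : ∀ i, Ord (d i) (r i)}
    {ê : Ord (fun x : Σ i, K i => p x.1 x.2 + d x.1 x.2) (N + M)}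
    {e' : Ord (fun x : Σ i, K i => d x.1 x.2) M} {o' : Ord r M} {ô : Ord n' (N + M)}
    (ho : ∀ i k l, e ⟨⟨i, k⟩, l⟩ = o ⟨i, c i ⟨k, l⟩⟩)
    (ho' : ∀ i k l, e' ⟨⟨i, k⟩, l⟩ = o' ⟨i, c' i ⟨k, l⟩⟩)
    (hô : ∀ i k l, ê ⟨⟨i, k⟩, l⟩ = ô ⟨i, ĉ i ⟨k, l⟩⟩) (q)
    (s : ∀ x : Σ i, K i, Fin (d x.1 x.2) → Fin (q.unop.len + 1)) (h : IsExtension e e' ê) :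
    preArr (Functor.pi fun x : Σ i, K i => (X x.1 x.2).iter (p x.1 x.2) q (s x))
      (mcompArr (a _ _ ô q) fun i => b i _ _ (ĉ i) q) =
      postArr (mcompArr (a _ _ o q) fun i => b i _ _ (c i) q)
        (Z.iter N q fun j => s (e'.symm j).1 (e'.symm j).2) := by
  choose u hu using fun i => exists_isExtension (c i) (c' i)
  obtain ⟨v, hv⟩ := exists_isExtension o o'
  refine (congrArg (preArr _) (mcompArr_congr (p := fun i k => p i k + d i k) ha hb
    (h.nested hu hv ho ho') hô q)).trans ?_
  let s' : ∀ i, Fin (r i) → Fin (q.unop.len + 1) :=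
    fun i j => s ⟨i, ((c' i).symm j).1⟩ ((c' i).symm j).2
  refine mcompArr_law (r := fun i k => (X i k).iter (p i k) q (s ⟨i, k⟩)) ((ha.iter o o' v q
    s' hv).trans (congrArg (fun s => postArr _ (Z.iter N q s)) (labels_eq fun i j => ?_)))
    fun i => (hb i).iter (c i) (c' i) (u i) q _ (hu i)
  obtain ⟨⟨k, l⟩, rfl⟩ := (c' i).surjective j
  dsimp only [s']
  rw [← ho', e'.symm_apply_apply, (c' i).symm_apply_apply]

end

variable {I : Type} [Finite I] {K : I → Type} [∀ i, Finite (K i)] {X : ∀ i, K i → SymSpectrum.{u}}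
  {Y : I → SymSpectrum.{u}} {Z : SymSpectrum.{u}} {G G' : Fam specO specT Y Z}
  {F F' : ∀ i, Fam specO specT (X i) (Y i)} {α : Fam.Hom G G'} {β : ∀ i, Fam.Hom (F i) (F' i)}

lemma comp (ha : MLaws fun p n e q => Arrow.mk (α p n e.cat q))
    (hb : ∀ i, MLaws fun p n e q => Arrow.mk (β i p n e.cat q)) :
    MLaws fun p n e q => Arrow.mk (Fam.Hom.comp hasConcat_specO α β p n e.cat q) where
  tr {p n} e q q' f := mcompArr_law (r := fun i k => (X i k).tr (p ⟨i, k⟩) f) (ha.tr _ f)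
    fun i => (hb i).tr _ f
  perm {p n} e e' := mcompArr_perm ha hb (p := fun i k => p ⟨i, k⟩)
    (Fam.outer_part hasConcat_specO e.cat) (Fam.outer_part hasConcat_specO e'.cat)
  iter {p d n N} e e' ê := mcompArr_iter ha hb (p := fun i k => p ⟨i, k⟩)
    (d := fun i k => d ⟨i, k⟩) (Fam.outer_part hasConcat_specO e.cat)
    (Fam.outer_part hasConcat_specO e'.cat) (Fam.outer_part hasConcat_specO ê.cat)

end MLaws

namespace MLin

section Basic

variable {I : Type} [Finite I] {X : I → SymSpectrum.{u}} {Z : SymSpectrum.{u}}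

lemma ext {F G : MLin I X Z} (h : ∀ {p n} (e : Ord p n) q, F.app e q = G.app e q) : F = G := by
  obtain ⟨F, _, _, _, _, _⟩ := F
  obtain ⟨G, _, _, _, _, _⟩ := G
  obtain rfl : @F = @G := by
    funext p n e q
    exact h e q
  rfl

/-- The component of a cell, as an arrow in the category of functors. -/
def arr {F G : MLin I X Z} (α : F ⟶ G) {p : I → ℕ} {n : ℕ} (e : Ord p n)
    (q : SimplexCategoryᵒᵖ) : Arrow ((∀ i, (X i).at (p i) q) ⥤ Z.at n q) := Arrow.mk (cell α e q)

lemma arrow_eq {F G F' G' : MLin I X Z} {α : F ⟶ G} {β : F' ⟶ G'}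
    (h : ∀ {p n} (e : Ord p n) q, arr α e q = arr β e q) : Arrow.mk α = Arrow.mk β := by
  obtain rfl := ext fun c q => left_eq_of_arrow (h c q)
  obtain rfl := ext fun c q => right_eq_of_arrow (h c q)
  congr 1
  refine MLin.Hom.ext ?_
  funext p n e q
  exact eq_of_heq (heq_of_arrow (h e q))

lemma functor_ext {V : Type*} [Category V] {L R : V ⥤ MLin I X Z}
    (h : ∀ {F G : V} (α : F ⟶ G) {p n} (e : Ord p n) q,
      arr (L.map α) e q = arr (R.map α) e q) : L = R :=
  functor_ext_arrow fun α => arrow_eq (h α)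

/-- The family of functors underlying a multilinear map. -/
abbrev fam (F : MLin I X Z) : Fam specO specT X Z := fun _ _ h q => F.app h.e q

lemma based (F : MLin I X Z) : Fam.Based SymSpectrum.pt F.fam :=
  ⟨fun h => F.obj_pt h.e, fun h => F.map_pt h.e⟩

variable {F G : MLin I X Z} (α : F ⟶ G)

abbrev famHom : Fam.Hom F.fam G.fam := fun _ _ h q => cell α h.e q

lemma based_famHom : Fam.Hom.Based SymSpectrum.pt (famHom α) := ⟨fun h => MLin.Hom.app_pt α h.e⟩

lemma laws : MLaws fun p n e q => Arrow.mk (famHom α p n e.cat q) where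
  tr e _ _ f := arrow_ext (F.naturality e f) (G.naturality e f) (MLin.Hom.naturality α e f)
  perm e e' τ π q h := arrow_ext (F.equivariance e e' τ π q h) (G.equivariance e e' τ π q h)
    fun x => MLin.Hom.equivariance α e e' τ π q x h
  iter e e' ê q s h := arrow_ext (F.structure_maps e e' ê q s h) (G.structure_maps e e' ê q s h)
    fun x => MLin.Hom.structure_maps α e e' ê q s x h

/-- The multilinear map given by a lawful family of functors. -/
abbrev ofFam (F : Fam specO specT X Z) (hF : Fam.Based SymSpectrum.pt F)
    {α : Fam.Hom F F} (hl : MLaws fun p n e q => Arrow.mk (α p n e.cat q)) : MLin I X Z where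
  app e q := F _ _ (Ord.cat e) q
  obj_pt e := hF.obj (Ord.cat e)
  map_pt e := hF.map (Ord.cat e)
  naturality e _ _ f := left_eq_of_arrow (hl.tr e f)
  equivariance e e' τ π q h := left_eq_of_arrow (hl.perm e e' τ π q h)
  structure_maps e e' ê q s h := left_eq_of_arrow (hl.iter e e' ê q s h)

/-- The cell given by a lawful family of transformations. -/
abbrev homOfFam {F G : MLin I X Z} (α : Fam.Hom F.fam G.fam) (hα : Fam.Hom.Based SymSpectrum.pt α)
    (hl : MLaws fun p n e q => Arrow.mk (α p n e.cat q)) : F ⟶ G where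
  app e q := α _ _ (Ord.cat e) q
  app_pt e := hα.app (Ord.cat e)
  naturality e _ _ f := app_heq_of_arrow (hl.tr e f)
  equivariance e e' τ π q x h := app_heq_of_arrow (hl.perm e e' τ π q h) x
  structure_maps e e' ê q s x h := app_heq_of_arrow (hl.iter e e' ê q s h) x

end Basic

/-- An ordering of a single set. -/
def idEquiv {p : Unit → ℕ} {n : ℕ} (e : Ord p n) : Fin (p ()) ≃ Fin n :=
  (unitSigma (Fin (p ()))).symm.trans (show (Σ _ : Unit, Fin (p ())) ≃ Fin n from e)

/-- The identity. -/
def id (X : SymSpectrum.{u}) : MLin Unit (fun _ => X) X where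
  app {p n} e q := Pi.eval (fun u => X.at (p u) q) () ⋙ X.idApp (idEquiv e) q
  obj_pt {p n} e q x i h := by
    change (X.idApp _ _).obj (x ()) = _
    rw [h, X.idApp_pt]
  map_pt e q x y f i _ hf := hf.map _
  naturality {p n} e {q q'} f := congrArg (Pi.eval (fun u => X.at (p u) q) () ⋙ ·)
    (X.idApp_naturality (idEquiv e) f)
  equivariance {p n} e e' τ π q h := congrArg (Pi.eval (fun u => X.at (p u) q) () ⋙ ·)
    (X.idApp_equivariance (idEquiv e) (idEquiv e') (τ ()) π q fun k => h () k)
  structure_maps {p d n N} e e' ê q s h := congrArg (Pi.eval (fun u => X.at (p u) q) () ⋙ ·)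
    (X.idApp_structure_maps (idEquiv e) (idEquiv e') (idEquiv (p := fun i => p i + d i) ê) q (s ())
      (fun k => h.1 () k) fun k => h.2 () k)

lemma id_app (X : SymSpectrum.{u}) (n : ℕ) (q : SimplexCategoryᵒᵖ) :
    (id X).app (p := fun _ => n) (unitSigma (Fin n)) q = Pi.eval (fun _ : Unit => X.at n q) () :=
  congrArg (Pi.eval (fun _ : Unit => X.at n q) () ⋙ ·) (X.perm_one q)

/-- The action of a bijection on multimorphisms and cells. -/
def actFunctor {I J : Type} [Finite I] [Finite J] (ε : I ≃ J) (X : J → SymSpectrum.{u})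
    (Z : SymSpectrum.{u}) : MLin J X Z ⥤ MLin I (fun i => X (ε i)) Z where
  obj F := ofFam (F.fam.act ε) F.based.act ((laws (𝟙 F)).act ε)
  map α := homOfFam ((famHom α).act ε) (based_famHom α).act ((laws α).act ε)
  map_id F := by
    refine MLin.Hom.ext ?_
    funext p n e q
    exact Fam.Hom.act_id ε (F := F.fam) p n (Ord.cat e) q
  map_comp α β := by
    refine MLin.Hom.ext ?_
    funext p n e q
    exact Fam.Hom.act_comp ε (famHom α) (famHom β) p n (Ord.cat e) q

lemma act_arr {I J : Type} [Finite I] [Finite J] (ε : I ≃ J) (X : J → SymSpectrum.{u})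
    (Z : SymSpectrum.{u}) {F G : MLin J X Z} (α : F ⟶ G) {p : J → ℕ} {n : ℕ}
    (e : Ord (fun i => p (ε i)) n) (e' : Ord p n) (q : SimplexCategoryᵒᵖ)
    (h : ∀ i k, e ⟨i, k⟩ = e' ⟨ε i, k⟩) : preArr (Pi.comap (fun j => (X j).at (p j) q) ε)
      (arr ((actFunctor ε X Z).map α) (p := fun i => p (ε i)) e q) = arr α e' q :=
  Fam.Hom.act_arr ε (famHom α) e.cat q (h' := e'.cat) h

variable {I : Type} [Finite I] {K : I → Type} [∀ i, Finite (K i)]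
  (X : ∀ i, K i → SymSpectrum.{u}) (Y : I → SymSpectrum.{u}) (Z : SymSpectrum.{u})

/-- Composition of multimorphisms and cells. -/
def compFunctor :
    MLin I Y Z × (∀ i, MLin (K i) (X i) (Y i)) ⥤ MLin (Σ i, K i) (fun x => X x.1 x.2) Z where
  obj F := ofFam (Fam.comp hasConcat_specO F.1.fam fun i => (F.2 i).fam)
    (F.1.based.comp fun i => (F.2 i).based) ((laws (𝟙 F.1)).comp fun i => laws (𝟙 (F.2 i)))
  map {F G} α := homOfFam (Fam.Hom.comp hasConcat_specO (famHom α.1) fun i => famHom (α.2 i))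
    ((based_famHom α.1).comp (fun i => based_famHom (α.2 i)) (fun i => (F.2 i).based) G.1.based)
    ((laws α.1).comp fun i => laws (α.2 i))
  map_id F := MLin.Hom.ext (by
    funext p n e q
    exact multicompHom_id (A := fun i k => (X i k).at (p ⟨i, k⟩) q) _ _)
  map_comp α β := MLin.Hom.ext (by
    funext p n e q
    exact multicompHom_comp (A := fun i k => (X i k).at (p ⟨i, k⟩) q) _ _ _ _)

lemma comp_arr {F F' : MLin I Y Z × (∀ i, MLin (K i) (X i) (Y i))} (α : F ⟶ F')
    {p : ∀ i, K i → ℕ} {n : I → ℕ} {N : ℕ} (a : ∀ i, Ord (p i) (n i)) (o : Ord n N)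
    (e : Ord (fun x : Σ i, K i => p x.1 x.2) N) (q : SimplexCategoryᵒᵖ)
    (ho : ∀ i k l, e ⟨⟨i, k⟩, l⟩ = o ⟨i, a i ⟨k, l⟩⟩) :
    arr ((compFunctor X Y Z).map α) (p := fun x => p x.1 x.2) e q =
      mcompArr (arr α.1 o q) fun i => arr (α.2 i) (a i) q :=
  MLaws.mcompArr_congr (laws α.1) (fun i => laws (α.2 i)) ho
    (Fam.outer_part hasConcat_specO (m := fun x => p x.1 x.2) e.cat) q

end MLin

/-- The components of multilinear maps of symmetric spectra. -/
def specComponents : Components MLin.{u} specO specT where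
  id X := MLin.id X
  act e X Y := MLin.actFunctor e X Y
  comp X Y Z := MLin.compFunctor X Y Z
  arr α _ _ h q := MLin.arr α h.e q
  exists_concat := hasConcat_specO
  id_arr X n q := congrArg (fun F => Arrow.mk (𝟙 F)) (MLin.id_app X n q)
  act_arr e _ _ _ _ α _ _ h h' q hh := MLin.act_arr e _ _ α h.e h'.e q hh
  comp_arr α _ _ _ h O H q hO := MLin.comp_arr _ _ _ α (fun i => (h i).e) O.e H.e q hO

/-- The multicategory of symmetric spectra. -/
def specMulticategory : Multicategory SymSpectrum.{u} MLin.{u} :=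
  specComponents.multicategory fun H => MLin.functor_ext fun α _ _ e q =>
    H α e.cat q

lemma isSpecMulticategory : IsSpecMulticategory specMulticategory.{u} where
  id_app X n q := MLin.id_app X n q
  act_app ε X Z F _ _ e e' q h := left_eq_of_arrow (MLin.act_arr ε X Z (𝟙 F) e e' q h)
  act_cell ε X Z _ _ α _ _ e e' q h := heq_of_arrow (MLin.act_arr ε X Z α e e' q h)
  comp_app X Y Z G F _ _ _ a o e q h := left_eq_of_arrow (MLin.comp_arr X Y Z
    (mkHom (𝟙 G) fun i => 𝟙 (F i)) a o e q h)
  comp_cell X Y Z _ _ _ _ α β _ _ _ a o e q h :=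
    heq_of_arrow (MLin.comp_arr X Y Z (mkHom α β) a o e q h)

/-! ### Whiskering of multinatural transformations -/

section Whisker

variable {Ob : Type w} {Hom : ∀ (I : Type) [Finite I], (I → Ob) → Ob → Type v}
  [∀ (I : Type) [Finite I] (a : I → Ob) (b : Ob), Category.{v₁} (Hom I a b)]
  {Ob' : Type w'} {Hom' : ∀ (I : Type) [Finite I], (I → Ob') → Ob' → Type v'}
  [∀ (I : Type) [Finite I] (a : I → Ob') (b : Ob'), Category.{v₂} (Hom' I a b)]
  {Ob'' : Type w''} {Hom'' : ∀ (I : Type) [Finite I], (I → Ob'') → Ob'' → Type v''}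
  [∀ (I : Type) [Finite I] (a : I → Ob'') (b : Ob''), Category.{v₃} (Hom'' I a b)]
  {M : Multicategory Ob Hom} {N : Multicategory Ob' Hom'} {P : Multicategory Ob'' Hom''}

lemma Multifunctor.post_map {J₀ : Ob' → Ob''} (J : Multifunctor N P J₀) {I : Type} [Finite I]
    (a : I → Ob') {b c : Ob'} (h : Hom' Unit (fun _ => b) c) :
    N.post a h ⋙ J.map a c = J.map a b ⋙
      P.post (fun i => J₀ (a i)) (b := J₀ b) ((J.map (fun _ : Unit => b) c).obj h) := by
  let Q : Hom' I a b ⥤ Hom' Unit (fun _ => b) c × (∀ _ : Unit, Hom' I a b) :=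
    Functor.prod' ((Functor.const _).obj h) (Functor.pi' fun _ : Unit => 𝟭 (Hom' I a b))
  let R := P.act (unitSigma I).symm (fun x : Σ _ : Unit, I => J₀ (a x.2)) (J₀ c)
  have h₁ := congrArg (fun T => Q ⋙ T ⋙ R) (J.map_comp (fun _ : Unit => a) (fun _ => b) c)
  have h₂ := congrArg (fun T => Q ⋙ N.comp (fun _ : Unit => a) (fun _ => b) c ⋙ T)
    (J.map_act (unitSigma I).symm (fun x : Σ _ : Unit, I => a x.2) c)
  have h₃ : Q ⋙ Functor.prod (J.map (fun _ : Unit => b) c) (Functor.pi fun _ => J.map a b) =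
      J.map a b ⋙ Functor.prod' ((Functor.const _).obj ((J.map (fun _ : Unit => b) c).obj h))
        (Functor.pi' fun _ : Unit => 𝟭 (Hom'' I (fun i => J₀ (a i)) (J₀ b))) :=
    hext (fun _ => rfl) fun x y f => heq_of_eq
      (Prod.ext (fmap_id _ _) rfl)
  exact h₂.trans (h₁.trans (congrArg (fun T => T ⋙
    P.comp (fun _ : Unit => fun i => J₀ (a i)) (fun _ => J₀ b) (J₀ c) ⋙ R) h₃))

lemma Multifunctor.pre_map {J₀ : Ob' → Ob''} (J : Multifunctor N P J₀) {I : Type} [Finite I]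
    {a a' : I → Ob'} (h : ∀ i, Hom' Unit (fun _ => a i) (a' i)) (b : Ob') :
    N.pre h b ⋙ J.map a b = J.map a' b ⋙ P.pre (a := fun i => J₀ (a i)) (a' := fun i => J₀ (a' i))
      (fun i => (J.map (fun _ : Unit => a i) (a' i)).obj (h i)) (J₀ b) := by
  let Q : Hom' I a' b ⥤ Hom' I a' b × (∀ i, Hom' Unit (fun _ => a i) (a' i)) :=
    Functor.prod' (𝟭 (Hom' I a' b)) ((Functor.const _).obj h)
  let R := P.act (sigmaUnit I).symm (fun x : Σ _ : I, Unit => J₀ (a x.1)) (J₀ b)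
  have h₁ := congrArg (fun T => Q ⋙ T ⋙ R) (J.map_comp (fun i (_ : Unit) => a i) a' b)
  have h₂ := congrArg (fun T => Q ⋙ N.comp (fun i (_ : Unit) => a i) a' b ⋙ T)
    (J.map_act (sigmaUnit I).symm (fun x : Σ _ : I, Unit => a x.1) b)
  have h₃ : Q ⋙ Functor.prod (J.map a' b) (Functor.pi fun i => J.map (fun _ : Unit => a i) (a' i)) =
      J.map a' b ⋙ Functor.prod' (𝟭 (Hom'' I (fun i => J₀ (a' i)) (J₀ b)))
        ((Functor.const _).obj fun i => (J.map (fun _ : Unit => a i) (a' i)).obj (h i)) :=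
    hext (fun _ => rfl) fun x y f => heq_of_eq
      (Prod.ext rfl (funext fun i => fmap_id _ _))
  exact h₂.trans (h₁.trans (congrArg (fun T => T ⋙
    P.comp (fun i (_ : Unit) => J₀ (a i)) (fun i => J₀ (a' i)) (J₀ b) ⋙ R) h₃))

/-- The composite of a multinatural transformation with a multifunctor. -/
def MultinatTrans.whisker {F₀ G₀ : Ob → Ob'} {F : Multifunctor M N F₀} {G : Multifunctor M N G₀}
    (φ : MultinatTrans F G) {J₀ : Ob' → Ob''} (J : Multifunctor N P J₀) :
    MultinatTrans (F.comp J) (G.comp J) where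
  app a := (J.map (fun _ : Unit => F₀ a) (G₀ a)).obj (φ.app a)
  naturality a b := (congrArg (F.map a b ⋙ ·) (J.post_map (fun i => F₀ (a i)) (φ.app b)).symm).trans
    ((congrArg (· ⋙ J.map (fun i => F₀ (a i)) (G₀ b)) (φ.naturality a b)).trans
      (congrArg (G.map a b ⋙ ·) (J.pre_map (fun i => φ.app (a i)) (G₀ b))))

end Whisker

/-! ### The multifunctor from `ℰ_*`-categories to symmetric spectra -/

section Diagonal

variable {I : Type} [Finite I] {X : I → EStarCat.{u}} {Y : EStarCat.{u}}

lemma isConcat_diagMap {p : I → ℕ} {n : ℕ} (e : (Σ i, Fin (p i)) ≃ Fin n)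
    {q q' : SimplexCategoryᵒᵖ} (f : q ⟶ q') :
    IsConcat (diagConcat e q) (diagConcat e q') (fun i => diagMap (p i) f) (diagMap n f) :=
  fun _ _ => ⟨rfl, fun x y h => by
    obtain rfl : x = y := Fin.ext h
    rfl⟩

lemma isConcat_permHom {p : I → ℕ} {n : ℕ} {e e' : (Σ i, Fin (p i)) ≃ Fin n}
    {τ : ∀ i, Equiv.Perm (Fin (p i))} {π : Equiv.Perm (Fin n)}
    (h : ∀ i k, e' ⟨i, τ i k⟩ = π (e ⟨i, k⟩)) (q : SimplexCategoryᵒᵖ) :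
    IsConcat (diagConcat e q) (diagConcat e' q) (fun i => permHom (τ i) q) (permHom π q) := by
  refine fun i k => ⟨?_, fun x y h => h⟩
  obtain ⟨k, rfl⟩ := (τ i).surjective k
  change some (π.symm (e' ⟨i, τ i k⟩)) = some (e ⟨i, (τ i).symm (τ i k)⟩)
  rw [h, Equiv.symm_apply_apply, Equiv.symm_apply_apply]

lemma isConcat_suspIter {p d : I → ℕ} {n N : ℕ} {e : (Σ i, Fin (p i)) ≃ Fin n}
    {e' : (Σ i, Fin (d i)) ≃ Fin N} {ê : (Σ i, Fin (p i + d i)) ≃ Fin (n + N)}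
    (h : IsExtension e e' ê) (q : SimplexCategoryᵒᵖ)
    (s : ∀ i, Fin (d i) → Fin (q.unop.len + 1)) :
    IsConcat (diagConcat e q) (diagConcat ê q) (fun i => suspIter (p i) q (d i) (s i))
      (suspIter n q N fun j => s (e'.symm j).1 (e'.symm j).2) := by
  obtain ⟨h₁, h₂⟩ := suspIter_spec n q N fun j => s (e'.symm j).1 (e'.symm j).2
  intro i k
  obtain ⟨h₃, h₄⟩ := suspIter_spec (p i) q (d i) (s i)
  change ePre (suspIter n q N _) (ê ⟨i, k⟩) = Option.map (fun l => e ⟨i, l⟩)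
    (ePre (suspIter (p i) q (d i) (s i)) k) ∧ ∀ x y : Fin (q.unop.len + 1),
    x.val = y.val → eMap (suspIter n q N _) (ê ⟨i, k⟩) x = eMap (suspIter (p i) q (d i) (s i)) k y
  revert k
  refine fun k => Fin.addCases (fun k => ?_) (fun k => ?_) k
  · rw [h.1, (h₁ _).1, (h₃ k).1]
    refine ⟨rfl, fun x y hx => ?_⟩
    rw [(h₁ _).2, (h₃ k).2, hx]
  · rw [h.2, (h₂ _).1, (h₄ k).1]
    refine ⟨rfl, fun x y hx => ?_⟩
    rw [(h₂ _).2, (h₄ k).2, Fin.ext hx, e'.symm_apply_apply]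

lemma ISpec_iter (X : EStarCat.{u}) (n : ℕ) (q : SimplexCategoryᵒᵖ) {p : ℕ}
    (s : Fin p → Fin (q.unop.len + 1)) : (ISpec X).iter n q s = X.tr (suspIter n q p s) :=
  congrArg BasedCat.func (X.iterSigma_eq n q p s)

lemma EMor.arr_suspIter {F G : EMor I X Y} (α : F ⟶ G) {p d : I → ℕ} {n N : ℕ}
    {e : (Σ i, Fin (p i)) ≃ Fin n} {e' : (Σ i, Fin (d i)) ≃ Fin N}
    {ê : (Σ i, Fin (p i + d i)) ≃ Fin (n + N)} (h : IsExtension e e' ê) (q : SimplexCategoryᵒᵖ)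
    (s : ∀ i, Fin (d i) → Fin (q.unop.len + 1)) :
    preArr (Functor.pi fun i => (ISpec (X i)).iter (p i) q (s i)) (EMor.arr α (diagConcat ê q)) =
      postArr (EMor.arr α (diagConcat e q))
        ((ISpec Y).iter n q fun j => s (e'.symm j).1 (e'.symm j).2) := by
  have h₁ : (fun i => (ISpec (X i)).iter (p i) q (s i)) =
    fun i => (X i).tr (suspIter (p i) q (d i) (s i)) := funext fun i => ISpec_iter _ _ _ _
  rw [h₁, ISpec_iter]
  exact EMor.arr_naturality α (isConcat_suspIter h q s)

lemma EMor.laws {F G : EMor I X Y} (α : F ⟶ G) : MLaws (X := fun i => ISpec (X i)) (Z := ISpec Y)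
    fun _ _ e q => Arrow.mk (cell α (diagConcat e q)) where
  tr e _ _ f := EMor.arr_naturality α (isConcat_diagMap e f)
  perm _ _ _ _ q h := EMor.arr_naturality α (isConcat_permHom h q)
  iter _ _ _ q s h := EMor.arr_suspIter α h q s

/-- The restriction of multimorphisms and cells to the diagonals. -/
def EMor.restrictFunctor (X : I → EStarCat.{u}) (Y : EStarCat.{u}) :
    EMor I X Y ⥤ MLin I (fun i => ISpec (X i)) (ISpec Y) where
  obj F := MLin.ofFam (fun _ _ h q => F.app (diagConcat h.e q))
    ⟨fun h q => F.obj_pt (diagConcat h.e q), fun h q => F.map_pt (diagConcat h.e q)⟩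
    (α := fun _ _ _ _ => 𝟙 _) (EMor.laws (𝟙 F))
  map α := MLin.homOfFam (fun _ _ h q => cell α (diagConcat h.e q))
    ⟨fun h q => EMor.Hom.app_pt α (diagConcat h.e q)⟩ (EMor.laws α)

lemma EMor.restrict_id (X : EStarCat.{u}) : (EMor.restrictFunctor (fun _ => X) X).obj (EMor.id X) = MLin.id (ISpec X) :=
  MLin.ext fun {p n} e q => by
    obtain rfl : p () = n := Fin.equiv_iff_eq.1 ⟨MLin.idEquiv e⟩
    have h := (exists_isConcat (Concat.self (diagObj (p ()) q)) (diagConcat e q)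
      fun _ => 𝟙 _).choose_spec
    have h' : IsConcat (m := fun _ : Unit => diagObj (p ()) q) (m' := fun i => diagObj (p i) q)
        (Concat.self (diagObj (p ()) q)) (diagConcat e q)
        (fun _ => 𝟙 _) (permHom (MLin.idEquiv e) q) := fun i k => by
      refine ⟨?_, fun x y h => h⟩
      exact congrArg some ((MLin.idEquiv e).symm_apply_apply k)
    exact congrArg (fun f => Pi.eval (fun _ : Unit => X.at (diagObj (p ()) q)) () ⋙ X.tr f)
      (h.unique h')

end Diagonal

/-- The multifunctor `I`. -/
def spectrumMultifunctor :
    Multifunctor estarMulticategory.{u} specMulticategory.{u} ISpec where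
  map X Y := EMor.restrictFunctor X Y
  map_id X := EMor.restrict_id X
  map_act ε X Y := MLin.functor_ext fun α p n e q => by
    obtain ⟨p, rfl⟩ := exists_comap_fun ε (S := fun _ => ℕ) p
    refine preArr_comap_injective ε (fun j => (ISpec (X j)).at (p j) q) ?_
    exact (EMor.act_arr ε X Y α (m := fun j => diagObj (p j) q) (diagConcat e q)
      (diagConcat (uncomapEquiv ε e) q) (uncomapEquiv_apply ε e)).trans
      (MLin.act_arr ε (fun j => ISpec (X j)) (ISpec Y) ((EMor.restrictFunctor X Y).map α) e
        (uncomapEquiv ε e) q (uncomapEquiv_apply ε e)).symm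
  map_comp {I} _ {K} _ X Y Z := MLin.functor_ext fun α p n e q => by
    obtain ⟨m, a, o, h⟩ := specComponents.{u}.exists_nested (Ord.cat e)
    exact (EMor.comp_arr X Y Z α (m := fun i k => diagObj (p ⟨i, k⟩) q)
      (fun i => diagConcat (a i).e q) (diagConcat o.e q) (diagConcat e q) h).trans
      (MLin.comp_arr (fun i k => ISpec (X i k)) (fun i => ISpec (Y i)) (ISpec Z)
        ((Functor.prod (EMor.restrictFunctor Y Z)
          (Functor.pi fun i => EMor.restrictFunctor (X i) (Y i))).map α)
        (p := fun i k => p ⟨i, k⟩) (fun i => (a i).e) o.e e q h).symm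

lemma isSpectrumMultifunctor : IsSpectrumMultifunctor spectrumMultifunctor.{u} where
  map_app _ _ _ _ _ _ _ := rfl
  map_cell _ _ _ _ _ _ _ _ _ := HEq.rfl

/-! ### Extension by zero -/

lemma heq_of_isZero {C : Type*} [Category C] {X Y X' Y' : C} {f : X ⟶ Y} {g : X' ⟶ Y'}
    (hX : X = X') (hY : Y = Y') (h : IsZero X ∨ IsZero Y) : HEq f g := by
  subst hX hY
  exact heq_of_eq (h.elim (fun h => h.eq_of_src _ _) fun h => h.eq_of_tgt _ _)

lemma poset_hom_heq {P : Type} [PartialOrder P] {x y x' y' : P} {f : x ⟶ y} {f' : x' ⟶ y'}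
    (hx : x = x') (hy : y = y') : HEq f f' := by
  subst hx hy
  exact heq_of_eq (Subsingleton.elim _ _)

lemma monoFunctor_ext {P Q : Type} [PartialOrder P] [PartialOrder Q] {F G : P ⥤ Q}
    (h : ∀ x, F.obj x = G.obj x) : F = G :=
  hext h fun x y f => poset_hom_heq (h x) (h y)

section ZeroExt

variable {P : Type} [PartialOrder P] {C : Type u} [SmallCategory C] {pt : C} (hz : IsZero pt)
  (N : Set P) [hN : N.OrdConnected]

open Classical in
/-- The extension by zero of the restriction of a functor to a convex set. -/
def zeroExt (G : P ⥤ C) : P ⥤ C where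
  obj x := if x ∈ N then G.obj x else pt
  map {x y} f := if h : x ∈ N ∧ y ∈ N then eqToHom (if_pos h.1) ≫ G.map f ≫
    eqToHom (if_pos h.2).symm else hz.from_ _ ≫ hz.to_ _
  map_id x := by
    by_cases h : x ∈ N
    · simp [h]
    · exact IsZero.eq_of_src (by rwa [if_neg h]) _ _
  map_comp {x y z} f g := by
    by_cases hx : x ∈ N
    · by_cases hy : z ∈ N
      · have : y ∈ N := hN.out hx hy ⟨leOfHom f, leOfHom g⟩
        simp [hx, hy, this]
      · exact IsZero.eq_of_tgt (by rwa [if_neg hy]) _ _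
    · exact IsZero.eq_of_src (by rwa [if_neg hx]) _ _

variable {N} {G G' : P ⥤ C}

lemma zeroExt_obj {x : P} (h : x ∈ N) : (zeroExt hz N G).obj x = G.obj x := if_pos h

lemma zeroExt_obj_of_notMem {x : P} (h : x ∉ N) : (zeroExt hz N G).obj x = pt := if_neg h

lemma zeroExt_isZero {x : P} (h : x ∉ N) : IsZero ((zeroExt hz N G).obj x) := by
  rwa [zeroExt_obj_of_notMem hz h]

lemma zeroExt_map {x y : P} (f : x ⟶ y) (hx : x ∈ N) (hy : y ∈ N) :
    HEq ((zeroExt hz N G).map f) (G.map f) := by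
  rw [show (zeroExt hz N G).map f = _ from dif_pos ⟨hx, hy⟩]
  exact ((isId_eqToHom _).comp_heq _).trans (IsId.heq_comp _ (isId_eqToHom _))

lemma eq_zeroExt {H : P ⥤ C} (h₁ : ∀ x ∈ N, H.obj x = G.obj x) (h₂ : ∀ x ∉ N, H.obj x = pt)
    (h₃ : ∀ {x y : P} (f : x ⟶ y), x ∈ N → y ∈ N → HEq (H.map f) (G.map f)) :
    H = zeroExt hz N G := by
  have h : ∀ x, H.obj x = (zeroExt hz N G).obj x := fun x => by
    by_cases hx : x ∈ N
    · exact (h₁ x hx).trans (zeroExt_obj hz hx).symm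
    · exact (h₂ x hx).trans (zeroExt_obj_of_notMem hz hx).symm
  refine hext h fun x y f => ?_
  by_cases hx : x ∈ N
  · by_cases hy : y ∈ N
    · exact (h₃ f hx hy).trans (zeroExt_map hz f hx hy).symm
    · exact heq_of_isZero (h _) (h _) (Or.inr (by rwa [h₂ y hy]))
  · exact heq_of_isZero (h _) (h _) (Or.inl (by rwa [h₂ x hx]))

variable (N)

open Classical in
/-- The extension by zero of a natural transformation. -/
def zeroExtMap (τ : G ⟶ G') : zeroExt hz N G ⟶ zeroExt hz N G' where
  app x := if h : x ∈ N then eqToHom (zeroExt_obj hz h) ≫ τ.app x ≫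
    eqToHom (zeroExt_obj hz h).symm else hz.from_ _ ≫ hz.to_ _
  naturality x y f := by
    by_cases hx : x ∈ N
    · by_cases hy : y ∈ N
      · have e : ∀ G : P ⥤ C, (zeroExt hz N G).map f = eqToHom (if_pos hx) ≫ G.map f ≫
          eqToHom (if_pos hy).symm := fun G => dif_pos ⟨hx, hy⟩
        rw [dif_pos hx, dif_pos hy, e, e]
        change (eqToHom _ ≫ G.map f ≫ eqToHom _) ≫ eqToHom (if_pos hy) ≫ τ.app y ≫
          eqToHom (if_pos hy).symm = (eqToHom (if_pos hx) ≫ τ.app x ≫ eqToHom (if_pos hx).symm) ≫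
            eqToHom _ ≫ G'.map f ≫ eqToHom _
        simp
      · exact (zeroExt_isZero hz hy).eq_of_tgt _ _
    · exact (zeroExt_isZero hz hx).eq_of_src _ _

variable {N}

lemma zeroExtMap_app {τ : G ⟶ G'} {x : P} (h : x ∈ N) :
    HEq ((zeroExtMap hz N τ).app x) (τ.app x) := by
  rw [show (zeroExtMap hz N τ).app x = _ from dif_pos h]
  exact ((isId_eqToHom _).comp_heq _).trans (IsId.heq_comp _ (isId_eqToHom _))

lemma heq_zeroExtMap {H H' : P ⥤ C} {α : H ⟶ H'} {τ : G ⟶ G'} (h : H = zeroExt hz N G)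
    (h' : H' = zeroExt hz N G') (hα : ∀ x ∈ N, HEq (α.app x) (τ.app x)) :
    HEq α (zeroExtMap hz N τ) := by
  refine natTrans_heq h h' fun x => ?_
  by_cases hx : x ∈ N
  · exact (hα x hx).trans (zeroExtMap_app hz hx).symm
  · subst h h'
    exact heq_of_isZero rfl rfl (Or.inl (zeroExt_isZero hz hx))

end ZeroExt

/-! ### The functors in the iterated Waldhausen construction -/

lemma Ar.ext {I : Type} {m : I → ℕ} {x y : Ar m} (h : x.src = y.src) (h' : x.tgt = y.tgt) :
    x = y := Subtype.ext (Prod.ext h h')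

/-- The object `(i, max i j)`. -/
def Ar.from {I : Type} {m : I → ℕ} (i j : Cube m) : Ar m := ⟨(i, i.sup j), Cube.le_sup_left⟩

lemma Ar.from_mono {I : Type} {m : I → ℕ} (i : Cube m) : Monotone (Ar.from i) :=
  fun _ _ h => ⟨le_refl _, fun k => max_le_max_left _ (h k)⟩

lemma Ar.from_le {I : Type} {m : I → ℕ} {i i' : Cube m} (h : i ≤ i') (j : Cube m) :
    Ar.from i j ≤ Ar.from i' j := ⟨h, fun k => max_le_max_right _ (h k)⟩

lemma Ar.from_tgt {I : Type} {m : I → ℕ} (y : Ar m) : Ar.from y.src y.tgt = y :=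
  Ar.ext rfl (funext fun k => max_eq_right (y.2 k))

/-- The element of a cube with one coordinate replaced. -/
def Cube.set {I : Type} {m : I → ℕ} (j : Cube m) (k : I) (a : Fin (m k + 1)) : Cube m :=
  open Classical in Function.update j k a

lemma Cube.set_self {I : Type} {m : I → ℕ} (j : Cube m) (k : I) (a : Fin (m k + 1)) :
    j.set k a k = a := by classical exact Function.update_self _ _ _

lemma Cube.set_ne {I : Type} {m : I → ℕ} (j : Cube m) (k : I) (a : Fin (m k + 1)) {l : I}
    (h : l ≠ k) : j.set k a l = j l := by classical exact Function.update_of_ne h _ _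

lemma Cube.set_le {I : Type} {m : I → ℕ} {j j' : Cube m} {k : I} {a : Fin (m k + 1)}
    (h : a ≤ j' k) (h' : ∀ l ≠ k, j l ≤ j' l) : j.set k a ≤ j' := fun l => by
  by_cases hl : l = k
  · subst hl; exact (set_self j l a).trans_le h
  · exact (set_ne j k a hl).trans_le (h' l hl)

section Sdot

variable {A : WaldCat.{u}} {I : Type} [Finite I] {m : I → ℕ} {F : Ar m ⥤ A.C}

lemma isIso_map_of_eq {P : Type} [PartialOrder P] {C : Type*} [Category C] (G : P ⥤ C) {x y : P}
    (f : x ⟶ y) (h : x = y) : IsIso (G.map f) := by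
  subst h
  rw [Subsingleton.elim f (𝟙 x)]
  infer_instance

open Classical in
lemma IsSdot.reedy_from (hF : IsSdot A F) (i : Cube m) :
    Reedy A ((Ar.from_mono i).functor ⋙ F) := by
  have key : ∀ S : Finset I, ∀ i : Cube m, (∀ k, k ∉ S → i k = 0) →
      Reedy A ((Ar.from_mono i).functor ⋙ F) := by
    intro S
    induction S using Finset.induction_on with
    | empty =>
      intro i hi
      obtain rfl : i = fun _ => 0 := funext fun k => hi k (by simp)
      refine (cubicallyCofibrant_iff.1 hF.cubical).of_iso (eqToIso ?_)
      exact congrArg (· ⋙ F) (monoFunctor_ext fun j => Ar.ext rfl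
        (funext fun k => (max_eq_right (Fin.zero_le _)).symm))
    | insert k S hk ih =>
      intro i hi
      let i' : Cube m := i.set k 0
      have hi' : i' ≤ i := Cube.set_le (Fin.zero_le _) fun _ _ => le_refl _
      have hne : ∀ l ≠ k, i' l = i l := fun l h => Cube.set_ne i k 0 h
      have hk' : i' k = 0 := Cube.set_self i k 0
      let s : Cube m → Cube m := fun j => j.set k (min (j k) (i k))
      have hs : ∀ j, s j ≤ j := fun j => Cube.set_le (min_le_left _ _) fun _ _ => le_refl _
      have hsk : ∀ j, s j k = min (j k) (i k) := fun j => Cube.set_self _ _ _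
      have hsne : ∀ j l, l ≠ k → s j l = j l := fun j l h => Cube.set_ne _ _ _ h
      refine (ih i' fun l hl => ?_).quotient (E := {j | j k ≤ i k})
        (fun x y h hx => (h k).trans hx) s (fun x => ?_) hs (fun x y hy hyx l => ?_)
        { app := fun j => F.map (homOfLE (Ar.from_le hi' j))
          naturality := fun x y f => by exact (F.map_comp _ _).symm.trans (F.map_comp (homOfLE (Ar.from_le hi' x)) (homOfLE (Ar.from_mono i (leOfHom f)))) } fun x => ?_
      · by_cases h : l = k
        · rw [h, hk']
        · rw [hne l h]
          exact hi l (by simp [h, hl])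
      · exact (hsk x).trans_le (min_le_right _ _)
      · by_cases h : l = k
        · subst h
          exact (le_min (hyx l) hy).trans_eq (hsk x).symm
        · rw [hsne x l h]; exact hyx l
      · have hpt : F.obj (Ar.from i (s x)) = A.pt := hF.obj_eq_pt _ k
          (max_eq_left ((hsk x).trans_le (min_le_right _ _))).symm
        have hp : IsPushout (F.map (homOfLE ((Ar.from_mono i') (hs x))))
            (F.map (homOfLE (Ar.from_le hi' (s x)))) (F.map (homOfLE (Ar.from_le hi' x)))
            (F.map (homOfLE ((Ar.from_mono i) (hs x)))) := by
          by_cases hx : i k ≤ x k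
          · refine hF.isPushout _ _ _ _ k rfl ?_ ?_ rfl ?_ ?_
            · refine funext fun l => ?_
              by_cases h : l = k
              · subst h
                change max (i l) (s x l) = max (i' l) (s x l)
                rw [hsk, hk', min_eq_right hx]
                simp
              · change max (i l) (s x l) = max (i' l) (s x l)
                rw [hne l h]
            · change i k = max (i' k) (s x k)
              rw [hsk, hk', min_eq_right hx]
              simp
            · refine funext fun l => ?_
              change max (i l) (x l) = max (i' l) (x l)
              by_cases h : l = k
              · subst h
                rw [hk', max_eq_right hx, max_eq_right (Fin.zero_le _)]
              · rw [hne l h]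
            · intro l h
              refine ⟨?_, (hne l h).symm⟩
              change max (i' l) (x l) = max (i' l) (s x l)
              rw [hsne x l h]
          · have e : s x = x := funext fun l => by
              by_cases h : l = k
              · subst h
                rw [hsk, min_eq_left (le_of_not_ge hx)]
              · rw [hsne x l h]
            have := isIso_map_of_eq F (homOfLE ((Ar.from_mono i') (hs x))) (by rw [e])
            have := isIso_map_of_eq F (homOfLE ((Ar.from_mono i) (hs x))) (by rw [e])
            exact IsPushout.of_horiz_isIso ⟨(map_homOfLE_comp F _ _).trans (map_homOfLE_comp F _ _).symm⟩
        exact isPushout_heq rfl rfl hpt rfl HEq.rfl (heq_of_isZero rfl hpt (Or.inr (by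
          rw [hpt]; exact A.isZero))) HEq.rfl (heq_of_isZero hpt rfl (Or.inl (by
          rw [hpt]; exact A.isZero))) hp
  obtain ⟨_⟩ := nonempty_fintype I
  exact key Finset.univ i fun k hk => (hk (Finset.mem_univ k)).elim

lemma IsSdot.cof_of_src_eq (hF : IsSdot A F) {x y : Ar m} (f : x ⟶ y) (h : x.src = y.src) :
    A.cof (F.map f) := by
  have := (hF.reedy_from x.src).map_cof (x := x.tgt) (y := y.tgt) (leOfHom f).2
  refine property_heq A.cof (congrArg F.obj (Ar.from_tgt x))
    (congrArg F.obj ((congrArg (Ar.from · _) h).trans (Ar.from_tgt y))) ?_ this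
  exact map_heq F (Ar.from_tgt x) ((congrArg (Ar.from · _) h).trans (Ar.from_tgt y))
    (poset_hom_heq (Ar.from_tgt x) ((congrArg (Ar.from · _) h).trans (Ar.from_tgt y)))

end Sdot

/-! ### The `ℰ_*`-category of a Waldhausen category -/

section Image

variable {r s t : EObj}

lemma ePre_eq_some {f : s ⟶ t} {i : Fin s.len} {j : Fin t.len} :
    ePre f j = some i ↔ eInj f i = j := EHom.p_eq_some f i j

lemma ePre_eInj (f : s ⟶ t) (i : Fin s.len) : ePre f (eInj f i) = some i := ePre_eq_some.2 rfl

lemma eInj_injective (f : s ⟶ t) : Function.Injective (eInj f) := fun i j h => by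
  have := ePre_eInj f i
  rw [h, ePre_eInj] at this
  exact (Option.some_injective _ this).symm

lemma eMap_lt (f : s ⟶ t) (k : Fin s.len) (x : Fin (t.val (eInj f k) + 1)) :
    eMap f (eInj f k) x < s.val k + 1 := EHom.β_lt f (ePre_eInj f k) x

/-- The entries of the image of `v` under the maps `β`. -/
def Cube.image (f : s ⟶ t) (v : Cube t.val) : Cube s.val := fun k => ⟨_, eMap_lt f k (v (eInj f k))⟩

lemma Cube.image_mono (f : s ⟶ t) : Monotone (Cube.image f) :=
  fun _ _ h k => eMap_mono f _ (h (eInj f k))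

/-- The image of an object of `Ar t` under a morphism of `ℰ`. -/
def Ar.image (f : s ⟶ t) (y : Ar t.val) : Ar s.val :=
  ⟨(Cube.image f y.src, Cube.image f y.tgt), Cube.image_mono f y.2⟩

lemma Ar.image_mono (f : s ⟶ t) : Monotone (Ar.image f) :=
  fun _ _ h => ⟨Cube.image_mono f h.1, Cube.image_mono f h.2⟩

lemma Ar.IsImage.eq {f : s ⟶ t} {y : Ar t.val} {x : Ar s.val} (h : Ar.IsImage f y x) :
    x = Ar.image f y :=
  Ar.ext (funext fun k => Fin.ext (h k).1) (funext fun k => Fin.ext (h k).2)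

lemma Cube.image_congr (f : s ⟶ t) {v w : Cube t.val} {k : Fin s.len}
    (h : v (eInj f k) = w (eInj f k)) : Cube.image f v k = Cube.image f w k :=
  Fin.ext (congrArg (eMap f _) h)

instance (f : s ⟶ t) : Set.OrdConnected {y | Ar.Nondeg f y} where
  out' x hx z hz y hy j hj := by
    refine ⟨Nat.le_zero.1 ((eMap_mono f j (hy.2.1 j)).trans_eq (hz j hj).1),
      le_antisymm ((eMap_le f j _).trans_eq (by rw [hj]; rfl)) ?_⟩
    exact (hx j hj).2.symm.trans_le (eMap_mono f j (hy.1.2 j))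

lemma eMap_comp_image (f : r ⟶ s) (g : s ⟶ t) (v : Cube t.val) (i : Fin s.len) :
    eMap (f ≫ g) (eInj g i) (v (eInj g i)) = eMap f i (Cube.image g v i) :=
  eMap_comp_some f g (ePre_eInj g i) _ _ rfl

lemma Cube.image_comp (f : r ⟶ s) (g : s ⟶ t) (v : Cube t.val) :
    Cube.image (f ≫ g) v = Cube.image f (Cube.image g v) :=
  funext fun k => Fin.ext (eMap_comp_image f g v (eInj f k))

lemma Ar.nondeg_comp (f : r ⟶ s) (g : s ⟶ t) (y : Ar t.val) :
    Ar.Nondeg (f ≫ g) y ↔ Ar.Nondeg g y ∧ Ar.Nondeg f (Ar.image g y) := by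
  refine ⟨fun h => ⟨fun j hj => ?_, fun i hi => ?_⟩, fun h j hj => ?_⟩
  · have := h j (by rw [ePre_comp, hj]; rfl)
    rwa [eMap_comp_none f g hj, eMap_comp_none f g hj] at this
  · have := h (eInj g i) (by rw [ePre_comp, ePre_eInj]; exact hi)
    rwa [eMap_comp_image, eMap_comp_image] at this
  · obtain hi | ⟨i, hi⟩ := (ePre g j).eq_none_or_eq_some
    · rw [eMap_comp_none f g hi, eMap_comp_none f g hi]
      exact h.1 j hi
    · obtain rfl := ePre_eq_some.1 hi
      rw [ePre_comp, hi] at hj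
      rw [eMap_comp_image, eMap_comp_image]
      exact h.2 i hj

variable (A : WaldCat.{u})

/-- The functor on `Ar t` induced by a functor on `Ar s` and a morphism `s ⟶ t` of `ℰ`. -/
def sdotFunctor (f : s ⟶ t) (F : Ar s.val ⥤ A.C) : Ar t.val ⥤ A.C :=
  zeroExt A.isZero {y | Ar.Nondeg f y} (monoFunctor (Ar.image f) (Ar.image_mono f) ⋙ F)

variable {A}

lemma sdotFunctor_obj {f : s ⟶ t} (F : Ar s.val ⥤ A.C) {y : Ar t.val} (h : Ar.Nondeg f y) :
    (sdotFunctor A f F).obj y = F.obj (Ar.image f y) :=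
  zeroExt_obj A.isZero (N := {y | Ar.Nondeg f y}) h

lemma sdotFunctor_obj_of_not {f : s ⟶ t} (F : Ar s.val ⥤ A.C) {y : Ar t.val}
    (h : ¬ Ar.Nondeg f y) : (sdotFunctor A f F).obj y = A.pt :=
  zeroExt_obj_of_notMem A.isZero (N := {y | Ar.Nondeg f y}) h

lemma sdotFunctor_map {f : s ⟶ t} (F : Ar s.val ⥤ A.C) {x y : Ar t.val} (g : x ⟶ y)
    (h : Ar.Nondeg f x) (h' : Ar.Nondeg f y) : HEq ((sdotFunctor A f F).map g)
      (F.map (homOfLE (Ar.image_mono f (leOfHom g)))) :=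
  zeroExt_map A.isZero (N := {y | Ar.Nondeg f y}) g h h'

/-- The natural transformation induced by a morphism of `ℰ`. -/
def sdotTrans (f : s ⟶ t) {F F' : Ar s.val ⥤ A.C} (α : F ⟶ F') :
    sdotFunctor A f F ⟶ sdotFunctor A f F' :=
  zeroExtMap A.isZero {y | Ar.Nondeg f y}
    (Functor.whiskerLeft (monoFunctor (Ar.image f) (Ar.image_mono f)) α)

lemma sdotTrans_app {f : s ⟶ t} {F F' : Ar s.val ⥤ A.C} (α : F ⟶ F') {y : Ar t.val}
    (h : Ar.Nondeg f y) : HEq ((sdotTrans f α).app y) (α.app (Ar.image f y)) :=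
  zeroExtMap_app A.isZero (N := {y | Ar.Nondeg f y}) h

lemma heq_sdotTrans {f : s ⟶ t} {F F' : Ar s.val ⥤ A.C} {H H' : Ar t.val ⥤ A.C} {β : H ⟶ H'}
    {α : F ⟶ F'} (h : H = sdotFunctor A f F) (h' : H' = sdotFunctor A f F')
    (hβ : ∀ y, Ar.Nondeg f y → HEq (β.app y) (α.app (Ar.image f y))) : HEq β (sdotTrans f α) :=
  heq_zeroExtMap A.isZero h h' hβ

lemma eq_sdotFunctor {f : s ⟶ t} {F : Ar s.val ⥤ A.C} {H : Ar t.val ⥤ A.C}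
    (h₁ : ∀ y, Ar.Nondeg f y → H.obj y = F.obj (Ar.image f y))
    (h₂ : ∀ y, ¬ Ar.Nondeg f y → H.obj y = A.pt)
    (h₃ : ∀ {x y : Ar t.val} (g : x ⟶ y), Ar.Nondeg f x → Ar.Nondeg f y →
      HEq (H.map g) (F.map (homOfLE (Ar.image_mono f (leOfHom g))))) :
    H = sdotFunctor A f F := eq_zeroExt A.isZero h₁ h₂ h₃

lemma eMap_of_none {f : s ⟶ t} {k : Fin t.len} (h : ePre f k = none) (x : Fin (t.val k + 1)) :
    eMap f k x = 0 ∨ eMap f k x = 1 := by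
  have := eMap_le f k x
  rw [h] at this
  change _ ≤ 1 at this
  omega

lemma sdotFunctor_map_isIso {f : s ⟶ t} {F : Ar s.val ⥤ A.C} {x y : Ar t.val} (g : x ⟶ y)
    (h : Ar.Nondeg f x ↔ Ar.Nondeg f y) (h' : Ar.Nondeg f x → Ar.image f x = Ar.image f y) :
    IsIso ((sdotFunctor A f F).map g) := by
  by_cases hx : Ar.Nondeg f x
  · exact property_heq (MorphismProperty.isomorphisms _) (sdotFunctor_obj F hx).symm
      (sdotFunctor_obj F (h.1 hx)).symm (sdotFunctor_map F g hx (h.1 hx)).symm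
      (isIso_map_of_eq F (homOfLE _) (h' hx))
  · have hx' : IsZero ((sdotFunctor A f F).obj x) := zeroExt_isZero _ hx
    have hy' : IsZero ((sdotFunctor A f F).obj y) := zeroExt_isZero _ fun hy => hx (h.2 hy)
    exact ⟨hy'.to_ _, hx'.eq_of_src _ _, hy'.eq_of_src _ _⟩

lemma exists_least_coordinatewise {I : Type} {m : I → ℕ} {U : ∀ k, Set (Fin (m k + 1))}
    {x : Cube m} (hx : ∀ k, x k ∈ U k) :
    ∃ x₀ : Cube m, (∀ k, x₀ k ∈ U k) ∧ ∀ y : Cube m, (∀ k, y k ∈ U k) → x₀ ≤ y := by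
  have h : ∀ k, ∃ a ∈ U k, ∀ b ∈ U k, a ≤ b := fun k =>
    ⟨_, WellFounded.min_mem wellFounded_lt (U k) ⟨_, hx k⟩, fun b hb =>
      WellFounded.min_le wellFounded_lt hb⟩
  choose x₀ h₀ h₁ using h
  exact ⟨x₀, h₀, fun y hy k => h₁ k _ (hy k)⟩

lemma reedy_sdotFunctor (f : s ⟶ t) {F : Ar s.val ⥤ A.C} (hF : IsSdot A F) :
    Reedy A (monoFunctor Ar.fromZero Ar.fromZero_mono ⋙ sdotFunctor A f F) := by
  let N : Set (Cube t.val) := {j | Ar.Nondeg f (Ar.fromZero j)}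
  have hle : ∀ x, Cube.image f (fun _ => 0) ≤ Cube.image f x := fun x =>
    Cube.image_mono f fun _ => Fin.zero_le _
  have hb : ∀ x : Cube t.val, Ar.image f (Ar.fromZero x) =
      Ar.from (Cube.image f fun _ => 0) (Cube.image f x) := fun x =>
    Ar.ext rfl (funext fun k => (max_eq_right (hle x k)).symm)
  have e : ∀ x ∈ N, (sdotFunctor A f F).obj (Ar.fromZero x) = F.obj (Ar.from
    (Cube.image f fun _ => 0) (Cube.image f x)) := fun x hx =>
    (sdotFunctor_obj F hx).trans (congrArg F.obj (hb x))
  refine (hF.reedy_from (Cube.image f fun _ => 0)).of_partial_adjoint (N := N)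
    (fun x y h hx j hj => ⟨(hx j hj).1, le_antisymm ((eMap_le f j _).trans_eq (by rw [hj]; rfl))
      ((hx j hj).2.symm.trans_le (eMap_mono f j ((show ∀ j, x j ≤ y j from h) j)))⟩)
    (fun x hx => zeroExt_isZero A.isZero (N := {y | Ar.Nondeg f y}) hx) (Cube.image f) (fun x _ y _ h => Cube.image_mono f h)
    (fun x hx => eqToIso (e x hx)) (fun x y hxy hx hy => ?_) fun p hp => ?_
  · refine eq_of_heq ((IsId.heq_comp _ (isId_eqToIso (e y hy))).trans (HEq.trans ?_
      ((isId_eqToIso (e x hx)).comp_heq _).symm))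
    exact (sdotFunctor_map F _ hx hy).trans
      (map_heq F (hb x) (hb y) (poset_hom_heq (hb x) (hb y)))
  · obtain ⟨x, hx, hpx⟩ := hp
    let U : ∀ k, Set (Fin (t.val k + 1)) := fun k =>
      {a | (∀ l, eInj f l = k → (p l).val ≤ eMap f k a) ∧ (ePre f k = none → eMap f k a = 1)}
    have hU : ∀ y ∈ N, p ≤ Cube.image f y → ∀ k, y k ∈ U k := fun y hy hpy k =>
      ⟨fun l hl => by subst hl; exact hpy l, fun hk => (hy k hk).2⟩
    obtain ⟨x₀, h₀, h₁⟩ := exists_least_coordinatewise (hU x hx hpx)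
    exact ⟨x₀, fun j hj => ⟨(hx j hj).1, (h₀ j).2 hj⟩, fun l => (h₀ _).1 l rfl,
      fun y hy hpy => h₁ y (hU y hy hpy)⟩

lemma isSdot_sdotFunctor (f : s ⟶ t) {F : Ar s.val ⥤ A.C} (hF : IsSdot A F) :
    IsSdot A (sdotFunctor A f F) where
  obj_eq_pt y k hk := by
    by_cases hy : Ar.Nondeg f y
    · refine (sdotFunctor_obj F hy).trans ?_
      obtain h | ⟨l, h⟩ := (ePre f k).eq_none_or_eq_some
      · have := hy k h
        rw [hk] at this
        omega
      · obtain rfl := ePre_eq_some.1 h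
        exact hF.obj_eq_pt _ l (Cube.image_congr f hk)
    · exact sdotFunctor_obj_of_not F hy
  cubical := cubicallyCofibrant_iff.2 (reedy_sdotFunctor f hF)
  isPushout {x y z w} g₁ g₂ g₃ g₄ k h₁ h₂ h₃ h₄ h₅ h₆ := by
    have comm : (sdotFunctor A f F).map g₁ ≫ (sdotFunctor A f F).map g₃ =
      (sdotFunctor A f F).map g₂ ≫ (sdotFunctor A f F).map g₄ :=
        (fmap_comp _ _ _).symm.trans ((congrArg _ (Subsingleton.elim _ _)).trans
          (fmap_comp _ _ _))
    obtain h | ⟨l, h⟩ := (ePre f k).eq_none_or_eq_some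
    · have hz : ¬ Ar.Nondeg f z := fun hz => by
        have := hz k h
        rw [h₃, h₂] at this
        omega
      have ext : ∀ a b : Ar t.val, (∀ j ≠ k, a.src j = b.src j ∧ a.tgt j = b.tgt j) →
          Ar.image f a = Ar.image f b := fun a b hab => by
        have hk : ∀ l, eInj f l ≠ k := fun l hl => by rw [ePre_eq_some.2 hl] at h; cases h
        exact Ar.ext (funext fun l => Cube.image_congr f (hab _ (hk l)).1)
          (funext fun l => Cube.image_congr f (hab _ (hk l)).2)
      have nd : ∀ a b : Ar t.val, (∀ j ≠ k, a.src j = b.src j ∧ a.tgt j = b.tgt j) →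
          (eMap f k (a.src k) = 0 → eMap f k (a.tgt k) = 1 →
            eMap f k (b.src k) = 0 ∧ eMap f k (b.tgt k) = 1) → Ar.Nondeg f a → Ar.Nondeg f b := by
        intro a b hab hk ha j hj
        by_cases e : j = k
        · subst e
          exact hk (ha j hj).1 (ha j hj).2
        · rw [← (hab j e).1, ← (hab j e).2]
          exact ha j hj
      have hxy : ∀ j ≠ k, x.src j = y.src j ∧ x.tgt j = y.tgt j := fun j hj =>
        ⟨(congrFun h₁ j).symm, (h₆ j hj).1.symm⟩
      have hyw : ∀ j ≠ k, y.src j = w.src j ∧ y.tgt j = w.tgt j := fun j hj =>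
        ⟨((congrFun h₁ j).trans (h₆ j hj).2.symm).trans (congrFun h₄ j).symm, (congrFun h₅ j).symm⟩
      have e₁ := congrFun h₁ k
      have e₂ := congrFun h₄ k
      have e₃ := congrFun h₅ k
      have hm₁ : eMap f k (x.tgt k) ≤ eMap f k (y.tgt k) := eMap_mono f k ((leOfHom g₁).2 k)
      have hm₂ : eMap f k (x.src k) ≤ eMap f k (x.tgt k) := eMap_mono f k (x.2 k)
      have hb := eMap_of_none h (x.tgt k)
      obtain hb | hb := hb
      · have hw : Ar.Nondeg f y ↔ Ar.Nondeg f w := by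
          refine ⟨nd _ _ hyw fun h h' => ?_, nd _ _ (fun j hj =>
            ⟨(hyw j hj).1.symm, (hyw j hj).2.symm⟩) fun h h' => ?_⟩
          · rw [e₂, h₃, e₃]; exact ⟨hb, h'⟩
          · rw [e₁, ← e₃]; exact ⟨by omega, h'⟩
        have hx : ¬ Ar.Nondeg f x := fun hx => by have := (hx k h).2; omega
        have := sdotFunctor_map_isIso (A := A) (F := F) g₂ (iff_of_false hx hz) fun h => (hx h).elim
        have := sdotFunctor_map_isIso (A := A) (F := F) g₃ hw fun _ => ext _ _ hyw
        exact IsPushout.of_vert_isIso ⟨comm⟩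
      · have hw : ¬ Ar.Nondeg f w := fun hw => by
          have := (hw k h).1
          rw [e₂, h₃] at this
          omega
        have hx : Ar.Nondeg f x ↔ Ar.Nondeg f y := by
          refine ⟨nd _ _ hxy fun h' _ => ?_, nd _ _ (fun j hj =>
            ⟨(hxy j hj).1.symm, (hxy j hj).2.symm⟩) fun h' _ => ?_⟩
          · rw [e₁]
            exact ⟨h', by have := eMap_of_none h (y.tgt k); omega⟩
          · rw [e₁] at h'
            exact ⟨h', hb⟩
        have := sdotFunctor_map_isIso (A := A) (F := F) g₄ (iff_of_false hz hw) fun h => (hz h).elim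
        have := sdotFunctor_map_isIso (A := A) (F := F) g₁ hx fun _ => ext _ _ hxy
        exact IsPushout.of_horiz_isIso ⟨comm⟩
    · obtain rfl := ePre_eq_some.1 h
      have nd : ∀ a b : Ar t.val, (∀ j, j ≠ eInj f l → a.src j = b.src j ∧ a.tgt j = b.tgt j) →
          Ar.Nondeg f a → Ar.Nondeg f b := by
        intro a b hab ha j hj
        have e : j ≠ eInj f l := fun e => by rw [e, h] at hj; cases hj
        rw [← (hab j e).1, ← (hab j e).2]
        exact ha j hj
      have hxy : ∀ j, j ≠ eInj f l → x.src j = y.src j ∧ x.tgt j = y.tgt j := fun j hj =>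
        ⟨(congrFun h₁ j).symm, (h₆ j hj).1.symm⟩
      have hxz : ∀ j, j ≠ eInj f l → x.src j = z.src j ∧ x.tgt j = z.tgt j := fun j hj =>
        ⟨(h₆ j hj).2.symm, (congrFun h₂ j).symm⟩
      have hxw : ∀ j, j ≠ eInj f l → x.src j = w.src j ∧ x.tgt j = w.tgt j := fun j hj =>
        ⟨(h₆ j hj).2.symm.trans (congrFun h₄ j).symm, (h₆ j hj).1.symm.trans (congrFun h₅ j).symm⟩
      by_cases hx : Ar.Nondeg f x
      · have hy := nd _ _ hxy hx
        have hz := nd _ _ hxz hx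
        have hw := nd _ _ hxw hx
        refine isPushout_heq (sdotFunctor_obj F hx).symm (sdotFunctor_obj F hy).symm
          (sdotFunctor_obj F hz).symm (sdotFunctor_obj F hw).symm (sdotFunctor_map F _ hx hy).symm
          (sdotFunctor_map F _ hx hz).symm (sdotFunctor_map F _ hy hw).symm
          (sdotFunctor_map F _ hz hw).symm ?_
        refine hF.isPushout _ _ _ _ l (congrArg (Cube.image f) h₁) (congrArg (Cube.image f) h₂)
          (Cube.image_congr f h₃) (congrArg (Cube.image f) h₄) (congrArg (Cube.image f) h₅)
          fun j hj => ?_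
        have := h₆ (eInj f j) fun e => hj (eInj_injective f e)
        exact ⟨Cube.image_congr f this.1, Cube.image_congr f this.2⟩
      · have hy : ¬ Ar.Nondeg f y := fun h => hx (nd _ _ (fun j hj => ⟨(hxy j hj).1.symm, (hxy j hj).2.symm⟩) h)
        have hz : ¬ Ar.Nondeg f z := fun h => hx (nd _ _ (fun j hj => ⟨(hxz j hj).1.symm, (hxz j hj).2.symm⟩) h)
        have hw : ¬ Ar.Nondeg f w := fun h => hx (nd _ _ (fun j hj => ⟨(hxw j hj).1.symm, (hxw j hj).2.symm⟩) h)
        have := sdotFunctor_map_isIso (A := A) (F := F) g₄ (iff_of_false hz hw) fun h => (hz h).elim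
        have := sdotFunctor_map_isIso (A := A) (F := F) g₁ (iff_of_false hx hy) fun h => (hx h).elim
        exact IsPushout.of_horiz_isIso ⟨comm⟩

end Image

namespace SdotObj

variable {A : WaldCat.{u}} {r s t : EObj}

lemma ext {F G : SdotObj A t} (h : F.functor = G.functor) : F = G := by
  cases F; cases G; cases h; rfl

lemma hom_heq {F G F' G' : SdotObj A t} {α : F ⟶ G} {β : F' ⟶ G'} (hF : F = F') (hG : G = G')
    (h : HEq (trans α) (trans β)) : HEq α β := by
  subst hF hG
  exact heq_of_eq (SdotObj.Hom.ext (eq_of_heq h))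

lemma functor_ext {X : Type*} [Category X] {L R : X ⥤ SdotObj A t}
    (h : ∀ x, (L.obj x).functor = (R.obj x).functor)
    (h' : ∀ {x y : X} (f : x ⟶ y), HEq (trans (L.map f)) (trans (R.map f))) : L = R :=
  hext (fun x => ext (h x)) fun x y f => hom_heq (ext (h x)) (ext (h y)) (h' f)

variable (A) in
/-- The functor `S s A ⥤ S t A` induced by a morphism `s ⟶ t` of `ℰ`. -/
def map (f : s ⟶ t) : SdotObj A s ⥤ SdotObj A t where
  obj F := ⟨_, isSdot_sdotFunctor f F.isSdot⟩
  map α := ⟨sdotTrans f (trans α)⟩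
  map_id F := SdotObj.Hom.ext (eq_of_heq (heq_sdotTrans rfl rfl fun x hx => by
    exact (isId_id _).heq (isId_id _) (sdotFunctor_obj _ hx)).symm)
  map_comp {F G H} α β := SdotObj.Hom.ext (eq_of_heq (heq_sdotTrans rfl rfl fun x hx =>
    heq_comp (sdotFunctor_obj _ hx) (sdotFunctor_obj _ hx) (sdotFunctor_obj _ hx)
      (sdotTrans_app _ hx) (sdotTrans_app _ hx)).symm)

lemma map_id (t : EObj) : map A (𝟙 t) = 𝟭 _ := by
  have h : ∀ F : SdotObj A t, F.functor = ((map A (𝟙 t)).obj F).functor := fun F =>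
    eq_sdotFunctor (fun _ _ => rfl) (fun y hy => (hy fun j hj => by cases hj).elim)
      fun _ _ _ => HEq.rfl
  exact functor_ext (fun F => (h F).symm) fun {F G} f =>
    (heq_sdotTrans (h F) (h G) fun x _ => HEq.rfl).symm

lemma map_comp (f : r ⟶ s) (g : s ⟶ t) : map A (f ≫ g) = map A f ⋙ map A g := by
  have hn := Ar.nondeg_comp f g
  have hi : ∀ y, Ar.image f (Ar.image g y) = Ar.image (f ≫ g) y := fun y =>
    Ar.ext (Cube.image_comp f g y.src).symm (Cube.image_comp f g y.tgt).symm
  have h : ∀ F : SdotObj A r, sdotFunctor A g (sdotFunctor A f F.functor) =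
      sdotFunctor A (f ≫ g) F.functor := fun F => by
    refine eq_sdotFunctor (fun y hy => ?_) (fun y hy => ?_) fun {y z} k hy hz => ?_
    · obtain ⟨h₁, h₂⟩ := (hn y).1 hy
      exact ((sdotFunctor_obj _ h₁).trans (sdotFunctor_obj _ h₂)).trans
        (congrArg F.functor.obj (hi y))
    · by_cases h₁ : Ar.Nondeg g y
      · exact (sdotFunctor_obj _ h₁).trans (sdotFunctor_obj_of_not _ fun h₂ => hy ((hn y).2 ⟨h₁, h₂⟩))
      · exact sdotFunctor_obj_of_not _ h₁
    · obtain ⟨h₁, h₂⟩ := (hn y).1 hy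
      obtain ⟨h₃, h₄⟩ := (hn z).1 hz
      exact ((sdotFunctor_map _ _ h₁ h₃).trans (sdotFunctor_map _ _ h₂ h₄)).trans
        (map_heq F.functor (hi y) (hi z) (poset_hom_heq (hi y) (hi z)))
  refine functor_ext (fun F => (h F).symm) fun {F G} α =>
    (heq_sdotTrans (h F) (h G) fun y hy => ?_).symm
  obtain ⟨h₁, h₂⟩ := (hn y).1 hy
  exact ((sdotTrans_app (sdotTrans f (trans α)) h₁).trans (sdotTrans_app _ h₂)).trans
    (app_heq_of_eq _ (hi y))

lemma isTrivial (t : EObj) (h : ∃ k, t.val k = 0) : (Sdot A t).IsTrivial := by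
  obtain ⟨k, hk⟩ := h
  have hpt : ∀ (F : SdotObj A t) (y : Ar t.val), F.functor.obj y = A.pt := fun F y =>
    F.isSdot.obj_eq_pt y k (Fin.ext (by omega))
  refine ⟨fun F => ext (hext (hpt F) fun x y f =>
    heq_of_isZero (hpt F x) (hpt F y) (Or.inl (by rw [hpt F x]; exact A.isZero))), fun f => ?_⟩
  exact SdotObj.Hom.ext (NatTrans.ext (funext fun y => A.isZero.eq_of_src _ _))

end SdotObj

/-- The structure of an `ℰ_*`-category on `S^() A`. -/
def sdotStr (A : WaldCat.{u}) : EStarStr (Sdot A) where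
  map f := ⟨SdotObj.map A f, SdotObj.ext (eq_sdotFunctor (fun _ _ => rfl) (fun _ _ => rfl)
    fun _ _ _ => HEq.rfl).symm⟩
  map_id t := BasedFunctor.ext (SdotObj.map_id t)
  map_comp f g := BasedFunctor.ext (SdotObj.map_comp f g)
  trivial := SdotObj.isTrivial

lemma isSdotStr : IsSdotStr.{u} fun A => sdotStr A.toWaldCat where
  obj_nondeg A _ _ f F y x h h' := by
    obtain rfl := h'.eq
    exact sdotFunctor_obj _ h
  obj_deg A _ _ f F y h := sdotFunctor_obj_of_not _ h
  map_nondeg A _ _ f F _ _ _ _ g k h h' hx hx' := by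
    obtain rfl := hx.eq
    obtain rfl := hx'.eq
    exact sdotFunctor_map _ g h h'
  trans_nondeg A _ _ f _ _ α y x h h' := by
    obtain rfl := h'.eq
    exact sdotTrans_app _ h

/-! ### The multifunctor given by the iterated Waldhausen construction -/

section Part

variable {I : Type} {m m' : I → EObj} {t t' : EObj}

/-- The entries of an element of a cube that belong to one part of a concatenation. -/
def Cube.part (h : Concat m t) (i : I) (v : Cube t.val) : Cube (m i).val := fun k =>
  Fin.cast (congrArg (· + 1) (h.val_eq i k)) (v (h.e ⟨i, k⟩))

lemma Cube.part_mono (h : Concat m t) (i : I) : Monotone (Cube.part h i) :=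
  fun _ _ hv k => hv (h.e ⟨i, k⟩)

/-- The entries of an object of `Ar t` that belong to one part of a concatenation. -/
def Ar.part (h : Concat m t) (i : I) (y : Ar t.val) : Ar (m i).val :=
  ⟨(Cube.part h i y.src, Cube.part h i y.tgt), Cube.part_mono h i y.2⟩

lemma Ar.part_mono (h : Concat m t) (i : I) : Monotone (Ar.part h i) :=
  fun _ _ hy => ⟨Cube.part_mono h i hy.1, Cube.part_mono h i hy.2⟩

lemma Ar.IsSplit.eq {h : Concat m t} {y : Ar t.val} {x : ∀ i, Ar (m i).val}
    (hx : Ar.IsSplit h y x) : x = fun i => Ar.part h i y := funext fun i =>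
  Ar.ext (funext fun k => Fin.ext (hx i k).1) (funext fun k => Fin.ext (hx i k).2)

lemma Cube.val_congr {J : Type} {m : J → ℕ} (v : Cube m) {j j' : J} (h : j = j') :
    (v j).val = (v j').val := by
  subst h; rfl

lemma Cube.part_congr (h : Concat m t) {i : I} {k : Fin (m i).len} {v w : Cube t.val}
    (e : v (h.e ⟨i, k⟩) = w (h.e ⟨i, k⟩)) : Cube.part h i v k = Cube.part h i w k :=
  congrArg (Fin.cast (congrArg (· + 1) (h.val_eq i k))) e

lemma Ar.part_eq {i : I} {h : Concat m t} {p : Cube t.val → Cube (m i).val}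
    (hp : Monotone p) (hh : ∀ v k, (p v k).val = (v (h.e ⟨i, k⟩)).val) :
    Ar.part h i = fun y => ⟨(p y.src, p y.tgt), hp y.2⟩ := funext fun y =>
  Ar.ext (funext fun k => Fin.ext (hh _ k).symm) (funext fun k => Fin.ext (hh _ k).symm)

lemma IsConcat.ePre_eq_none {h : Concat m t} {h' : Concat m' t'} {f : ∀ i, m i ⟶ m' i}
    {g : t ⟶ t'} (hc : IsConcat h h' f g) (i : I) (k : Fin (m' i).len) :
    ePre g (h'.e ⟨i, k⟩) = none ↔ ePre (f i) k = none := by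
  rw [(hc i k).1, Option.map_eq_none_iff]

lemma IsConcat.eInj {h : Concat m t} {h' : Concat m' t'} {f : ∀ i, m i ⟶ m' i}
    {g : t ⟶ t'} (hc : IsConcat h h' f g) (i : I) (k : Fin (m i).len) :
    eInj g (h.e ⟨i, k⟩) = h'.e ⟨i, KTheory.eInj (f i) k⟩ := by
  refine ePre_eq_some.1 ?_
  rw [(hc i _).1, ePre_eInj]
  rfl

lemma IsConcat.part_image {h : Concat m t} {h' : Concat m' t'} {f : ∀ i, m i ⟶ m' i}
    {g : t ⟶ t'} (hc : IsConcat h h' f g) (i : I) (v : Cube t'.val) :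
    Cube.part h i (Cube.image g v) = Cube.image (f i) (Cube.part h' i v) :=
  funext fun k => Fin.ext (by
    change eMap g (KTheory.eInj g (h.e ⟨i, k⟩)) _ = eMap (f i) _ _
    rw [← (hc i _).2 (v (h'.e ⟨i, KTheory.eInj (f i) k⟩)) _ rfl]
    exact eMap_congr g (hc.eInj i k) (Cube.val_congr v (hc.eInj i k)))

lemma IsConcat.nondeg {h : Concat m t} {h' : Concat m' t'} {f : ∀ i, m i ⟶ m' i}
    {g : t ⟶ t'} (hc : IsConcat h h' f g) (y : Ar t'.val) :
    Ar.Nondeg g y ↔ ∀ i, Ar.Nondeg (f i) (Ar.part h' i y) := by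
  have e : ∀ i k, (eMap g (h'.e ⟨i, k⟩) (y.src (h'.e ⟨i, k⟩)) =
      eMap (f i) k ((Ar.part h' i y).src k)) ∧ (eMap g (h'.e ⟨i, k⟩) (y.tgt (h'.e ⟨i, k⟩)) =
      eMap (f i) k ((Ar.part h' i y).tgt k)) := fun i k => ⟨(hc i k).2 _ _ rfl, (hc i k).2 _ _ rfl⟩
  refine ⟨fun hy i k hk => ?_, fun hy j hj => ?_⟩
  · rw [← (e i k).1, ← (e i k).2]
    exact hy _ ((hc.ePre_eq_none i k).2 hk)
  · obtain ⟨i, k, rfl⟩ := h'.surj j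
    rw [(e i k).1, (e i k).2]
    exact hy i k ((hc.ePre_eq_none i k).1 hj)

lemma Cube.exists_part (h : Concat m t) (p : ∀ i, Cube (m i).val) :
    ∃ v : Cube t.val, ∀ i, Cube.part h i v = p i := by
  refine ⟨fun j => Fin.cast (congrArg (· + 1) ?_) (p (h.e.symm j).1 (h.e.symm j).2),
    fun i => funext fun k => Fin.ext ?_⟩
  · rw [← h.val_eq]
    exact congrArg t.val (h.e.apply_symm_apply j)
  · change (p (h.e.symm (h.e ⟨i, k⟩)).1 (h.e.symm (h.e ⟨i, k⟩)).2).val = _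
    rw [h.e.symm_apply_apply]

lemma Cube.le_of_part (h : Concat m t) {v w : Cube t.val}
    (H : ∀ i, Cube.part h i v ≤ Cube.part h i w) : v ≤ w := fun j => by
  obtain ⟨i, k, rfl⟩ := h.surj j
  exact H i k

end Part

lemma isId_map_of_eq {P : Type} [PartialOrder P] {C : Type*} [Category C] (G : P ⥤ C) {x y : P}
    (f : x ⟶ y) (h : x = y) : IsId (G.map f) := by
  subst h
  rw [Subsingleton.elim f (𝟙 x)]
  exact (isId_id _).map G

section Multi

variable {I : Type} {A : I → WaldVee.{u}} {B : WaldVee.{u}} {m m' : I → EObj} {t t' : EObj}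

/-- The product of a family of objects of the iterated Waldhausen constructions. -/
def sdotProd {T : Type} [PartialOrder T] (pr : ∀ i, T → Ar (m i).val) (hm : ∀ i, Monotone (pr i)) :
    (∀ i, SdotObj (A i).toWaldCat (m i)) ⥤ (T ⥤ ∀ i, (A i).C) where
  obj X := prodDiag (fun i => (X i).functor) pr hm
  map f :=
    { app := fun y i => (SdotObj.trans (f i)).app (pr i y)
      naturality := fun x y g => funext fun i => (SdotObj.trans (f i)).naturality _ }

lemma IsMultiexact.isSdot [Finite I] {F : (∀ i, (A i).C) ⥤ B.C} (hF : IsMultiexact A B F)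
    (h : Concat m t) (X : ∀ i, SdotObj (A i).toWaldCat (m i)) :
    IsSdot B.toWaldCat ((sdotProd (Ar.part h) (Ar.part_mono h)).obj X ⋙ F) where
  obj_eq_pt y j hj := by
    obtain ⟨i, k, rfl⟩ := h.surj j
    exact hF.map_pt _ i ((X i).isSdot.obj_eq_pt _ k (Cube.part_congr h (v := y.src) (w := y.tgt) hj))
  cubical := by
    have e : ∀ i v, Ar.fromZero (Cube.part h i v) = Ar.part h i (Ar.fromZero v) := fun i v =>
      Ar.ext (funext fun k => Fin.ext rfl) rfl
    have e' : prodDiag (fun i => monoFunctor Ar.fromZero Ar.fromZero_mono ⋙ (X i).functor)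
        (Cube.part h) (Cube.part_mono h) = monoFunctor Ar.fromZero Ar.fromZero_mono ⋙
          (sdotProd (Ar.part h) (Ar.part_mono h)).obj X :=
      hext (fun v => funext fun i => congrArg (X i).functor.obj (e i v))
      fun v w f => pi_heq (funext fun i => congrArg (X i).functor.obj (e i v))
        (funext fun i => congrArg (X i).functor.obj (e i w)) fun i =>
        map_heq (X i).functor (e i v) (e i w) (poset_hom_heq (e i v) (e i w))
    exact cubicallyCofibrant_iff.2 ((hF.reedy (T := Cube t.val)
      (fun i => cubicallyCofibrant_iff.1 (X i).isSdot.cubical) (Cube.part_mono h)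
      (fun v w hv => Cube.le_of_part h hv) (Cube.exists_part h)).of_iso
        (Functor.isoWhiskerRight (eqToIso e') F))
  isPushout {x y z w} f g p q j h₁ h₂ h₃ h₄ h₅ h₆ := by
    obtain ⟨i, k, rfl⟩ := h.surj j
    have ne : ∀ {i'} {k' : Fin (m i').len}, i' ≠ i → h.e ⟨i', k'⟩ ≠ h.e ⟨i, k⟩ := fun hi e =>
      hi (congrArg Sigma.fst (h.e.injective e))
    have key : ∀ {a b : Ar t.val} (r : a ⟶ b), (∀ j, j ≠ h.e ⟨i, k⟩ → a.src j = b.src j ∧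
        a.tgt j = b.tgt j) → IsAlong i (((sdotProd (Ar.part h) (Ar.part_mono h)).obj X).map r) :=
      fun r hr i' hi => isId_map_of_eq (X i').functor _ (Ar.ext
        (funext fun k' => Cube.part_congr h (hr _ (ne hi)).1)
        (funext fun k' => Cube.part_congr h (hr _ (ne hi)).2))
    have part_eq : ∀ {a b : Cube t.val}, a = b → Cube.part h i a = Cube.part h i b := fun e => by
      rw [e]
    refine hF.map_pushout _ _ _ _ i (key f fun j hj => ?_) (key g fun j hj => ?_)
      (key p fun j hj => ?_) (key q fun j hj => ?_) ((X i).isSdot.cof_of_src_eq _ (part_eq h₁.symm))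
      ((X i).isSdot.isPushout _ _ _ _ k (part_eq h₁) (part_eq h₂) (Cube.part_congr h h₃)
        (part_eq h₄) (part_eq h₅) fun k' hk => ?_)
    · exact ⟨(congrFun h₁ j).symm, (h₆ j hj).1.symm⟩
    · exact ⟨(h₆ j hj).2.symm, (congrFun h₂ j).symm⟩
    · exact ⟨((congrFun h₁ j).trans (h₆ j hj).2.symm).trans (congrFun h₄ j).symm,
        (congrFun h₅ j).symm⟩
    · exact ⟨(congrFun h₄ j).symm, ((congrFun h₂ j).trans (h₆ j hj).1.symm).trans
        (congrFun h₅ j).symm⟩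
    · have := h₆ (h.e ⟨i, k'⟩) fun e => hk (by simpa using h.e.injective e)
      exact ⟨Cube.part_congr h this.1, Cube.part_congr h this.2⟩

end Multi

namespace SdotObj

variable {A : WaldCat.{u}} {t : EObj}

lemma eq_pt {F : SdotObj A t} (h : ∀ y, F.functor.obj y = A.pt) : F = (Sdot A t).pt :=
  ext (hext h fun x y f =>
    heq_of_isZero (h x) (h y) (Or.inl (by rw [h x]; exact A.isZero)))

lemma isId_of_eq_pt {F G : SdotObj A t} (hF : F = (Sdot A t).pt) (hG : G = (Sdot A t).pt)
    (f : F ⟶ G) : IsId f := by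
  subst hF hG
  exact ⟨rfl, SdotObj.Hom.ext (NatTrans.ext (funext fun y => A.isZero.eq_of_src _ _))⟩

variable (A t) in
/-- The underlying functors. -/
def forget : SdotObj A t ⥤ (Ar t.val ⥤ A.C) where
  obj F := F.functor
  map α := trans α

lemma postArr_injective {X : Type*} [Category X] {a b : Arrow (X ⥤ SdotObj A t)}
    (h : postArr a (forget A t) = postArr b (forget A t)) : a = b := by
  have key : ∀ {L R : X ⥤ SdotObj A t}, L ⋙ forget A t = R ⋙ forget A t → L = R := fun e =>
    functor_ext (fun x => CategoryTheory.Functor.congr_obj e x) fun f => functor_map_heq e f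
  have h₀ := key (left_eq_of_arrow h)
  have h₁ := key (right_eq_of_arrow h)
  refine arrow_ext h₀ h₁ fun x => hom_heq (CategoryTheory.Functor.congr_obj h₀ x)
    (CategoryTheory.Functor.congr_obj h₁ x) (app_heq_of_arrow h x)

end SdotObj

section Multi

variable {I : Type} [Finite I] {A : I → WaldVee.{u}} {B : WaldVee.{u}}

/-- The functor on the iterated Waldhausen constructions induced by a multiexact functor. -/
def KExact.sdot (F : KExact I A B) {m : I → EObj} {t : EObj} (h : Concat m t) :
    (∀ i, SdotObj (A i).toWaldCat (m i)) ⥤ SdotObj B.toWaldCat t where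
  obj X := ⟨_, F.isMultiexact.isSdot h X⟩
  map f := ⟨Functor.whiskerRight ((sdotProd (Ar.part h) (Ar.part_mono h)).map f) F.functor⟩
  map_id X := SdotObj.Hom.ext (NatTrans.ext (funext fun _ => F.functor.map_id _))
  map_comp f g := SdotObj.Hom.ext (NatTrans.ext (funext fun _ => F.functor.map_comp _ _))

/-- The transformation of functors on the iterated Waldhausen constructions induced by a cell. -/
def KExact.sdotCell {F G : KExact I A B} (α : F ⟶ G) {m : I → EObj} {t : EObj} (h : Concat m t) :
    F.sdot h ⟶ G.sdot h where
  app X := ⟨Functor.whiskerLeft ((sdotProd (Ar.part h) (Ar.part_mono h)).obj X) (KExact.cell α)⟩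
  naturality _ _ _ := SdotObj.Hom.ext (NatTrans.ext (funext fun _ => (KExact.cell α).naturality _))

variable {m m' : I → EObj} {t t' : EObj} {h : Concat m t} {h' : Concat m' t'} {f : ∀ i, m i ⟶ m' i}
  {g : t ⟶ t'}

lemma IsConcat.image_part (hc : IsConcat h h' f g) (i : I) (y : Ar t'.val) :
    Ar.image (f i) (Ar.part h' i y) = Ar.part h i (Ar.image g y) :=
  Ar.ext (hc.part_image i y.src).symm (hc.part_image i y.tgt).symm

lemma IsConcat.sdotFunctor_obj (hc : IsConcat h h' f g) (X : ∀ i, SdotObj (A i).toWaldCat (m i))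
    {y : Ar t'.val} (hy : Ar.Nondeg g y) :
    (fun i => (sdotFunctor (A i).toWaldCat (f i) (X i).functor).obj (Ar.part h' i y)) =
      fun i => (X i).functor.obj (Ar.part h i (Ar.image g y)) :=
  funext fun i => (KTheory.sdotFunctor_obj _ ((hc.nondeg y).1 hy i)).trans
    (congrArg (X i).functor.obj (hc.image_part i y))

lemma KExact.sdot_map_obj (F : KExact I A B) (hc : IsConcat h h' f g)
    (X : ∀ i, SdotObj (A i).toWaldCat (m i)) :
    ((F.sdot h').obj fun i => (SdotObj.map (A i).toWaldCat (f i)).obj (X i)) =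
      (SdotObj.map B.toWaldCat g).obj ((F.sdot h).obj X) := by
  refine SdotObj.ext (eq_sdotFunctor
    (fun y hy => congrArg F.functor.obj (hc.sdotFunctor_obj X hy)) (fun y hy => ?_)
    fun {x y} k hx hy => map_heq F.functor (hc.sdotFunctor_obj X hx) (hc.sdotFunctor_obj X hy)
      (pi_heq (hc.sdotFunctor_obj X hx) (hc.sdotFunctor_obj X hy) fun i =>
        (sdotFunctor_map _ _ ((hc.nondeg x).1 hx i) ((hc.nondeg y).1 hy i)).trans
          (map_heq (X i).functor (hc.image_part i x) (hc.image_part i y)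
            (poset_hom_heq (hc.image_part i x) (hc.image_part i y)))))
  obtain ⟨i, hi⟩ := not_forall.1 fun H => hy ((hc.nondeg y).2 H)
  exact F.isMultiexact.map_pt _ i (sdotFunctor_obj_of_not _ hi)

lemma KExact.sdot_obj_pt (F : KExact I A B) (h : Concat m t)
    {X : ∀ i, SdotObj (A i).toWaldCat (m i)} {i : I} (hX : X i = (Sdot (A i).toWaldCat (m i)).pt) :
    (F.sdot h).obj X = (Sdot B.toWaldCat t).pt :=
  SdotObj.eq_pt fun y => F.isMultiexact.map_pt _ i (by
    change (X i).functor.obj _ = _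
    rw [hX]; rfl)

/-- The multimorphism of `ℰ_*`-categories induced by a multiexact functor. -/
def KExact.sdotMor (F : KExact I A B) :
    EMor I (fun i => (sdotStr (A i).toWaldCat).toEStarCat) (sdotStr B.toWaldCat).toEStarCat where
  app h := F.sdot h
  naturality h h' f g hc := SdotObj.functor_ext
    (fun X => congrArg SdotObj.functor (F.sdot_map_obj hc X)) fun {X Y} α =>
      heq_sdotTrans (congrArg SdotObj.functor (F.sdot_map_obj hc X))
        (congrArg SdotObj.functor (F.sdot_map_obj hc Y)) fun y hy =>
        map_heq F.functor (hc.sdotFunctor_obj X hy) (hc.sdotFunctor_obj Y hy)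
          (pi_heq (hc.sdotFunctor_obj X hy) (hc.sdotFunctor_obj Y hy) fun i =>
            (sdotTrans_app _ ((hc.nondeg y).1 hy i)).trans
              (app_heq_of_eq _ (hc.image_part i y)))
  obj_pt h X i hX := F.sdot_obj_pt h hX
  map_pt h X Y f i hX hf := by
    obtain ⟨e, -⟩ := hf
    exact SdotObj.isId_of_eq_pt (F.sdot_obj_pt h hX) (F.sdot_obj_pt h (e.symm.trans hX)) _

variable (A B) in
/-- The functor sending a multiexact functor to the induced multimorphism of `ℰ_*`-categories. -/
def sdotMorFunctor : KExact I A B ⥤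
    EMor I (fun i => (sdotStr (A i).toWaldCat).toEStarCat) (sdotStr B.toWaldCat).toEStarCat where
  obj F := F.sdotMor
  map {F G} α :=
    { app := fun h => KExact.sdotCell α h
      modification := fun h h' f g hc X => SdotObj.hom_heq (F.sdot_map_obj hc X)
        (G.sdot_map_obj hc X) (heq_sdotTrans (congrArg SdotObj.functor (F.sdot_map_obj hc X))
          (congrArg SdotObj.functor (G.sdot_map_obj hc X)) fun y hy =>
            app_heq_of_eq (KExact.cell α) (hc.sdotFunctor_obj X hy))
      app_pt := fun h X i hX =>
        SdotObj.isId_of_eq_pt (F.sdot_obj_pt h hX) (G.sdot_obj_pt h hX) _ }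

/-- The arrow `T ↦ a ∘ T`. -/
def whArr {C D : Type u} [SmallCategory C] [SmallCategory D] (T : Type) [PartialOrder T]
    (a : Arrow (C ⥤ D)) : Arrow ((T ⥤ C) ⥤ (T ⥤ D)) :=
  Arrow.mk ((Functor.whiskeringRight T C D).map a.hom)

lemma sdotMor_arr {F G : KExact I A B} (α : F ⟶ G) (h : Concat m t)
    {pr : ∀ i, Ar t.val → Ar (m i).val} (hm : ∀ i, Monotone (pr i)) (hpr : Ar.part h = pr) :
    postArr (EMor.arr ((sdotMorFunctor A B).map α) h) (SdotObj.forget B.toWaldCat t) =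
      preArr (sdotProd pr hm) (whArr (Ar t.val) (KExact.arr α)) := by
  subst hpr
  rfl

end Multi

/-- The multifunctor `S^()`. -/
def sdotMultifunctor : Multifunctor waldMulticategory.{u} estarMulticategory.{u}
    (fun A => (sdotStr A.toWaldCat).toEStarCat) where
  map A B := sdotMorFunctor A B
  map_id A := EMor.unit_ext fun t => by
    have h : (waldMulticategory.id A).sdot (Concat.self t) =
        Pi.eval (fun _ : Unit => SdotObj A.toWaldCat t) () :=
      SdotObj.functor_ext (fun X => rfl) fun f => HEq.rfl
    exact h.trans (EMor.id_app (sdotStr A.toWaldCat).toEStarCat t).symm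
  map_act e A B := EMor.functor_ext fun α m t h => by
    obtain ⟨m, rfl⟩ := exists_comap_obj e (fun _ => EObj) m
    refine preArr_comap_injective e (fun j => SdotObj (A j).toWaldCat (m j)) ?_
    refine Eq.trans (SdotObj.postArr_injective ?_) (EMor.act_arr e
      (fun j => (sdotStr (A j).toWaldCat).toEStarCat) (sdotStr B.toWaldCat).toEStarCat
      ((sdotMorFunctor A B).map α) h (h.uncomap e) (h.uncomap_e e)).symm
    refine Eq.trans ?_ (sdotMor_arr α (h.uncomap e) (Ar.part_mono _) rfl).symm
    refine (congrArg (preArr (Pi.comap (fun j => SdotObj (A j).toWaldCat (m j)) e))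
      (sdotMor_arr ((kexactAct e A B).map α) h (pr := fun i => Ar.part (h.uncomap e) (e i))
        (fun i => Ar.part_mono _ _) (funext fun i => Ar.part_eq
          (m := fun i => m (e i)) (i := i) (h := h) (p := Cube.part (h.uncomap e) (e i)) (Cube.part_mono _ _) fun v k => Cube.val_congr v (h.uncomap_e e i k).symm))).trans ?_
    exact congrArg (fun a => preArr (sdotProd (Ar.part (h.uncomap e)) (Ar.part_mono _))
      (whArr (Ar t.val) a)) (kexactAct_arr e A B α)
  map_comp {I} _ {K} _ A B C := EMor.functor_ext fun α m t H => by
    obtain ⟨s, h, O, hO⟩ := estarComponents.{u}.exists_nested H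
    refine Eq.trans (SdotObj.postArr_injective ?_) (EMor.comp_arr
      (fun i k => (sdotStr (A i k).toWaldCat).toEStarCat)
      (fun i => (sdotStr (B i).toWaldCat).toEStarCat) (sdotStr C.toWaldCat).toEStarCat
      ((Functor.prod (sdotMorFunctor B C) (Functor.pi fun i => sdotMorFunctor (A i) (B i))).map α)
      h O H hO).symm
    exact sdotMor_arr ((kexactComp A B C).map α) H
      (pr := fun x y => Ar.part (h x.1) x.2 (Ar.part O x.1 y))
      (fun x _ _ hy => Ar.part_mono _ _ (Ar.part_mono _ _ hy)) (funext fun x =>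
        Ar.part_eq (p := fun v => Cube.part (h x.1) x.2 (Cube.part O x.1 v))
          (fun _ _ hv => Cube.part_mono _ _ (Cube.part_mono _ _ hv))
          fun v k => Cube.val_congr v (hO x.1 x.2 k).symm)

lemma isSdotMultifunctor : IsSdotMultifunctor sdotMultifunctor.{u} where
  obj_obj A B F m t h X y x hx := by
    obtain rfl := hx.eq
    rfl
  obj_map A B F m t h X y y' x x' g f hx hx' := by
    obtain rfl := hx.eq
    obtain rfl := hx'.eq
    rfl
  map_app A B F m t h X X' α y x hx := by
    obtain rfl := hx.eq
    rfl
  cell_app A B F G μ m t h X y x hx := by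
    obtain rfl := hx.eq
    rfl

section

open MonoidalCategory

/-! ### Structure isomorphisms at the unit -/

lemma IsId.of_comp_right {C : Type*} [Category C] {X Y Z : C} {f : X ⟶ Y} {g : Y ⟶ Z}
    (h : IsId (f ≫ g)) (hg : IsId g) : IsId f := by
  obtain ⟨rfl, rfl⟩ := hg
  exact ⟨h.1, by simpa using h.2⟩

lemma IsId.whiskerLeft {C : Type*} [Category C] [MonoidalCategory C] (X : C) {Y Z : C}
    {f : Y ⟶ Z} (h : IsId f) : IsId (X ◁ f) := by
  rw [← id_tensorHom]
  exact (isId_id X).tensorHom h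

lemma IsId.whiskerRight {C : Type*} [Category C] [MonoidalCategory C] (X : C) {Y Z : C}
    {f : Y ⟶ Z} (h : IsId f) : IsId (f ▷ X) := by
  rw [← tensorHom_id]
  exact h.tensorHom (isId_id X)

namespace SMCat

variable (C : SMCat.{u})

lemma isId_associator {X Y Z : C.C} (h : X = 𝟙_ C.C ∨ Y = 𝟙_ C.C ∨ Z = 𝟙_ C.C) :
    IsId (α_ X Y Z).hom := by
  obtain rfl | rfl | rfl := h
  · refine IsId.of_comp_right (g := (λ_ (Y ⊗ Z)).hom) ?_ (C.left_strict _)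
    rw [← leftUnitor_whiskerRight]
    exact (C.left_strict _).whiskerRight _
  · refine IsId.of_comp_right (g := X ◁ (λ_ Z).hom) ?_ ((C.left_strict _).whiskerLeft _)
    rw [triangle]
    exact (C.right_strict _).whiskerRight _
  · refine IsId.of_comp_right (g := X ◁ (ρ_ Y).hom) ?_ ((C.right_strict _).whiskerLeft _)
    rw [← rightUnitor_tensor_hom]
    exact C.right_strict _

lemma isId_braiding {X Y : C.C} (h : X = 𝟙_ C.C ∨ Y = 𝟙_ C.C) : IsId (β_ X Y).hom := by
  obtain rfl | rfl := h
  · refine IsId.of_comp_right (g := (ρ_ Y).hom) ?_ (C.right_strict _)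
    rw [braiding_rightUnitor]
    exact C.left_strict _
  · refine IsId.of_comp_right (g := (λ_ X).hom) ?_ (C.left_strict _)
    rw [braiding_leftUnitor]
    exact C.right_strict _

lemma isId_tensorμ {X₁ X₂ Y₁ Y₂ : C.C} (h : X₂ = 𝟙_ C.C ∨ Y₁ = 𝟙_ C.C)
    (h₁ : X₁ = 𝟙_ C.C ∨ X₂ = 𝟙_ C.C ∨ (Y₁ = 𝟙_ C.C ∧ Y₂ = 𝟙_ C.C))
    (h₂ : X₁ = 𝟙_ C.C ∨ Y₁ = 𝟙_ C.C ∨ (X₂ = 𝟙_ C.C ∧ Y₂ = 𝟙_ C.C)) :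
    IsId (tensorμ X₁ X₂ Y₁ Y₂) := by
  have e {X Y : C.C} (h : X = 𝟙_ C.C ∧ Y = 𝟙_ C.C) : X ⊗ Y = 𝟙_ C.C := by
    rw [h.1, h.2]
    exact (C.left_strict _).1
  refine (C.isId_associator (h₁.imp id (Or.imp id e))).comp (IsId.comp ?_ (IsId.comp ?_
    (IsId.comp ?_ (C.isId_associator (h₂.imp id (Or.imp id e))).inv)))
  · exact (C.isId_associator (h.imp id Or.inl)).inv.whiskerLeft _
  · exact ((C.isId_braiding h).whiskerRight _).whiskerLeft _
  · exact (C.isId_associator (h.symm.imp id Or.inl)).whiskerLeft _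

variable {C}

lemma tensorHom_heq_left {X Y Z T : C.C} (f : X ⟶ Y) {g : Z ⟶ T} (hg : IsId g)
    (hT : T = 𝟙_ C.C) : HEq (f ⊗ₘ g) f := by
  obtain ⟨rfl, hg⟩ := hg
  subst hT
  obtain rfl : g = 𝟙 _ := hg
  rw [tensorHom_id]
  refine ((IsId.heq_comp _ (C.right_strict Y)).symm.trans (heq_of_eq ?_)).trans
    ((C.right_strict X).comp_heq f)
  rw [rightUnitor_naturality]

lemma tensorHom_heq_right {X Y Z T : C.C} (f : X ⟶ Y) {g : Z ⟶ T} (hg : IsId g)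
    (hT : T = 𝟙_ C.C) : HEq (g ⊗ₘ f) f := by
  obtain ⟨rfl, hg⟩ := hg
  subst hT
  obtain rfl : g = 𝟙 _ := hg
  rw [id_tensorHom]
  refine ((IsId.heq_comp _ (C.left_strict Y)).symm.trans (heq_of_eq ?_)).trans
    ((C.left_strict X).comp_heq f)
  rw [leftUnitor_naturality]

end SMCat

/-! ### Systems extended by the unit object -/

namespace BarObj

variable {C : SMCat.{u}} {t : EObj} (X : BarObj C t)

/-- The objects of a system, extended by the unit object. -/
def ext : Option (Subsets t) → C.C
  | none => 𝟙_ C.C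
  | some S => X.obj S

/-- The structure isomorphisms of a system in the direction of one entry, extended by
identities. The entry is absent in a direction in which the unit object has been inserted. -/
inductive IsRho : (o : Option (Fin t.len)) → (P Q R : Option (Subsets t)) →
    (X.ext P ⊗ X.ext Q ≅ X.ext R) → Prop
  | split (k : Fin t.len) {T U S : Subsets t} (h : Split k T U S) :
      IsRho (some k) (some T) (some U) (some S) (X.ρ k h)
  | left (Q : Option (Subsets t)) (r : X.ext none ⊗ X.ext Q ≅ X.ext Q) (hr : IsId r.hom) :
      IsRho none none Q Q r
  | right (Q : Option (Subsets t)) (r : X.ext Q ⊗ X.ext none ≅ X.ext Q) (hr : IsId r.hom) :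
      IsRho none Q none Q r
  | deg (o : Option (Fin t.len)) (r : X.ext none ⊗ X.ext none ≅ X.ext none) (hr : IsId r.hom) :
      IsRho o none none none r

namespace IsRho

variable {X} {o o' : Option (Fin t.len)} {P Q R : Option (Subsets t)}

lemma isId {r : X.ext P ⊗ X.ext Q ≅ X.ext R} (h : IsRho X o P Q R r)
    (h' : (∀ T, P = some T → ∃ k, o = some k ∧ T k = ∅) ∨
      (∀ T, Q = some T → ∃ k, o = some k ∧ T k = ∅) ∨ ∀ T, R = some T → ∃ k, T k = ∅) :
    IsId r.hom := by
  cases h with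
  | split k h =>
    refine X.ρ_empty k h ?_
    refine h'.imp (fun h => ?_) (Or.imp (fun h => ?_) fun h => h _ rfl) <;>
    · obtain ⟨k, hk, h⟩ := h _ rfl
      obtain rfl := Option.some.inj hk
      exact h
  | left Q r hr => exact hr
  | right Q r hr => exact hr
  | deg o r hr => exact hr

lemma isId_of_none {r : X.ext P ⊗ X.ext Q ≅ X.ext R} (h : IsRho X o P Q R r)
    (ho : o = none ∨ R = none) : IsId r.hom := by
  cases h with
  | split => simp at ho
  | left Q r hr => exact hr
  | right Q r hr => exact hr
  | deg o r hr => exact hr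

lemma unique {r r' : X.ext P ⊗ X.ext Q ≅ X.ext R} (h : IsRho X o P Q R r)
    (h' : IsRho X o P Q R r') : r.hom = r'.hom := by
  cases h with
  | split k h => cases h'; rfl
  | left Q r hr => exact hr.eq (h'.isId_of_none (Or.inl rfl))
  | right Q r hr => exact hr.eq (h'.isId_of_none (Or.inl rfl))
  | deg o r hr => exact hr.eq (h'.isId_of_none (Or.inr rfl))

lemma symm {r : X.ext P ⊗ X.ext Q ≅ X.ext R} {r' : X.ext Q ⊗ X.ext P ≅ X.ext R}
    (h : IsRho X o P Q R r) (h' : IsRho X o Q P R r') : r.hom = (β_ _ _).hom ≫ r'.hom := by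
  cases h with
  | split k h => cases h'; exact X.ρ_symm k _ _
  | left Q r hr => exact hr.eq ((C.isId_braiding (Or.inl rfl)).comp (h'.isId_of_none (Or.inl rfl)))
  | right Q r hr => exact hr.eq ((C.isId_braiding (Or.inr rfl)).comp (h'.isId_of_none (Or.inl rfl)))
  | deg o r hr => exact hr.eq ((C.isId_braiding (Or.inl rfl)).comp (h'.isId_of_none (Or.inr rfl)))

variable {V PQ QV : Option (Subsets t)}

lemma assoc {r₁ : X.ext P ⊗ X.ext Q ≅ X.ext PQ} {r₂ : X.ext PQ ⊗ X.ext V ≅ X.ext R}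
    {r₃ : X.ext Q ⊗ X.ext V ≅ X.ext QV} {r₄ : X.ext P ⊗ X.ext QV ≅ X.ext R}
    (h₁ : IsRho X o P Q PQ r₁) (h₂ : IsRho X o PQ V R r₂) (h₃ : IsRho X o Q V QV r₃)
    (h₄ : IsRho X o P QV R r₄) :
    r₁.hom ▷ X.ext V ≫ r₂.hom = (α_ _ _ _).hom ≫ X.ext P ◁ r₃.hom ≫ r₄.hom := by
  have key (h : IsId r₁.hom ∧ IsId r₂.hom ∧ IsId r₃.hom ∧ IsId r₄.hom)
      (h' : P = none ∨ Q = none ∨ V = none) :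
      r₁.hom ▷ X.ext V ≫ r₂.hom = (α_ _ _ _).hom ≫ X.ext P ◁ r₃.hom ≫ r₄.hom :=
    ((h.1.whiskerRight _).comp h.2.1).eq ((C.isId_associator (by
      obtain rfl | rfl | rfl := h' <;> simp [BarObj.ext])).comp
      ((h.2.2.1.whiskerLeft _).comp h.2.2.2))
  have hn (ho : o = none) : IsId r₁.hom ∧ IsId r₂.hom ∧ IsId r₃.hom ∧ IsId r₄.hom :=
    ⟨h₁.isId_of_none (Or.inl ho), h₂.isId_of_none (Or.inl ho), h₃.isId_of_none (Or.inl ho),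
      h₄.isId_of_none (Or.inl ho)⟩
  cases h₁ with
  | split k h => cases h₂; cases h₃; cases h₄; exact X.ρ_assoc k _ _ _ _
  | left => exact key (hn rfl) (Or.inl rfl)
  | right => exact key (hn rfl) (Or.inr (Or.inl rfl))
  | deg o r hr =>
    refine key ⟨hr, ?_⟩ (Or.inl rfl)
    cases h₂ with
    | left => exact (hn rfl).2
    | right => exact (hn rfl).2
    | deg o r' hr' => exact ⟨hr', h₃.isId_of_none (by cases h₃ <;> simp),
        h₄.isId_of_none (Or.inr rfl)⟩

lemma eq_of_left {r : X.ext none ⊗ X.ext Q ≅ X.ext R} (h : IsRho X o none Q R r) : Q = R := by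
  cases h <;> rfl

lemma eq_of_right {r : X.ext P ⊗ X.ext none ≅ X.ext R} (h : IsRho X o P none R r) : P = R := by
  cases h <;> rfl

lemma eq_none {r : X.ext P ⊗ X.ext Q ≅ X.ext none} (h : IsRho X o P Q none r) :
    P = none ∧ Q = none := by
  cases h <;> exact ⟨rfl, rfl⟩

lemma eq_none_or {r : X.ext P ⊗ X.ext Q ≅ X.ext R} (h : IsRho X none P Q R r) :
    P = none ∨ Q = none := by
  cases h <;> simp

lemma interchange (ho : ∀ k, o = some k → o' ≠ some k) {P₀₀ P₁₀ P₀₁ P₁₁ A B E D : Option (Subsets t)}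
    {r₁ : X.ext P₀₀ ⊗ X.ext P₁₀ ≅ X.ext A} {r₂ : X.ext P₀₁ ⊗ X.ext P₁₁ ≅ X.ext B}
    {r₃ : X.ext A ⊗ X.ext B ≅ X.ext R} {r₄ : X.ext P₀₀ ⊗ X.ext P₀₁ ≅ X.ext E}
    {r₅ : X.ext P₁₀ ⊗ X.ext P₁₁ ≅ X.ext D} {r₆ : X.ext E ⊗ X.ext D ≅ X.ext R}
    (h₁ : IsRho X o P₀₀ P₁₀ A r₁) (h₂ : IsRho X o P₀₁ P₁₁ B r₂) (h₃ : IsRho X o' A B R r₃)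
    (h₄ : IsRho X o' P₀₀ P₀₁ E r₄) (h₅ : IsRho X o' P₁₀ P₁₁ D r₅) (h₆ : IsRho X o E D R r₆) :
    (r₁.hom ⊗ₘ r₂.hom) ≫ r₃.hom = tensorμ _ _ _ _ ≫ (r₄.hom ⊗ₘ r₅.hom) ≫ r₆.hom := by
  obtain _ | k := o <;> obtain _ | k' := o'
  · refine (((h₁.isId_of_none (Or.inl rfl)).tensorHom (h₂.isId_of_none (Or.inl rfl))).comp
      (h₃.isId_of_none (Or.inl rfl))).eq ((C.isId_tensorμ ?_ ?_ ?_).comp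
      (((h₄.isId_of_none (Or.inl rfl)).tensorHom (h₅.isId_of_none (Or.inl rfl))).comp
      (h₆.isId_of_none (Or.inl rfl))))
    all_goals cases h₁ <;> cases h₂ <;> cases h₃ <;> simp [BarObj.ext]
  · have i₁ := (h₁.isId_of_none (Or.inl rfl)).tensorHom (h₂.isId_of_none (Or.inl rfl))
    have i₆ := h₆.isId_of_none (Or.inl rfl)
    refine eq_of_heq ((i₁.comp_heq _).trans (HEq.trans ?_ (IsId.comp_heq (C.isId_tensorμ ?_ ?_ ?_) _).symm))
    rotate_left
    iterate 3 cases h₁ <;> cases h₂ <;> cases h₄ <;> cases h₅ <;> simp [BarObj.ext]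
    refine HEq.trans ?_ (IsId.heq_comp _ i₆).symm
    obtain rfl | rfl := h₆.eq_none_or
    · obtain ⟨rfl, rfl⟩ := h₄.eq_none
      obtain rfl := h₁.eq_of_left
      obtain rfl := h₂.eq_of_left
      obtain rfl := h₆.eq_of_left
      rw [h₃.unique h₅]
      exact (SMCat.tensorHom_heq_right _ (h₄.isId_of_none (Or.inr rfl)) rfl).symm
    · obtain ⟨rfl, rfl⟩ := h₅.eq_none
      obtain rfl := h₁.eq_of_right
      obtain rfl := h₂.eq_of_right
      obtain rfl := h₆.eq_of_right
      rw [h₃.unique h₄]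
      exact (SMCat.tensorHom_heq_left _ (h₅.isId_of_none (Or.inr rfl)) rfl).symm
  · have i₄ := (h₄.isId_of_none (Or.inl rfl)).tensorHom (h₅.isId_of_none (Or.inl rfl))
    have i₃ := h₃.isId_of_none (Or.inl rfl)
    refine eq_of_heq ((IsId.heq_comp _ i₃).trans (HEq.trans ?_
      (IsId.comp_heq ((C.isId_tensorμ ?_ ?_ ?_).comp i₄) _).symm |>.trans
        (heq_of_eq (Category.assoc _ _ _))))
    rotate_left
    iterate 3 cases h₁ <;> cases h₂ <;> cases h₄ <;> cases h₅ <;> simp [BarObj.ext]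
    obtain rfl | rfl := h₃.eq_none_or
    · obtain ⟨rfl, rfl⟩ := h₁.eq_none
      obtain rfl := h₄.eq_of_left
      obtain rfl := h₅.eq_of_left
      obtain rfl := h₃.eq_of_left
      rw [h₆.unique h₂]
      exact SMCat.tensorHom_heq_right _ (h₁.isId_of_none (Or.inr rfl)) rfl
    · obtain ⟨rfl, rfl⟩ := h₂.eq_none
      obtain rfl := h₄.eq_of_right
      obtain rfl := h₅.eq_of_right
      obtain rfl := h₃.eq_of_right
      rw [h₆.unique h₁]
      exact SMCat.tensorHom_heq_left _ (h₂.isId_of_none (Or.inr rfl)) rfl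
  · cases h₃ with
    | split k' h =>
      cases h₁; cases h₂; cases h₄; cases h₅; cases h₆
      exact X.ρ_ρ _ _ (fun e => ho k rfl (by rw [e])) _ _ _ _ _ _
    | deg o r i₃ =>
      obtain ⟨rfl, rfl⟩ := h₆.eq_none
      have i₁ := h₁.isId_of_none (Or.inr rfl)
      obtain ⟨rfl, rfl⟩ := h₁.eq_none
      exact ((i₁.tensorHom (h₂.isId_of_none (Or.inr rfl))).comp i₃).eq
        ((C.isId_tensorμ (Or.inl rfl) (Or.inl rfl) (Or.inl rfl)).comp
        (((h₄.isId_of_none (Or.inr rfl)).tensorHom (h₅.isId_of_none (Or.inr rfl))).comp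
        (h₆.isId_of_none (Or.inr rfl))))

end IsRho
lemma IsRho.exists_some (k : Fin t.len) {P Q R : Option (Subsets t)}
    (h : (P = none ∧ Q = none ∧ R = none) ∨
      ∃ T U S, P = some T ∧ Q = some U ∧ R = some S ∧ Split k T U S) :
    ∃ r, IsRho X (some k) P Q R r := by
  obtain ⟨rfl, rfl, rfl⟩ | ⟨T, U, S, rfl, rfl, rfl, h⟩ := h
  · exact ⟨_, .deg _ (λ_ _) (C.left_strict _)⟩
  · exact ⟨_, .split k h⟩

lemma IsRho.exists_none {P Q R : Option (Subsets t)}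
    (h : (P = none ∧ Q = R) ∨ (Q = none ∧ P = R)) : ∃ r, IsRho X none P Q R r := by
  obtain ⟨rfl, rfl⟩ | ⟨rfl, rfl⟩ := h
  · exact ⟨_, .left _ (λ_ _) (C.left_strict _)⟩
  · exact ⟨_, .right _ (ρ_ _) (C.right_strict _)⟩

variable {X} {Y : BarObj C t}

/-- The components of a morphism of systems, extended by the identity of the unit object. -/
def extMap (f : X ⟶ Y) : ∀ P, X.ext P ⟶ Y.ext P
  | none => 𝟙 _
  | some S => component f S

lemma IsRho.naturality {o : Option (Fin t.len)} {P Q R : Option (Subsets t)}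
    {r : X.ext P ⊗ X.ext Q ≅ X.ext R} {r' : Y.ext P ⊗ Y.ext Q ≅ Y.ext R}
    (h : IsRho X o P Q R r) (h' : IsRho Y o P Q R r') (f : X ⟶ Y) :
    r.hom ≫ extMap f R = (extMap f P ⊗ₘ extMap f Q) ≫ r'.hom := by
  cases h with
  | split k h => cases h'; exact BarObj.Hom.app_ρ f k h
  | left _ _ hr =>
    exact eq_of_heq ((hr.comp_heq _).trans ((SMCat.tensorHom_heq_right _ (isId_id _) rfl).symm.trans
      (IsId.heq_comp _ (h'.isId_of_none (Or.inl rfl))).symm))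
  | right _ _ hr =>
    exact eq_of_heq ((hr.comp_heq _).trans ((SMCat.tensorHom_heq_left _ (isId_id _) rfl).symm.trans
      (IsId.heq_comp _ (h'.isId_of_none (Or.inl rfl))).symm))
  | deg _ _ hr =>
    exact eq_of_heq ((hr.comp_heq _).trans ((SMCat.tensorHom_heq_left _ (isId_id _) rfl).symm.trans
      (IsId.heq_comp _ (h'.isId_of_none (Or.inr rfl))).symm))

end BarObj

/-! ### Preimages of tuples of subsets -/

lemma exists_step_iff {n : ℕ} {F : Fin (n + 1) → ℕ} (hF : Monotone F) (x y : Fin (n + 1))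
    (l : ℕ) : (∃ b : Fin n, (x.val ≤ b.val ∧ b.val < y.val) ∧ F b.castSucc ≤ l ∧ l < F b.succ) ↔
      F x ≤ l ∧ l < F y := by
  refine ⟨fun ⟨b, ⟨h₁, h₂⟩, h₃, h₄⟩ => ⟨(hF (show x ≤ b.castSucc from h₁)).trans h₃,
    h₄.trans_le (hF (show b.succ ≤ y from h₂))⟩, fun ⟨h₁, h₂⟩ => ?_⟩
  induction y using Fin.induction with
  | zero => exact (((hF (Fin.zero_le x)).trans h₁).not_gt h₂).elim
  | succ b ih =>
    by_cases h : l < F b.castSucc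
    · obtain ⟨a, ha, h'⟩ := ih ⟨h₁, h⟩ h
      exact ⟨a, ⟨ha.1, ha.2.trans b.val.lt_succ_self⟩, h'⟩
    · refine ⟨b, ⟨not_lt.1 fun hx => ?_, b.val.lt_succ_self⟩, not_lt.1 h, h₂⟩
      exact ((hF (show b.succ ≤ x from hx)).trans h₁).not_gt h₂

section Preimage

variable {s t w : EObj} (f : s ⟶ t)

lemma Subsets.nondeg_congr {S T : Subsets t} (h : ∀ j, ePre f j = none → S j = T j) :
    S.Nondeg f ↔ T.Nondeg f :=
  forall₂_congr fun j hj => by rw [h j hj]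

lemma Subsets.preimage_congr {S T : Subsets t} {k : Fin s.len}
    (h : S (eInj f k) = T (eInj f k)) : S.preimage f k = T.preimage f k := by
  simp only [Subsets.preimage, h]

variable {f} in
lemma Split.nondeg_iff {T U S : Subsets t} {j : Fin t.len} (h : Split j T U S)
    {k : Fin s.len} (hk : ePre f j = some k) :
    (T.Nondeg f ↔ S.Nondeg f) ∧ (U.Nondeg f ↔ S.Nondeg f) := by
  have e (i) (hi : ePre f i = none) : i ≠ j := by
    rintro rfl
    simp [hi] at hk
  exact ⟨Subsets.nondeg_congr f fun i hi => h.left i (e i hi),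
    Subsets.nondeg_congr f fun i hi => h.right i (e i hi)⟩

lemma Split.preimage {T U S : Subsets t} {k : Fin s.len} (h : Split (eInj f k) T U S) :
    Split k (T.preimage f) (U.preimage f) (S.preimage f) where
  inter := by
    rw [Set.eq_empty_iff_forall_notMem]
    rintro l ⟨⟨a, ha, h₁, h₂⟩, b, hb, h₃, h₄⟩
    have hm := eMap_mono f (eInj f k)
    obtain hab | rfl | hab := lt_trichotomy a b
    · have := hm (show a.succ ≤ b.castSucc from hab)
      omega
    · have : a ∈ T (eInj f k) ∩ U (eInj f k) := ⟨ha, hb⟩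
      rw [h.inter] at this
      exact this
    · have := hm (show b.succ ≤ a.castSucc from hab)
      omega
  union := by
    ext l
    simp only [Subsets.preimage, ← h.union, Set.mem_union, Set.mem_ofPred_eq, or_and_right,
      exists_or]
  left i hi := Subsets.preimage_congr f (h.left _ fun e => hi (eInj_injective f e))
  right i hi := Subsets.preimage_congr f (h.right _ fun e => hi (eInj_injective f e))

open Classical in
/-- The preimage of a nondegenerate tuple. -/
def Subsets.index (S : Subsets t) : Option (Subsets s) :=
  if S.Nondeg f then some (S.preimage f) else none

variable {f} in
lemma Subsets.index_of_nondeg {S : Subsets t} (h : S.Nondeg f) :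
    S.index f = some (S.preimage f) := if_pos h

variable {f} in
lemma Subsets.index_of_not {S : Subsets t} (h : ¬ S.Nondeg f) : S.index f = none := if_neg h

lemma Subsets.index_congr {t t' : EObj} {f : s ⟶ t} {f' : s ⟶ t'} {S : Subsets t}
    {T : Subsets t'} (h : S.Nondeg f ↔ T.Nondeg f') (h' : S.preimage f = T.preimage f') :
    S.index f = T.index f' := by
  by_cases hS : S.Nondeg f
  · rw [index_of_nondeg hS, index_of_nondeg (h.1 hS), h']
  · rw [index_of_not hS, index_of_not (mt h.2 hS)]

lemma Split.nondeg_of_none {T U S : Subsets t} {j : Fin t.len} (h : Split j T U S)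
    (hj : ePre f j = none) :
    (¬ T.Nondeg f ∧ (U.Nondeg f ↔ S.Nondeg f)) ∨ (¬ U.Nondeg f ∧ (T.Nondeg f ↔ S.Nondeg f)) := by
  by_cases hT : ∃ a ∈ T j, eMap f j a.castSucc = 0 ∧ eMap f j a.succ = 1
  · refine Or.inr ⟨fun hU => ?_, ⟨fun hT' i hi => ?_, fun hS i hi => ?_⟩⟩
    · obtain ⟨a, ha, h₁, h₂⟩ := hT
      obtain ⟨b, hb, h₃, h₄⟩ := hU j hj
      have hm := eMap_mono f j
      obtain hab | rfl | hab := lt_trichotomy a b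
      · have := hm (show a.succ ≤ b.castSucc from hab)
        omega
      · have : a ∈ T j ∩ U j := ⟨ha, hb⟩
        rw [h.inter] at this
        exact this
      · have := hm (show b.succ ≤ a.castSucc from hab)
        omega
    · by_cases hij : i = j
      · subst hij
        obtain ⟨a, ha, h'⟩ := hT
        exact ⟨a, h.union ▸ Or.inl ha, h'⟩
      · rw [← h.left i hij]
        exact hT' i hi
    · by_cases hij : i = j
      · subst hij; exact hT
      · rw [h.left i hij]
        exact hS i hi
  · refine Or.inl ⟨fun h' => hT (h' j hj), ⟨fun hU i hi => ?_, fun hS i hi => ?_⟩⟩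
    · by_cases hij : i = j
      · subst hij
        obtain ⟨a, ha, h'⟩ := hU i hi
        exact ⟨a, h.union ▸ Or.inr ha, h'⟩
      · rw [← h.right i hij]
        exact hU i hi
    · by_cases hij : i = j
      · subst hij
        obtain ⟨a, ha, h'⟩ := hS i hi
        rw [← h.union] at ha
        exact ⟨a, ha.resolve_left fun hc => hT ⟨a, hc, h'⟩, h'⟩
      · rw [h.right i hij]
        exact hS i hi

variable {f} in
lemma Split.preimage_of_none {T U S : Subsets t} {j : Fin t.len} (h : Split j T U S)
    (hj : ePre f j = none) : T.preimage f = S.preimage f ∧ U.preimage f = S.preimage f := by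
  have e (k) : eInj f k ≠ j := by
    rintro rfl
    simp [ePre_eInj] at hj
  exact ⟨funext fun k => Subsets.preimage_congr f (h.left _ (e k)),
    funext fun k => Subsets.preimage_congr f (h.right _ (e k))⟩

lemma BarObj.exists_isRho {C : SMCat.{u}} (X : BarObj C s) (j : Fin t.len) {T U S : Subsets t}
    (h : Split j T U S) :
    ∃ r, IsRho X (ePre f j) (T.index f) (U.index f) (S.index f) r := by
  obtain hj | ⟨k, hk⟩ := (ePre f j).eq_none_or_eq_some
  · rw [hj]
    refine IsRho.exists_none X ?_
    obtain ⟨eT, eU⟩ := h.preimage_of_none hj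
    refine (h.nondeg_of_none f hj).imp (fun h' => ⟨if_neg h'.1, ?_⟩) fun h' => ⟨if_neg h'.1, ?_⟩
    · exact Subsets.index_congr h'.2 eU
    · exact Subsets.index_congr h'.2 eT
  · rw [hk]
    refine IsRho.exists_some X k ?_
    obtain ⟨eT, eU⟩ := h.nondeg_iff hk
    obtain rfl := ePre_eq_some.1 hk
    by_cases hS : S.Nondeg f
    · exact Or.inr ⟨_, _, _, if_pos (eT.2 hS), if_pos (eU.2 hS), if_pos hS, h.preimage f⟩
    · exact Or.inl ⟨if_neg (mt eT.1 hS), if_neg (mt eU.1 hS), if_neg hS⟩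

lemma Subsets.exists_preimage_iff {S : Subsets t} {i : Fin s.len} {F : Fin (s.val i + 1) → ℕ}
    (hF : Monotone F) (l : ℕ) : (∃ b ∈ S.preimage f i, F b.castSucc ≤ l ∧ l < F b.succ) ↔
      ∃ a ∈ S (eInj f i), F ⟨_, eMap_lt f i a.castSucc⟩ ≤ l ∧ l < F ⟨_, eMap_lt f i a.succ⟩ := by
  constructor
  · rintro ⟨b, ⟨a, ha, h⟩, h'⟩
    exact ⟨a, ha, (exists_step_iff hF ⟨_, eMap_lt f i a.castSucc⟩ ⟨_, eMap_lt f i a.succ⟩ l).1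
      ⟨b, h, h'⟩⟩
  · rintro ⟨a, ha, h⟩
    obtain ⟨b, h, h'⟩ := (exists_step_iff hF _ _ l).2 h
    exact ⟨b, ⟨a, ha, h⟩, h'⟩

lemma Subsets.preimage_comp (g : t ⟶ w) (S : Subsets w) :
    S.preimage (f ≫ g) = (S.preimage g).preimage f := by
  funext k
  ext l
  refine Iff.trans (exists_congr fun a => and_congr_right fun _ => ?_)
    (Subsets.exists_preimage_iff g (F := eMap f (eInj f k)) (eMap_mono f _) l.val).symm
  rw [← eMap_comp_some f g (ePre_eInj g (eInj f k)) a.castSucc _ rfl,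
    ← eMap_comp_some f g (ePre_eInj g (eInj f k)) a.succ _ rfl]
  rfl

lemma Subsets.nondeg_iff (S : Subsets t) : S.Nondeg f ↔ ∀ j, ePre f j = none →
    ∃ a ∈ S j, eMap f j a.castSucc ≤ 0 ∧ 0 < eMap f j a.succ :=
  forall₂_congr fun j hj => exists_congr fun a => and_congr_right fun _ => by
    have := eMap_of_none hj a.succ
    omega

lemma Subsets.nondeg_comp (g : t ⟶ w) (S : Subsets w) :
    S.Nondeg (f ≫ g) ↔ S.Nondeg g ∧ (S.preimage g).Nondeg f := by
  simp only [Subsets.nondeg_iff]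
  refine ⟨fun h => ⟨fun j hj => ?_, fun i hi => ?_⟩, fun h j hj => ?_⟩
  · have := h j (by rw [ePre_comp, hj]; rfl)
    simpa only [eMap_comp_none f g hj] using this
  · refine (Subsets.exists_preimage_iff g (eMap_mono f i) 0).2 ?_
    obtain ⟨a, ha, h'⟩ := h (eInj g i) (by rw [ePre_comp, ePre_eInj]; exact hi)
    rw [eMap_comp_some f g (ePre_eInj g i) _ ⟨_, eMap_lt g i a.castSucc⟩ rfl,
      eMap_comp_some f g (ePre_eInj g i) _ ⟨_, eMap_lt g i a.succ⟩ rfl] at h'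
    exact ⟨a, ha, h'⟩
  · obtain hi | ⟨i, hi⟩ := (ePre g j).eq_none_or_eq_some
    · simpa only [eMap_comp_none f g hi] using h.1 j hi
    · obtain rfl := ePre_eq_some.1 hi
      rw [ePre_comp, hi] at hj
      obtain ⟨a, ha, h'⟩ := (Subsets.exists_preimage_iff g (eMap_mono f i) 0).1 (h.2 i hj)
      refine ⟨a, ha, ?_⟩
      rw [eMap_comp_some f g hi _ ⟨_, eMap_lt g i a.castSucc⟩ rfl,
        eMap_comp_some f g hi _ ⟨_, eMap_lt g i a.succ⟩ rfl]
      exact h'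

lemma Subsets.index_comp (g : t ⟶ w) (S : Subsets w) :
    S.index (f ≫ g) = (S.index g).bind (Subsets.index f) := by
  by_cases hg : S.Nondeg g
  · rw [index_of_nondeg hg, Option.bind_some]
    exact Subsets.index_congr ((nondeg_comp f g S).trans (and_iff_right hg)) (preimage_comp f g S)
  · rw [index_of_not hg, index_of_not fun h => hg ((nondeg_comp f g S).1 h).1]
    rfl

lemma Subsets.index_id (S : Subsets t) : S.index (𝟙 t) = some S := by
  rw [index_of_nondeg fun j hj => by simp [ePre_id] at hj]
  congr 1
  funext k
  ext l
  constructor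
  · rintro ⟨a, ha, h₁, h₂⟩
    obtain rfl : a = l := Fin.ext (le_antisymm h₁ (Nat.lt_succ_iff.1 h₂))
    exact ha
  · exact fun h => ⟨l, h, le_refl l.val, l.val.lt_succ_self⟩

lemma Subsets.preimage_eq_empty {S : Subsets t} {j : Fin t.len} (h : S j = ∅) {T : Subsets s}
    (hT : S.index f = some T) : ∃ k, ePre f j = some k ∧ T k = ∅ := by
  have hS : S.Nondeg f := by
    by_contra hS
    simp [Subsets.index, hS] at hT
  rw [Subsets.index_of_nondeg hS] at hT
  obtain rfl := Option.some.inj hT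
  obtain hj | ⟨k, hk⟩ := (ePre f j).eq_none_or_eq_some
  · obtain ⟨a, ha, -⟩ := hS j hj
    simp [h] at ha
  · refine ⟨k, hk, ?_⟩
    obtain rfl := ePre_eq_some.1 hk
    simp [Subsets.preimage, h]

end Preimage

/-! ### The action of `ℰ` on systems -/

namespace BarObj

variable {C : SMCat.{u}} {s t w : EObj}

lemma ext_eq_unit (X : BarObj C t) {P : Option (Subsets t)}
    (h : ∀ T, P = some T → ∃ k, T k = ∅) : X.ext P = 𝟙_ C.C := by
  obtain _ | T := P
  · rfl
  · obtain ⟨k, hk⟩ := h T rfl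
    exact X.obj_empty T k hk

lemma isId_extMap {X Y : BarObj C t} (f : X ⟶ Y) {P : Option (Subsets t)}
    (h : ∀ T, P = some T → ∃ k, T k = ∅) : IsId (extMap f P) := by
  obtain _ | T := P
  · exact isId_id _
  · obtain ⟨k, hk⟩ := h T rfl
    exact BarObj.Hom.app_empty f T k hk

/-- The system induced by a morphism of `ℰ`. -/
def push (f : s ⟶ t) (X : BarObj C s) : BarObj C t where
  obj S := X.ext (S.index f)
  ρ j _ _ _ h := (X.exists_isRho f j h).choose
  obj_empty S j h := X.ext_eq_unit fun T hT =>
    (S.preimage_eq_empty f h hT).imp fun _ h => h.2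
  ρ_empty j T U S h h' := (X.exists_isRho f j h).choose_spec.isId
    (h'.imp (fun h _ => Subsets.preimage_eq_empty f h) (Or.imp
      (fun h _ => Subsets.preimage_eq_empty f h) fun ⟨_, h⟩ _ hT =>
        (Subsets.preimage_eq_empty f h hT).imp fun _ h => h.2))
  ρ_symm j _ _ _ h h' := (X.exists_isRho f j h).choose_spec.symm
    (X.exists_isRho f j h').choose_spec
  ρ_assoc j _ _ _ _ _ _ h₁ h₂ h₃ h₄ := (X.exists_isRho f j h₁).choose_spec.assoc
    (X.exists_isRho f j h₂).choose_spec (X.exists_isRho f j h₃).choose_spec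
    (X.exists_isRho f j h₄).choose_spec
  ρ_ρ i j _ _ _ _ _ _ _ _ _ hij h₁ h₂ h₃ h₄ h₅ h₆ :=
    (X.exists_isRho f i h₁).choose_spec.interchange
      (fun k hi hj => hij ((ePre_eq_some.1 hi).symm.trans (ePre_eq_some.1 hj)))
      (X.exists_isRho f i h₂).choose_spec (X.exists_isRho f j h₃).choose_spec
      (X.exists_isRho f j h₄).choose_spec (X.exists_isRho f j h₅).choose_spec
      (X.exists_isRho f i h₆).choose_spec

lemma push_isRho (f : s ⟶ t) (X : BarObj C s) (j : Fin t.len) {T U S : Subsets t}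
    (h : Split j T U S) :
    IsRho X (ePre f j) (T.index f) (U.index f) (S.index f) ((X.push f).ρ j h) :=
  (X.exists_isRho f j h).choose_spec

/-- The morphism of systems induced by a morphism of `ℰ`. -/
def pushMap (f : s ⟶ t) {X Y : BarObj C s} (g : X ⟶ Y) : X.push f ⟶ Y.push f :=
  BarObj.Hom.mk (fun S => extMap g (S.index f))
    (fun S j h => isId_extMap g fun T hT => (S.preimage_eq_empty f h hT).imp fun _ h => h.2)
    fun j _ _ _ h => (X.push_isRho f j h).naturality (Y.push_isRho f j h) g

lemma hom_ext {X Y : BarObj C t} {f g : X ⟶ Y} (h : ∀ S, component f S = component g S) :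
    f = g := BarObj.Hom.ext (funext h)

lemma obj_ext {X Y : BarObj C t} (h : ∀ S, X.obj S = Y.obj S)
    (hρ : ∀ (i : Fin t.len) (T U S : Subsets t) (h : Split i T U S),
      HEq (X.ρ i h).hom (Y.ρ i h).hom) : X = Y := by
  obtain ⟨o, r, _, _, _, _, _⟩ := X
  obtain ⟨o', r', _, _, _, _, _⟩ := Y
  obtain rfl : o = o' := funext h
  congr 1
  funext i T U S hh
  exact Iso.ext (eq_of_heq (hρ i T U S hh))

lemma hom_heq {X Y X' Y' : BarObj C t} (hX : X = X') (hY : Y = Y') {f : X ⟶ Y} {g : X' ⟶ Y'}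
    (h : ∀ S, HEq (component f S) (component g S)) : HEq f g := by
  subst hX hY
  exact heq_of_eq (hom_ext fun S => eq_of_heq (h S))

variable (C) in
/-- The functor between categories of systems induced by a morphism of `ℰ`. -/
def pushFunctor (f : s ⟶ t) : BarObj C s ⥤ BarObj C t where
  obj X := X.push f
  map g := pushMap f g
  map_id X := hom_ext fun S => by
    change extMap (𝟙 X) (S.index f) = 𝟙 (X.ext (S.index f))
    cases S.index f <;> rfl
  map_comp g h := hom_ext fun S => by
    change extMap (g ≫ h) (S.index f) = extMap g (S.index f) ≫ extMap h (S.index f)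
    cases S.index f
    · exact (id_comp _).symm
    · rfl

lemma eq_const {X : BarObj C t} (h : ∀ S, X.obj S = 𝟙_ C.C)
    (hρ : ∀ (i : Fin t.len) (T U S : Subsets t) (h : Split i T U S), IsId (X.ρ i h).hom) :
    X = const C t :=
  obj_ext h fun i T U S hh => (hρ i T U S hh).heq (C.left_strict _) (by rw [h, h]; rfl)

lemma IsRho.isId_const {o : Option (Fin t.len)} {P Q R : Option (Subsets t)}
    {r : (const C t).ext P ⊗ (const C t).ext Q ≅ (const C t).ext R}
    (h : IsRho (const C t) o P Q R r) : IsId r.hom := by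
  cases h with
  | split => exact C.left_strict _
  | left Q r hr => exact hr
  | right Q r hr => exact hr
  | deg o r hr => exact hr

lemma push_const (f : s ⟶ t) : (const C s).push f = const C t := by
  refine eq_const (fun S => ?_) fun j T U S h => ?_
  · change ext _ (S.index f) = _
    cases S.index f <;> rfl
  · exact ((const C s).push_isRho f j h).isId_const

lemma push_ext (f : s ⟶ t) (X : BarObj C s) (P : Option (Subsets t)) :
    X.ext (P.bind (Subsets.index f)) = (X.push f).ext P := by
  cases P <;> rfl

lemma pushMap_extMap (f : s ⟶ t) {X Y : BarObj C s} (g : X ⟶ Y) (P : Option (Subsets t)) :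
    HEq (extMap g (P.bind (Subsets.index f))) (extMap (pushMap f g) P) := by
  cases P <;> rfl

lemma IsRho.push {f : s ⟶ t} {X : BarObj C s} {o : Option (Fin t.len)}
    {P Q R : Option (Subsets t)} {r : (X.push f).ext P ⊗ (X.push f).ext Q ≅ (X.push f).ext R}
    (h : IsRho (X.push f) o P Q R r)
    {r' : X.ext (P.bind (Subsets.index f)) ⊗ X.ext (Q.bind (Subsets.index f)) ≅
      X.ext (R.bind (Subsets.index f))}
    (h' : IsRho X (o.bind (ePre f)) (P.bind (Subsets.index f)) (Q.bind (Subsets.index f))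
      (R.bind (Subsets.index f)) r') : HEq r'.hom r.hom := by
  have e : X.ext (P.bind (Subsets.index f)) ⊗ X.ext (Q.bind (Subsets.index f)) =
      (X.push f).ext P ⊗ (X.push f).ext Q := by rw [push_ext, push_ext]
  cases h with
  | split k h => exact heq_of_eq (h'.unique (X.push_isRho f k h))
  | left Q r hr => exact (h'.isId_of_none (Or.inl rfl)).heq hr e
  | right Q r hr => exact (h'.isId_of_none (Or.inl rfl)).heq hr e
  | deg o r hr => exact (h'.isId_of_none (Or.inr rfl)).heq hr e

lemma IsRho.heq_of_eq {X : BarObj C t} {o o' : Option (Fin t.len)}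
    {P Q R P' Q' R' : Option (Subsets t)} {r : X.ext P ⊗ X.ext Q ≅ X.ext R}
    {r' : X.ext P' ⊗ X.ext Q' ≅ X.ext R'} (h : IsRho X o P Q R r) (h' : IsRho X o' P' Q' R' r')
    (ho : o = o') (hP : P = P') (hQ : Q = Q') (hR : R = R') : HEq r.hom r'.hom := by
  subst ho hP hQ hR
  exact _root_.heq_of_eq (h.unique h')

lemma exists_isRho_bind (f : s ⟶ t) {X : BarObj C s} (g : t ⟶ w) (j : Fin w.len)
    {T U S : Subsets w} (h : Split j T U S) :
    ∃ r, IsRho X ((ePre g j).bind (ePre f)) ((T.index g).bind (Subsets.index f))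
      ((U.index g).bind (Subsets.index f)) ((S.index g).bind (Subsets.index f)) r := by
  rw [← Subsets.index_comp, ← Subsets.index_comp, ← Subsets.index_comp]
  exact X.exists_isRho (f ≫ g) j h

lemma push_comp (f : s ⟶ t) (g : t ⟶ w) (X : BarObj C s) :
    X.push (f ≫ g) = (X.push f).push g := by
  refine obj_ext (fun S => ?_) fun j T U S h => ?_
  · exact (congrArg X.ext (Subsets.index_comp f g S)).trans (push_ext f X _)
  · obtain ⟨r, hr⟩ := exists_isRho_bind f (X := X) g j h
    exact ((X.push_isRho (f ≫ g) j h).heq_of_eq hr rfl (Subsets.index_comp f g T)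
      (Subsets.index_comp f g U) (Subsets.index_comp f g S)).trans
      (((X.push f).push_isRho g j h).push hr)

lemma push_id (X : BarObj C t) : X.push (𝟙 t) = X :=
  obj_ext (fun S => congrArg X.ext (Subsets.index_id S)) fun j T U S h =>
    (X.push_isRho (𝟙 t) j h).heq_of_eq (.split j h) rfl (Subsets.index_id T)
      (Subsets.index_id U) (Subsets.index_id S)

lemma functor_ext {D : Type*} [Category D] {F G : D ⥤ BarObj C t} (h : ∀ x, F.obj x = G.obj x)
    (h' : ∀ {x y : D} (f : x ⟶ y) (S : Subsets t),
      HEq (component (F.map f) S) (component (G.map f) S)) : F = G :=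
  Functor.hext h fun _ _ f => hom_heq (h _) (h _) (h' f)

lemma extMap_congr {X Y : BarObj C t} (f : X ⟶ Y) {P Q : Option (Subsets t)} (h : P = Q) :
    HEq (extMap f P) (extMap f Q) := by
  rw [h]

lemma isTrivial (h : ∃ k, t.val k = 0) : (bar C t).IsTrivial := by
  obtain ⟨k, hk⟩ := h
  have e (S : Subsets t) : S k = ∅ :=
    Set.eq_empty_of_forall_notMem fun l => ((Nat.not_lt_zero _) (l.2.trans_eq hk)).elim
  exact ⟨fun X => eq_const (fun S => X.obj_empty S k (e S)) fun i T U S h =>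
    X.ρ_empty i h (Or.inr (Or.inr ⟨k, e S⟩)),
    fun f => hom_ext fun S => (BarObj.Hom.app_empty f S k (e S)).eq (isId_id _)⟩

end BarObj

/-- The construction of Elmendorf and Mandell as an `ℰ_*`-category. -/
def barStr (C : SMCat.{u}) : EStarStr (bar C) where
  map f := ⟨BarObj.pushFunctor C f, BarObj.push_const f⟩
  map_id t := BasedFunctor.ext (BarObj.functor_ext (fun X => X.push_id) fun g S =>
    BarObj.extMap_congr g (Subsets.index_id S))
  map_comp f g := BasedFunctor.ext (BarObj.functor_ext (fun X => X.push_comp f g) fun h S =>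
    (BarObj.extMap_congr h (Subsets.index_comp f g S)).trans (BarObj.pushMap_extMap f h _))
  trivial _ := BarObj.isTrivial

lemma isBarStr : IsBarStr.{u} barStr where
  obj_nondeg C _ _ f X S h := congrArg X.ext (Subsets.index_of_nondeg h)
  obj_deg C _ _ f X S h := congrArg X.ext (Subsets.index_of_not h)
  ρ_some C _ _ f X k T U S h h' hS := (X.push_isRho f _ h).heq_of_eq (.split k h') (ePre_eInj f k)
    (Subsets.index_of_nondeg ((h.nondeg_iff (ePre_eInj f k)).1.2 hS))
    (Subsets.index_of_nondeg ((h.nondeg_iff (ePre_eInj f k)).2.2 hS)) (Subsets.index_of_nondeg hS)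
  ρ_none C _ _ f X j T U S h hS := (X.push_isRho f j h).isId_of_none
    (hS.symm.imp id Subsets.index_of_not)
  map_nondeg C _ _ f X Y g S h := BarObj.extMap_congr g (Subsets.index_of_nondeg h)
  map_deg C _ _ f X Y g S h :=
    isId_of_heq (congrArg X.ext (Subsets.index_of_not h)).symm
      (congrArg Y.ext (Subsets.index_of_not h)).symm
      (BarObj.extMap_congr g (Subsets.index_of_not h)).symm (isId_id _)

end

section

open MonoidalCategory

/-! ### Sums in a Waldhausen category with a choice of wedges -/

lemma IsId.of_comp_left {C : Type*} [Category C] {X Y Z : C} {f : X ⟶ Y} {g : Y ⟶ Z}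
    (h : IsId (f ≫ g)) (hf : IsId f) : IsId g := by
  obtain ⟨rfl, rfl⟩ := hf
  aesop

lemma IsAlong.comp {I : Type} {A : I → Type u} [∀ i, SmallCategory (A i)] {i : I}
    {x y z : ∀ i, A i} {f : x ⟶ y} {g : y ⟶ z} (hf : IsAlong i f) (hg : IsAlong i g) :
    IsAlong i (f ≫ g) := fun j hj => (hf j hj).comp (hg j hj)

namespace WaldVee

variable (A : WaldVee.{u})

variable {A}

lemma isId_inl {X Y : A.C} (h : Y = A.pt) : IsId (A.inl X Y) := by
  subst h
  rw [A.inl_pt]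
  exact isId_eqToHom _

lemma isId_inr {X Y : A.C} (h : X = A.pt) : IsId (A.inr X Y) := by
  subst h
  rw [A.inr_pt]
  exact isId_eqToHom _

lemma inl_heq {X Y X' Y' : A.C} (hX : X = X') (hY : Y = Y') : HEq (A.inl X Y) (A.inl X' Y') := by grind

lemma inr_heq {X Y X' Y' : A.C} (hX : X = X') (hY : Y = Y') : HEq (A.inr X Y) (A.inr X' Y') := by aesop

lemma isId_of_eq_pt {X Y : A.C} (f : X ⟶ Y) (hX : X = A.pt) (hY : Y = A.pt) : IsId f := by
  subst hX
  exact isId_of_heq_id rfl hY (heq_of_isZero rfl hY (Or.inl A.isZero))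

lemma inl_tensorHom_assoc {X Y X' Y' Z : A.C} (f : X ⟶ X') (g : Y ⟶ Y')
    (h : A.wedge X' Y' ⟶ Z) : A.inl X Y ≫ (f ⊗ₘ g) ≫ h = f ≫ A.inl X' Y' ≫ h := inl_desc_assoc _ _ _ |>.trans (by simp)

lemma inr_tensorHom_assoc {X Y X' Y' Z : A.C} (f : X ⟶ X') (g : Y ⟶ Y')
    (h : A.wedge X' Y' ⟶ Z) : A.inr X Y ≫ (f ⊗ₘ g) ≫ h = g ≫ A.inr X' Y' ≫ h := inr_desc_assoc _ _ _ |>.trans (by simp)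

lemma inl_associator (X Y Z : A.C) :
    A.inl (A.wedge X Y) Z ≫ (α_ X Y Z).hom = A.desc (A.inl _ _) (A.inl _ _ ≫ A.inr _ _) := inl_desc _ _

lemma inr_associator (X Y Z : A.C) :
    A.inr (A.wedge X Y) Z ≫ (α_ X Y Z).hom = A.inr _ _ ≫ A.inr _ _ := inr_desc _ _

lemma inl_braiding (X Y : A.C) : A.inl X Y ≫ (β_ X Y).hom = A.inr _ _ := inl_desc _ _

lemma inr_braiding (X Y : A.C) : A.inr X Y ≫ (β_ X Y).hom = A.inl _ _ := inr_desc _ _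

lemma inl_tensorμ (X₁ X₂ Y₁ Y₂ : A.C) : A.inl (A.wedge X₁ X₂) (A.wedge Y₁ Y₂) ≫ tensorμ X₁ X₂ Y₁ Y₂ =
    A.wedgeMap (A.inl X₁ Y₁) (A.inl X₂ Y₂) := by
  change A.inl _ _ ≫ (A.wedgeAssoc _ _ _).hom ≫ A.wedgeMap (𝟙 _) (A.wedgeAssoc _ _ _).inv ≫
    A.wedgeMap (𝟙 _) (A.wedgeMap (A.wedgeSymm _ _).hom (𝟙 _)) ≫
    A.wedgeMap (𝟙 _) (A.wedgeAssoc _ _ _).hom ≫ (A.wedgeAssoc _ _ _).inv = _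
  ext <;> simp [wedgeMap, wedgeAssoc, wedgeSymm]

lemma inr_tensorμ (X₁ X₂ Y₁ Y₂ : A.C) : A.inr (A.wedge X₁ X₂) (A.wedge Y₁ Y₂) ≫ tensorμ X₁ X₂ Y₁ Y₂ =
    A.wedgeMap (A.inr X₁ Y₁) (A.inr X₂ Y₂) := by
  change A.inr _ _ ≫ (A.wedgeAssoc _ _ _).hom ≫ A.wedgeMap (𝟙 _) (A.wedgeAssoc _ _ _).inv ≫
    A.wedgeMap (𝟙 _) (A.wedgeMap (A.wedgeSymm _ _).hom (𝟙 _)) ≫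
    A.wedgeMap (𝟙 _) (A.wedgeAssoc _ _ _).hom ≫ (A.wedgeAssoc _ _ _).inv = _
  ext <;> simp [wedgeMap, wedgeAssoc, wedgeSymm]

end WaldVee

namespace KExact

variable {I : Type} [Finite I] {A : I → WaldVee.{u}} {B : WaldVee.{u}} (F : KExact I A B)

lemma isPushout_map {i : I} {x y z : ∀ i, (A i).C} {a : x ⟶ z} {b : y ⟶ z} (ha : IsAlong i a)
    (hb : IsAlong i b) (h : IsPushout ((A i).isZero.to_ (x i)) ((A i).isZero.to_ (y i)) (a i) (b i)) :
    IsPushout (B.isZero.to_ (F.functor.obj x)) (B.isZero.to_ (F.functor.obj y))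
      (F.functor.map a) (F.functor.map b) := by
  let p := (upd z i).obj (A i).pt
  have e (j) (hj : j ≠ i) : p j = z j := upd_obj_ne z hj.symm _
  obtain ⟨f, hf, hf'⟩ := exists_along (A := fun i => (A i).lambda) (w := p) (z := x)
    (fun j hj => (e j hj).trans (ha j hj).1.symm) (upd_obj_self z i _) _
  obtain ⟨g, hg, hg'⟩ := exists_along (A := fun i => (A i).lambda) (w := p) (z := y)
    (fun j hj => (e j hj).trans (hb j hj).1.symm) (upd_obj_self z i _) _
  have hp := F.isMultiexact.map_pt p i (upd_obj_self z i _)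
  have := F.isMultiexact.map_pushout f g a b i hf' hg' ha hb
    (property_heq _ (upd_obj_self z i _).symm rfl hf.symm ((A i).cof_of_pt _))
    (isPushout_heq (upd_obj_self z i _).symm rfl rfl rfl hf.symm hg.symm HEq.rfl HEq.rfl h)
  have hp' := hp ▸ B.isZero
  exact isPushout_heq hp rfl rfl rfl (heq_of_isZero hp rfl (Or.inl hp'))
    (heq_of_isZero hp rfl (Or.inl hp')) HEq.rfl HEq.rfl this

variable {i : I} {x y z : ∀ i, (A i).C}

lemma exists_inl (h : SumAt (A := fun i => (A i).lambda) i x y z) :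
    ∃ a : x ⟶ z, HEq (a i) ((A i).inl (x i) (y i)) ∧ IsAlong i a := by
  obtain ⟨r, hr⟩ := exists_heq_hom rfl h.1 _
  obtain ⟨a, ha, ha'⟩ := exists_along (A := fun i => (A i).lambda) (fun j hj => (h.2 j hj).1) rfl r
  exact ⟨a, ha.trans hr, ha'⟩

lemma exists_inr (h : SumAt (A := fun i => (A i).lambda) i x y z) :
    ∃ b : y ⟶ z, HEq (b i) ((A i).inr (x i) (y i)) ∧ IsAlong i b := by
  obtain ⟨r, hr⟩ := exists_heq_hom rfl h.1 _
  obtain ⟨a, ha, ha'⟩ := exists_along (A := fun i => (A i).lambda) (fun j hj => (h.2 j hj).2) rfl r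
  exact ⟨a, ha.trans hr, ha'⟩

lemma exists_wedgeIso (h : SumAt (A := fun i => (A i).lambda) i x y z) :
    ∃ δ : B.wedge (F.functor.obj x) (F.functor.obj y) ≅ F.functor.obj z,
      (∀ a : x ⟶ z, HEq (a i) ((A i).inl (x i) (y i)) → IsAlong i a →
        B.inl _ _ ≫ δ.hom = F.functor.map a) ∧
      ∀ b : y ⟶ z, HEq (b i) ((A i).inr (x i) (y i)) → IsAlong i b →
        B.inr _ _ ≫ δ.hom = F.functor.map b := by
  obtain ⟨a, ha, ha'⟩ := exists_inl h
  obtain ⟨b, hb, hb'⟩ := exists_inr h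
  have hp := F.isPushout_map ha' hb'
    (isPushout_heq rfl rfl rfl h.1.symm HEq.rfl HEq.rfl ha.symm hb.symm ((A i).isPushout _ _))
  refine ⟨(B.isPushout _ _).isoIsPushout _ _ hp, fun a₁ h₁ h₁' => ?_, fun b₁ h₁ h₁' => ?_⟩
  · rw [IsPushout.inl_isoIsPushout_hom, hom_ext_along ha' h₁' (eq_of_heq (ha.trans h₁.symm))]
  · rw [IsPushout.inr_isoIsPushout_hom, hom_ext_along hb' h₁' (eq_of_heq (hb.trans h₁.symm))]

/-- The isomorphism `F (…, X_i, …) ∨ F (…, X_i', …) ≅ F (…, X_i ∨ X_i', …)`. -/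
def wedgeIso (h : SumAt (A := fun i => (A i).lambda) i x y z) :
    B.wedge (F.functor.obj x) (F.functor.obj y) ≅ F.functor.obj z := (F.exists_wedgeIso h).choose

variable {F} in
lemma inl_wedgeIso (h : SumAt (A := fun i => (A i).lambda) i x y z) {a : x ⟶ z}
    (ha : HEq (a i) ((A i).inl (x i) (y i))) (ha' : IsAlong i a) :
    B.inl _ _ ≫ (F.wedgeIso h).hom = F.functor.map a :=
  (F.exists_wedgeIso h).choose_spec.1 a ha ha'

variable {F} in
lemma inr_wedgeIso (h : SumAt (A := fun i => (A i).lambda) i x y z) {b : y ⟶ z}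
    (hb : HEq (b i) ((A i).inr (x i) (y i))) (hb' : IsAlong i b) :
    B.inr _ _ ≫ (F.wedgeIso h).hom = F.functor.map b :=
  (F.exists_wedgeIso h).choose_spec.2 b hb hb'

lemma wedgeIso_naturality (h : SumAt (A := fun i => (A i).lambda) i x y z)
    {x' y' z' : ∀ i, (A i).C} (h' : SumAt (A := fun i => (A i).lambda) i x' y' z')
    (f : x ⟶ x') (g : y ⟶ y') (k : z ⟶ z')
    (hk : HEq (k i) ((A i).wedgeMap (f i) (g i)))
    (hk' : ∀ j ≠ i, HEq (f j) (k j) ∧ HEq (g j) (k j)) :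
    B.wedgeMap (F.functor.map f) (F.functor.map g) ≫ (F.wedgeIso h').hom =
      (F.wedgeIso h).hom ≫ F.functor.map k := by
  obtain ⟨a, ha, ha'⟩ := exists_inl h
  obtain ⟨b, hb, hb'⟩ := exists_inr h
  obtain ⟨a₁, h₁, h₁'⟩ := exists_inl h'
  obtain ⟨b₁, h₂, h₂'⟩ := exists_inr h'
  refine B.wedge_ext ?_ ?_
  · rw [← assoc (B.inl _ _) (F.wedgeIso h).hom, inl_wedgeIso h ha ha', ← Functor.map_comp]
    refine (WaldVee.inl_desc_assoc _ _ _).trans ?_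
    rw [assoc, inl_wedgeIso h' h₁ h₁', ← Functor.map_comp]
    refine congrArg F.functor.map (funext fun j => eq_of_heq ?_)
    by_cases hj : j = i
    · subst hj
      exact (heq_comp rfl rfl h'.1 HEq.rfl h₁).trans ((heq_of_eq (WaldVee.inl_desc _ _).symm).trans
        (heq_comp rfl h.1 h'.1 ha hk).symm)
    · exact (IsId.heq_comp _ (h₁' j hj)).trans ((hk' j hj).1.trans ((ha' j hj).comp_heq _).symm)
  · rw [← assoc (B.inr _ _) (F.wedgeIso h).hom, inr_wedgeIso h hb hb', ← Functor.map_comp]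
    refine (WaldVee.inr_desc_assoc _ _ _).trans ?_
    rw [assoc, inr_wedgeIso h' h₂ h₂', ← Functor.map_comp]
    refine congrArg F.functor.map (funext fun j => eq_of_heq ?_)
    by_cases hj : j = i
    · subst hj
      exact (heq_comp rfl rfl h'.1 HEq.rfl h₂).trans ((heq_of_eq (WaldVee.inr_desc _ _).symm).trans
        (heq_comp rfl h.1 h'.1 hb hk).symm)
    · exact (IsId.heq_comp _ (h₂' j hj)).trans ((hk' j hj).2.trans ((hb' j hj).comp_heq _).symm)

lemma map_pt_of_isId {x y : ∀ i, (A i).C} (f : x ⟶ y) (i : I) (h : x i = (A i).pt)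
    (hf : IsId (f i)) : IsId (F.functor.map f) :=
  WaldVee.isId_of_eq_pt _ (F.isMultiexact.map_pt x i h)
    (F.isMultiexact.map_pt y i (hf.1.symm.trans h))

lemma isId_wedgeIso (h : SumAt (A := fun i => (A i).lambda) i x y z)
    (h' : x i = (A i).pt ∨ y i = (A i).pt ∨ ∃ j, j ≠ i ∧ z j = (A j).pt) :
    IsId (F.wedgeIso h).hom := by
  obtain ⟨a, ha, ha'⟩ := exists_inl h
  obtain ⟨b, hb, hb'⟩ := exists_inr h
  obtain hx | hy | ⟨j, hj, hz⟩ := h'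
  · refine IsId.of_comp_left ?_
      (WaldVee.isId_inr (F.isMultiexact.map_pt x i hx))
    rw [inr_wedgeIso h hb hb']
    refine IsId.map _ (isId_pi fun j => ?_)
    by_cases hj : j = i
    · subst hj
      exact isId_of_heq rfl h.1.symm hb.symm (WaldVee.isId_inr hx)
    · exact hb' j hj
  · refine IsId.of_comp_left ?_
      (WaldVee.isId_inl (F.isMultiexact.map_pt y i hy))
    rw [inl_wedgeIso h ha ha']
    refine IsId.map _ (isId_pi fun j => ?_)
    by_cases hj : j = i
    · subst hj
      exact isId_of_heq rfl h.1.symm ha.symm (WaldVee.isId_inl hy)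
    · exact ha' j hj
  · have hx := F.isMultiexact.map_pt x j ((h.2 j hj).1.trans hz)
    have hy := F.isMultiexact.map_pt y j ((h.2 j hj).2.trans hz)
    exact WaldVee.isId_of_eq_pt _ (by rw [hx, hy, B.wedge_pt]) (F.isMultiexact.map_pt z j hz)

lemma wedgeIso_assoc {w xy yw s s' : ∀ i, (A i).C}
    (h₁ : SumAt (A := fun i => (A i).lambda) i x y xy)
    (h₂ : SumAt (A := fun i => (A i).lambda) i xy w s)
    (h₃ : SumAt (A := fun i => (A i).lambda) i y w yw)
    (h₄ : SumAt (A := fun i => (A i).lambda) i x yw s') (a : s ⟶ s')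
    (ha : HEq (a i) (α_ (x i) (y i) (w i)).hom) (ha' : IsAlong i a) :
    (F.wedgeIso h₁).hom ▷ F.functor.obj w ≫ (F.wedgeIso h₂).hom ≫ F.functor.map a =
      (α_ _ _ _).hom ≫ F.functor.obj x ◁ (F.wedgeIso h₃).hom ≫ (F.wedgeIso h₄).hom := by
  obtain ⟨a₁, l₁, l₁'⟩ := exists_inl h₁
  obtain ⟨b₁, r₁, r₁'⟩ := exists_inr h₁
  obtain ⟨a₂, l₂, l₂'⟩ := exists_inl h₂
  obtain ⟨b₂, r₂, r₂'⟩ := exists_inr h₂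
  obtain ⟨a₃, l₃, l₃'⟩ := exists_inl h₃
  obtain ⟨b₃, r₃, r₃'⟩ := exists_inr h₃
  obtain ⟨a₄, l₄, l₄'⟩ := exists_inl h₄
  obtain ⟨b₄, r₄, r₄'⟩ := exists_inr h₄
  have es : s i = (A i).wedge ((A i).wedge (x i) (y i)) (w i) := by
    rw [h₂.1, h₁.1]; rfl
  have es' : s' i = (A i).wedge (x i) ((A i).wedge (y i) (w i)) := by
    rw [h₄.1, h₃.1]; rfl
  have eyw : (yw i : (A i).C) = (A i).wedge (y i) (w i) := h₃.1
  have exy : (xy i : (A i).C) = (A i).wedge (x i) (y i) := h₁.1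
  have L₂' := l₂.trans (WaldVee.inl_heq exy rfl)
  have R₂' := r₂.trans (WaldVee.inr_heq exy rfl)
  have L₄' := l₄.trans (WaldVee.inl_heq rfl eyw)
  have R₄' := r₄.trans (WaldVee.inr_heq rfl eyw)
  have e₁ : a₁ ≫ a₂ ≫ a = a₄ := hom_ext_along (l₁'.comp (l₂'.comp ha')) l₄' <| eq_of_heq <|
    (heq_comp rfl h₁.1 es' l₁ (heq_comp h₁.1 es es' L₂' ha)).trans ((heq_of_eq (by
      rw [WaldVee.inl_associator, WaldVee.inl_desc])).trans L₄'.symm)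
  have e₂ := hom_ext_along (r₁'.comp (l₂'.comp ha')) (l₃'.comp r₄') <|
    eq_of_heq <| (heq_comp rfl h₁.1 es' r₁ (heq_comp h₁.1 es es' L₂' ha)).trans ((heq_of_eq (by
      rw [WaldVee.inl_associator, WaldVee.inr_desc])).trans (heq_comp rfl eyw es' l₃ R₄').symm)
  have e₃ : b₂ ≫ a = b₃ ≫ b₄ := hom_ext_along (r₂'.comp ha') (r₃'.comp r₄') <| eq_of_heq <|
    (heq_comp rfl es es' R₂' ha).trans ((heq_of_eq (WaldVee.inr_associator _ _ _)).trans
      (heq_comp rfl eyw es' r₃ R₄').symm)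
  rw [← tensorHom_id, ← id_tensorHom]
  refine B.wedge_ext (B.wedge_ext ?_ ?_) ?_
  · simp only [WaldVee.inl_tensorHom_assoc, reassoc_of% (inl_wedgeIso (F := F) h₂ l₂ l₂'),
      reassoc_of% (inl_wedgeIso (F := F) h₁ l₁ l₁'), reassoc_of% (WaldVee.inl_associator (A := B)),
      WaldVee.inl_desc_assoc, id_comp, inl_wedgeIso (F := F) h₄ l₄ l₄', ← Functor.map_comp, e₁]
  · simp only [WaldVee.inl_tensorHom_assoc, reassoc_of% (inl_wedgeIso (F := F) h₂ l₂ l₂'),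
      reassoc_of% (inr_wedgeIso (F := F) h₁ r₁ r₁'), reassoc_of% (WaldVee.inl_associator (A := B)),
      WaldVee.inr_desc_assoc, assoc, WaldVee.inr_tensorHom_assoc, reassoc_of% (inl_wedgeIso (F := F) h₃ l₃ l₃'), inr_wedgeIso (F := F) h₄ r₄ r₄', ← Functor.map_comp, e₂]
  · simp only [WaldVee.inr_tensorHom_assoc, reassoc_of% (inr_wedgeIso (F := F) h₂ r₂ r₂'),
      reassoc_of% (WaldVee.inr_associator (A := B)), id_comp,
      reassoc_of% (inr_wedgeIso (F := F) h₃ r₃ r₃'), inr_wedgeIso (F := F) h₄ r₄ r₄', ← Functor.map_comp, e₃]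

lemma wedgeIso_symm {s s' : ∀ i, (A i).C} (h : SumAt (A := fun i => (A i).lambda) i x y s)
    (h' : SumAt (A := fun i => (A i).lambda) i y x s') (a : s ⟶ s')
    (ha : HEq (a i) (β_ (x i) (y i)).hom) (ha' : IsAlong i a) :
    (F.wedgeIso h).hom ≫ F.functor.map a = (β_ _ _).hom ≫ (F.wedgeIso h').hom := by
  obtain ⟨a₁, l₁, l₁'⟩ := exists_inl h
  obtain ⟨b₁, r₁, r₁'⟩ := exists_inr h
  obtain ⟨a₂, l₂, l₂'⟩ := exists_inl h'
  obtain ⟨b₂, r₂, r₂'⟩ := exists_inr h'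
  have e₁ := hom_ext_along (l₁'.comp ha') r₂' <| eq_of_heq <|
    (heq_comp rfl h.1 h'.1 l₁ ha).trans ((heq_of_eq (WaldVee.inl_braiding _ _)).trans r₂.symm)
  have e₂ := hom_ext_along (r₁'.comp ha') l₂' <| eq_of_heq <|
    (heq_comp rfl h.1 h'.1 r₁ ha).trans ((heq_of_eq (WaldVee.inr_braiding _ _)).trans l₂.symm)
  refine B.wedge_ext ?_ ?_
  · rw [reassoc_of% (inl_wedgeIso h l₁ l₁'), reassoc_of% (WaldVee.inl_braiding),
      inr_wedgeIso h' r₂ r₂', ← Functor.map_comp, e₁]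
  · rw [reassoc_of% (inr_wedgeIso (F := F) h r₁ r₁'), reassoc_of% (WaldVee.inr_braiding (A := B)),
      inl_wedgeIso h' l₂ l₂', ← Functor.map_comp, e₂]

lemma wedgeIso_interchange {i j : I} {x₀₀ x₁₀ x₀₁ x₁₁ a b c d s : ∀ i, (A i).C} (hij : i ≠ j)
    (h₁ : SumAt (A := fun i => (A i).lambda) i x₀₀ x₁₀ a)
    (h₂ : SumAt (A := fun i => (A i).lambda) i x₀₁ x₁₁ b)
    (h₃ : SumAt (A := fun i => (A i).lambda) j a b s)
    (h₄ : SumAt (A := fun i => (A i).lambda) j x₀₀ x₀₁ c)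
    (h₅ : SumAt (A := fun i => (A i).lambda) j x₁₀ x₁₁ d)
    (h₆ : SumAt (A := fun i => (A i).lambda) i c d s) :
    ((F.wedgeIso h₁).hom ⊗ₘ (F.wedgeIso h₂).hom) ≫ (F.wedgeIso h₃).hom =
      tensorμ _ _ _ _ ≫ ((F.wedgeIso h₄).hom ⊗ₘ (F.wedgeIso h₅).hom) ≫ (F.wedgeIso h₆).hom := by
  obtain ⟨a₁, l₁, l₁'⟩ := exists_inl h₁
  obtain ⟨b₁, r₁, r₁'⟩ := exists_inr h₁
  obtain ⟨a₂, l₂, l₂'⟩ := exists_inl h₂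
  obtain ⟨b₂, r₂, r₂'⟩ := exists_inr h₂
  obtain ⟨a₃, l₃, l₃'⟩ := exists_inl h₃
  obtain ⟨b₃, r₃, r₃'⟩ := exists_inr h₃
  obtain ⟨a₄, l₄, l₄'⟩ := exists_inl h₄
  obtain ⟨b₄, r₄, r₄'⟩ := exists_inr h₄
  obtain ⟨a₅, l₅, l₅'⟩ := exists_inl h₅
  obtain ⟨b₅, r₅, r₅'⟩ := exists_inr h₅
  obtain ⟨a₆, l₆, l₆'⟩ := exists_inl h₆
  obtain ⟨b₆, r₆, r₆'⟩ := exists_inr h₆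
  have key {p q q' r : ∀ i, (A i).C} {f : p ⟶ q} {g : q ⟶ r} {f' : p ⟶ q'} {g' : q' ⟶ r}
      (hf : IsAlong i f) (hg : IsAlong j g) (hf' : IsAlong j f') (hg' : IsAlong i g')
      (hi : HEq (f i) (g' i)) (hj : HEq (g j) (f' j)) : F.functor.map f ≫ F.functor.map g =
      F.functor.map f' ≫ F.functor.map g' := by
    rw [← Functor.map_comp, ← Functor.map_comp]
    refine congrArg F.functor.map (funext fun l => eq_of_heq ?_)
    by_cases hl : l = i
    · subst hl
      exact (IsId.heq_comp _ (hg l hij)).trans (hi.trans ((hf' l hij).comp_heq _).symm)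
    · by_cases hl' : l = j
      · subst hl'
        exact ((hf l hl).comp_heq _).trans (hj.trans (IsId.heq_comp _ (hg' l hl)).symm)
      · exact ((hf l hl).comp (hg l hl')).heq ((hf' l hl').comp (hg' l hl)) rfl
  have hji := hij.symm
  refine B.wedge_ext (B.wedge_ext ?_ ?_) (B.wedge_ext ?_ ?_)
  · simp only [WaldVee.inl_tensorHom_assoc, reassoc_of% (WaldVee.inl_tensorμ (A := B)),
      WaldVee.wedgeMap, WaldVee.inl_desc_assoc, WaldVee.inl_tensorHom_assoc, assoc,
      inl_wedgeIso (F := F) h₃ l₃ l₃', reassoc_of% (inl_wedgeIso (F := F) h₁ l₁ l₁'),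
      reassoc_of% (inl_wedgeIso (F := F) h₄ l₄ l₄'), inl_wedgeIso (F := F) h₆ l₆ l₆']
    exact key l₁' l₃' l₄' l₆' (l₁.trans ((WaldVee.inl_heq (h₄.2 i hij).1 (h₅.2 i hij).1).trans
      l₆.symm)) (l₃.trans ((WaldVee.inl_heq (h₁.2 j hji).1 (h₂.2 j hji).1).symm.trans l₄.symm))
  · simp only [WaldVee.inl_tensorHom_assoc, reassoc_of% (WaldVee.inl_tensorμ (A := B)),
      WaldVee.wedgeMap, WaldVee.inr_desc_assoc, WaldVee.inr_tensorHom_assoc, assoc,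
      inl_wedgeIso (F := F) h₃ l₃ l₃', reassoc_of% (inr_wedgeIso (F := F) h₁ r₁ r₁'),
      reassoc_of% (inl_wedgeIso (F := F) h₅ l₅ l₅'), inr_wedgeIso (F := F) h₆ r₆ r₆']
    exact key r₁' l₃' l₅' r₆' (r₁.trans ((WaldVee.inr_heq (h₄.2 i hij).1 (h₅.2 i hij).1).trans
      r₆.symm)) (l₃.trans ((WaldVee.inl_heq (h₁.2 j hji).2 (h₂.2 j hji).2).symm.trans l₅.symm))
  · simp only [WaldVee.inr_tensorHom_assoc, reassoc_of% (WaldVee.inr_tensorμ (A := B)),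
      WaldVee.wedgeMap, WaldVee.inl_desc_assoc, WaldVee.inl_tensorHom_assoc, assoc,
      inr_wedgeIso (F := F) h₃ r₃ r₃', reassoc_of% (inl_wedgeIso (F := F) h₂ l₂ l₂'),
      reassoc_of% (inr_wedgeIso (F := F) h₄ r₄ r₄'), inl_wedgeIso (F := F) h₆ l₆ l₆']
    exact key l₂' r₃' r₄' l₆' (l₂.trans ((WaldVee.inl_heq (h₄.2 i hij).2 (h₅.2 i hij).2).trans
      l₆.symm)) (r₃.trans ((WaldVee.inr_heq (h₁.2 j hji).1 (h₂.2 j hji).1).symm.trans r₄.symm))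
  · simp only [WaldVee.inr_tensorHom_assoc, reassoc_of% (WaldVee.inr_tensorμ (A := B)),
      WaldVee.wedgeMap, WaldVee.inr_desc_assoc, WaldVee.inr_tensorHom_assoc, assoc,
      inr_wedgeIso (F := F) h₃ r₃ r₃', reassoc_of% (inr_wedgeIso (F := F) h₂ r₂ r₂'),
      reassoc_of% (inr_wedgeIso (F := F) h₅ r₅ r₅'), inr_wedgeIso (F := F) h₆ r₆ r₆']
    exact key r₂' r₃' r₅' r₆' (r₂.trans ((WaldVee.inr_heq (h₄.2 i hij).2 (h₅.2 i hij).2).trans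
      r₆.symm)) (r₃.trans ((WaldVee.inr_heq (h₁.2 j hji).2 (h₂.2 j hji).2).symm.trans r₅.symm))

/-- The multilinear functor given by a multiexact functor. -/
def lambda : KLinear I (fun i => (A i).lambda) B.lambda where
  functor := F.functor
  δ _ _ _ _ h := F.wedgeIso h
  δ_naturality _ _ _ _ _ _ _ h h' f g k hk hk' := F.wedgeIso_naturality h h' f g k hk hk'
  obj_unit x i h := F.isMultiexact.map_pt x i h
  map_unit f i h hf := F.map_pt_of_isId f i h hf
  δ_unit _ _ _ _ h h' := F.isId_wedgeIso h h'
  δ_assoc _ _ _ _ _ _ _ _ h₁ h₂ h₃ h₄ a ha ha' := F.wedgeIso_assoc h₁ h₂ h₃ h₄ a ha ha'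
  δ_symm _ _ _ _ _ h h' a ha ha' := F.wedgeIso_symm h h' a ha ha'
  δ_δ _ _ _ _ _ _ _ _ _ _ _ hij h₁ h₂ h₃ h₄ h₅ h₆ := F.wedgeIso_interchange hij h₁ h₂ h₃ h₄ h₅ h₆

section SumIso

variable {F} (hx : ∀ j ≠ i, x j = z j) (hy : ∀ j ≠ i, y j = z j)
  (r : (A i).wedge (x i) (y i) ≅ z i)

lemma inl_sumIso {a : x ⟶ z} (ha : a i = (A i).inl (x i) (y i) ≫ r.hom) (ha' : IsAlong i a) :
    B.inl _ _ ≫ (F.lambda.sumIso hx hy r).hom = F.functor.map a := by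
  obtain ⟨w, h, k, hk, hk', e⟩ := F.lambda.exists_sumIso hx hy r
  obtain ⟨c, hc, hc'⟩ := exists_inl h
  rw [e]
  refine ((reassoc_of% (inl_wedgeIso h hc hc')) _).trans ((F.functor.map_comp _ _).symm.trans
    (congrArg F.functor.map (hom_ext_along (hc'.comp hk') ha' (eq_of_heq ?_))))
  rw [ha]
  exact heq_comp rfl h.1 rfl hc hk

lemma inr_sumIso {b : y ⟶ z} (hb : b i = (A i).inr (x i) (y i) ≫ r.hom) (hb' : IsAlong i b) :
    B.inr _ _ ≫ (F.lambda.sumIso hx hy r).hom = F.functor.map b := by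
  obtain ⟨w, h, k, hk, hk', e⟩ := F.lambda.exists_sumIso hx hy r
  obtain ⟨c, hc, hc'⟩ := exists_inr h
  rw [e]
  refine ((reassoc_of% (inr_wedgeIso h hc hc')) _).trans ((F.functor.map_comp _ _).symm.trans
    (congrArg F.functor.map (hom_ext_along (hc'.comp hk') hb' (eq_of_heq ?_))))
  rw [hb]
  exact heq_comp rfl h.1 rfl hc hk

end SumIso

variable {F} in
lemma lambda_δ_ext {L : KLinear I (fun i => (A i).lambda) B.lambda} (e : L.functor = F.functor)
    (h : SumAt (A := fun i => (A i).lambda) i x y z)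
    (hl : ∀ a : x ⟶ z, HEq (a i) ((A i).inl (x i) (y i)) → IsAlong i a →
      B.inl _ _ ≫ (L.δ i h).hom = L.functor.map a)
    (hr : ∀ b : y ⟶ z, HEq (b i) ((A i).inr (x i) (y i)) → IsAlong i b →
      B.inr _ _ ≫ (L.δ i h).hom = L.functor.map b) :
    HEq (F.wedgeIso h).hom (L.δ i h).hom := by
  obtain ⟨functor, δ, _, _, _, _, _, _, _⟩ := L
  obtain rfl := e
  obtain ⟨a, ha, ha'⟩ := exists_inl h
  obtain ⟨b, hb, hb'⟩ := exists_inr h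
  exact heq_of_eq (B.wedge_ext ((inl_wedgeIso h ha ha').trans (hl a ha ha').symm)
    ((inr_wedgeIso h hb hb').trans (hr b hb hb').symm))

/-- The cell of `SMC` given by a natural transformation of multiexact functors. -/
def lambdaCell {F G : KExact I A B} (α : F ⟶ G) : F.lambda ⟶ G.lambda :=
  KLinear.Hom.mk (cell α) (fun i x y z h => by
    obtain ⟨a, ha, ha'⟩ := exists_inl h
    obtain ⟨b, hb, hb'⟩ := exists_inr h
    refine B.wedge_ext ?_ ?_
    · refine ((reassoc_of% (inl_wedgeIso h ha ha')) _).trans (Eq.trans ?_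
        (WaldVee.inl_tensorHom_assoc _ _ _).symm)
      refine Eq.trans ?_ (congrArg (_ ≫ ·) (inl_wedgeIso (F := G) h ha ha').symm)
      exact (cell α).naturality a
    · refine ((reassoc_of% (inr_wedgeIso (F := F) h hb hb')) _).trans (Eq.trans ?_
        (WaldVee.inr_tensorHom_assoc _ _ _).symm)
      refine Eq.trans ?_ (congrArg (_ ≫ ·) (inr_wedgeIso (F := G) h hb hb').symm)
      exact (cell α).naturality b) fun x i h =>
    WaldVee.isId_of_eq_pt _ (F.isMultiexact.map_pt x i h) (G.isMultiexact.map_pt x i h)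

variable (A B) in
/-- The functor `Λ` on multimorphisms and cells. -/
def lambdaFunctor : KExact I A B ⥤ KLinear I (fun i => (A i).lambda) B.lambda where
  obj F := F.lambda
  map α := lambdaCell α

end KExact

/-- The multifunctor `Λ`. -/
def lambdaMultifunctor :
    Multifunctor waldMulticategory.{u} smMulticategory WaldVee.lambda where
  map A B := KExact.lambdaFunctor A B
  map_id A := KLinear.ext rfl fun i x y z h => by
    refine KExact.lambda_δ_ext (L := KLinear.id A.lambda) rfl h (fun a ha _ => ?_) fun b hb _ => ?_
    · exact eq_of_heq ((IsId.heq_comp _ (isId_eqToIso h.1.symm)).trans ha.symm)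
    · exact eq_of_heq ((IsId.heq_comp _ (isId_eqToIso h.1.symm)).trans hb.symm)
  map_act {I J} _ _ e A B := KLinear.functor_ext (fun α => rfl) fun F i x y z h => by
    refine KExact.lambda_δ_ext (L := (F.lambda).act e) rfl h (fun a ha ha' => ?_)
      fun b hb hb' => ?_
    · exact KExact.inl_wedgeIso (F := F) (h.reindex e)
        ((reindex_map e (fun j => (A j).C) a i).trans (ha.trans (WaldVee.inl_heq
          (reindex_obj e (fun j => (A j).C) x i).symm (reindex_obj e (fun j => (A j).C) y i).symm)))
        (isAlong_reindex e ha')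
    · exact KExact.inr_wedgeIso (F := F) (h.reindex e)
        ((reindex_map e (fun j => (A j).C) b i).trans (hb.trans (WaldVee.inr_heq
          (reindex_obj e (fun j => (A j).C) x i).symm (reindex_obj e (fun j => (A j).C) y i).symm)))
        (isAlong_reindex e hb')
  map_comp {I} _ {K} _ A B C := KLinear.functor_ext (fun α => rfl) fun F i x y z h => by
    obtain ⟨i, k⟩ := i
    have hs := SumAt.slice (A := fun i k => (A i k).lambda) (l := ⟨i, k⟩) h
    refine KExact.lambda_δ_ext (L := KLinear.comp F.1.lambda fun i => (F.2 i).lambda) rfl h (fun a ha ha' => ?_)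
      fun b hb hb' => ?_
    · exact KExact.inl_sumIso (F := F.1) (KLinear.vals_left (fun i => (F.2 i).lambda) h)
        (KLinear.vals_right (fun i => (F.2 i).lambda) h) _
        (KExact.inl_wedgeIso (F := F.2 i) hs (a := fun k => a ⟨i, k⟩) ha
          fun m hm => ha' ⟨i, m⟩ fun e => hm (by cases e; rfl)).symm
        (KLinear.isAlong_vals (fun i => (F.2 i).lambda) ha')
    · exact KExact.inr_sumIso (F := F.1) (KLinear.vals_left (fun i => (F.2 i).lambda) h)
        (KLinear.vals_right (fun i => (F.2 i).lambda) h) _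
        (KExact.inr_wedgeIso (F := F.2 i) hs (b := fun k => b ⟨i, k⟩) hb
          fun m hm => hb' ⟨i, m⟩ fun e => hm (by cases e; rfl)).symm
        (KLinear.isAlong_vals (fun i => (F.2 i).lambda) hb')

lemma isLambda : IsLambda lambdaMultifunctor.{u} where
  functor_eq _ _ _ := rfl
  inl_δ _ _ _ _ _ _ _ h _ ha ha' := heq_of_eq (KExact.inl_wedgeIso h ha ha')
  inr_δ _ _ _ _ _ _ _ h _ hb hb' := heq_of_eq (KExact.inr_wedgeIso h hb hb')
  cell_eq _ _ _ _ _ := HEq.rfl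

end

section

open MonoidalCategory

/-! ### The multifunctor given by the construction of Elmendorf and Mandell -/

section Part

variable {I : Type} {m m' : I → EObj} {t t' : EObj}

/-- The entries of a tuple of subsets that belong to one part of a concatenation. -/
def Subsets.part (h : Concat m t) (i : I) (S : Subsets t) : Subsets (m i) := fun k =>
  {l | Fin.cast (h.val_eq i k).symm l ∈ S (h.e ⟨i, k⟩)}

lemma Subsets.mem_congr (S : Subsets t) {j j' : Fin t.len} (h : j = j') {l : Fin (t.val j)}
    {l' : Fin (t.val j')} (hl : l.val = l'.val) : l ∈ S j ↔ l' ∈ S j' := by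
  subst h
  rw [Fin.ext hl]

lemma Subsets.IsSplit.eq {h : Concat m t} {S : Subsets t} {T : ∀ i, Subsets (m i)}
    (hS : S.IsSplit h T) : T = fun i => S.part h i :=
  funext fun i => funext fun k => Set.ext fun l =>
    (hS i k (Fin.cast (h.val_eq i k).symm l) l rfl).symm

lemma Subsets.part_congr {h : Concat m t} {i : I} {k : Fin (m i).len} {S T : Subsets t}
    (e : S (h.e ⟨i, k⟩) = T (h.e ⟨i, k⟩)) : S.part h i k = T.part h i k := by
  simp only [Subsets.part, e]

/-- The tuples `T`, `U` and `S` agree outside one entry, in which `S` is the disjoint union of `T`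
and `U`. -/
structure SplitAt (p : Σ i, Fin (m i).len) (T U S : ∀ i, Subsets (m i)) : Prop where
  split : Split p.2 (T p.1) (U p.1) (S p.1)
  left (i : I) : i ≠ p.1 → T i = S i
  right (i : I) : i ≠ p.1 → U i = S i

lemma Split.part {j : Fin t.len} {T U S : Subsets t} (hs : Split j T U S) (h : Concat m t)
    {p : Σ i, Fin (m i).len} (hp : h.e p = j) :
    SplitAt p (fun i => T.part h i) (fun i => U.part h i) fun i => S.part h i := by
  obtain ⟨i, k⟩ := p
  subst hp
  have ne {i'} {k' : Fin (m i').len} (hi : (⟨i', k'⟩ : Σ i, Fin (m i).len) ≠ ⟨i, k⟩) :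
      h.e ⟨i', k'⟩ ≠ h.e ⟨i, k⟩ := fun e => hi (h.e.injective e)
  refine ⟨⟨Set.eq_empty_of_forall_notMem fun l hl => ?_, Set.ext fun l => ?_,
    fun k' hk => Subsets.part_congr (hs.left _ (ne fun e => hk (by simpa using e))),
    fun k' hk => Subsets.part_congr (hs.right _ (ne fun e => hk (by simpa using e)))⟩,
    fun i' hi => funext fun k' => Subsets.part_congr (hs.left _ (ne fun e => hi (by cases e; rfl))),
    fun i' hi => funext fun k' => Subsets.part_congr (hs.right _ (ne fun e => hi (by cases e; rfl)))⟩
  · have : Fin.cast (h.val_eq i k).symm l ∈ T (h.e ⟨i, k⟩) ∩ U (h.e ⟨i, k⟩) := hl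
    rwa [hs.inter] at this
  · exact Set.ext_iff.1 hs.union (Fin.cast (h.val_eq i k).symm l)

end Part

namespace KLinear

variable {I : Type} [Finite I] {C : I → SMCat.{u}} {D : SMCat.{u}} (F : KLinear I C D)
  {m m' : I → EObj} {t t' : EObj} (X Y : ∀ i, BarObj (C i) (m i))

/-- The values of a family of systems. -/
abbrev barVals (T : ∀ i, Subsets (m i)) (i : I) : (C i).C := (X i).obj (T i)

omit [Finite I] in
lemma obj_left {p : Σ i, Fin (m i).len} {T U S : ∀ i, Subsets (m i)} (h : SplitAt p T U S)
    (i : I) (hi : i ≠ p.1) : barVals X T i = barVals X S i := congrArg (X i).obj (h.left i hi)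

omit [Finite I] in
lemma obj_right {p : Σ i, Fin (m i).len} {T U S : ∀ i, Subsets (m i)} (h : SplitAt p T U S)
    (i : I) (hi : i ≠ p.1) : barVals X U i = barVals X S i := congrArg (X i).obj (h.right i hi)

/-- The value of a multilinear functor at the values of a family of systems. -/
abbrev barVal (T : ∀ i, Subsets (m i)) : D.C := F.functor.obj (barVals X T)

variable {p q : Σ i, Fin (m i).len} {T U S : ∀ i, Subsets (m i)}

/-- The structure isomorphism induced by the structure isomorphism of one entry. -/
def barRho (h : SplitAt p T U S) : F.barVal X T ⊗ F.barVal X U ≅ F.barVal X S :=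
  F.sumIso (obj_left X h) (obj_right X h) ((X p.1).ρ p.2 h.split)

lemma barRho_congr (h : SplitAt p T U S) {T' U' S' : ∀ i, Subsets (m i)}
    (h' : SplitAt q T' U' S') (hp : p = q) (hT : T = T') (hU : U = U') (hS : S = S') :
    HEq (F.barRho X h).hom (F.barRho X h').hom := by
  subst hp hT hU hS
  rfl

lemma barVal_eq_unit (h : S p.1 p.2 = ∅) : F.barVal X S = 𝟙_ D.C :=
  F.obj_unit _ p.1 ((X p.1).obj_empty _ p.2 h)

lemma isId_barRho (h : SplitAt p T U S)
    (h' : T p.1 p.2 = ∅ ∨ U p.1 p.2 = ∅ ∨ ∃ q : Σ i, Fin (m i).len, S q.1 q.2 = ∅) :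
    IsId (F.barRho X h).hom := by
  obtain ⟨i, k⟩ := p
  obtain h' | h' | ⟨⟨i', k'⟩, hq⟩ := h'
  · exact F.isId_sumIso _ _ _ (Or.inl ⟨(X i).ρ_empty _ _ (Or.inl h'),
      Or.inl ((X i).obj_empty _ k h')⟩)
  · exact F.isId_sumIso _ _ _ (Or.inl ⟨(X i).ρ_empty _ _ (Or.inr (Or.inl h')),
      Or.inr ((X i).obj_empty _ k h')⟩)
  · by_cases hi : i' = i
    · subst hi
      refine F.isId_sumIso _ _ _ (Or.inl ⟨(X i').ρ_empty _ _ (Or.inr (Or.inr ⟨k', hq⟩)),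
        Or.inl ((X i').obj_empty _ k' ?_)⟩)
      by_cases hk : k' = k
      · subst hk
        exact Set.subset_eq_empty (h.split.union ▸ Set.subset_union_left) hq
      · exact (h.split.left k' hk).trans hq
    · exact F.isId_sumIso _ _ _ (Or.inr ⟨i', hi, (X i').obj_empty _ k' hq⟩)

lemma barRho_symm (h : SplitAt p T U S) (h' : SplitAt p U T S) :
    (F.barRho X h).hom = (β_ _ _).hom ≫ (F.barRho X h').hom := by
  have := F.sumIso_symm (obj_left X h) (obj_right X h) (obj_left X h) (obj_right X h)
    ((X p.1).ρ p.2 h.split) ((X p.1).ρ p.2 h'.split) (𝟙 _)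
    (isAlong_id _ _) ((comp_id _).trans ((X p.1).ρ_symm p.2 h.split h'.split))
  rwa [fmap_id, comp_id] at this

lemma barRho_assoc {V TU UV : ∀ i, Subsets (m i)} (h₁ : SplitAt p T U TU)
    (h₂ : SplitAt p TU V S) (h₃ : SplitAt p U V UV) (h₄ : SplitAt p T UV S) :
    (F.barRho X h₁).hom ▷ F.barVal X V ≫ (F.barRho X h₂).hom =
      (α_ _ _ _).hom ≫ F.barVal X T ◁ (F.barRho X h₃).hom ≫ (F.barRho X h₄).hom := by
  have := F.sumIso_assoc (obj_left X h₁) (obj_right X h₁) (obj_left X h₂) (obj_right X h₂)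
    (obj_left X h₃) (obj_right X h₃) (obj_left X h₄) (obj_right X h₄) ((X p.1).ρ p.2 h₁.split) ((X p.1).ρ p.2 h₂.split)
    ((X p.1).ρ p.2 h₃.split) ((X p.1).ρ p.2 h₄.split) (𝟙 _) (isAlong_id _ _)
    ((congrArg (_ ≫ ·) (comp_id _)).trans
      ((X p.1).ρ_assoc p.2 h₁.split h₂.split h₃.split h₄.split))
  rwa [fmap_id, comp_id] at this

lemma barRho_interchange {S₀₀ S₁₀ S₀₁ S₁₁ A B E G : ∀ i, Subsets (m i)} (hpq : p ≠ q)
    (h₁ : SplitAt p S₀₀ S₁₀ A) (h₂ : SplitAt p S₀₁ S₁₁ B) (h₃ : SplitAt q A B S)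
    (h₄ : SplitAt q S₀₀ S₀₁ E) (h₅ : SplitAt q S₁₀ S₁₁ G) (h₆ : SplitAt p E G S) :
    ((F.barRho X h₁).hom ⊗ₘ (F.barRho X h₂).hom) ≫ (F.barRho X h₃).hom =
      tensorμ _ _ _ _ ≫ ((F.barRho X h₄).hom ⊗ₘ (F.barRho X h₅).hom) ≫ (F.barRho X h₆).hom := by
  obtain ⟨i, k⟩ := p
  obtain ⟨j, l⟩ := q
  have key {i : I} {k : Fin (m i).len} {T U S T' U' S' : Subsets (m i)} (h : Split k T U S)
      (h' : Split k T' U' S') (hT : T = T') (hU : U = U') (hS : S = S') :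
      HEq ((X i).ρ k h).hom ((X i).ρ k h').hom := by
    subst hT hU hS
    rfl
  by_cases e : i = j
  · subst e
    exact F.sumIso_tensorμ _ _ _ _ _ _ _ _ _ _ _ _ _ _ _ _ _ _ ((X i).ρ_ρ k l
      (fun e => hpq (by rw [e])) h₁.split h₂.split h₃.split h₄.split h₅.split h₆.split)
  · have e' : j ≠ i := Ne.symm e
    exact F.sumIso_interchange e _ _ _ _ _ _ _ _ _ _ _ _ _ _ _ _ _ _
      (key _ _ (h₄.left i e) (h₅.left i e) (h₃.left i e))
      (key _ _ (h₄.right i e) (h₅.right i e) (h₃.right i e))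
      (key _ _ (h₁.left j e') (h₂.left j e') (h₆.left j e'))
      (key _ _ (h₁.right j e') (h₂.right j e') (h₆.right j e'))

/-- The system of values of a multilinear functor at a family of systems. -/
def barObj (h : Concat m t) : BarObj D t where
  obj S := F.barVal X fun i => S.part h i
  ρ j _ _ _ hs := F.barRho X (hs.part h (h.e.apply_symm_apply j))
  obj_empty S j hj := by
    obtain ⟨i, k, rfl⟩ := h.surj j
    exact F.barVal_eq_unit X (p := ⟨i, k⟩) (by simp [Subsets.part, hj])
  ρ_empty j T U S hs h' := by
    have key (V : Subsets t) (j) (hV : V j = ∅) : ∀ p, h.e p = j → V.part h p.1 p.2 = ∅ := by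
      rintro p rfl
      simp [Subsets.part, hV]
    refine F.isId_barRho X _ (h'.imp (fun h' => key _ _ h' _ ?_) (Or.imp
      (fun h' => key _ _ h' _ ?_) fun ⟨j', h'⟩ => ⟨h.e.symm j', key _ _ h' _ ?_⟩)) <;>
    exact h.e.apply_symm_apply _
  ρ_symm _ _ _ _ _ _ := F.barRho_symm X _ _
  ρ_assoc _ _ _ _ _ _ _ _ _ _ _ := F.barRho_assoc X _ _ _ _
  ρ_ρ i j _ _ _ _ _ _ _ _ _ hij _ _ _ _ _ _ :=
    F.barRho_interchange X (fun e => hij (h.e.symm.injective e)) _ _ _ _ _ _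

lemma barObj_ρ (h : Concat m t) {j : Fin t.len} {T U S : Subsets t} (hs : Split j T U S)
    {P Q R : ∀ i, Subsets (m i)} (h' : SplitAt p P Q R) (hp : h.e p = j)
    (hP : (fun i => T.part h i) = P) (hQ : (fun i => U.part h i) = Q)
    (hR : (fun i => S.part h i) = R) :
    HEq ((F.barObj X h).ρ j hs).hom (F.barRho X h').hom :=
  F.barRho_congr X (hs.part h (h.e.apply_symm_apply j)) h' (h.e.symm_apply_eq.2 hp.symm) hP hQ hR

variable {X Y} in
/-- The morphism of systems of values induced by a family of morphisms of systems. -/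
def barMap (h : Concat m t) (f : X ⟶ Y) : F.barObj X h ⟶ F.barObj Y h :=
  BarObj.Hom.mk (X := F.barObj X h) (Y := F.barObj Y h)
    (fun S => F.functor.map (X := barVals X fun i => S.part h i)
      (Y := barVals Y fun i => S.part h i) fun i => BarObj.component (f i) (S.part h i))
    (fun S j hj => by
      obtain ⟨i, k, rfl⟩ := h.surj j
      have e : S.part h i k = ∅ := by simp [Subsets.part, hj]
      exact F.map_unit _ i ((X i).obj_empty _ k e) (BarObj.Hom.app_empty (f i) _ k e))
    fun j T U S hs => by
      have hp := hs.part h (h.e.apply_symm_apply j)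
      exact (F.sumIso_naturality (obj_left X hp) (obj_right X hp) _ (obj_left Y hp)
        (obj_right Y hp) _ _ _ _ (BarObj.Hom.app_ρ (f (h.e.symm j).1) _ hp.split).symm
        (fun i hi => congr_arg_heq (BarObj.component (f i)) (hp.left i hi))
        fun i hi => congr_arg_heq (BarObj.component (f i)) (hp.right i hi)).symm

/-- The functor on systems induced by a multilinear functor. -/
def bar (h : Concat m t) : (∀ i, BarObj (C i) (m i)) ⥤ BarObj D t where
  obj X := F.barObj X h
  map f := F.barMap h f
  map_id X := BarObj.hom_ext fun S => F.functor.map_id _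
  map_comp f g := BarObj.hom_ext fun S => F.functor.map_comp _ _

/-- The transformation of functors on systems induced by a cell. -/
def barCell {F G : KLinear I C D} (α : F ⟶ G) (h : Concat m t) :
    F.bar h ⟶ G.bar h where
  app X := BarObj.Hom.mk (X := F.barObj X h) (Y := G.barObj X h) (fun S => (KLinear.cell α).app fun i => (X i).obj (S.part h i))
    (fun S j hj => by
      obtain ⟨i, k, rfl⟩ := h.surj j
      have e : S.part h i k = ∅ := by simp [Subsets.part, hj]
      exact KLinear.Hom.app_unit α _ i ((X i).obj_empty _ k e))
    fun j _ _ _ hs => KLinear.sumIso_cell α (obj_left X (hs.part h (h.e.apply_symm_apply j)))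
      (obj_right X (hs.part h (h.e.apply_symm_apply j))) _
  naturality _ _ _ := BarObj.hom_ext fun S => (KLinear.cell α).naturality _

variable {h : Concat m t} {h' : Concat m' t'} {f : ∀ i, m i ⟶ m' i} {g : t ⟶ t'}

end KLinear

section

variable {I : Type} {m m' : I → EObj} {t t' : EObj} {h : Concat m t} {h' : Concat m' t'}
  {f : ∀ i, m i ⟶ m' i} {g : t ⟶ t'}

lemma IsConcat.mem_part_step (hc : IsConcat h h' f g) (i : I) (k : Fin (m' i).len)
    (S : Subsets t') (Q : ℕ → ℕ → Prop) :
    (∃ a ∈ S (h'.e ⟨i, k⟩), Q (eMap g (h'.e ⟨i, k⟩) a.castSucc) (eMap g (h'.e ⟨i, k⟩) a.succ)) ↔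
      ∃ a ∈ S.part h' i k, Q (eMap (f i) k a.castSucc) (eMap (f i) k a.succ) := by
  refine ⟨fun ⟨a, ha, hQ⟩ => ⟨Fin.cast (h'.val_eq i k) a, ha, ?_⟩,
    fun ⟨a, ha, hQ⟩ => ⟨Fin.cast (h'.val_eq i k).symm a, ha, ?_⟩⟩
  · rwa [(hc i k).2 a.castSucc (Fin.cast (h'.val_eq i k) a).castSucc rfl,
      (hc i k).2 a.succ (Fin.cast (h'.val_eq i k) a).succ rfl] at hQ
  · rwa [← (hc i k).2 (Fin.cast (h'.val_eq i k).symm a).castSucc a.castSucc rfl,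
      ← (hc i k).2 (Fin.cast (h'.val_eq i k).symm a).succ a.succ rfl] at hQ

lemma IsConcat.subsets_nondeg (hc : IsConcat h h' f g) (S : Subsets t') :
    S.Nondeg g ↔ ∀ i, (S.part h' i).Nondeg (f i) := by
  have e := fun i k => hc.mem_part_step i k S fun a b => a = 0 ∧ b = 1
  refine ⟨fun hy i k hk => (e i k).1 (hy _ ((hc.ePre_eq_none i k).2 hk)), fun hy j hj => ?_⟩
  obtain ⟨i, k, rfl⟩ := h'.surj j
  exact (e i k).2 (hy i k ((hc.ePre_eq_none i k).1 hj))

lemma IsConcat.part_preimage (hc : IsConcat h h' f g) (S : Subsets t') (i : I) :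
    (S.part h' i).preimage (f i) = (S.preimage g).part h i := by
  funext k
  ext l
  refine (hc.mem_part_step i (KTheory.eInj (f i) k) S fun a b => a ≤ l.val ∧ l.val < b).symm.trans ?_
  rw [← hc.eInj i k]
  rfl

lemma IsConcat.index_part (hc : IsConcat h h' f g) {S : Subsets t'} (hS : S.Nondeg g) (i : I) :
    (S.part h' i).index (f i) = some ((S.preimage g).part h i) :=
  (Subsets.index_of_nondeg ((hc.subsets_nondeg S).1 hS i)).trans
    (congrArg some (hc.part_preimage S i))

lemma IsConcat.exists_index_part (hc : IsConcat h h' f g) {S : Subsets t'} (hS : ¬ S.Nondeg g) :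
    ∃ i, (S.part h' i).index (f i) = none := by
  obtain ⟨i, hi⟩ := not_forall.1 fun H => hS ((hc.subsets_nondeg S).2 H)
  exact ⟨i, Subsets.index_of_not hi⟩

end

lemma BarObj.IsRho.left_eq_none {C : SMCat.{u}} {t : EObj} {X : BarObj C t}
    {o : Option (Fin t.len)} {P Q R : Option (Subsets t)} {r : X.ext P ⊗ X.ext Q ≅ X.ext R}
    (h : X.IsRho o P Q R r) (hR : R = none) : P = none := by
  subst hR
  exact h.eq_none.1

lemma BarObj.isId_component {C : SMCat.{u}} {t : EObj} {X Y : BarObj C t} {f : X ⟶ Y}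
    (h : IsId f) (S : Subsets t) : IsId (component f S) := by
  obtain ⟨rfl, h⟩ := h
  obtain rfl : f = 𝟙 X := h
  exact isId_id _

lemma BarObj.isId_of {C : SMCat.{u}} {t : EObj} {X Y : BarObj C t} {f : X ⟶ Y} (hX : X = Y)
    (h : ∀ S, IsId (component f S)) : IsId f := by
  subst hX
  exact ⟨rfl, hom_ext fun S => (h S).eq (isId_id _)⟩

variable (C : SMCat.{u}) in
/-- The value of systems at a tuple of subsets. -/
def BarObj.eval {t : EObj} (S : Subsets t) : BarObj C t ⥤ C.C where
  obj X := X.obj S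
  map f := BarObj.component f S

lemma BarObj.arrow_ext {C : SMCat.{u}} {t : EObj} {X : Type*} [Category X]
    {a b : Arrow (X ⥤ BarObj C t)} (h : ∀ S, postArr a (eval C S) = postArr b (eval C S))
    (hρ : ∀ (x : X) (i : Fin t.len) {T U S : Subsets t} (h : Split i T U S),
      HEq ((a.left.obj x).ρ i h).hom ((b.left.obj x).ρ i h).hom ∧
        HEq ((a.right.obj x).ρ i h).hom ((b.right.obj x).ρ i h).hom) : a = b := by
  have h₀ (S) := left_eq_of_arrow (h S)
  have h₁ (S) := right_eq_of_arrow (h S)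
  have e₀ : a.left = b.left := functor_ext
    (fun x => obj_ext (fun S => Functor.congr_obj (h₀ S) x) fun i T U S h => (hρ x i h).1)
    fun f S => functor_map_heq (h₀ S) f
  have e₁ : a.right = b.right := functor_ext
    (fun x => obj_ext (fun S => Functor.congr_obj (h₁ S) x) fun i T U S h => (hρ x i h).2)
    fun f S => functor_map_heq (h₁ S) f
  exact KTheory.arrow_ext e₀ e₁ fun x => hom_heq (Functor.congr_obj e₀ x)
    (Functor.congr_obj e₁ x) fun S => app_heq_of_arrow (h S) x

namespace KLinear

variable {I : Type} [Finite I] {C : I → SMCat.{u}} {D : SMCat.{u}} (F : KLinear I C D)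
  {m m' : I → EObj} {t t' : EObj} {h : Concat m t} {h' : Concat m' t'}
  {f : ∀ i, m i ⟶ m' i} {g : t ⟶ t'} (X Y : ∀ i, BarObj (C i) (m i))

lemma barVals_push (hc : IsConcat h h' f g) {S : Subsets t'} (hS : S.Nondeg g) :
    barVals (fun i => (X i).push (f i)) (fun i => S.part h' i) =
      barVals X fun i => (S.preimage g).part h i :=
  funext fun i => congrArg (X i).ext (hc.index_part hS i)

lemma barVal_push (hc : IsConcat h h' f g) (S : Subsets t') :
    F.barVal (fun i => (X i).push (f i)) (fun i => S.part h' i) =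
      (F.barObj X h).ext (S.index g) := by
  by_cases hS : S.Nondeg g
  · rw [Subsets.index_of_nondeg hS]
    exact congrArg F.functor.obj (barVals_push X hc hS)
  · rw [Subsets.index_of_not hS]
    obtain ⟨i, hi⟩ := hc.exists_index_part hS
    exact F.obj_unit _ i (congrArg (X i).ext hi)

lemma barObj_push (hc : IsConcat h h' f g) :
    F.barObj (fun i => (X i).push (f i)) h' = (F.barObj X h).push g := by
  refine BarObj.obj_ext (F.barVal_push X hc) fun j T U S hs => ?_
  obtain ⟨i, k, rfl⟩ := h'.surj j
  have hp := hs.part h' (p := ⟨i, k⟩) rfl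
  refine (F.barObj_ρ _ h' hs hp rfl rfl rfl rfl).trans ?_
  have hr := (F.barObj X h).push_isRho g _ hs
  have hr' := (X i).push_isRho (f i) _ hp.split
  have key (h₁ : IsId (F.barRho (fun i => (X i).push (f i)) hp).hom)
      (h₂ : IsId (((F.barObj X h).push g).ρ (h'.e ⟨i, k⟩) hs).hom) :
      HEq (F.barRho (fun i => (X i).push (f i)) hp).hom
        (((F.barObj X h).push g).ρ (h'.e ⟨i, k⟩) hs).hom :=
    h₁.heq h₂ (congrArg₂ (· ⊗ ·) (F.barVal_push X hc T) (F.barVal_push X hc U))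
  by_cases hS : S.Nondeg g
  · obtain hk | ⟨k', hk⟩ := (ePre (f i) k).eq_none_or_eq_some
    · refine key (F.isId_sumIso _ _ _ (Or.inl ⟨hr'.isId_of_none (Or.inl hk), ?_⟩))
        (hr.isId_of_none (Or.inl ((hc.ePre_eq_none i k).2 hk)))
      rw [hk] at hr'
      exact hr'.eq_none_or.imp (congrArg (X i).ext) (congrArg (X i).ext)
    · obtain rfl := ePre_eq_some.1 hk
      have hs' : Split (eInj g (h.e ⟨i, k'⟩)) T U S := by rwa [hc.eInj i k']
      have hg : ePre g (h'.e ⟨i, eInj (f i) k'⟩) = some (h.e ⟨i, k'⟩) :=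
        ePre_eq_some.2 (hc.eInj i k')
      have hT := (hs.nondeg_iff hg).1.2 hS
      have hU := (hs.nondeg_iff hg).2.2 hS
      refine HEq.trans ?_ (hr.heq_of_eq (.split _ (hs'.preimage g)) hg
        (Subsets.index_of_nondeg hT) (Subsets.index_of_nondeg hU) (Subsets.index_of_nondeg hS)).symm
      have hp' := (hs'.preimage g).part h (p := ⟨i, k'⟩) rfl
      refine HEq.trans ?_ (F.barObj_ρ X h (hs'.preimage g) hp' rfl rfl rfl rfl).symm
      exact F.sumIso_heq rfl rfl (barVals_push X hc hT) (barVals_push X hc hU)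
        (barVals_push X hc hS) _ _ _ _ (hr'.heq_of_eq (.split _ hp'.split) hk (hc.index_part hT i)
          (hc.index_part hU i) (hc.index_part hS i))
  · refine key ?_ (hr.isId_of_none (Or.inr (Subsets.index_of_not hS)))
    obtain ⟨i', hi⟩ := hc.exists_index_part hS
    by_cases e : i' = i
    · subst e
      refine F.isId_sumIso _ _ _ (Or.inl ⟨hr'.isId_of_none (Or.inr hi), Or.inl ?_⟩)
      exact congrArg (X i').ext (hr'.left_eq_none hi)
    · exact F.isId_sumIso _ _ _ (Or.inr ⟨i', e, congrArg (X i').ext hi⟩)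

lemma barObj_eq_const (h : Concat m t) {i : I} (hX : X i = BarObj.const (C i) (m i)) :
    F.barObj X h = BarObj.const D t := BarObj.eq_const
    (fun S => F.obj_unit _ i (by rw [barVals, hX]; rfl)) fun j T U S hs => by
      have hp := hs.part h (h.e.apply_symm_apply j)
      have e (T) : (X i).obj T = 𝟙_ (C i).C := by rw [hX]; rfl
      by_cases hi : i = (h.e.symm j).1
      · refine F.isId_sumIso (obj_left X hp) (obj_right X hp) _ (Or.inl ⟨?_, Or.inl (hi ▸ e _)⟩)
        rw [hi] at hX
        have key (Y : BarObj (C (h.e.symm j).1) (m (h.e.symm j).1))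
          (hY : Y = BarObj.const _ _) : IsId (Y.ρ _ hp.split).hom := by
          subst hY
          exact (C (h.e.symm j).1).left_strict _
        exact key _ hX
      · exact F.isId_sumIso (obj_left X hp) (obj_right X hp) _ (Or.inr ⟨i, hi, e _⟩)

/-- The multimorphism of `ℰ_*`-categories induced by a multilinear functor. -/
def barMor :
    EMor I (fun i => (barStr (C i)).toEStarCat) (barStr D).toEStarCat where
  app h := F.bar h
  naturality {m m' t t'} h h' f g hc := BarObj.functor_ext (fun X => F.barObj_push X hc)
    fun {X Y} α S => by
      change HEq (F.functor.map (X := barVals (fun i => (X i).push (f i)) fun i => S.part h' i)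
        (Y := barVals (fun i => (Y i).push (f i)) fun i => S.part h' i)
        fun i => BarObj.extMap (α i) ((S.part h' i).index (f i)))
          (BarObj.extMap (F.barMap h α) (S.index g))
      by_cases hS : S.Nondeg g
      · refine HEq.trans ?_ (BarObj.extMap_congr _ (Subsets.index_of_nondeg hS)).symm
        exact map_heq F.functor (barVals_push X hc hS) (barVals_push Y hc hS)
          (pi_heq (barVals_push X hc hS) (barVals_push Y hc hS) fun i =>
            BarObj.extMap_congr (α i) (hc.index_part hS i))
      · refine HEq.trans ?_ (BarObj.extMap_congr _ (Subsets.index_of_not hS)).symm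
        obtain ⟨i, hi⟩ := hc.exists_index_part hS
        exact (F.map_unit _ i (congrArg (X i).ext hi) (isId_of_heq (congrArg (X i).ext hi).symm
          (congrArg (Y i).ext hi).symm (BarObj.extMap_congr (α i) hi).symm (isId_id _))).heq
          (isId_id _) (F.obj_unit _ i (congrArg (X i).ext hi))
  obj_pt h X i hX := F.barObj_eq_const X h hX
  map_pt h X Y f i hX hf := BarObj.isId_of ((F.barObj_eq_const X h hX).trans
    (F.barObj_eq_const Y h (hf.1.symm.trans hX)).symm) fun S =>
      F.map_unit _ i (by change (X i).obj _ = _; rw [hX]; rfl) (BarObj.isId_component hf _)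

variable (C D) in
/-- The functor sending a multilinear functor to the induced multimorphism of `ℰ_*`-categories. -/
def barMorFunctor : KLinear I C D ⥤
    EMor I (fun i => (barStr (C i)).toEStarCat) (barStr D).toEStarCat where
  obj F := F.barMor
  map {F G} α :=
    { app := fun h => KLinear.barCell α h
      modification := fun h h' f g hc X => BarObj.hom_heq (F.barObj_push X hc)
        (G.barObj_push X hc) fun S => by
          change HEq ((KLinear.cell α).app (barVals (fun i => (X i).push (f i)) _))
            (BarObj.extMap ((KLinear.barCell α h).app X) (S.index g))
          by_cases hS : S.Nondeg g
          · refine HEq.trans ?_ (BarObj.extMap_congr _ (Subsets.index_of_nondeg hS)).symm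
            exact app_heq_of_eq (KLinear.cell α) (barVals_push X hc hS)
          · refine HEq.trans ?_ (BarObj.extMap_congr _ (Subsets.index_of_not hS)).symm
            obtain ⟨i, hi⟩ := hc.exists_index_part hS
            exact (KLinear.Hom.app_unit α _ i (congrArg (X i).ext hi)).heq (isId_id _)
              (F.obj_unit _ i (congrArg (X i).ext hi))
      app_pt := fun h X i hX => BarObj.isId_of ((F.barObj_eq_const X h hX).trans
        (G.barObj_eq_const X h hX).symm) fun S => KLinear.Hom.app_unit α _ i (by rw [hX]; rfl) }

lemma barMor_arr {F G : KLinear I C D} (α : F ⟶ G) (h : Concat m t) (S : Subsets t)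
    {T : ∀ i, Subsets (m i)} (hT : (fun i => S.part h i) = T) :
    postArr (EMor.arr ((barMorFunctor C D).map α) h) (BarObj.eval D S) =
      preArr (Functor.pi fun i => BarObj.eval (C i) (T i)) (KLinear.arr α) := by
  subst hT
  rfl

end KLinear

lemma Subsets.part_eq {I : Type} {m : I → EObj} {t : EObj} {h : Concat m t} {i : I}
    {S : Subsets t} {T : Subsets (m i)} (H : ∀ k l (l' : Fin ((m i).val k)), l.val = l'.val →
      (l ∈ S (h.e ⟨i, k⟩) ↔ l' ∈ T k)) : S.part h i = T :=
  funext fun k => Set.ext fun l => H k (Fin.cast (h.val_eq i k).symm l) l rfl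

lemma Subsets.mem_part {I : Type} {m : I → EObj} {t : EObj} {h : Concat m t} {i : I}
    {k : Fin (m i).len} {S : Subsets t} {j : Fin t.len} (hj : h.e ⟨i, k⟩ = j) {l : Fin (t.val j)}
    {l' : Fin ((m i).val k)} (hl : l.val = l'.val) : l ∈ S j ↔ l' ∈ S.part h i k :=
  S.mem_congr hj.symm hl

/-- The multifunctor `C ↦ C̄`. -/
def barMultifunctor : Multifunctor smMulticategory.{u} estarMulticategory.{u}
    (fun C => (barStr C).toEStarCat) where
  map C D := KLinear.barMorFunctor C D
  map_id C := EMor.unit_ext fun t => by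
    have e (S : Subsets t) : S.part (Concat.self t) () = S := Subsets.part_eq fun _ _ _ hl =>
      S.mem_congr rfl hl
    have h : (smMulticategory.id C).bar (Concat.self t) =
        Pi.eval (fun _ : Unit => BarObj C t) () :=
      BarObj.functor_ext (fun X => BarObj.obj_ext (fun S => congrArg (X ()).obj (e S))
        fun i T U S hs => by
          have hp : SplitAt (m := fun _ : Unit => t) ⟨(), i⟩ (fun _ => T) (fun _ => U) fun _ => S :=
            ⟨hs, fun _ h => (h rfl).elim, fun _ h => (h rfl).elim⟩
          refine (KLinear.barObj_ρ _ _ _ hs hp rfl (funext fun _ => e T) (funext fun _ => e U)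
            (funext fun _ => e S)).trans ?_
          exact KLinear.id_sumIso C (KLinear.obj_left X hp) (KLinear.obj_right X hp)
            ((X ()).ρ i hs)) fun f S => congr_arg_heq (BarObj.component (f ())) (e S)
    exact h.trans (EMor.id_app (barStr C).toEStarCat t).symm
  map_act e C D := EMor.functor_ext fun {F G} α m t h => by
    obtain ⟨m, rfl⟩ := exists_comap_obj e (fun _ => EObj) m
    refine preArr_comap_injective e (fun j => BarObj (C j) (m j)) ?_
    have hT (S : Subsets t) : (fun i => S.part h i) = fun i => S.part (h.uncomap e) (e i) :=
      funext fun i => Subsets.part_eq fun k l l' hl => Subsets.mem_part (h.uncomap_e e i k).symm hl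
    have key (F : KLinear _ C D) (X : ∀ j, BarObj (C j) (m j)) (j : Fin t.len) {T U S : Subsets t}
        (hs : Split j T U S) : HEq (((F.act e).barObj (fun i => X (e i)) h).ρ j hs).hom
          ((F.barObj X (h.uncomap e)).ρ j hs).hom := by
      obtain ⟨i, k, rfl⟩ := h.surj j
      have hp := hs.part (h.uncomap e) (p := ⟨e i, k⟩) (h.uncomap_e e i k).symm
      have ne {l : _} (hl : l ≠ i) : e l ≠ e i := fun h => hl (e.injective h)
      have hp' : SplitAt (m := fun i => m (e i)) ⟨i, k⟩ (fun i => T.part (h.uncomap e) (e i))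
          (fun i => U.part (h.uncomap e) (e i)) fun i => S.part (h.uncomap e) (e i) :=
        ⟨hp.split, fun l hl => hp.left (e l) (ne hl), fun l hl => hp.right (e l) (ne hl)⟩
      refine ((F.act e).barObj_ρ (fun i => X (e i)) h hs hp' rfl (hT T) (hT U) (hT S)).trans
        (HEq.trans ?_ (F.barObj_ρ X (h.uncomap e) hs hp (h.uncomap_e e i k).symm rfl rfl rfl).symm)
      exact KLinear.act_sumIso e F (KLinear.obj_left (fun i => X (e i)) hp')
        (KLinear.obj_right (fun i => X (e i)) hp') (KLinear.obj_left X hp) (KLinear.obj_right X hp)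
        ((X (e i)).ρ k hp.split)
    refine Eq.trans (BarObj.arrow_ext (fun S => ?_) fun X j T U S hs => ?_) (EMor.act_arr e
      (fun j => (barStr (C j)).toEStarCat) (barStr D).toEStarCat
      ((KLinear.barMorFunctor C D).map α) h (h.uncomap e) (h.uncomap_e e)).symm
    · refine Eq.trans ?_ (KLinear.barMor_arr α (h.uncomap e) S rfl).symm
      refine (congrArg (preArr (Pi.comap (fun j => BarObj (C j) (m j)) e))
        (KLinear.barMor_arr ((klinearAct e C D).map α) h S (hT S))).trans ?_
      exact congrArg (preArr (Functor.pi fun j => BarObj.eval (C j) (S.part (h.uncomap e) j)))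
        (klinearAct_arr e C D α)
    · exact ⟨key F X j hs, key G X j hs⟩
  map_comp {I} _ {K} _ A B C := EMor.functor_ext fun {F G} α m t H => by
    obtain ⟨s, h, O, hO⟩ := estarComponents.{u}.exists_nested H
    have hT (S : Subsets t) : (fun x => S.part H x) =
        fun x : Σ i, K i => (S.part O x.1).part (h x.1) x.2 := funext fun x =>
      Subsets.part_eq fun k l l' hl => (Subsets.mem_part (h := O) (hO x.1 x.2 k).symm
        (l' := Fin.cast ((h x.1).val_eq x.2 k).symm l') hl).trans (Subsets.mem_part rfl rfl)
    have key (F : KLinear I B C × ∀ i, KLinear (K i) (A i) (B i))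
        (X : ∀ x : Σ i, K i, BarObj (A x.1 x.2) (m x)) (j : Fin t.len) {T U S : Subsets t}
        (hs : Split j T U S) : HEq (((F.1.comp F.2).barObj X H).ρ j hs).hom
          ((F.1.barObj (fun i => (F.2 i).barObj (fun k => X ⟨i, k⟩) (h i)) O).ρ j hs).hom := by
      obtain ⟨⟨i, k⟩, l, rfl⟩ := H.surj j
      have hp := hs.part O (p := ⟨i, (h i).e ⟨k, l⟩⟩) (hO i k l).symm
      have hq := hp.split.part (h i) (p := ⟨k, l⟩) rfl
      have hr : SplitAt (m := m) ⟨⟨i, k⟩, l⟩ (fun x => (T.part O x.1).part (h x.1) x.2)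
          (fun x => (U.part O x.1).part (h x.1) x.2) fun x => (S.part O x.1).part (h x.1) x.2 := by
        refine ⟨hq.split, ?_, ?_⟩ <;>
        · rintro ⟨i', k'⟩ hx
          by_cases hi : i' = i
          · subst hi
            first
            | exact hq.left k' fun e => hx (by rw [e])
            | exact hq.right k' fun e => hx (by rw [e])
          · first
            | exact congrArg (fun T => Subsets.part (h i') k' T) (hp.left i' hi)
            | exact congrArg (fun T => Subsets.part (h i') k' T) (hp.right i' hi)
      refine ((F.1.comp F.2).barObj_ρ X H hs hr rfl (hT T) (hT U) (hT S)).trans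
        (HEq.trans ?_ (F.1.barObj_ρ _ O hs hp (hO i k l).symm rfl rfl rfl).symm)
      refine (heq_of_eq (KLinear.comp_sumIso F.1 F.2 (KLinear.obj_left X hr)
        (KLinear.obj_right X hr) ((X ⟨i, k⟩).ρ l hr.split)
        (KLinear.obj_left (fun i => (F.2 i).barObj (fun k => X ⟨i, k⟩) (h i)) hp)
        (KLinear.obj_right (fun i => (F.2 i).barObj (fun k => X ⟨i, k⟩) (h i)) hp) (KLinear.obj_left (fun k => X ⟨i, k⟩) hq)
        (KLinear.obj_right (fun k => X ⟨i, k⟩) hq))).trans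
        (F.1.sumIso_heq rfl rfl rfl rfl rfl _ _ _ _ ?_)
      exact ((F.2 i).barObj_ρ (fun k => X ⟨i, k⟩) (h i) hp.split hq rfl rfl rfl rfl).symm
    refine Eq.trans (BarObj.arrow_ext (fun S => ?_) fun X j T U S hs => ?_) (EMor.comp_arr
      (fun i k => (barStr (A i k)).toEStarCat)
      (fun i => (barStr (B i)).toEStarCat) (barStr C).toEStarCat
      ((Functor.prod (KLinear.barMorFunctor B C) (Functor.pi fun i =>
        KLinear.barMorFunctor (A i) (B i))).map α) h O H hO).symm
    · exact KLinear.barMor_arr ((klinearComp A B C).map α) H S (hT S)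
    · exact ⟨key F X j hs, key G X j hs⟩

lemma isBarMultifunctor : IsBarMultifunctor barMultifunctor.{u} where
  obj_obj C D F m t h X S T hS := by
    obtain rfl := hS.eq
    rfl
  obj_ρ C D F m t h X i k S S' S'' T T' T'' hS hT w hw a h₁ h₂ h₃ ha ha' := by
    obtain rfl := h₁.eq
    obtain rfl := h₂.eq
    obtain rfl := h₃.eq
    have hp := hS.part h (p := ⟨i, k⟩) rfl
    refine (F.barObj_ρ X h hS hp rfl rfl rfl rfl).trans (heq_of_eq ?_)
    exact F.sumIso_hom_eq (KLinear.obj_left X hp) (KLinear.obj_right X hp) ((X i).ρ k hT) hw a ha ha'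
  map_app C D F m t h X Y f S T hS := by
    obtain rfl := hS.eq
    rfl
  cell_app C D F G μ m t h X S T hS := by
    obtain rfl := hS.eq
    rfl

end

section

open MonoidalCategory

/-! ### Systems in a Waldhausen category -/

lemma Split.symm {t : EObj} {k : Fin t.len} {T U S : Subsets t} (h : Split k T U S) :
    Split k U T S :=
  ⟨(Set.inter_comm _ _).trans h.inter, (Set.union_comm _ _).trans h.union, h.right, h.left⟩

/-- Replacement of one entry of a tuple of subsets. -/
def Subsets.set {t : EObj} (S : Subsets t) (k : Fin t.len) (a : Set (Fin (t.val k))) : Subsets t :=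
  Function.update (β := fun k => Set (Fin (t.val k))) S k a

lemma Subsets.set_self {t : EObj} (S : Subsets t) (k : Fin t.len) (a : Set (Fin (t.val k))) :
    S.set k a k = a := Function.update_self (β := fun k => Set (Fin (t.val k))) k a S

lemma Subsets.set_ne {t : EObj} (S : Subsets t) {k : Fin t.len} (a : Set (Fin (t.val k)))
    {j : Fin t.len} (h : j ≠ k) : S.set k a j = S j :=
  Function.update_of_ne (β := fun k => Set (Fin (t.val k))) h a S

lemma Split.of_subset {t : EObj} {k : Fin t.len} {T S : Subsets t} (hk : T k ⊆ S k)
    (h : ∀ j ≠ k, T j = S j) : Split k T (S.set k (S k \ T k)) S :=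
  ⟨by rw [S.set_self]; exact Set.inter_sdiff_self _ _,
    by rw [S.set_self]; exact Set.union_sdiff_cancel hk, h, fun j hj => S.set_ne _ hj⟩

lemma Split.mem_iff {t : EObj} {k : Fin t.len} {T U S : Subsets t} (h : Split k T U S)
    (x : Fin (t.val k)) : (x ∈ S k ↔ x ∈ T k ∨ x ∈ U k) ∧ ¬ (x ∈ T k ∧ x ∈ U k) :=
  ⟨by rw [← h.union]; rfl, fun hx => Set.eq_empty_iff_forall_notMem.1 h.inter x hx⟩

lemma Split.ext_right {t : EObj} {k : Fin t.len} {T U U' S : Subsets t} (h : Split k T U S)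
    (h' : Split k T U' S) : U = U' := funext fun j => by
  by_cases hj : j = k
  · subst hj
    ext x
    have := h.mem_iff x
    have := h'.mem_iff x
    tauto
  · rw [h.right j hj, h'.right j hj]

lemma Split.trans {t : EObj} {k : Fin t.len} {T U V W TU S : Subsets t} (h₁ : Split k T U TU)
    (h₂ : Split k TU V S) (h₃ : Split k T W S) : Split k U V W := by
  refine ⟨?_, ?_, fun j hj => ?_, fun j hj => ?_⟩
  · rw [Set.eq_empty_iff_forall_notMem]
    rintro x ⟨hx, hx'⟩
    exact (h₂.mem_iff x).2 ⟨(h₁.mem_iff x).1.2 (Or.inr hx), hx'⟩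
  · ext x
    have := h₁.mem_iff x
    have := h₂.mem_iff x
    have := h₃.mem_iff x
    simp only [Set.mem_union]
    tauto
  · rw [h₁.right j hj, h₂.left j hj, h₃.right j hj]
  · rw [h₂.right j hj, h₃.right j hj]

lemma Split.set {t : EObj} {j k : Fin t.len} {T U S : Subsets t} (h : Split j T U S)
    (hk : k ≠ j) {a b c : Set (Fin (t.val k))} (hac : a = c) (hbc : b = c) :
    Split j (T.set k a) (U.set k b) (S.set k c) := by
  subst hac hbc
  refine ⟨?_, ?_, fun i hi => ?_, fun i hi => ?_⟩
  · rw [T.set_ne _ hk.symm, U.set_ne _ hk.symm, h.inter]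
  · rw [T.set_ne _ hk.symm, U.set_ne _ hk.symm, S.set_ne _ hk.symm, h.union]
  · by_cases e : i = k
    · subst e
      rw [T.set_self, S.set_self]
    · rw [T.set_ne _ e, S.set_ne _ e, h.left i hi]
  · by_cases e : i = k
    · subst e
      rw [U.set_self, S.set_self]
    · rw [U.set_ne _ e, S.set_ne _ e, h.right i hi]

/-- The zero map. -/
def WaldVee.zero (A : WaldVee.{u}) (X Y : A.C) : X ⟶ Y :=
  A.isZero.from_ X ≫ A.isZero.to_ Y

lemma WaldVee.zero_comp {A : WaldVee.{u}} (X : A.C) {Y Z : A.C} (f : Y ⟶ Z) :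
    A.zero X Y ≫ f = A.zero X Z :=
  (assoc _ _ _).trans (congrArg (_ ≫ ·) (A.isZero.eq_of_src _ _))

lemma WaldVee.comp_zero {A : WaldVee.{u}} {X Y : A.C} (f : X ⟶ Y) (Z : A.C) :
    f ≫ A.zero Y Z = A.zero X Z :=
  (assoc _ _ _).symm.trans (congrArg (· ≫ _) (A.isZero.eq_of_tgt _ _))

/-- The maps `ι l` for `l` in `D` exhibit `Z` as a sum of the objects `P l`. -/
structure WaldVee.IsSum {A : WaldVee.{u}} {K : Type} (P : K → A.C) (D : Set K) {Z : A.C}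
    (ι : ∀ l ∈ D, (P l ⟶ Z)) : Prop where
  hom_ext {W : A.C} {f g : Z ⟶ W} : (∀ l h, ι l h ≫ f = ι l h ≫ g) → f = g
  exists_desc {W : A.C} (d : ∀ l, P l ⟶ W) : ∃ f : Z ⟶ W, ∀ l h, ι l h ≫ f = d l

namespace WaldVee.IsSum

variable {A : WaldVee.{u}} {K : Type} {P : K → A.C} {D : Set K} {Z : A.C}
  {ι : ∀ l ∈ D, (P l ⟶ Z)}

lemma exists_cof (h : IsSum P D ι) (E : Finset K) :
    ∃ (Z' : A.C) (ι' : ∀ l, l ∈ D ∪ E → (P l ⟶ Z')) (f : Z ⟶ Z'), IsSum P (D ∪ E) ι' ∧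
      (∀ l h, ι l h ≫ f = ι' l (Or.inl h)) ∧ A.cof f := by
  classical
  induction E using Finset.induction_on with
  | empty => exact ⟨Z, fun l h => ι l (h.resolve_right (Finset.notMem_empty l)), 𝟙 Z,
      ⟨fun h' => h.hom_ext fun l hl => h' l (Or.inl hl), fun d => (h.exists_desc d).imp
        fun f hf l _ => hf l _⟩, fun _ _ => comp_id _, A.cof_of_isIso _ inferInstance⟩
  | insert a E ha ih =>
    obtain ⟨Z', ι', f, hι, hf, hc⟩ := ih
    have hs {l} (hl : l ∈ D ∪ E) : l ∈ D ∪ (insert a E : Finset K) :=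
      hl.imp id (Finset.mem_insert_of_mem)
    by_cases haD : a ∈ D
    · have hs' {l} (hl : l ∈ D ∪ (insert a E : Finset K)) : l ∈ D ∪ E := by
        obtain hl | hl := hl
        · exact Or.inl hl
        · exact (Finset.mem_insert.1 hl).elim (fun e => Or.inl (e ▸ haD)) Or.inr
      exact ⟨Z', fun l h => ι' l (hs' h), f, ⟨fun h' => hι.hom_ext fun l hl => h' l (hs hl),
        fun d => (hι.exists_desc d).imp fun f hf l _ => hf l _⟩, hf, hc⟩
    · have hs' {l} (hl : l ∈ D ∪ (insert a E : Finset K)) (h : l ≠ a) : l ∈ D ∪ E :=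
        hl.imp id fun hl => (Finset.mem_insert.1 hl).resolve_left h
      have hne {l} (hl : l ∈ D ∪ E) : l ≠ a := by
        rintro rfl
        exact hl.elim haD ha
      refine ⟨A.wedge Z' (P a), fun l h => if e : l = a then eqToHom (congrArg P e) ≫ A.inr _ _
        else ι' l (hs' h e) ≫ A.inl _ _, f ≫ A.inl _ _, ⟨fun {W g g'} hg => ?_, fun {W} d => ?_⟩,
        fun l h => ?_, A.cof_comp _ _ hc ?_⟩
      · refine wedge_ext (hι.hom_ext fun l hl => ?_) ?_
        · have := hg l (hs hl)
          simpa [hne hl] using this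
        · simpa using hg a (Or.inr (Finset.mem_insert_self a E))
      · obtain ⟨g, hg⟩ := hι.exists_desc d
        refine ⟨A.desc g (d a), fun l hl => ?_⟩
        by_cases e : l = a
        · subst e
          simp
        · simp [e, hg]
      · simp [hne (Or.inl h), reassoc_of% hf]
      · exact A.cof_pushout (A.isPushout Z' (P a)).flip (A.cof_of_pt _)

lemma cof_of_subset [Finite K] (h : IsSum P D ι) {D' : Set K} {Z' : A.C}
    {ι' : ∀ l, l ∈ D' → (P l ⟶ Z')} (h' : IsSum P D' ι') (hD : D ⊆ D') (f : Z ⟶ Z')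
    (hf : ∀ l hl, ι l hl ≫ f = ι' l (hD hl)) : A.cof f := by
  classical
  obtain ⟨Z'', ι'', g, h'', hg, hc⟩ := h.exists_cof (Set.toFinite D').toFinset
  have hm {l} : l ∈ D ∪ (Set.toFinite D').toFinset ↔ l ∈ D' := by
    simpa using fun hl => hD hl
  obtain ⟨a, ha⟩ := h''.exists_desc fun l => if hl : l ∈ D' then ι' l hl else A.zero _ _
  obtain ⟨b, hb⟩ := h'.exists_desc fun l => if hl : l ∈ D' then ι'' l (hm.2 hl) else A.zero _ _
  have hi : IsIso a := by
    refine ⟨b, h''.hom_ext fun l hl => ?_, h'.hom_ext fun l hl => ?_⟩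
    · rw [reassoc_of% (ha l hl), dif_pos (hm.1 hl), hb, dif_pos (hm.1 hl), comp_id]
    · rw [reassoc_of% (hb l hl), dif_pos hl, ha, dif_pos hl, comp_id]
  rw [show f = g ≫ a from h.hom_ext fun l hl => by
    exact (hf l hl).trans (((reassoc_of% (hg l hl)) a).trans ((ha _ _).trans (dif_pos (hD hl)))).symm]
  exact A.cof_comp _ _ hc (A.cof_of_isIso _ hi)

lemma exists_isSum [Finite K] (P : K → A.C) (D : Set K) :
    ∃ (Z : A.C) (ι : ∀ l ∈ D, (P l ⟶ Z)), IsSum P D ι := by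
  classical
  have h : IsSum P ∅ (Z := A.pt) fun l h => h.elim :=
    ⟨fun _ => A.isZero.eq_of_src _ _, fun _ => ⟨A.isZero.to_ _, fun _ h => h.elim⟩⟩
  obtain ⟨Z, ι, _, h, _⟩ := h.exists_cof (Set.toFinite D).toFinset
  have hm {l} : l ∈ ∅ ∪ ((Set.toFinite D).toFinset : Set K) ↔ l ∈ D := by simp
  exact ⟨Z, fun l hl => ι l (hm.2 hl), fun h' => h.hom_ext fun l hl => h' l (hm.1 hl),
    fun d => (h.exists_desc d).imp fun f hf l _ => hf l _⟩

end WaldVee.IsSum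

namespace BarObj

variable {A : WaldVee.{u}} {t : EObj} (X : BarObj A.lambda t) {k : Fin t.len} {T U S : Subsets t}

/-- The values of a system, as objects of the Waldhausen category. -/
abbrev val (S : Subsets t) : A.C := X.obj S

/-- The inclusion of a summand. -/
def inc (h : Split k T U S) : X.val T ⟶ X.val S :=
  A.inl (X.obj T) (X.obj U) ≫ (X.ρ k h).hom

/-- The projection to a summand. -/
def proj (h : Split k T U S) : X.val S ⟶ X.val U :=
  (X.ρ k h).inv ≫ A.π₂ (X.obj T) (X.obj U)

lemma inr_ρ (h : Split k T U S) : A.inr (X.obj T) (X.obj U) ≫ (X.ρ k h).hom = X.inc h.symm := by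
  rw [X.ρ_symm k h h.symm]
  exact (reassoc_of% (WaldVee.inr_braiding (A := A) (X.obj T) (X.obj U))) _

lemma inc_proj (h : Split k T U S) : X.inc h ≫ X.proj h = A.zero _ _ := by
  refine (assoc _ _ _).trans ((congrArg (_ ≫ ·) (Iso.hom_inv_id_assoc _ _)).trans ?_)
  exact WaldVee.inl_desc _ _

lemma inc_symm_proj (h : Split k T U S) : X.inc h.symm ≫ X.proj h = 𝟙 _ := by
  rw [← X.inr_ρ h]
  refine (assoc _ _ _).trans ((congrArg (_ ≫ ·) (Iso.hom_inv_id_assoc _ _)).trans ?_)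
  exact WaldVee.inr_desc _ _

lemma isZero_val (h : S k = ∅) : IsZero (X.val S) := by
  rw [val, X.obj_empty S k h]
  exact A.isZero

variable {X} in
lemma summand_ext (h : Split k T U S) {Z : A.C} {f g : X.val S ⟶ Z}
    (h₁ : X.inc h ≫ f = X.inc h ≫ g) (h₂ : X.inc h.symm ≫ f = X.inc h.symm ≫ g) : f = g := by
  rw [← cancel_epi (X.ρ k h).hom]
  rw [← X.inr_ρ h, assoc, assoc] at h₂
  exact WaldVee.wedge_ext ((assoc _ _ _).symm.trans (h₁.trans (assoc _ _ _))) h₂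

lemma exists_summand_desc (h : Split k T U S) {Z : A.C} (f : X.val T ⟶ Z)
    (g : X.val U ⟶ Z) : ∃ d : X.val S ⟶ Z,
      X.inc h ≫ d = f ∧ X.inc h.symm ≫ d = g := by
  refine ⟨(X.ρ k h).inv ≫ A.desc f g, ?_, ?_⟩
  · refine (assoc _ _ _).trans ((congrArg (_ ≫ ·) (Iso.hom_inv_id_assoc _ _)).trans ?_)
    exact WaldVee.inl_desc _ _
  · rw [← X.inr_ρ h]
    refine (assoc _ _ _).trans ((congrArg (_ ≫ ·) (Iso.hom_inv_id_assoc _ _)).trans ?_)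
    exact WaldVee.inr_desc _ _

lemma isId_inc (h : Split k T U S) (hU : U k = ∅) : IsId (X.inc h) :=
  (WaldVee.isId_inl (X.obj_empty U k hU)).comp (X.ρ_empty k h (Or.inr (Or.inl hU)))

lemma inc_trans {V W TU : Subsets t} (h₁ : Split k T U TU) (h₂ : Split k TU V S)
    (h₄ : Split k T W S) : X.inc h₁ ≫ X.inc h₂ = X.inc h₄ := by
  have h₃ := h₁.trans h₂ h₄
  have := congrArg (A.inl _ _ ≫ A.inl _ _ ≫ ·) (X.ρ_assoc k h₁ h₂ h₃ h₄)
  change A.inl (X.obj T) (X.obj U) ≫ A.inl _ (X.obj V) ≫ A.wedgeMap (X.ρ k h₁).hom (𝟙 _) ≫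
    (X.ρ k h₂).hom = A.inl _ _ ≫ A.inl _ _ ≫ (A.wedgeAssoc _ _ _).hom ≫
      A.wedgeMap (𝟙 _) (X.ρ k h₃).hom ≫ (X.ρ k h₄).hom at this
  simp [WaldVee.wedgeMap, WaldVee.wedgeAssoc] at this
  exact (assoc _ _ _).trans this

lemma inc_comm {i j : Fin t.len} (hij : i ≠ j) {S₀₀ S₁₀ S₀₁ S₁₁ B B' D D' : Subsets t}
    (h₁ : Split i S₀₀ S₁₀ B) (h₂ : Split i S₀₁ S₁₁ B') (h₃ : Split j B B' S)
    (h₄ : Split j S₀₀ S₀₁ D) (h₅ : Split j S₁₀ S₁₁ D') (h₆ : Split i D D' S) :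
    X.inc h₁ ≫ X.inc h₃ = X.inc h₄ ≫ X.inc h₆ := by
  have := congrArg (A.inl _ _ ≫ A.inl _ _ ≫ ·) (X.ρ_ρ i j hij h₁ h₂ h₃ h₄ h₅ h₆)
  change A.inl (X.obj S₀₀) (X.obj S₁₀) ≫ A.inl (A.wedge (X.obj S₀₀) (X.obj S₁₀))
    (A.wedge (X.obj S₀₁) (X.obj S₁₁)) ≫ A.wedgeMap (X.ρ i h₁).hom (X.ρ i h₂).hom ≫
    (X.ρ j h₃).hom = A.inl _ _ ≫ A.inl (A.wedge (X.obj S₀₀) (X.obj S₁₀))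
    (A.wedge (X.obj S₀₁) (X.obj S₁₁)) ≫ tensorμ (X.obj S₀₀) (X.obj S₁₀) (X.obj S₀₁)
      (X.obj S₁₁) ≫ A.wedgeMap (X.ρ j h₄).hom (X.ρ j h₅).hom ≫ (X.ρ i h₆).hom at this
  rw [reassoc_of% (WaldVee.inl_tensorμ (A := A))] at this
  simp [WaldVee.wedgeMap] at this
  exact (assoc _ _ _).trans (this.trans (assoc _ _ _).symm)

/-! ### Decomposition into atoms -/

/-- The tuple of singletons. -/
def single (l : ∀ k, Fin (t.val k)) : Subsets t := fun k => {l k}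

/-- The element `l` of the product of the sets `S k`. -/
def Mem (l : ∀ k, Fin (t.val k)) (S : Subsets t) : Prop := ∀ k, l k ∈ S k

lemma inc_congr {T' U' : Subsets t} (h : Split k T U S) (h' : Split k T' U' S) (hT : T = T') :
    HEq (X.inc h) (X.inc h') := by
  subst hT
  obtain rfl := h.ext_right h'
  rfl

lemma exists_atoms (l : ∀ k, Fin (t.val k)) (D : Finset (Fin t.len)) :
    ∃ ι : ∀ S : Subsets t, Mem l S → (∀ k ∉ D, S k = {l k}) →
        (X.val (single l) ⟶ X.val S),
      (∀ h h', ι (single l) h h' = 𝟙 _) ∧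
      ∀ {k T U S} (h : Split k T U S) (h₁ h₂ h₃ h₄), ι T h₁ h₂ ≫ X.inc h = ι S h₃ h₄ := by
  classical
  induction D using Finset.induction_on with
  | empty =>
    have e {S : Subsets t} (h : ∀ k ∉ (∅ : Finset (Fin t.len)), S k = {l k}) : single l = S :=
      funext fun k => (h k (Finset.notMem_empty k)).symm
    refine ⟨fun S _ h => eqToHom (congrArg X.obj (e h)), fun _ _ => rfl,
      fun {k T U S} h h₁ h₂ h₃ h₄ => ?_⟩
    obtain rfl := e h₂
    obtain rfl := e h₄
    refine (id_comp _).trans ((X.isId_inc h ?_).eq (isId_id _))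
    have h₅ := h.inter
    rw [Set.inter_eq_right.2 (h.union.le.trans' Set.subset_union_right)] at h₅
    exact h₅
  | insert k D hk ih =>
    obtain ⟨ι, hι, hι'⟩ := ih
    have hs {S : Subsets t} (h : l k ∈ S k) :
        Split k (S.set k {l k}) (S.set k (S k \ {l k})) S := by
      have := Split.of_subset (T := S.set k {l k}) (S := S) (k := k)
        (by rw [S.set_self]; exact Set.singleton_subset_iff.2 h) fun j hj => S.set_ne _ hj
      rwa [S.set_self] at this
    have hm {S} (h : Mem l S) : Mem l (S.set k {l k}) := fun j => by
      by_cases hj : j = k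
      · subst hj
        rw [S.set_self]
        rfl
      · rw [S.set_ne _ hj]
        exact h j
    have hd {S : Subsets t} (h : ∀ j ∉ insert k D, S j = {l j}) : ∀ j ∉ D, S.set k {l k} j = {l j} :=
      fun j hj => by
        by_cases hjk : j = k
        · subst hjk
          rw [S.set_self]
        · rw [S.set_ne _ hjk]
          exact h j (by simp [hjk, hj])
    refine ⟨fun S h h' => ι _ (hm h) (hd h') ≫ X.inc (hs (h k)), fun h h' => ?_,
      fun {j T U S} h h₁ h₂ h₃ h₄ => ?_⟩
    · have e : (single l).set k {l k} = single l := Function.update_eq_self k _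
      have key {Q : Subsets t} (hQ : Q = single l) (h₁ h₂) : IsId (ι Q h₁ h₂) := by
        subst hQ
        rw [hι]
        exact isId_id _
      refine ((key e _ _).comp (X.isId_inc _ ?_)).eq (isId_id _)
      rw [Subsets.set_self]
      exact Set.sdiff_self
    · refine (assoc _ _ _).trans ?_
      by_cases hj : j = k
      · subst hj
        have e : T.set j {l j} = S.set j {l j} := funext fun i => by
          by_cases hi : i = j
          · subst hi
            rw [T.set_self, S.set_self]
          · rw [T.set_ne _ hi, S.set_ne _ hi, h.left i hi]
        have key {Q Q' V V' : Subsets t} (hQ : Q = Q') (m₁ d₁ m₂ d₂) (h : Split j Q V S)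
            (h' : Split j Q' V' S) : ι Q m₁ d₁ ≫ X.inc h = ι Q' m₂ d₂ ≫ X.inc h' := by
          subst hQ
          rw [eq_of_heq (X.inc_congr h h' rfl)]
        have hT : Split j (T.set j {l j}) (S.set j (S j \ {l j})) S := e ▸ hs (h₃ j)
        rw [X.inc_trans _ _ hT]
        exact key e _ _ _ _ _ _
      · have hk := Ne.symm hj
        rw [X.inc_comm hk (hs (h₁ k)) (hs (S := U) ((h.right k hk).symm ▸ h₃ k)) h
          (h.set hk rfl rfl) (h.set hk (by rw [h.left k hk]) (by rw [h.right k hk])) (hs (h₃ k))]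
        exact (assoc _ _ _).symm.trans (congrArg (· ≫ _) (hι' _ _ _ _ _))

/-- The inclusion of an atom. -/
def atom (l : ∀ k, Fin (t.val k)) {S : Subsets t} (h : Mem l S) :
    X.val (single l) ⟶ X.val S :=
  (X.exists_atoms l Finset.univ).choose S h fun k hk => (hk (Finset.mem_univ k)).elim

lemma atom_single (l : ∀ k, Fin (t.val k)) (h : Mem l (single l)) : X.atom l h = 𝟙 _ :=
  (X.exists_atoms l Finset.univ).choose_spec.1 _ _

lemma atom_inc {l : ∀ k, Fin (t.val k)} (h : Split k T U S) (hT : Mem l T) (hS : Mem l S) :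
    X.atom l hT ≫ X.inc h = X.atom l hS :=
  (X.exists_atoms l Finset.univ).choose_spec.2 h _ _ _ _

lemma mem_split (h : Split k T U S) {l : ∀ k, Fin (t.val k)} (hS : Mem l S) :
    Mem l T ∨ Mem l U := by
  refine ((h.mem_iff (l k)).1.1 (hS k)).imp (fun hk j => ?_) fun hk j => ?_
  · by_cases hj : j = k
    · exact hj ▸ hk
    · exact h.left j hj ▸ hS j
  · by_cases hj : j = k
    · exact hj ▸ hk
    · exact h.right j hj ▸ hS j

lemma mem_left (h : Split k T U S) {l : ∀ k, Fin (t.val k)} (hT : Mem l T) : Mem l S :=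
  fun j => by
    by_cases hj : j = k
    · subst hj
      exact (h.mem_iff _).1.2 (Or.inl (hT _))
    · exact h.left j hj ▸ hT j

lemma Mem.induction {l : ∀ k, Fin (t.val k)} {Q : Subsets t → Prop} (h₀ : Q (single l))
    (h₁ : ∀ {k T U S}, Split k T U S → Mem l T → Q T → Q S) {S : Subsets t} (hS : Mem l S) :
    Q S := by
  classical
  have key : ∀ (D : Finset (Fin t.len)) (S : Subsets t), Mem l S → (∀ k ∉ D, S k = {l k}) →
      Q S := by
    intro D
    induction D using Finset.induction_on with
    | empty => exact fun S _ h => (funext fun k => h k (Finset.notMem_empty k) : S = single l) ▸ h₀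
    | insert k D hk ih =>
      intro S hS h
      have hm : Mem l (S.set k {l k}) := fun j => by
        by_cases hj : j = k
        · subst hj
          rw [S.set_self]
          rfl
        · rw [S.set_ne _ hj]
          exact hS j
      refine h₁ (Split.of_subset (k := k) (by
        rw [S.set_self]; exact Set.singleton_subset_iff.2 (hS k)) fun j hj => S.set_ne _ hj) hm
        (ih _ hm fun j hj => ?_)
      by_cases hjk : j = k
      · subst hjk
        rw [S.set_self]
      · rw [S.set_ne _ hjk]
        exact h j (by simp [hjk, hj])
  exact key Finset.univ S hS fun k hk => (hk (Finset.mem_univ k)).elim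

lemma isSum (S : Subsets t) :
    WaldVee.IsSum (fun l => X.val (single l)) {l | Mem l S} (Z := X.val S) fun l h => X.atom l h := by
  have wf : WellFounded (@LT.lt (∀ k, Set (Fin (t.val k))) _) := wellFounded_lt
  refine wf.induction (C := fun S : Subsets t => WaldVee.IsSum (fun l => X.val (single l))
    {l | Mem l S} (Z := X.val S) fun l h => X.atom l h) S fun (S : Subsets t) ih => ?_
  by_cases he : ∃ k, S k = ∅
  · obtain ⟨k, hk⟩ := he
    have hz := X.isZero_val hk
    exact ⟨fun _ => hz.eq_of_src _ _, fun d => ⟨hz.to_ _, fun l h =>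
      (Set.eq_empty_iff_forall_notMem.1 hk _ (h k)).elim⟩⟩
  by_cases hs : ∃ l, S = single l
  · obtain ⟨l, rfl⟩ := hs
    have hl : Mem l (single l) := fun _ => rfl
    refine ⟨fun {W f g} h => ?_, fun d => ⟨d l, fun l' h => ?_⟩⟩
    · have := h l hl
      change X.atom l hl ≫ f = X.atom l hl ≫ g at this
      rwa [X.atom_single l hl, id_comp, id_comp] at this
    · obtain rfl : l' = l := funext h
      change X.atom l' hl ≫ _ = _
      rw [X.atom_single l' hl, id_comp]
  push Not at he
  choose l hl using he
  obtain ⟨k, hk⟩ : ∃ k, S k ≠ {l k} := by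
    by_contra h
    push Not at h
    exact hs ⟨l, funext h⟩
  have hS := Split.of_subset (T := S.set k {l k}) (S := S) (k := k)
      (by rw [S.set_self]; exact Set.singleton_subset_iff.2 (hl k)) fun j hj => S.set_ne _ hj
  have hlt {a : Set (Fin (t.val k))} (ha : a < S k) :
      @LT.lt (∀ k, Set (Fin (t.val k))) _ (S.set k a) S := update_lt_self_iff.2 ha
  have h₁ := ih _ (hlt (lt_of_le_of_ne (Set.singleton_subset_iff.2 (hl k)) hk.symm))
  have h₂ := ih (S.set k (S k \ S.set k {l k} k)) (hlt (by
    rw [S.set_self]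
    exact ⟨Set.sdiff_subset, fun h => (h (hl k)).2 rfl⟩))
  refine ⟨fun {W f g} h => summand_ext hS (h₁.hom_ext fun l hT => ?_)
    (h₂.hom_ext fun l hT => ?_), fun d => ?_⟩
  · have := h l (mem_left hS hT)
    change X.atom l (mem_left hS hT) ≫ f = X.atom l (mem_left hS hT) ≫ g at this
    rwa [← X.atom_inc hS hT, assoc, assoc] at this
  · have := h l (mem_left hS.symm hT)
    change X.atom l (mem_left hS.symm hT) ≫ f = X.atom l (mem_left hS.symm hT) ≫ g at this
    rwa [← X.atom_inc hS.symm hT, assoc, assoc] at this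
  · obtain ⟨f, hf⟩ := h₁.exists_desc d
    obtain ⟨g, hg⟩ := h₂.exists_desc d
    obtain ⟨e, rfl, rfl⟩ := X.exists_summand_desc hS f g
    refine ⟨e, fun l h => ?_⟩
    obtain hT | hU := mem_split hS h
    · rw [← X.atom_inc hS hT, assoc]
      exact hf l hT
    · rw [← X.atom_inc hS.symm hU, assoc]
      exact hg l hU

open Classical in
lemma exists_theta (S S' : Subsets t) : ∃ f : X.val S ⟶ X.val S', ∀ l (h : Mem l S),
    X.atom l h ≫ f = if h' : Mem l S' then X.atom l h' else A.zero _ _ :=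
  (X.isSum S).exists_desc _

/-- The map which is the identity of the common atoms, and zero on the others. -/
def theta (S S' : Subsets t) : X.val S ⟶ X.val S' := (X.exists_theta S S').choose

lemma atom_theta {S S' : Subsets t} {l} (h : Mem l S) (h' : Mem l S') :
    X.atom l h ≫ X.theta S S' = X.atom l h' :=
  ((X.exists_theta S S').choose_spec l h).trans (dif_pos h')

lemma atom_theta_of_not {S S' : Subsets t} {l} (h : Mem l S) (h' : ¬ Mem l S') :
    X.atom l h ≫ X.theta S S' = A.zero _ _ :=
  ((X.exists_theta S S').choose_spec l h).trans (dif_neg h')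

lemma eq_theta {S S' : Subsets t} {f : X.val S ⟶ X.val S'}
    (hf : ∀ l (h : Mem l S) (h' : Mem l S'), X.atom l h ≫ f = X.atom l h')
    (hf' : ∀ l (h : Mem l S), ¬ Mem l S' → X.atom l h ≫ f = A.zero _ _) : f = X.theta S S' :=
  (X.isSum S).hom_ext fun l h => by
    by_cases h' : Mem l S'
    · exact (hf l h h').trans (X.atom_theta h h').symm
    · exact (hf' l h h').trans (X.atom_theta_of_not h h').symm

lemma theta_self (S : Subsets t) : X.theta S S = 𝟙 _ :=
  (X.eq_theta (fun _ _ _ => comp_id _) fun _ h h' => (h' h).elim).symm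

lemma theta_comp {S S' S'' : Subsets t} (h : ∀ l, Mem l S → Mem l S'' → Mem l S') :
    X.theta S S' ≫ X.theta S' S'' = X.theta S S'' := by
  refine X.eq_theta (fun l hl hl' => ?_) fun l hl hl' => ?_
  · rw [← assoc, X.atom_theta hl (h l hl hl'), X.atom_theta]
  · rw [← assoc]
    by_cases hm : Mem l S'
    · rw [X.atom_theta hl hm, X.atom_theta_of_not _ hl']
    · rw [X.atom_theta_of_not hl hm, WaldVee.zero_comp]

lemma theta_eq_zero {S S' : Subsets t} (h : ∀ l, Mem l S → ¬ Mem l S') :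
    X.theta S S' = A.zero _ _ :=
  (X.eq_theta (fun l hl hl' => (h l hl hl').elim) fun _ _ _ => WaldVee.comp_zero _ _).symm

lemma inc_eq_theta (h : Split k T U S) : X.inc h = X.theta T S :=
  X.eq_theta (fun _ hT hS => X.atom_inc h hT hS) fun _ hT hS => (hS (mem_left h hT)).elim

lemma proj_eq_theta (h : Split k T U S) : X.proj h = X.theta S U := by
  refine X.eq_theta (fun l hS hU => ?_) fun l hS hU => ?_
  · rw [← X.atom_inc h.symm hU hS, assoc, inc_symm_proj, comp_id]
  · rw [← X.atom_inc h ((mem_split h hS).resolve_right hU) hS, assoc, inc_proj,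
      WaldVee.comp_zero]

variable {X} in
lemma component_atom {Y : BarObj A.lambda t} (f : X ⟶ Y) {l : ∀ k, Fin (t.val k)} (h : Mem l S) :
    X.atom l h ≫ component f S = component f (single l) ≫ Y.atom l h := by
  revert h
  refine fun h => Mem.induction (Q := fun S => ∀ h : Mem l S, X.atom l h ≫ component f S =
    component f (single l) ≫ Y.atom l h) (fun h => ?_) (fun {k T U S} hs hT ih hS => ?_) h h
  · rw [atom_single, atom_single]
    exact (id_comp _).trans (comp_id _).symm
  · rw [← X.atom_inc hs hT, ← Y.atom_inc hs hT]
    have e : X.inc hs ≫ component f S = component f T ≫ Y.inc hs := by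
      have := congrArg (A.inl (X.obj T) (X.obj U) ≫ ·) (Hom.app_ρ f k hs)
      change A.inl (X.obj T) (X.obj U) ≫ (X.ρ k hs).hom ≫ component f S =
        A.inl (X.obj T) (X.obj U) ≫ A.wedgeMap (component f T) (component f U) ≫ (Y.ρ k hs).hom
        at this
      rw [inc, assoc, inc]
      refine this.trans ?_
      simp [WaldVee.wedgeMap]
    rw [assoc, e, reassoc_of% (ih hT)]

variable {X} in
lemma theta_component {Y : BarObj A.lambda t} (f : X ⟶ Y) (S S' : Subsets t) :
    X.theta S S' ≫ component f S' = component f S ≫ Y.theta S S' := by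
  refine (X.isSum S).hom_ext fun l h => ?_
  refine (assoc _ _ _).symm.trans (.trans ?_ (assoc _ _ _))
  rw [component_atom]
  by_cases h' : Mem l S'
  · rw [X.atom_theta h h', component_atom, assoc, Y.atom_theta h h']
  · rw [X.atom_theta_of_not h h', assoc, Y.atom_theta_of_not h h', WaldVee.zero_comp,
      WaldVee.comp_zero]

end BarObj

end

section

open MonoidalCategory

/-! ### The functor from systems to the iterated Waldhausen construction -/

lemma Split.interval {t : EObj} {i j i' j' : Cube t.val} {k : Fin t.len} (h : i k ≤ j k)
    (h' : j k ≤ j' k) (hk : i' k = j k) (hl : ∀ l ≠ k, i' l = i l ∧ j l = j' l) :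
    Split k (Subsets.interval i j) (Subsets.interval i' j') (Subsets.interval i j') where
  inter := by
    rw [Set.eq_empty_iff_forall_notMem]
    rintro a ⟨ha, hb⟩
    exact (hk ▸ hb.1 : (j k).val ≤ a.val).not_gt ha.2
  union := by
    ext a
    change (_ ∧ _) ∨ (_ ∧ _) ↔ _ ∧ _
    rw [hk]
    simp only [Fin.le_def] at h h'
    omega
  left l hlk := by simp only [Subsets.interval, (hl l hlk).2]
  right l hlk := by simp only [Subsets.interval, (hl l hlk).1]

namespace BarObj

variable {A : WaldVee.{u}} {s t : EObj} (X : BarObj A.lambda t)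

lemma mem_interval {v w : Cube t.val} {l : ∀ k, Fin (t.val k)} : Mem l (Subsets.interval v w) ↔
    ∀ k, (v k).val ≤ (l k).val ∧ (l k).val < (w k).val := Iff.rfl

/-- The functor given by the values of a system at intervals. -/
def arFunctor : Ar t.val ⥤ A.C where
  obj y := X.val (Subsets.interval y.src y.tgt)
  map _ := X.theta _ _
  map_id _ := X.theta_self _
  map_comp f g := (X.theta_comp fun _ h h' => mem_interval.2 fun k =>
    ⟨le_trans (Fin.le_def.1 ((leOfHom g).1 k)) (mem_interval.1 h' k).1,
      lt_of_lt_of_le (mem_interval.1 h k).2 (Fin.le_def.1 ((leOfHom f).2 k))⟩).symm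

lemma reedy_arFunctor :
    Reedy A.toWaldCat (monoFunctor Ar.fromZero Ar.fromZero_mono ⋙ X.arFunctor) := by
  intro w
  let S (x : Cube t.val) : Subsets t := Subsets.interval (Ar.fromZero x).src (Ar.fromZero x).tgt
  have hS {x l} : Mem l (S x) ↔ ∀ k, (l k).val < (x k).val :=
    forall_congr' fun k => and_iff_right (Nat.zero_le _)
  let up (l : ∀ k, Fin (t.val k)) : Cube t.val := fun k => (l k).succ
  have hup {x l} : Mem l (S x) ↔ up l ≤ x := hS
  obtain ⟨Z, ι, hZ⟩ := WaldVee.IsSum.exists_isSum (fun l => X.val (single l)) {l | up l < w}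
  have hm {x} (hx : x < w) {l} (hl : Mem l (S x)) : up l < w := (hup.1 hl).trans_lt hx
  have hc (x) := (X.isSum (S x)).exists_desc (W := Z) fun l =>
    open Classical in if h : up l < w then ι l h else A.zero _ _
  choose c hc using hc
  have hc' {x} (hx : x < w) {l} (hl : Mem l (S x)) : X.atom l hl ≫ c x = ι l (hm hx hl) :=
    (hc x l hl).trans (dif_pos _)
  obtain ⟨f, hf⟩ := hZ.exists_desc (W := X.val (S w)) fun l =>
    open Classical in if h : Mem l (S w) then X.atom l h else A.zero _ _
  have hf' (l) (hl : up l < w) : ι l hl ≫ f = X.atom l (hup.2 hl.le) := (hf l hl).trans (dif_pos _)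
  refine ⟨Z, fun x _ => c x, f, ⟨fun x y hxy hx hy => ?_, fun {T} d hd => ?_, fun {T} g g' h => ?_⟩,
    fun x hx => ?_, hZ.cof_of_subset (X.isSum (S w)) (fun l hl => hup.2 (le_of_lt hl)) f hf'⟩
  · refine (X.isSum (S x)).hom_ext fun l hl => ?_
    change X.atom l hl ≫ X.theta (S x) (S y) ≫ c y = X.atom l hl ≫ c x
    have hl' : Mem l (S y) := hup.2 ((hup.1 hl).trans hxy)
    rw [← assoc, X.atom_theta hl hl', hc' hy hl', hc' hx hl]
  · obtain ⟨g, hg⟩ := hZ.exists_desc (W := T) fun l => open Classical in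
      if h : up l < w then X.atom l (hup.2 le_rfl) ≫ d (up l) h else A.zero _ _
    refine ⟨g, fun x hx => (X.isSum (S x)).hom_ext fun l hl => ?_⟩
    change X.atom l hl ≫ c x ≫ g = X.atom l hl ≫ d x hx
    rw [← assoc, hc' hx hl, hg, dif_pos (hm hx hl), ← hd _ _ (hup.1 hl) (hm hx hl) hx]
    refine (assoc _ _ _).symm.trans (congrArg (· ≫ d x hx) ?_)
    exact X.atom_theta (S := S (up l)) (S' := S x) _ _
  · refine hZ.hom_ext fun l hl => ?_
    rw [← hc' hl (hup.2 le_rfl)]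
    exact (assoc _ _ _).trans ((congrArg (_ ≫ ·) (h (up l) hl)).trans
      (assoc _ _ _).symm)
  · refine (X.isSum (S x)).hom_ext fun l hl => ?_
    change X.atom l hl ≫ c x ≫ f = X.atom l hl ≫ X.theta (S x) (S w)
    rw [← assoc, hc' hx hl, hf', X.atom_theta hl (hup.2 ((hup.1 hl).trans (le_of_lt hx)))]

lemma isSdot : IsSdot A.toWaldCat X.arFunctor where
  obj_eq_pt y k h := X.obj_empty _ k (Set.eq_empty_iff_forall_notMem.2 fun l hl =>
    (hl.1.trans_lt hl.2).ne (congrArg Fin.val h))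
  cubical := cubicallyCofibrant_iff.2 X.reedy_arFunctor
  isPushout {x y z w} f g h l k hyx hzx hzk hwz hwy hj := by
    let S (x : Ar t.val) := Subsets.interval x.src x.tgt
    have hzz : IsZero (X.val (S z)) := X.isZero_val (k := k)
      (Set.eq_empty_iff_forall_notMem.2 fun a ha => (ha.1.trans_lt ha.2).ne
        (congrArg Fin.val (hzk.trans (congrFun hzx k).symm)))
    have hs : Split k (S x) (S w) (S y) := by
      have h₁ : x.src k ≤ x.tgt k := x.2 k
      have h₂ : x.tgt k ≤ y.tgt k := (leOfHom f).2 k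
      have := Split.interval (i := x.src) (i' := w.src) (j := x.tgt) (j' := y.tgt) (k := k) h₁ h₂
        ((congrFun hwz k).trans hzk) fun l hl =>
          ⟨(congrFun hwz l).trans (hj l hl).2, (hj l hl).1.symm⟩
      simp only [S, hyx, hwy]
      exact this
    change IsPushout (X.theta (S x) (S y)) (X.theta (S x) (S z)) (X.theta (S y) (S w))
      (X.theta (S z) (S w))
    have e₁ : X.theta (S x) (S z) = A.zero _ _ := hzz.eq_of_tgt _ _
    rw [← X.inc_eq_theta hs, ← X.proj_eq_theta hs, e₁]
    refine ⟨⟨(X.inc_proj hs).trans ((WaldVee.zero_comp _ _).symm)⟩,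
      ⟨PushoutCocone.IsColimit.mk _ (fun c => X.inc hs.symm ≫ c.inl) (fun c => ?_)
        (fun c => hzz.eq_of_src _ _) fun c m h₁ h₂ => ?_⟩⟩
    · have hcc : X.inc hs ≫ c.inl = A.zero _ _ := c.condition.trans
        ((congrArg (_ ≫ ·) (hzz.eq_of_src _ (A.zero _ _))).trans (WaldVee.comp_zero _ _))
      refine summand_ext hs ?_ ?_
      · rw [← assoc, inc_proj, WaldVee.zero_comp, hcc]
      · rw [← assoc, inc_symm_proj, id_comp]
    · rw [← h₁, ← assoc, inc_symm_proj, id_comp]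

variable (A t) in
/-- The functor from systems to the iterated Waldhausen construction. -/
def toSdot : BarObj A.lambda t ⥤ SdotObj A.toWaldCat t where
  obj X := ⟨X.arFunctor, X.isSdot⟩
  map f := ⟨{ app := fun y => component f (Subsets.interval y.src y.tgt)
              naturality := fun _ _ _ => theta_component f _ _ }⟩
  map_id _ := rfl
  map_comp _ _ := rfl

lemma toSdot_const : (toSdot A t).obj (const A.lambda t) = (Sdot A.toWaldCat t).pt :=
  SdotObj.eq_pt fun _ => rfl

end BarObj

/-! ### Naturality with respect to `ℰ` -/

lemma eq_of_step {n : ℕ} {F : Fin (n + 1) → ℕ} (hF : Monotone F) {a b : Fin n} {l : ℕ}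
    (ha : F a.castSucc ≤ l ∧ l < F a.succ) (hb : F b.castSucc ≤ l ∧ l < F b.succ) : a = b := by
  have key {a b : Fin n} (ha : l < F a.succ) (hb : F b.castSucc ≤ l) : b ≤ a := by
    by_contra h
    exact (ha.trans_le ((hF (show a.succ ≤ b.castSucc from not_le.1 h)).trans hb)).false
  exact le_antisymm (key hb.2 ha.1) (key ha.2 hb.1)

section Push

variable {A : WaldVee.{u}} {s t : EObj} {f : s ⟶ t}

lemma Subsets.mem_preimage {S : Subsets t} {k : Fin s.len} {l : Fin (s.val k)} :
    l ∈ S.preimage f k ↔ ∃ a ∈ S (eInj f k), eMap f (eInj f k) a.castSucc ≤ l.val ∧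
      l.val < eMap f (eInj f k) a.succ := Iff.rfl

lemma Subsets.preimage_interval (f : s ⟶ t) (v w : Cube t.val) :
    (Subsets.interval v w).preimage f = Subsets.interval (Cube.image f v) (Cube.image f w) :=
  funext fun k => Set.ext fun l => exists_step_iff (eMap_mono f (eInj f k)) _ _ l.val

lemma Subsets.nondeg_interval (f : s ⟶ t) (y : Ar t.val) :
    (Subsets.interval y.src y.tgt).Nondeg f ↔ Ar.Nondeg f y := by
  rw [Subsets.nondeg_iff]
  refine forall₂_congr fun j hj => ?_
  refine (exists_step_iff (eMap_mono f j) (y.src j) (y.tgt j) 0).trans ?_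
  have := eMap_of_none hj (y.tgt j)
  omega

lemma Subsets.Nondeg.mono {S T : Subsets t} (h : T.Nondeg f) (hTS : ∀ j, T j ⊆ S j) :
    S.Nondeg f := fun j hj => (h j hj).imp fun _ ha => ⟨hTS j ha.1, ha.2⟩

namespace BarObj

variable (X : BarObj A.lambda s) {S S' T U : Subsets t}

lemma mem_preimage {l : ∀ k, Fin (t.val k)} (hl : Mem l S) {l' : ∀ k, Fin (s.val k)}
    (h : Mem l' ((single l).preimage f)) : Mem l' (S.preimage f) := fun k => by
  obtain ⟨a, rfl, ha⟩ := Subsets.mem_preimage.1 (h k)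
  exact ⟨_, hl _, ha⟩

lemma push_val (h : S.Nondeg f) : (X.push f).val S = X.val (S.preimage f) :=
  congrArg X.ext (Subsets.index_of_nondeg h)

lemma push_val_of_not (h : ¬ S.Nondeg f) : (X.push f).val S = A.pt :=
  congrArg X.ext (Subsets.index_of_not h)

lemma push_inc {j : Fin t.len} (h : Split j T U S) (hT : T.Nondeg f) (hS : S.Nondeg f) :
    HEq ((X.push f).inc h) (X.theta (T.preimage f) (S.preimage f)) := by
  obtain hj | ⟨k, hk⟩ := (ePre f j).eq_none_or_eq_some
  · have e := (h.preimage_of_none hj).1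
    have hU : ¬ U.Nondeg f := ((h.nondeg_of_none f hj).resolve_left fun h => h.1 hT).1
    have h₁ : IsId ((X.push f).inc h) := (WaldVee.isId_inl (X.push_val_of_not hU)).comp
      (isBarStr.ρ_none A.lambda f X j h (Or.inr hj))
    have h₂ : IsId (X.theta (T.preimage f) (S.preimage f)) := by
      rw [e, theta_self]
      exact isId_id _
    exact h₁.heq h₂ (X.push_val hT)
  · obtain rfl := ePre_eq_some.1 hk
    rw [← X.inc_eq_theta h.preimage]
    have hU : U.Nondeg f := (h.nondeg_iff hk).2.2 hS
    exact heq_comp (X.push_val hT) (congrArg₂ A.wedge (X.push_val hT) (X.push_val hU))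
      (X.push_val hS) (WaldVee.inl_heq (X.push_val hT) (X.push_val hU))
      (isBarStr.ρ_some A.lambda f X k h h.preimage hS)

lemma push_atom {l : ∀ k, Fin (t.val k)} (hl : (single l).Nondeg f) (h : Mem l S) :
    HEq ((X.push f).atom l h) (X.theta ((single l).preimage f) (S.preimage f)) := by
  have hn {T : Subsets t} (hT : Mem l T) : T.Nondeg f :=
    hl.mono fun j => Set.singleton_subset_iff.2 (hT j)
  refine Mem.induction (Q := fun S => ∀ h : Mem l S, HEq ((X.push f).atom l h)
    (X.theta ((single l).preimage f) (S.preimage f))) (fun h => ?_) (fun {k T U S} hs hT ih hS => ?_)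
    h h
  · rw [atom_single, theta_self]
    exact (isId_id _).heq (isId_id _) (X.push_val hl)
  · rw [← atom_inc _ hs hT hS, ← X.theta_comp (S := (single l).preimage f)
      (S' := T.preimage f) (S'' := S.preimage f) fun l' hl' _ => mem_preimage hT hl']
    exact heq_comp (X.push_val hl) (X.push_val (hn hT)) (X.push_val (hn hS)) (ih hT)
      (X.push_inc hs (hn hT) (hn hS))

lemma push_theta (hS : S.Nondeg f) (hS' : S'.Nondeg f) :
    HEq ((X.push f).theta S S') (X.theta (S.preimage f) (S'.preimage f)) := by
  let g : (X.push f).val S ⟶ (X.push f).val S' := eqToHom (X.push_val hS) ≫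
    X.theta (S.preimage f) (S'.preimage f) ≫ eqToHom (X.push_val hS').symm
  have hg : HEq g (X.theta (S.preimage f) (S'.preimage f)) :=
    ((isId_eqToHom _).comp_heq _).trans (IsId.heq_comp _ (isId_eqToHom _))
  suffices g = (X.push f).theta S S' from this ▸ hg
  have key {l} (hl : Mem l S) (h : (single l).Nondeg f) : HEq ((X.push f).atom l hl ≫ g)
      (X.theta ((single l).preimage f) (S'.preimage f)) := by
    rw [← X.theta_comp (S := (single l).preimage f)
      (S' := S.preimage f) (S'' := S'.preimage f) fun l' hl' _ => mem_preimage hl hl']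
    exact heq_comp (X.push_val h) (X.push_val hS) (X.push_val hS') (X.push_atom h hl) hg
  refine eq_theta _ (fun l hl hl' => ?_) fun l hl hl' => ?_
  · by_cases h : (single l).Nondeg f
    · exact eq_of_heq ((key hl h).trans (X.push_atom h hl').symm)
    · have hz : IsZero ((X.push f).val (single l)) := by
        rw [X.push_val_of_not h]
        exact A.isZero
      exact hz.eq_of_src _ _
  · by_cases h : (single l).Nondeg f
    · refine eq_of_heq ((key hl h).trans ?_)
      rw [X.theta_eq_zero fun l' h₁ h₂ => hl' fun j => ?_]
      · rw [X.push_val h, X.push_val hS']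
      · obtain hj | ⟨k, hk⟩ := (ePre f j).eq_none_or_eq_some
        · obtain ⟨a, ha, ha'⟩ := h j hj
          obtain ⟨b, hb, hb'⟩ := hS' j hj
          obtain rfl : a = l j := ha
          rwa [eq_of_step (eMap_mono f j) (a := l j) (b := b) (l := 0) (by omega) (by omega)]
        · obtain rfl := ePre_eq_some.1 hk
          obtain ⟨a, ha, ha'⟩ := Subsets.mem_preimage.1 (h₁ k)
          obtain ⟨b, hb, hb'⟩ := Subsets.mem_preimage.1 (h₂ k)
          obtain rfl : a = l _ := ha
          rwa [eq_of_step (eMap_mono f _) ha' hb']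
    · have hz : IsZero ((X.push f).val (single l)) := by
        rw [X.push_val_of_not h]
        exact A.isZero
      exact hz.eq_of_src _ _

lemma arFunctor_push (f : s ⟶ t) : (X.push f).arFunctor = sdotFunctor A.toWaldCat f X.arFunctor := by
  have hn {y} := (Subsets.nondeg_interval f y).2
  have e (y : Ar t.val) := Subsets.preimage_interval f y.src y.tgt
  refine eq_sdotFunctor (fun y hy => (X.push_val (hn hy)).trans (congrArg X.val (e y)))
    (fun y hy => X.push_val_of_not (mt (Subsets.nondeg_interval f y).1 hy)) fun {x y} g hx hy => ?_
  refine (X.push_theta (hn hx) (hn hy)).trans ?_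
  rw [e, e]
  rfl

lemma pushFunctor_toSdot (f : s ⟶ t) :
    pushFunctor A.lambda f ⋙ toSdot A t = toSdot A s ⋙ SdotObj.map A.toWaldCat f :=
  SdotObj.functor_ext (fun X => X.arFunctor_push f) fun {X Y} g =>
    heq_sdotTrans (X.arFunctor_push f) (Y.arFunctor_push f) fun y hy => by
      refine (extMap_congr g (Subsets.index_of_nondeg ((Subsets.nondeg_interval f y).2 hy))).trans ?_
      change HEq (component g _) (component g _)
      rw [Subsets.preimage_interval f y.src y.tgt]
      rfl

end BarObj

end Push

end

section

open MonoidalCategory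

/-! ### Multinaturality -/

lemma KExact.map_eq_zero {I : Type} [Finite I] {A : I → WaldVee.{u}} {B : WaldVee.{u}}
    (F : KExact I A B) {x y : ∀ i, (A i).C} {a : x ⟶ y} {i : I} (h : a i = (A i).zero _ _) :
    F.functor.map a = B.zero _ _ := by
  have hp (j) : ∃ (p : (A j).C) (f : x j ⟶ p) (g : p ⟶ y j), f ≫ g = a j ∧
      (j = i → p = (A j).pt) := by
    by_cases hj : j = i
    · subst hj
      exact ⟨_, _, _, h.symm, fun _ => rfl⟩
    · exact ⟨_, 𝟙 _, a j, id_comp _, fun e => (hj e).elim⟩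
  choose p f g hfg hp using hp
  have hz : F.functor.obj p = B.pt := F.isMultiexact.map_pt p i (hp i rfl)
  have hz : IsZero (F.functor.obj p) := hz ▸ B.isZero
  rw [show a = (show x ⟶ p from f) ≫ (show p ⟶ y from g) from funext fun j => (hfg j).symm,
    Functor.map_comp, hz.eq_of_src (F.functor.map (show p ⟶ y from g)) (B.zero _ _), WaldVee.comp_zero]

section

variable {I : Type} [Finite I] {A : I → WaldVee.{u}} {B : WaldVee.{u}} (F : KExact I A B)
  {m : I → EObj} {t : EObj} (h : Concat m t) (X : ∀ i, BarObj (A i).lambda (m i))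

open BarObj

lemma BarObj.isId_theta {A : WaldVee.{u}} {t : EObj} (X : BarObj A.lambda t) {S S' : Subsets t}
    (h : S = S') : IsId (X.theta S S') := by
  subst h
  rw [theta_self]
  exact isId_id _

/-- The image of a family of maps between values of systems. -/
def KExact.barTheta (S S' : Subsets t) : (F.lambda.barObj X h).val S ⟶ (F.lambda.barObj X h).val S' :=
  F.functor.map (X := fun i => (X i).val (S.part h i)) (Y := fun i => (X i).val (S'.part h i))
    fun i => (X i).theta (S.part h i) (S'.part h i)

lemma KExact.barTheta_comp {S S' S'' : Subsets t}
    (hl : ∀ i l, Mem l (S.part h i) → Mem l (S''.part h i) → Mem l (S'.part h i)) :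
    F.barTheta h X S S' ≫ F.barTheta h X S' S'' = F.barTheta h X S S'' :=
  (F.functor.map_comp _ _).symm.trans
    (congrArg F.functor.map (funext fun i => (X i).theta_comp (hl i)))

lemma KExact.barTheta_self (S : Subsets t) : F.barTheta h X S S = 𝟙 _ :=
  (congrArg F.functor.map (funext fun i => (X i).theta_self _)).trans (F.functor.map_id _)

lemma KExact.inc_eq_barTheta {j : Fin t.len} {T U S : Subsets t} (hs : Split j T U S) :
    (F.lambda.barObj X h).inc hs = F.barTheta h X T S := by
  have hp := hs.part h (h.e.apply_symm_apply j)
  exact F.inl_sumIso (KLinear.obj_left X hp) (KLinear.obj_right X hp) _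
    ((X _).inc_eq_theta hp.split).symm fun i hi => (X i).isId_theta (hp.left i hi)

variable {h} in
lemma Subsets.mem_part_of_single {l : ∀ k, Fin (t.val k)} {S : Subsets t} (hl : Mem l S) {i : I}
    {l' : ∀ k, Fin ((m i).val k)} (h' : Mem l' ((single l).part h i)) : Mem l' (S.part h i) := fun k => by
  have e : Fin.cast (h.val_eq i k).symm (l' k) = l (h.e ⟨i, k⟩) := h' k
  change Fin.cast _ _ ∈ S _
  exact e ▸ hl _

lemma KExact.atom_eq_barTheta {l : ∀ k, Fin (t.val k)} {S : Subsets t} (hl : Mem l S) :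
    (F.lambda.barObj X h).atom l hl = F.barTheta h X (single l) S := by
  refine Mem.induction (Q := fun S => ∀ hl : Mem l S, (F.lambda.barObj X h).atom l hl =
    F.barTheta h X (single l) S) (fun _ => ?_) (fun {k T U S} hs hT ih hS => ?_) hl hl
  · rw [atom_single, F.barTheta_self]
  · rw [← atom_inc _ hs hT hS, ih hT, F.inc_eq_barTheta,
      F.barTheta_comp h X fun i l' hl' _ => Subsets.mem_part_of_single hT hl']

lemma KExact.theta_eq_barTheta (S S' : Subsets t) :
    (F.lambda.barObj X h).theta S S' = F.barTheta h X S S' := by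
  refine (eq_theta _ (fun l hl hl' => ?_) fun l hl hl' => ?_).symm
  · rw [F.atom_eq_barTheta, F.atom_eq_barTheta,
      F.barTheta_comp h X fun i l' hl' _ => Subsets.mem_part_of_single hl hl']
  · rw [F.atom_eq_barTheta, F.barTheta_comp h X fun i l' hl' _ => Subsets.mem_part_of_single hl hl']
    obtain ⟨j, hj⟩ := not_forall.1 hl'
    obtain ⟨i, k, rfl⟩ := h.surj j
    refine F.map_eq_zero (i := i) ((X i).theta_eq_zero fun l' h₁ h₂ => hj ?_)
    exact (show Fin.cast (h.val_eq i k).symm (l' k) = l _ from h₁ k) ▸ h₂ k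

lemma KExact.bar_toSdot : F.lambda.bar h ⋙ toSdot B t =
    Functor.pi (fun i => toSdot (A i) (m i)) ⋙ F.sdot h :=
  SdotObj.functor_ext (fun X => hext (fun _ => rfl)
    fun _ _ _ => heq_of_eq (F.theta_eq_barTheta h X _ _)) fun {X Y} f =>
      natTrans_heq (hext (fun _ => rfl)
        fun _ _ _ => heq_of_eq (F.theta_eq_barTheta h X _ _))
        (hext (fun _ => rfl)
        fun _ _ _ => heq_of_eq (F.theta_eq_barTheta h Y _ _)) fun y => HEq.rfl

lemma KExact.cell_toSdot {F G : KExact I A B} (α : F ⟶ G) :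
    postArr (EMor.arr ((KLinear.barMorFunctor (fun i => (A i).lambda) B.lambda).map
      (KExact.lambdaCell α)) h) (toSdot B t) =
    preArr (Functor.pi fun i => toSdot (A i) (m i)) (EMor.arr ((sdotMorFunctor A B).map α) h) := by
  have e (F : KExact I A B) (X) := congrArg SdotObj.functor (CategoryTheory.Functor.congr_obj (F.bar_toSdot h) X)
  exact arrow_ext (F.bar_toSdot h) (G.bar_toSdot h) fun X => SdotObj.hom_heq
    (CategoryTheory.Functor.congr_obj (F.bar_toSdot h) X)
    (CategoryTheory.Functor.congr_obj (G.bar_toSdot h) X)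
    (natTrans_heq (e F X) (e G X) fun y => HEq.rfl)

end

namespace EMor

variable {X Y : EStarCat.{u}} (F : ∀ t, X.at t ⥤ Y.at t)
  (hF : ∀ {s t : EObj} (f : s ⟶ t), X.tr f ⋙ F t = F s ⋙ Y.tr f)
  (hp : ∀ t, (F t).obj (X.functor.obj t).pt = (Y.functor.obj t).pt)

lemma ofNatural_arr (t : EObj) : arr (𝟙 (ofNatural F hF hp)) (Concat.self t) =
    Arrow.mk (𝟙 (Pi.eval (fun _ : Unit => X.at t) () ⋙ F t)) :=
  congrArg (fun F => Arrow.mk (𝟙 F)) (ofNatural_app F hF hp t)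

lemma post_arr {I : Type} [Finite I] (Z : I → EStarCat.{u}) {G G' : EMor I Z X} (α : G ⟶ G')
    {m : I → EObj} {t : EObj} (h : Concat m t) :
    arr ((estarMulticategory.post Z (ofNatural F hF hp)).map α) h = postArr (arr α h) (F t) := by
  refine preArr_comap_injective (unitSigma I).symm (fun x => (Z x.2).at (m x.2)) ?_
  refine (act_arr (unitSigma I).symm (fun x => Z x.2) Y ((compFunctor (fun _ : Unit => Z)
    (fun _ => X) Y).map (mkHom (𝟙 (ofNatural F hF hp)) fun _ : Unit => α))
    (m := fun x => m x.2) h _ (h.uncomap_e (m := fun x => m x.2) (unitSigma I).symm)).trans ?_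
  refine (comp_arr (fun _ : Unit => Z) (fun _ => X) Y
    (mkHom (𝟙 (ofNatural F hF hp)) fun _ : Unit => α) (m := fun _ => m)
    (fun _ => h) (Concat.self t) _ fun _ i k =>
      (h.uncomap_e (m := fun x => m x.2) (unitSigma I).symm i k).symm).trans ?_
  refine (congrArg (fun a => mcompArr (A := fun (_ : Unit) i => (Z i).at (m i)) a fun _ => arr α h)
    (ofNatural_arr F hF hp t)).trans (arrow_ext rfl rfl fun x =>
      heq_of_eq (id_comp ((F t).map ((arr α h).hom.app fun i => x ⟨(), i⟩))))

lemma pre_arr {I : Type} [Finite I] {X Y : I → EStarCat.{u}} (Z : EStarCat.{u})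
    (F : ∀ i t, (X i).at t ⥤ (Y i).at t)
    (hF : ∀ i {s t : EObj} (f : s ⟶ t), (X i).tr f ⋙ F i t = F i s ⋙ (Y i).tr f)
    (hp : ∀ i t, (F i t).obj ((X i).functor.obj t).pt = ((Y i).functor.obj t).pt)
    {G G' : EMor I Y Z} (α : G ⟶ G') {m : I → EObj} {t : EObj} (h : Concat m t) :
    arr ((estarMulticategory.pre (fun i => ofNatural (F i) (hF i) (hp i)) Z).map α) h =
      preArr (Functor.pi fun i => F i (m i)) (arr α h) := by
  refine preArr_comap_injective (sigmaUnit I).symm (fun x => (X x.1).at (m x.1)) ?_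
  refine (act_arr (sigmaUnit I).symm (fun x => X x.1) Z ((compFunctor (fun i (_ : Unit) => X i)
    Y Z).map (mkHom α fun i => 𝟙 (ofNatural (F i) (hF i) (hp i))))
    (m := fun x => m x.1) h _ (h.uncomap_e (m := fun x => m x.1) (sigmaUnit I).symm)).trans ?_
  refine (comp_arr (fun i (_ : Unit) => X i) Y Z
    (mkHom α fun i => 𝟙 (ofNatural (F i) (hF i) (hp i))) (m := fun i _ => m i)
    (fun i => Concat.self (m i)) h _ fun i _ k =>
      (h.uncomap_e (m := fun x => m x.1) (sigmaUnit I).symm i k).symm).trans ?_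
  refine (congrArg (fun b => mcompArr (A := fun i (_ : Unit) => (X i).at (m i)) (arr α h) b)
    (funext fun i => ofNatural_arr (F i) (hF i) (hp i) (m i))).trans (arrow_ext rfl rfl fun x =>
      heq_of_eq ((congrArg ((arr α h).hom.app _ ≫ ·) ((arr α h).right.map_id
        (fun i => (F i (m i)).obj (x ⟨i, ()⟩)))).trans (comp_id _)))

end EMor

variable (A : WaldVee.{u}) (t : EObj)

/-- The components of the transformation from the construction of Elmendorf and Mandell to the
iterated Waldhausen construction. -/
def toSdotMor :
    EMor Unit (fun _ => (barStr A.lambda).toEStarCat) (sdotStr A.toWaldCat).toEStarCat :=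
  EMor.ofNatural (fun t => BarObj.toSdot A t) (fun f => BarObj.pushFunctor_toSdot f)
    fun _ => BarObj.toSdot_const

lemma toSdotMor_app : (toSdotMor A).app (Concat.self t) =
    Pi.eval (fun _ : Unit => BarObj A.lambda t) () ⋙ BarObj.toSdot A t :=
  EMor.ofNatural_app _ _ _ t

lemma toSdotMor_obj (X : BarObj A.lambda t) :
    ((toSdotMor A).app (Concat.self t)).obj (fun _ => X) = (BarObj.toSdot A t).obj X :=
  CategoryTheory.Functor.congr_obj (toSdotMor_app A t) fun _ => X

lemma toSdotMor_map {X X' : BarObj A.lambda t} (f : X ⟶ X') :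
    HEq (((toSdotMor A).app (Concat.self t)).map (X := fun _ => X) (Y := fun _ => X') fun _ => f)
      ((BarObj.toSdot A t).map f) :=
  functor_map_heq (toSdotMor_app A t) (X := fun _ => X) (Y := fun _ => X') fun _ => f

lemma SdotObj.trans_app_heq {A : WaldCat.{u}} {t : EObj} {F G F' G' : SdotObj A t} {α : F ⟶ G}
    {β : F' ⟶ G'} (hF : F = F') (hG : G = G') (h : HEq α β) (y : Ar t.val) :
    HEq ((trans α).app y) ((trans β).app y) := by
  subst hF hG
  rw [eq_of_heq h]

/-- The transformation from the construction of Elmendorf and Mandell to the iterated Waldhausen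
construction. -/
def phi : MultinatTrans (lambdaMultifunctor.{u}.comp barMultifunctor)
    sdotMultifunctor where
  app A := toSdotMor A
  naturality {I} _ A B := EMor.functor_ext fun α m t h => by
    have h₁ := EMor.post_arr (fun t => BarObj.toSdot B t) (fun f => BarObj.pushFunctor_toSdot f)
      (fun _ => BarObj.toSdot_const) (X := (barStr B.lambda).toEStarCat)
      (Y := (sdotStr B.toWaldCat).toEStarCat) (fun i => (barStr (A i).lambda).toEStarCat)
      ((KLinear.barMorFunctor (fun i => (A i).lambda) B.lambda).map (KExact.lambdaCell α)) h
    have h₂ := EMor.pre_arr (X := fun i => (barStr (A i).lambda).toEStarCat)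
      (Y := fun i => (sdotStr (A i).toWaldCat).toEStarCat) (sdotStr B.toWaldCat).toEStarCat
      (fun i t => BarObj.toSdot (A i) t) (fun i _ _ f => BarObj.pushFunctor_toSdot f)
      (fun _ _ => BarObj.toSdot_const) ((sdotMorFunctor A B).map α) h
    exact h₁.trans ((KExact.cell_toSdot h α).trans h₂.symm)

lemma isPhi : IsPhi phi.{u} := by
  refine ⟨fun A t X y => ?_, fun A t X y y' g k U V h h' hj => ?_, fun A t X X' f y => ?_⟩
  · change (((toSdotMor A).app (Concat.self t)).obj fun _ => X).functor.obj y = _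
    rw [toSdotMor_obj]
    rfl
  · change HEq ((((toSdotMor A).app (Concat.self t)).obj fun _ => X).functor.map g) _
    rw [toSdotMor_obj]
    refine heq_of_eq ?_
    change X.theta _ _ = _
    rw [← X.theta_comp (S' := Subsets.interval y.src y'.tgt), ← X.inc_eq_theta h,
      ← X.proj_eq_theta h']
    · exact assoc _ _ _
    · intro l hl hl'
      exact BarObj.mem_interval.2 fun j => ⟨(BarObj.mem_interval.1 hl j).1,
        (BarObj.mem_interval.1 hl' j).2⟩
  · exact SdotObj.trans_app_heq (toSdotMor_obj A t X) (toSdotMor_obj A t X') (toSdotMor_map A t f) y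

end

end KTheory

end

theorem mainTheorem2 :
    ∃ (W : Multicategory WaldVee.{u} KExact.{u}) (M : Multicategory SMCat.{u} KLinear.{u})
      (E : Multicategory EStarCat.{u} EMor.{u}) (P : Multicategory SymSpectrum.{u} MLin.{u}),
      IsWaldMulticategory W ∧ IsSMMulticategory M ∧ IsEStarMulticategory E ∧
      IsSpecMulticategory P ∧
    ∃ (s : ∀ A : WaldVee.{u}, EStarStr (Sdot A.toWaldCat)) (b : ∀ C : SMCat.{u}, EStarStr (bar C)),
      IsSdotStr s ∧ IsBarStr b ∧
    ∃ (L : Multifunctor W M WaldVee.lambda)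
      (S : Multifunctor W E (fun A => (s A).toEStarCat))
      (B : Multifunctor M E (fun C => (b C).toEStarCat))
      (J : Multifunctor E P ISpec),
      IsLambda L ∧ IsSdotMultifunctor S ∧ IsBarMultifunctor B ∧ IsSpectrumMultifunctor J ∧
    ∃ φ : MultinatTrans (L.comp B) S, IsPhi φ ∧
    ∃ ψ : MultinatTrans (L.comp (B.comp J)) (S.comp J),
      ∀ A : WaldVee.{u}, ψ.app A = (J.map _ _).obj (φ.app A) :=
  ⟨waldMulticategory, smMulticategory, estarMulticategory, specMulticategory, isWaldMulticategory,
    isSMMulticategory, isEStarMulticategory, isSpecMulticategory,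
    fun A => KTheory.sdotStr A.toWaldCat, barStr, isSdotStr, isBarStr,
    lambdaMultifunctor, sdotMultifunctor, barMultifunctor, spectrumMultifunctor,
    isLambda, isSdotMultifunctor, isBarMultifunctor, isSpectrumMultifunctor,
    phi, isPhi, phi.whisker spectrumMultifunctor, fun _ => rfl⟩
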